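/- **Conventions.** $\lambda$ is the security parameter. A QPT algorithm (or adversary) is a family of polynomial-size quantum circuits, one for each $\lambda$ (and one for each message length $\ell$, of size polynomial in $\lambda+\ell$, for encryption and decryption of $\ell$-bit messages), made of unitary gates on at most three qubits, with ancillas initialised to $|0\rangle$; no uniformity is required. Negligible means $\lambda^{-\omega(1)}$. **PRFSPD.** A pseudorandom function-like state generator with proofs of destruction, with key length $w(\lambda)$, input length $d(\lambda)$, output length $n(\lambda)$ and proof length $c(\lambda)$, consists of QPT algorithms $\mathsf{Gen}$, $\mathsf{Destruct}$, $\mathsf{Ver}$: $\mathsf{Gen}$ computes coherently $|k,x\rangle\mapsto|k,x\rangle|\psi_{k,x}\rangle$ for $k\in\{0,1\}^w$, $x\in\{0,1\}^d$, with $|\psi_{k,x}\rangle$ an $n$-qubit pure state; $\mathsf{Destruct}$ maps an $n$-qubit state to a classical proof in $\{0,1\}^c$; $\mathsf{Ver}(k,x,p)$ outputs a bit. It is *quantum-secure* if * (correctness) for every $\lambda$ and $x$, $\Pr_k[\mathsf{Ver}(k,x,\mathsf{Destruct}(|\psi_{k,x}\rangle))=1]=1$; * (pseudorandomness) no QPT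 adversary with superposition queries distinguishes with non-negligible advantage the oracle $|x\rangle\mapsto|x\rangle|\psi_{k,x}\rangle$, for uniform $k$, from $|x\rangle\mapsto|x\rangle|\phi_x\rangle$, for independent Haar-random $\phi_x$; * (unclonability of proofs) every QPT adversary with classical oracle access to $\mathsf{Gen}(k,\cdot)$ and $\mathsf{Ver}(k,\cdot,\cdot)$, for uniform $k$, outputs only with negligible probability some $x$ and $t_x+1$ distinct proofs all accepted by $\mathsf{Ver}(k,x,\cdot)$, where $t_x\ge 0$ is the number of its $\mathsf{Gen}$ queries on $x$. Its input size is super-logarithmic if $d(\lambda)=\omega(\log\lambda)$. **Symmetric encryption.** A quantum-secure symmetric scheme consists of QPT algorithms $\mathsf{enc}(k,m)$, $\mathsf{dec}(k,c)$ with keys $k\in\{0,1\}^{\kappa(\lambda)}$, messages in $\{0,1\}^*$ and classical ciphertexts (the message length being part of the ciphertext, and the number of remaining ciphertext bits depending only on $\lambda$ and the message length). It is correct up to a negligible error, uniformly over all messages of any given polynomially bounded length, and it is IND-CPA secure against QPT adversaries with classical oracle access to $\mathsf{enc}(k,\cdot)$. **qPKE.** An encryption scheme with quantum public keys and classical ciphertexts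 consists of QPT algorithms: $\mathsf{Gen}$ outputs a classical key $\mathsf{dk}$; $\mathsf{QPKGen}(\mathsf{dk})$ outputs a pure state $|\mathsf{qpk}\rangle$ determined by $\mathsf{dk}$; $\mathsf{Enc}$ maps a (fresh or recycled) public key and $m\in\{0,1\}^*$ to a classical ciphertext and a recycled public key; $\mathsf{Dec}(\mathsf{dk},\cdot)$ outputs a message. It is *correct* (*reusable*) if, for every polynomial $p$, there is a negligible $\varepsilon$ such that every message of length at most $p(\lambda)$ is (any at most $p(\lambda)$ such messages, encrypted successively with one public key, are all) decrypted correctly with probability at least $1-\varepsilon(\lambda)$. It is *IND-CPA-EO secure* if every QPT adversary wins the following game with probability at most $\frac12+\varepsilon(\lambda)$ for some negligible $\varepsilon$. The challenger generates $\mathsf{dk}$ and a public key $|\mathsf{qpk}\rangle$. The adversary may obtain copies of $|\mathsf{qpk}\rangle$, and adaptively sends messages, each of which the challenger encrypts with its own, successively recycled, public key, returning the ciphertext. At some point the adversary sends $m_0',m_1'$ of equal length; the challenger picks a uniform bit $b$ and encrypts $m_b'$ with its current public key; the adversary then continues as before, and wins if it outputs $b$. **Construction.** Given a PRFSPD and a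 symmetric scheme $(\mathsf{enc},\mathsf{dec})$ with key length $\kappa=\kappa(\lambda)$: * $\mathsf{Gen}$: $\mathsf{dk}=(\mathsf{dk}_{0,i})_{i\le\kappa}$ with uniform $\mathsf{dk}_{0,i}\in\{0,1\}^{w}$. * $\mathsf{QPKGen}$: $|\mathsf{qpk}\rangle=\bigotimes_{i\le\kappa}2^{-d/2}\sum_{x_i\in\{0,1\}^d}|x_i\rangle|\psi_{\mathsf{dk}_{0,i},x_i}\rangle$ (padded by zero qubits, which include a flag that tells fresh from recycled keys). * $\mathsf{Enc}$ with a fresh key: measure the $x_i$; apply $\mathsf{Destruct}$ to the residual states to get $y_i$; pick uniform $\mathsf{dk}_{1,i}\in\{0,1\}^w$ and set $y_i'=\mathsf{Destruct}(|\psi_{\mathsf{dk}_{1,i},x_i}\rangle)$; pick a uniform $k\in\{0,1\}^\kappa$; set $\tilde y_i=y_i$ if $k_i=1$ and $\tilde y_i=y_i'$ if $k_i=0$; output the ciphertext $(\mathsf{enc}(k,m),(x_i,\tilde y_i)_i)$ and the recycled key $(k,(x_i,\tilde y_i)_i)$. With a recycled key $(k,(x_i,\tilde y_i)_i)$: output $(\mathsf{enc}(k,m),(x_i,\tilde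 y_i)_i)$ and keep the key. * $\mathsf{Dec}(\mathsf{dk},(c',(x_i,\tilde y_i)_i))$: let $k_i'=\mathsf{Ver}(\mathsf{dk}_{0,i},x_i,\tilde y_i)$ and output $\mathsf{dec}(k',c')$. **Theorem.** Let a quantum-secure PRFSPD with super-logarithmic input size be given. Then there is a quantum-secure symmetric encryption scheme with classical ciphertexts; and for every such scheme, the construction applied to the PRFSPD and this scheme is a qPKE with classical ciphertexts (all its algorithms are QPT) which is correct, reusable and IND-CPA-EO secure. In particular, if a quantum-secure PRFSPD with super-logarithmic input size exists, then there exists a correct and reusable qPKE with classical ciphertexts that is IND-CPA-EO secure. -/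

import Mathlib

namespace QPK

open Matrix MeasureTheory Asymptotics Filter

noncomputable section

/-! ### Asymptotics -/

/-- `f` is bounded by a polynomial in the security parameter. -/
def PolyBounded (f : ℕ → ℕ) : Prop :=
  ∃ p : Polynomial ℕ, ∀ lam, f lam ≤ p.eval lam

/-- `ε` decays faster than every inverse polynomial. -/
def Negligible (ε : ℕ → ℝ) : Prop :=
  SuperpolynomialDecay atTop (fun lam : ℕ => (lam : ℝ)) ε

/-! ### Qubit registers -/

/-- Computational basis of the register whose qubits ("wires") are labelled by `ι`;
equivalently, bit strings indexed by `ι`. -/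
abbrev Cfg (ι : Type) : Type := ι → Bool

/-- Operators (in particular density operators) on the register labelled by `ι`. -/
abbrev Op (ι : Type) : Type := Matrix (Cfg ι) (Cfg ι) ℂ

section Registers

variable {ι κ W : Type} [Fintype ι] [DecidableEq ι] [Fintype κ] [DecidableEq κ]
  [Fintype W] [DecidableEq W]

/-- Basis vector `|a⟩`. -/
def ket (a : Cfg ι) : Cfg ι → ℂ := Pi.single a 1

/-- The rank-one operator `|v⟩⟨v|`. -/
def pureState (v : Cfg ι → ℂ) : Op ι := Matrix.vecMulVec v (star v)

/-- Tensor product of operators. -/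
def tensor (ρ : Op ι) (σ : Op κ) : Op (ι ⊕ κ) :=
  Matrix.of fun b b' => ρ (b ∘ Sum.inl) (b' ∘ Sum.inl) * σ (b ∘ Sum.inr) (b' ∘ Sum.inr)

/-- `L ρ L*`. -/
def conj {S T : Type} [Fintype S] [Fintype T] (L : Matrix S T ℂ) (ρ : Matrix T T ℂ) :
    Matrix S S ℂ := L * ρ * Lᴴ

open Classical in
/-- The operator `K`, acting on the wires selected by `f`, tensored with the identity on all
other wires. -/
def onWires (f : ι ↪ W) (K : Op ι) : Op W :=
  Matrix.of fun b b' => if ∀ j, j ∉ Set.range f → b j = b' j then K (b ∘ f) (b' ∘ f) else 0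

open Classical in
/-- Partial trace over all wires not selected by `f`. -/
def keepWires (f : κ ↪ W) (σ : Op W) : Op κ :=
  Matrix.of fun y y' => ∑ b : Cfg W, ∑ b' : Cfg W,
    if b ∘ f = y ∧ b' ∘ f = y' ∧ ∀ j, j ∉ Set.range f → b j = b' j then σ b b' else 0

open Classical in
/-- The isometry which places the register `ι` on the wires selected by `f` and initialises all
other wires to `|0⟩`. -/
def placeWires (f : ι ↪ W) : Matrix (Cfg W) (Cfg ι) ℂ :=
  Matrix.of fun b a => if b = Function.extend f a (fun _ => false) then 1 else 0

/-- Discard the wires selected by `f` and replace them by a fresh copy of the pure state `φ`. -/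
def overwrite (f : κ ↪ W) (φ : Cfg κ → ℂ) (ρ : Op W) : Op W :=
  ∑ s : Cfg κ, conj (onWires f (Matrix.of fun b b' => if b' = s then φ b else 0)) ρ

/-- The (unnormalised) branch in which the wires `f ∘ inl` are measured with outcome `a`, and
the wires `f ∘ inr` are discarded and replaced by the pure state `φ`. -/
def readWrite (f : ι ⊕ κ ↪ W) (a : Cfg ι) (φ : Cfg κ → ℂ) (ρ : Op W) : Op W :=
  ∑ s : Cfg κ, conj (onWires f (Matrix.of fun b b' =>
    if b ∘ Sum.inl = a ∧ b' ∘ Sum.inl = a ∧ b' ∘ Sum.inr = s then φ (b ∘ Sum.inr) else 0)) ρ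

/-- Superposition query: discard the wires `f ∘ inr` and then apply the isometry
`|x⟩ ↦ |x⟩|φ x⟩`, reading `x` from the wires `f ∘ inl` and writing on the wires `f ∘ inr`. -/
def superQuery (f : ι ⊕ κ ↪ W) (φ : Cfg ι → Cfg κ → ℂ) (ρ : Op W) : Op W :=
  ∑ s : Cfg κ, conj (onWires f (Matrix.of fun b b' =>
    if b ∘ Sum.inl = b' ∘ Sum.inl ∧ b' ∘ Sum.inr = s
    then φ (b ∘ Sum.inl) (b ∘ Sum.inr) else 0)) ρ

end Registers

/-- The (unnormalised) branch in which the wire `w` is measured with outcome `v`. -/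
def branch {W : Type} (w : W) (v : Bool) (ρ : Op W) : Op W :=
  Matrix.of fun b b' => if b w = v ∧ b' w = v then ρ b b' else 0

/-- The all-zero state. -/
def zeroState (N : ℕ) : Op (Fin N) := pureState (ket fun _ => false)

/-! ### Quantum circuits and algorithms -/

/-- A gate: an arbitrary unitary on at most three of the `N` wires. -/
structure Gate (N : ℕ) where
  arity : ℕ
  arity_le : arity ≤ 3
  wires : Fin arity ↪ Fin N
  mat : Op (Fin arity)
  unitary : mat ∈ Matrix.unitaryGroup (Cfg (Fin arity)) ℂ

/-- Apply a gate to a density operator. -/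
def Gate.apply {N : ℕ} (g : Gate N) (ρ : Op (Fin N)) : Op (Fin N) :=
  conj (onWires g.wires g.mat) ρ

/-- A quantum circuit with input register `ι` and output register `κ`: the input is placed on
the wires `inp`, the other wires start in `|0⟩`, the gates are applied in the order of the list,
and all wires outside `out` are discarded. -/
structure QAlg (ι κ : Type) where
  wires : ℕ
  inp : ι ↪ Fin wires
  out : κ ↪ Fin wires
  gates : List (Gate wires)

namespace QAlg

variable {ι κ : Type} [Fintype ι] [DecidableEq ι] [Fintype κ] [DecidableEq κ]

/-- Number of wires plus number of gates. -/
def size (A : QAlg ι κ) : ℕ := A.wires + A.gates.length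

/-- The quantum channel computed by the circuit. -/
def run (A : QAlg ι κ) (ρ : Op ι) : Op κ :=
  keepWires A.out (A.gates.foldl (fun σ g => g.apply σ) (conj (placeWires A.inp) ρ))

/-- Probability that measuring the output gives `y`, on the classical input `a`. -/
def prob (A : QAlg ι κ) (a : Cfg ι) (y : Cfg κ) : ℝ := (A.run (pureState (ket a)) y y).re

/-- Probability that measuring the output gives `y`, on the pure input state `v`. -/
def probPure (A : QAlg ι κ) (v : Cfg ι → ℂ) (y : Cfg κ) : ℝ := (A.run (pureState v) y y).re

/-- The coefficients of the measurement "run the circuit and measure the output": on input `σ`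
the outcome `y` has probability `∑ s s', σ s s' * A.coeff y s s'`. -/
def coeff (A : QAlg ι κ) (y : Cfg κ) (s s' : Cfg ι) : ℂ := A.run (Matrix.single s s' 1) y y

end QAlg

/-- Uniform average over all bit strings of length `w`. -/
def avg {w : ℕ} (f : Cfg (Fin w) → ℝ) : ℝ := (∑ k, f k) / 2 ^ w

/-! ### Pseudorandom function-like states with proofs of destruction -/

/-- The algorithms of a PRFSPD scheme, as families of circuits (one for each security
parameter).  `gen` computes coherently the isometry `|k,x⟩ ↦ |k,x⟩|ψ_k^x⟩`. -/
structure PRFSPD where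
  keyLen : ℕ → ℕ
  inLen : ℕ → ℕ
  outLen : ℕ → ℕ
  proofLen : ℕ → ℕ
  state : ∀ lam, Cfg (Fin (keyLen lam)) → Cfg (Fin (inLen lam)) → Cfg (Fin (outLen lam)) → ℂ
  gen : ∀ lam, QAlg (Fin (keyLen lam) ⊕ Fin (inLen lam))
    ((Fin (keyLen lam) ⊕ Fin (inLen lam)) ⊕ Fin (outLen lam))
  gen_spec : ∀ lam ρ, (gen lam).run ρ = conj (Matrix.of fun b a =>
    if b ∘ Sum.inl = a then state lam (a ∘ Sum.inl) (a ∘ Sum.inr) (b ∘ Sum.inr) else 0) ρ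
  destruct : ∀ lam, QAlg (Fin (outLen lam)) (Fin (proofLen lam))
  ver : ∀ lam, QAlg (Fin (keyLen lam) ⊕ (Fin (inLen lam) ⊕ Fin (proofLen lam))) Unit

/-- Oracle programs for the pseudorandomness experiment: gates, and superposition queries to an
oracle mapping `d` qubits to `n` further qubits. -/
inductive PRInstr (d n N : ℕ) where
  | gate (g : Gate N)
  | query (f : Fin d ⊕ Fin n ↪ Fin N)

/-- A distinguisher: it starts in the all-zero state, runs its program, and measures `out`. -/
structure PRAdv (d n : ℕ) where
  wires : ℕ
  prog : List (PRInstr d n wires)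
  out : Fin wires

namespace PRAdv

def size {d n : ℕ} (A : PRAdv d n) : ℕ := A.wires + A.prog.length

/-- The final state when the oracle is `|x⟩ ↦ |x⟩|φ x⟩`. -/
def final {d n : ℕ} (A : PRAdv d n) (φ : Cfg (Fin d) → Cfg (Fin n) → ℂ) : Op (Fin A.wires) :=
  A.prog.foldl (fun ρ i => match i with
    | .gate g => g.apply ρ
    | .query f => superQuery f φ ρ) (zeroState A.wires)

/-- Probability of the output bit `1`. -/
def accept {d n : ℕ} (A : PRAdv d n) (φ : Cfg (Fin d) → Cfg (Fin n) → ℂ) : ℝ :=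
  ∑ b, if b A.out = true then (A.final φ b b).re else 0

end PRAdv

/-- Unit vectors of `(ℂ²)^{⊗ n}`. -/
abbrev StateSphere (n : ℕ) : Type :=
  Metric.sphere (0 : EuclideanSpace ℂ (Cfg (Fin n))) 1

/-- The distribution of a Haar-random pure state: the normalised surface measure. -/
def haarState (n : ℕ) : Measure (StateSphere n) :=
  let μ := (volume : Measure (EuclideanSpace ℂ (Cfg (Fin n)))).toSphere
  (μ Set.univ)⁻¹ • μ

/-- Oracle programs for the cloning experiment: gates, classical queries to the state generator
(made only when the control wire `ctrl` is measured to be `1`; reads `x`, writes `|ψ^x⟩`) and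
classical queries to the verification algorithm (reads `(x, p)`, writes the answer bit). -/
inductive CloneInstr (d n c N : ℕ) where
  | gate (g : Gate N)
  | gen (ctrl : Fin N) (f : Fin d ⊕ Fin n ↪ Fin N)
  | ver (f : (Fin d ⊕ Fin c) ⊕ Unit ↪ Fin N)

/-- A cloning adversary.  At the end `out` is measured, which gives a string `x` and `slots`
candidate proofs. -/
structure CloneAdv (d n c : ℕ) where
  wires : ℕ
  prog : List (CloneInstr d n c wires)
  slots : ℕ
  out : Fin d ⊕ (Fin slots × Fin c) ↪ Fin wires

namespace CloneAdv

variable {d n c : ℕ}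

def size (A : CloneAdv d n c) : ℕ := A.wires + A.prog.length

/-- Run a program from the (unnormalised) state `ρ`, where `t x` counts the generator queries
made on `x` so far, and evaluate the outcome by `fin`.  Here `ψ x` is the state returned on `x`
and `v x p` is the probability that `p` is accepted as a proof for `x`. -/
def exec {N : ℕ} (ψ : Cfg (Fin d) → Cfg (Fin n) → ℂ) (v : Cfg (Fin d) → Cfg (Fin c) → ℝ)
    (fin : (Cfg (Fin d) → ℕ) → Op (Fin N) → ℝ) :
    List (CloneInstr d n c N) → (Cfg (Fin d) → ℕ) → Op (Fin N) → ℝ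
  | [], t, ρ => fin t ρ
  | .gate g :: is, t, ρ => exec ψ v fin is t (g.apply ρ)
  | .gen ctrl f :: is, t, ρ =>
      exec ψ v fin is t (branch ctrl false ρ) +
      ∑ x, exec ψ v fin is (Function.update t x (t x + 1))
        (readWrite f x (ψ x) (branch ctrl true ρ))
  | .ver f :: is, t, ρ => exec ψ v fin is t (∑ a,
      (((v (a ∘ Sum.inl) (a ∘ Sum.inr) : ℝ) : ℂ) • readWrite f a (ket fun _ => true) ρ +
        ((1 - v (a ∘ Sum.inl) (a ∘ Sum.inr) : ℝ) : ℂ) • readWrite f a (ket fun _ => false) ρ))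

open Classical in
/-- Probability that the output `x, (p_i)_i` wins: the first `t x + 1` proofs must exist, be
pairwise distinct, and all be accepted. -/
def score (v : Cfg (Fin d) → Cfg (Fin c) → ℝ) {r : ℕ} (t : Cfg (Fin d) → ℕ)
    (x : Cfg (Fin d)) (p : Fin r → Cfg (Fin c)) : ℝ :=
  if t x + 1 ≤ r ∧ ∀ i j : Fin r, (i : ℕ) ≤ t x → (j : ℕ) ≤ t x → p i = p j → i = j
  then ∏ i : Fin r, if (i : ℕ) ≤ t x then v x (p i) else 1
  else 0

/-- Probability of winning the cloning game. -/
def win (A : CloneAdv d n c) (ψ : Cfg (Fin d) → Cfg (Fin n) → ℂ)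
    (v : Cfg (Fin d) → Cfg (Fin c) → ℝ) : ℝ :=
  exec ψ v (fun t ρ => ∑ b : Cfg (Fin A.wires), (ρ b b).re *
      score v t (fun j => b (A.out (Sum.inl j))) (fun i j => b (A.out (Sum.inr (i, j)))))
    A.prog (fun _ => 0) (zeroState A.wires)

end CloneAdv

namespace PRFSPD

variable (P : PRFSPD)

/-- All three algorithms have polynomial size. -/
def IsQPT : Prop :=
  PolyBounded (fun lam => (P.gen lam).size) ∧ PolyBounded (fun lam => (P.destruct lam).size) ∧
    PolyBounded (fun lam => (P.ver lam).size)

/-- Probability that the verification accepts. -/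
def verProb (lam : ℕ) (k : Cfg (Fin (P.keyLen lam))) (x : Cfg (Fin (P.inLen lam)))
    (p : Cfg (Fin (P.proofLen lam))) : ℝ :=
  (P.ver lam).prob (Sum.elim k (Sum.elim x p)) (fun _ => true)

/-- Honestly generated proofs are accepted with probability one. -/
def Correct : Prop :=
  ∀ lam x, avg (fun k => ∑ p, (P.destruct lam).probPure (P.state lam k x) p *
    P.verProb lam k x p) = 1

/-- Pseudorandomness against superposition queries: the generated states are indistinguishable
from independent Haar-random states, one for each `x`. -/
def Pseudorandom : Prop :=
  ∀ A : ∀ lam, PRAdv (P.inLen lam) (P.outLen lam), PolyBounded (fun lam => (A lam).size) →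
    ∃ ε : ℕ → ℝ, Negligible ε ∧ ∀ lam,
      |avg (fun k => (A lam).accept (P.state lam k)) -
        ∫ φ : Cfg (Fin (P.inLen lam)) → StateSphere (P.outLen lam),
          (A lam).accept (fun x s => (φ x).1 s)
          ∂(Measure.pi fun _ => haarState (P.outLen lam))| ≤ ε lam

/-- Unclonability of proofs. -/
def UnclonableProofs : Prop :=
  ∀ A : ∀ lam, CloneAdv (P.inLen lam) (P.outLen lam) (P.proofLen lam),
    PolyBounded (fun lam => (A lam).size) →
    ∃ ε : ℕ → ℝ, Negligible ε ∧ ∀ lam,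
      avg (fun k => (A lam).win (P.state lam k) (P.verProb lam k)) ≤ ε lam

/-- A quantum-secure PRFSPD. -/
structure QuantumSecure : Prop where
  qpt : P.IsQPT
  correct : P.Correct
  pseudorandom : P.Pseudorandom
  unclonable : P.UnclonableProofs

/-- The input length is `ω(log λ)`. -/
def SuperlogInput : Prop :=
  (fun lam : ℕ => Real.log lam) =o[atTop] (fun lam : ℕ => (P.inLen lam : ℝ))

end PRFSPD

/-! ### The chosen-plaintext game with an encryption oracle

The challenger holds a (possibly quantum) register `K` which is updated by every encryption.
`ct ℓ` labels the bits of a ciphertext of an `ℓ`-bit message, and `pk` labels the qubits of the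
public key. -/

/-- Programs of an adversary with `N` wires: gates; requests for a copy of the public key;
classical encryption queries; and the challenge query on two messages of equal length.  The
last two are performed only when the control wire `ctrl` is measured to be `1`, so that the
adversary may decide adaptively whether, and on messages of which lengths, to query. -/
inductive CPAInstr (pk : Type) (ct : ℕ → Type) (N : ℕ) where
  | gate (g : Gate N)
  | key (out : pk ↪ Fin N)
  | enc (ctrl : Fin N) (ℓ : ℕ) (f : Fin ℓ ⊕ ct ℓ ↪ Fin N)
  | chal (ctrl : Fin N) (ℓ : ℕ) (f : (Fin ℓ ⊕ Fin ℓ) ⊕ ct ℓ ↪ Fin N)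

structure CPAAdv (pk : Type) (ct : ℕ → Type) where
  wires : ℕ
  prog : List (CPAInstr pk ct wires)
  out : Fin wires

namespace CPAAdv

variable {pk K : Type} {ct : ℕ → Type} [Fintype pk] [DecidableEq pk] [Fintype K] [DecidableEq K]
  [∀ ℓ, Fintype (ct ℓ)] [∀ ℓ, DecidableEq (ct ℓ)]

def size (A : CPAAdv pk ct) : ℕ := A.wires + A.prog.length

/-- Joint states of the challenger's register and the adversary's wires. -/
abbrev Joint (K : Type) (N : ℕ) : Type :=
  Matrix (Cfg K × Cfg (Fin N)) (Cfg K × Cfg (Fin N)) ℂ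

/-- A linear map acting on the challenger's register only. -/
def onLeft {N : ℕ} (E : Op K → Op K) (σ : Joint K N) : Joint K N :=
  Matrix.of fun u u' => E (Matrix.of fun k k' => σ (k, u.2) (k', u'.2)) u.1 u'.1

/-- A linear map acting on the adversary's wires only. -/
def onRight {N : ℕ} (F : Op (Fin N) → Op (Fin N)) (σ : Joint K N) : Joint K N :=
  Matrix.of fun u u' => F (Matrix.of fun s s' => σ (u.1, s) (u'.1, s')) u.2 u'.2

/-- Measure the wires `f ∘ inl`, encrypt the message that `sel` extracts from the outcome, and
write the ciphertext on the wires `f ∘ inr`.  `E m c` is the (unnormalised) update of the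
challenger's register when the encryption of `m` results in the ciphertext `c`. -/
def encStep {N ℓ : ℕ} {ι : Type} [Fintype ι] [DecidableEq ι]
    (E : Cfg (Fin ℓ) → Cfg (ct ℓ) → Op K → Op K) (sel : Cfg ι → Cfg (Fin ℓ))
    (f : ι ⊕ ct ℓ ↪ Fin N) (σ : Joint K N) : Joint K N :=
  ∑ a : Cfg ι, ∑ c : Cfg (ct ℓ), onLeft (E (sel a) c) (onRight (readWrite f a (ket c)) σ)

/-- Run a program when the challenge bit is `β`; the flag says whether the challenge has already
been issued (afterwards, challenge queries are ignored). -/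
def exec {N : ℕ} (v : Cfg pk → ℂ) (E : ∀ ℓ, Cfg (Fin ℓ) → Cfg (ct ℓ) → Op K → Op K) (β : Bool) :
    List (CPAInstr pk ct N) → Bool → Joint K N → Joint K N
  | [], _, σ => σ
  | .gate g :: is, done, σ => exec v E β is done (onRight g.apply σ)
  | .key out :: is, done, σ => exec v E β is done (onRight (overwrite out v) σ)
  | .enc ctrl ℓ f :: is, done, σ => exec v E β is done
      (onRight (branch ctrl false) σ + encStep (E ℓ) id f (onRight (branch ctrl true) σ))
  | .chal _ _ _ :: is, true, σ => exec v E β is true σ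
  | .chal ctrl ℓ f :: is, false, σ =>
      exec v E β is false (onRight (branch ctrl false) σ) +
      exec v E β is true (encStep (E ℓ)
        (fun a => if β then a ∘ Sum.inr else a ∘ Sum.inl) f (onRight (branch ctrl true) σ))

/-- Probability of guessing the uniformly random challenge bit, when copies of `v` are handed
out as public key and the challenger's register is initially in the state `ρ₀`. -/
def win (A : CPAAdv pk ct) (v : Cfg pk → ℂ)
    (E : ∀ ℓ, Cfg (Fin ℓ) → Cfg (ct ℓ) → Op K → Op K) (ρ₀ : Op K) : ℝ :=
  (1 / 2) * ∑ β : Bool, ∑ u : Cfg K × Cfg (Fin A.wires), if u.2 A.out = β then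
    (exec v E β A.prog false
      (Matrix.of fun u u' => ρ₀ u.1 u'.1 * zeroState A.wires u.2 u'.2) u u).re else 0

end CPAAdv

/-! ### Symmetric-key encryption with classical keys and ciphertexts, and quantum algorithms -/

/-- Circuits for encrypting and decrypting `ℓ`-bit messages, for every security parameter and
every `ℓ`.  The length `ℓ` is regarded as part of the ciphertext. -/
structure SKE where
  keyLen : ℕ → ℕ
  ctLen : ℕ → ℕ → ℕ
  enc : ∀ lam ℓ, QAlg (Fin (keyLen lam) ⊕ Fin ℓ) (Fin (ctLen lam ℓ))
  dec : ∀ lam ℓ, QAlg (Fin (keyLen lam) ⊕ Fin (ctLen lam ℓ)) (Fin ℓ)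

namespace SKE

variable (S : SKE)

def IsQPT : Prop :=
  ∃ p : Polynomial ℕ, ∀ lam ℓ,
    (S.enc lam ℓ).size ≤ p.eval (lam + ℓ) ∧ (S.dec lam ℓ).size ≤ p.eval (lam + ℓ)

/-- Probability that the message `m` is encrypted to `c` under the key `k`. -/
def encProb (lam ℓ : ℕ) (k : Cfg (Fin (S.keyLen lam))) (m : Cfg (Fin ℓ))
    (c : Cfg (Fin (S.ctLen lam ℓ))) : ℝ := (S.enc lam ℓ).prob (Sum.elim k m) c

/-- Probability that `c` is decrypted to `m` under the key `k`. -/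
def decProb (lam ℓ : ℕ) (k : Cfg (Fin (S.keyLen lam))) (c : Cfg (Fin (S.ctLen lam ℓ)))
    (m : Cfg (Fin ℓ)) : ℝ := (S.dec lam ℓ).prob (Sum.elim k c) m

/-- Messages of polynomial length are decrypted correctly up to a negligible error. -/
def Correct : Prop :=
  ∀ p : Polynomial ℕ, ∃ ε : ℕ → ℝ, Negligible ε ∧ ∀ lam ℓ, ℓ ≤ p.eval lam → ∀ m : Cfg (Fin ℓ),
    1 - ε lam ≤ avg fun k => ∑ c, S.encProb lam ℓ k m c * S.decProb lam ℓ k c m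

/-- IND-CPA security against quantum adversaries with classical oracle access to the encryption.
There is no public key, and the challenger keeps the same key `k` throughout. -/
def INDCPA : Prop :=
  ∀ A : ∀ lam, CPAAdv Empty (fun ℓ => Fin (S.ctLen lam ℓ)),
    PolyBounded (fun lam => (A lam).size) →
    ∃ ε : ℕ → ℝ, Negligible ε ∧ ∀ lam,
      avg (fun k => (A lam).win (K := Empty) (fun _ => 1)
        (fun ℓ m c ρ => (S.encProb lam ℓ k m c : ℂ) • ρ) 1) ≤ 1 / 2 + ε lam

/-- A quantum-secure symmetric-key encryption scheme. -/
structure QuantumSecure : Prop where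
  qpt : S.IsQPT
  correct : S.Correct
  indcpa : S.INDCPA

end SKE

/-! ### Encryption with quantum public keys and classical ciphertexts -/

/-- The input-output behaviour of an encryption scheme with quantum public keys and classical
ciphertexts.  The wires of decryption keys, of the (fresh or recycled) public-key register, and
of ciphertexts of `ℓ`-bit messages are labelled by `Dk`, `Key` and `Ct`; the length `ℓ` is
regarded as part of the ciphertext. -/
structure QPKE where
  Dk : ℕ → Type
  Key : ℕ → Type
  Ct : ℕ → ℕ → Type
  [fDk : ∀ lam, Fintype (Dk lam)]
  [dDk : ∀ lam, DecidableEq (Dk lam)]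
  [fKey : ∀ lam, Fintype (Key lam)]
  [dKey : ∀ lam, DecidableEq (Key lam)]
  [fCt : ∀ lam ℓ, Fintype (Ct lam ℓ)]
  [dCt : ∀ lam ℓ, DecidableEq (Ct lam ℓ)]
  /-- distribution of the decryption key -/
  gen : ∀ lam, Cfg (Dk lam) → ℝ
  /-- the pure public-key state of a decryption key -/
  qpk : ∀ lam, Cfg (Dk lam) → Cfg (Key lam) → ℂ
  /-- `enc lam ℓ m c` maps the state of the public-key register to the (unnormalised) state of
  the recycled public key, in the event that the encryption of `m` gives the ciphertext `c` -/
  enc : ∀ lam ℓ, Cfg (Fin ℓ) → Cfg (Ct lam ℓ) → Op (Key lam) → Op (Key lam)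
  /-- probability that a ciphertext is decrypted to a given message -/
  dec : ∀ lam ℓ, Cfg (Dk lam) → Cfg (Ct lam ℓ) → Cfg (Fin ℓ) → ℝ

namespace QPKE

attribute [instance] fDk dDk fKey dKey fCt dCt

variable (Q : QPKE)

/-- The four algorithms are computed by circuits of polynomial size; in particular `gen` and
`dec` are probability distributions, `qpk` is a pure state and `enc` is a quantum instrument. -/
def IsQPT : Prop :=
  ∃ (G : ∀ lam, QAlg Empty (Q.Dk lam)) (H : ∀ lam, QAlg (Q.Dk lam) (Q.Key lam))
    (E : ∀ lam ℓ, QAlg (Q.Key lam ⊕ Fin ℓ) (Q.Key lam ⊕ Q.Ct lam ℓ))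
    (D : ∀ lam ℓ, QAlg (Q.Dk lam ⊕ Q.Ct lam ℓ) (Fin ℓ)),
    PolyBounded (fun lam => (G lam).size) ∧ PolyBounded (fun lam => (H lam).size) ∧
    (∃ p : Polynomial ℕ, ∀ lam ℓ,
      (E lam ℓ).size ≤ p.eval (lam + ℓ) ∧ (D lam ℓ).size ≤ p.eval (lam + ℓ)) ∧
    (∀ lam dk, Q.gen lam dk = (G lam).prob Empty.elim dk) ∧
    (∀ lam dk, (H lam).run (pureState (ket dk)) = pureState (Q.qpk lam dk)) ∧
    (∀ lam ℓ m c ρ k k', Q.enc lam ℓ m c ρ k k' =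
      (E lam ℓ).run (tensor ρ (pureState (ket m))) (Sum.elim k c) (Sum.elim k' c)) ∧
    (∀ lam ℓ dk c m, Q.dec lam ℓ dk c m = (D lam ℓ).prob (Sum.elim dk c) m)

/-- Encrypt the messages one after the other, reusing the public-key register; the probability
that all ciphertexts are decrypted correctly. -/
def successFrom (lam : ℕ) (dk : Cfg (Q.Dk lam)) :
    List (Σ ℓ : ℕ, Cfg (Fin ℓ)) → Op (Q.Key lam) → ℝ
  | [], ρ => ρ.trace.re
  | m :: ms, ρ => ∑ c, Q.dec lam m.1 dk c m.2 * successFrom lam dk ms (Q.enc lam m.1 m.2 c ρ)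

/-- The same, averaged over the decryption key, starting from the public key it defines. -/
def success (lam : ℕ) (ms : List (Σ ℓ : ℕ, Cfg (Fin ℓ))) : ℝ :=
  ∑ dk, Q.gen lam dk * Q.successFrom lam dk ms (pureState (Q.qpk lam dk))

/-- Correctness for one message (of polynomial length). -/
def Correct : Prop :=
  ∀ p : Polynomial ℕ, ∃ ε : ℕ → ℝ, Negligible ε ∧ ∀ lam ℓ, ℓ ≤ p.eval lam → ∀ m : Cfg (Fin ℓ),
    1 - ε lam ≤ Q.success lam [⟨ℓ, m⟩]

/-- Reusability: correctness for polynomially many messages (of polynomial lengths) which are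
encrypted with a single public key. -/
def Reusable : Prop :=
  ∀ p : Polynomial ℕ, ∃ ε : ℕ → ℝ, Negligible ε ∧ ∀ lam (ms : List (Σ ℓ : ℕ, Cfg (Fin ℓ))),
    ms.length ≤ p.eval lam → (∀ m ∈ ms, m.1 ≤ p.eval lam) → 1 - ε lam ≤ Q.success lam ms

/-- IND-CPA-EO security: the adversary may ask for copies of the public key, and has an
encryption oracle which uses the same public-key register as the challenge encryption. -/
def INDCPAEO : Prop :=
  ∀ A : ∀ lam, CPAAdv (Q.Key lam) (Q.Ct lam), PolyBounded (fun lam => (A lam).size) →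
    ∃ ε : ℕ → ℝ, Negligible ε ∧ ∀ lam,
      ∑ dk, Q.gen lam dk * (A lam).win (Q.qpk lam dk) (Q.enc lam) (pureState (Q.qpk lam dk))
        ≤ 1 / 2 + ε lam

end QPKE

/-! ### The construction -/

namespace Construction

/-- Wires of the public-key register, with `s` slots: a flag (`0` for a fresh key and `1` for a
recycled key), and for each slot a string `x` (`d` bits), a state (`n` qubits), a bit of the
symmetric key, and a proof (`c` bits). -/
abbrev KeyW (s d n c : ℕ) : Type := Unit ⊕ (Fin s × ((Fin d ⊕ Fin n) ⊕ (Unit ⊕ Fin c)))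

variable {s d n c : ℕ}

def flag (b : Cfg (KeyW s d n c)) : Bool := b (Sum.inl ())

def str (b : Cfg (KeyW s d n c)) (i : Fin s) : Cfg (Fin d) :=
  fun j => b (Sum.inr (i, Sum.inl (Sum.inl j)))

def sys (b : Cfg (KeyW s d n c)) (i : Fin s) : Cfg (Fin n) :=
  fun j => b (Sum.inr (i, Sum.inl (Sum.inr j)))

def bit (b : Cfg (KeyW s d n c)) : Cfg (Fin s) :=
  fun i => b (Sum.inr (i, Sum.inr (Sum.inl ())))

def prf (b : Cfg (KeyW s d n c)) (i : Fin s) : Cfg (Fin c) :=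
  fun j => b (Sum.inr (i, Sum.inr (Sum.inr j)))

variable (P : PRFSPD) (S : SKE)

/-- Public-key register: one slot for each bit of the symmetric key. -/
abbrev Key (lam : ℕ) : Type :=
  KeyW (S.keyLen lam) (P.inLen lam) (P.outLen lam) (P.proofLen lam)

/-- One PRFSPD key for each slot. -/
abbrev Dk (lam : ℕ) : Type := Fin (S.keyLen lam) × Fin (P.keyLen lam)

/-- Ciphertexts: a symmetric ciphertext, and a pair `(x_i, ỹ_i)` for each slot. -/
abbrev Ct (lam ℓ : ℕ) : Type :=
  Fin (S.ctLen lam ℓ) ⊕ (Fin (S.keyLen lam) × (Fin (P.inLen lam) ⊕ Fin (P.proofLen lam)))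

variable {P S} in
/-- The PRFSPD key of slot `i`. -/
def slotKey {lam : ℕ} (dk : Cfg (Dk P S lam)) (i : Fin (S.keyLen lam)) :
    Cfg (Fin (P.keyLen lam)) := fun j => dk (i, j)

variable {P S} in
def ctStr {lam ℓ : ℕ} (z : Cfg (Ct P S lam ℓ)) (i : Fin (S.keyLen lam)) :
    Cfg (Fin (P.inLen lam)) := fun j => z (Sum.inr (i, Sum.inl j))

variable {P S} in
def ctPrf {lam ℓ : ℕ} (z : Cfg (Ct P S lam ℓ)) (i : Fin (S.keyLen lam)) :
    Cfg (Fin (P.proofLen lam)) := fun j => z (Sum.inr (i, Sum.inr j))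

variable {P S} in
def ctSym {lam ℓ : ℕ} (z : Cfg (Ct P S lam ℓ)) : Cfg (Fin (S.ctLen lam ℓ)) :=
  fun j => z (Sum.inl j)

/-- The public key `⨂ᵢ 2^{-d/2} ∑ₓ |x⟩|ψ_{dkᵢ}^x⟩`; the remaining wires are `0`. -/
def qpk (lam : ℕ) (dk : Cfg (Dk P S lam)) (b : Cfg (Key P S lam)) : ℂ :=
  if flag b = false ∧ bit b = (fun _ => false) ∧ prf b = (fun _ _ => false) then
    ∏ i, (((√(2 ^ P.inLen lam))⁻¹ : ℝ) : ℂ) * P.state lam (slotKey dk i) (str b i) (sys b i)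
  else 0

/-- Distribution of the destruction proof of `|ψ_{dk'}^x⟩` for a fresh uniform key `dk'`. -/
def fakeProof (lam : ℕ) (x : Cfg (Fin (P.inLen lam))) (y : Cfg (Fin (P.proofLen lam))) : ℝ :=
  avg fun k => (P.destruct lam).probPure (P.state lam k x) y

/-- Probability weight of the event that the register in state `ρ` holds a fresh key, that its
strings are measured to be the `xᵢ` stored in `r`, that the uniformly chosen symmetric key is the
`k` stored in `r`, and that the proofs are the `ỹᵢ` stored in `r`: for `kᵢ = 1` the proof of
destruction of the residual state of slot `i`; for `kᵢ = 0` the residual state is destructed too,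
its proof is dropped, and a proof for a fresh PRFSPD key is used. -/
def freshWeight (lam : ℕ) (ρ : Op (Key P S lam)) (r : Cfg (Key P S lam)) : ℂ :=
  (1 / 2 ^ S.keyLen lam) * ∑ u : Cfg (Key P S lam), ∑ u' : Cfg (Key P S lam),
    if flag u = false ∧ flag u' = false ∧ str u = str r ∧ str u' = str r ∧
        bit u = bit u' ∧ prf u = prf u' then
      ρ u u' * ∏ i, if bit r i = true
        then (P.destruct lam).coeff (prf r i) (sys u i) (sys u' i)
        else (∑ y, (P.destruct lam).coeff y (sys u i) (sys u' i)) *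
          (fakeProof P lam (str r i) (prf r i) : ℂ)
    else 0

/-- Probability weight of the event that the register in state `ρ` is measured to hold a recycled
key with the strings, symmetric key and proofs stored in `r`. -/
def recycledWeight (lam : ℕ) (ρ : Op (Key P S lam)) (r : Cfg (Key P S lam)) : ℂ :=
  ∑ u : Cfg (Key P S lam),
    if flag u = true ∧ str u = str r ∧ bit u = bit r ∧ prf u = prf r then ρ u u else 0

/-- Encryption.  In both cases `(x_i)_i`, `k` and `(ỹ_i)_i` get determined; the ciphertext is
`(enc(k, m), (x_i, ỹ_i)_i)` and the recycled key is `(k, (x_i, ỹ_i)_i)`. -/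
def enc (lam ℓ : ℕ) (m : Cfg (Fin ℓ)) (z : Cfg (Ct P S lam ℓ)) (ρ : Op (Key P S lam)) :
    Op (Key P S lam) :=
  Matrix.of fun r r' =>
    if r = r' ∧ flag r = true ∧ sys r = (fun _ _ => false) ∧ str r = ctStr z ∧ prf r = ctPrf z then
      (freshWeight P S lam ρ r + recycledWeight P S lam ρ r) *
        (S.encProb lam ℓ (bit r) m (ctSym z) : ℂ)
    else 0

/-- Decryption: `k'_i` is the answer of the verification in slot `i`, and the symmetric
ciphertext is decrypted with `k'`. -/
def dec (lam ℓ : ℕ) (dk : Cfg (Dk P S lam)) (z : Cfg (Ct P S lam ℓ)) (m : Cfg (Fin ℓ)) : ℝ :=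
  ∑ k : Cfg (Fin (S.keyLen lam)),
    (∏ i, if k i = true then P.verProb lam (slotKey dk i) (ctStr z i) (ctPrf z i)
      else 1 - P.verProb lam (slotKey dk i) (ctStr z i) (ctPrf z i)) *
    S.decProb lam ℓ k (ctSym z) m

end Construction

/-- The public-key scheme obtained from a PRFSPD and a symmetric scheme. -/
def construction (P : PRFSPD) (S : SKE) : QPKE where
  Dk := Construction.Dk P S
  Key := Construction.Key P S
  Ct := Construction.Ct P S
  gen lam _ := 1 / 2 ^ (S.keyLen lam * P.keyLen lam)
  qpk := Construction.qpk P S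
  enc := Construction.enc P S
  dec := Construction.dec P S

end

end QPK

namespace QPK

open Matrix MeasureTheory Asymptotics Filter
open Finset (sum_congr sum_eq_single mul_sum sum_comm mem_univ sum_mul sum_eq_zero sum_le_sum
  sum_add_distrib prod_congr sum_nonneg sum_sub_distrib mul_prod_erase sum_div prod_mul_distrib
  prod_nonneg prod_eq_one ne_of_mem_erase prod_eq_zero single_le_sum sum_const card_univ
  induction_on sum_insert smul_sum prod_const abs_sum_le_sum_abs sum_ite_eq sum_ite_eq'
  sum_const_zero prod_const_one univ prod_insert sum_filter prod_le_one)
open Sum (inl inr elim elim_comp_inl elim_comp_inr elim_inl elim_inr inr_ne_inl inl_ne_inr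
  elim_comp_inl_inr)
open Fintype (card card_fin card_sum card_prod card_unit sum_prod_type sum_equiv sum_bool
  card_le_of_embedding card_empty sum_prod_type' equivFin prod_unique sum_of_injective card_ne_zero
  card_fun)
open Function (update update_self update_of_ne Injective Embedding)
open Complex (re_sum ofReal_sum ofReal_mul)

noncomputable section

set_option linter.unusedSectionVars false
set_option linter.unusedFintypeInType false
set_option linter.unusedDecidableInType false

/-! ### Strings used by a PRFSPD -/

abbrev PRFSPD.Input (P : PRFSPD) (lam : ℕ) : Type := Cfg (Fin (P.inLen lam))

abbrev PRFSPD.Output (P : PRFSPD) (lam : ℕ) : Type := Cfg (Fin (P.outLen lam))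

abbrev PRFSPD.Proof (P : PRFSPD) (lam : ℕ) : Type := Cfg (Fin (P.proofLen lam))

abbrev PRFSPD.Seed (P : PRFSPD) (lam : ℕ) : Type := Cfg (Fin (P.keyLen lam))

abbrev SKE.Slot (S : SKE) (lam : ℕ) : Type := Fin (S.keyLen lam)

/-- A family of states. -/
abbrev States (d n : ℕ) : Type := Cfg (Fin d) → StateSphere n

/-- The amplitudes of a family of vectors. -/
abbrev Amps (d n : ℕ) : Type := Cfg (Fin d) → Cfg (Fin n) → ℂ

/-! ### Calculus of wires -/

section Wires

variable {ι κ μ W V R Z : Type}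

/-- Overwrite the bits of `b` selected by `f` by those of `a`. -/
abbrev splice {ι W : Type} (f : ι ↪ W) (a : Cfg ι) (b : Cfg W) : Cfg W := Function.extend f a b

@[simp] lemma splice_apply (f : ι ↪ W) (a : Cfg ι) (b : Cfg W) (i : ι) :
    splice f a b (f i) = a i := f.injective.extend_apply _ _ _

lemma splice_of_notMem (f : ι ↪ W) (a : Cfg ι) (b : Cfg W) {j : W} (h : j ∉ Set.range f) :
    splice f a b j = b j := Function.extend_apply' _ _ _ h

@[simp] lemma splice_comp (f : ι ↪ W) (a : Cfg ι) (b : Cfg W) : splice f a b ∘ f = a :=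
  funext fun i => splice_apply f a b i

lemma splice_ext (f : ι ↪ W) {a : Cfg ι} {b c : Cfg W} (h : c ∘ f = a)
    (h' : ∀ j, j ∉ Set.range f → b j = c j) : splice f a b = c := by
  funext j
  by_cases hj : j ∈ Set.range f
  · obtain ⟨i, rfl⟩ := hj
    rw [splice_apply, ← h]; rfl
  · rw [splice_of_notMem f a b hj, h' j hj]

@[simp] lemma splice_self (f : ι ↪ W) (b : Cfg W) : splice f (b ∘ f) b = b :=
  splice_ext f rfl fun _ _ => rfl

@[simp] lemma splice_splice (f : ι ↪ W) (a a' : Cfg ι) (b : Cfg W) :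
    splice f a (splice f a' b) = splice f a b :=
  splice_ext f (splice_comp f a b) fun j hj => by
    rw [splice_of_notMem f _ _ hj, splice_of_notMem f _ _ hj]

lemma splice_trans (f : ι ↪ κ) (g : κ ↪ W) (a : Cfg ι) (b : Cfg W) :
    splice (f.trans g) a b = splice g (splice f a (b ∘ g)) b := by
  refine splice_ext _ ?_ ?_
  · funext i
    simp [Function.comp_def]
  · intro j hj
    by_cases h : j ∈ Set.range g
    · obtain ⟨i, rfl⟩ := h
      rw [splice_apply, splice_of_notMem]
      · rfl
      · rintro ⟨l, rfl⟩
        exact hj ⟨l, rfl⟩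
    · rw [splice_of_notMem g _ _ h]

/-- `G`, acting on the wires selected by `f`; `Z` is a classical register outside the circuit. -/
def applyZ (f : ι ↪ W) (G : (Z → Op ι) → Z → Op ι) (ρ : Z → Op W) : Z → Op W := fun z =>
  of fun b b' =>
    G (fun z' => of fun a a' => ρ z' (splice f a b) (splice f a' b')) z (b ∘ f) (b' ∘ f)

/-- `F`, acting on the wires selected by `f`. -/
def applyOn (f : ι ↪ W) (F : Op ι → Op ι) (ρ : Op W) : Op W :=
  of fun b b' =>
    F (of fun a a' => ρ (splice f a b) (splice f a' b')) (b ∘ f) (b' ∘ f)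

lemma applyOn_apply (f : ι ↪ W) (F : Op ι → Op ι) (ρ : Op W) (b b' : Cfg W) : applyOn f F ρ b b' =
    F (of fun a a' => ρ (splice f a b) (splice f a' b')) (b ∘ f) (b' ∘ f) := rfl

lemma applyZ_lift (f : ι ↪ W) (F : Op ι → Op ι) (ρ : Z → Op W) :
    applyZ f (fun ρ z => F (ρ z)) ρ = fun z => applyOn f F (ρ z) := rfl

lemma applyZ_trans (f : ι ↪ κ) (g : κ ↪ W) (G : (Z → Op ι) → Z → Op ι) :
    applyZ (f.trans g) G = applyZ g (applyZ f G) := by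
  funext ρ z
  ext b b'
  simp only [applyZ, of_apply]
  congr 1
  funext z'
  ext a a'
  simp only [of_apply, splice_trans]

lemma applyOn_trans (f : ι ↪ κ) (g : κ ↪ W) (F : Op ι → Op ι) :
    applyOn (f.trans g) F = applyOn g (applyOn f F) := by
  funext ρ
  exact congrFun (congrFun (applyZ_trans (Z := Unit) f g (fun ρ z => F (ρ z))) fun _ => ρ) ()

lemma applyOn_refl (F : Op ι → Op ι) : applyOn (Embedding.refl ι) F = F := by
  funext ρ
  ext b b'
  have h : ∀ a b : Cfg ι, splice (Embedding.refl ι) a b = a := fun a b =>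
    splice_ext _ rfl fun j hj => absurd ⟨j, rfl⟩ hj
  simp only [applyOn_apply, h]
  rfl

lemma applyOn_comp (f : ι ↪ W) (F G : Op ι → Op ι) (ρ : Op W) :
    applyOn f F (applyOn f G ρ) = applyOn f (fun σ => F (G σ)) ρ := by
  ext b b'
  simp only [applyOn_apply, splice_comp, splice_splice]
  rfl

variable [Fintype ι] [DecidableEq ι] [Fintype κ] [DecidableEq κ] [Fintype μ] [DecidableEq μ]
  [Fintype W] [DecidableEq W] [Fintype V] [DecidableEq V] [Fintype R] [DecidableEq R]

open Classical in
lemma sum_splice {M : Type*} [AddCommMonoid M] (f : ι ↪ W) (b₀ : Cfg W) (g : Cfg W → M) :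
    (∑ b, if ∀ j, j ∉ Set.range f → b₀ j = b j then g b else 0) = ∑ a, g (splice f a b₀) := by
  rw [← sum_filter]
  symm
  refine Finset.sum_nbij (fun a => splice f a b₀) ?_ ?_ ?_ fun _ _ => rfl
  · intro a _
    simp only [Finset.mem_filter, mem_univ, true_and]
    intro j hj
    rw [splice_of_notMem f _ _ hj]
  · intro a _ a' _ h
    have := congrArg (fun c => c ∘ f) h
    simpa using this
  · intro b hb
    simp only [Finset.coe_filter, mem_univ, true_and, Set.mem_ofPred_eq] at hb
    exact ⟨b ∘ f, by simp, splice_ext f rfl hb⟩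

lemma conj_apply {S T : Type} [Fintype S] [Fintype T] (L : Matrix S T ℂ) (ρ : Matrix T T ℂ)
    (s s' : S) : conj L ρ s s' = ∑ t, ∑ t', L s t * ρ t t' * star (L s' t') := by
  simp only [conj, mul_apply, conjTranspose_apply, sum_mul]
  rw [sum_comm]

lemma conj_onWires (f : ι ↪ W) (K : Op ι) (ρ : Op W) :
    conj (onWires f K) ρ = applyOn f (conj K) ρ := by
  classical
  ext b b'
  rw [applyOn_apply, conj_apply, conj_apply]
  simp only [onWires, of_apply, ite_mul, zero_mul]
  have h1 : ∀ t, (∑ t', if ∀ j, j ∉ Set.range f → b j = t j then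
        K (b ∘ f) (t ∘ f) * ρ t t' * star (if ∀ j, j ∉ Set.range f → b' j = t' j
          then K (b' ∘ f) (t' ∘ f) else 0) else 0) = if ∀ j, j ∉ Set.range f → b j = t j then
        ∑ a', K (b ∘ f) (t ∘ f) * ρ t (splice f a' b') * star (K (b' ∘ f) a') else 0 := by
    intro t
    split_ifs
    · have := sum_splice f b' fun t' => K (b ∘ f) (t ∘ f) * ρ t t' * star (K (b' ∘ f) (t' ∘ f))
      simp only [splice_comp] at this
      rw [← this]
      refine sum_congr rfl fun t' _ => ?_
      split_ifs <;> simp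
    · simp
  simp only [h1]
  rw [sum_splice f b fun t => ∑ a', K (b ∘ f) (t ∘ f) * ρ t (splice f a' b') * star (K (b' ∘ f) a')]
  simp only [splice_comp]

lemma keepWires_apply (f : κ ↪ W) (σ : Op W) (y y' : Cfg κ) :
    keepWires f σ y y' = ∑ b, if b ∘ f = y then σ b (splice f y' b) else 0 := by
  classical
  simp only [keepWires, of_apply]
  refine sum_congr rfl fun b _ => ?_
  split_ifs with h
  · rw [sum_eq_single (splice f y' b)]
    · rw [if_pos]
      refine ⟨h, splice_comp _ _ _, fun j hj => ?_⟩
      rw [splice_of_notMem f _ _ hj]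
    · intro b' _ hb'
      rw [if_neg]
      rintro ⟨-, h2, h3⟩
      exact hb' (splice_ext f h2 h3).symm
    · simp
  · refine sum_eq_zero fun b' _ => ?_
    rw [if_neg]
    tauto

/-- All bits outside the range of `f` vanish. -/
def ZeroOff {ι W : Type} (f : ι ↪ W) (b : Cfg W) : Prop := ∀ j, j ∉ Set.range f → b j = false

/-- Place a register on the wires selected by `f`, the other wires being initialised to zero. -/
def place (f : ι ↪ W) (ρ : Op ι) : Op W := conj (placeWires f) ρ

open Classical in
lemma place_apply (f : ι ↪ W) (ρ : Op ι) (b b' : Cfg W) :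
    place f ρ b b' = if ZeroOff f b ∧ ZeroOff f b' then ρ (b ∘ f) (b' ∘ f) else 0 := by
  have key : ∀ (b : Cfg W) (a : Cfg ι), b = Function.extend f a (fun _ => false) ↔
      ZeroOff f b ∧ a = b ∘ f := by
    intro b a
    constructor
    · rintro rfl
      exact ⟨fun j hj => splice_of_notMem f _ _ hj, (splice_comp _ _ _).symm⟩
    · rintro ⟨h, rfl⟩
      exact (splice_ext f rfl fun j hj => (h j hj).symm).symm
  rw [place, conj_apply]
  simp only [placeWires, of_apply, key]
  by_cases h1 : ZeroOff f b
  · by_cases h2 : ZeroOff f b'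
    · simp [h1, h2]
    · simp [h2]
  · simp [h1]

lemma zeroOff_trans (f : ι ↪ κ) (g : κ ↪ W) (b : Cfg W) :
    ZeroOff (f.trans g) b ↔ ZeroOff g b ∧ ZeroOff f (b ∘ g) := by
  constructor
  · intro h
    refine ⟨fun j hj => h j ?_, fun j hj => h (g j) ?_⟩
    · rintro ⟨i, rfl⟩
      exact hj ⟨f i, rfl⟩
    · rintro ⟨i, hi⟩
      exact hj ⟨i, g.injective hi⟩
  · rintro ⟨h, h'⟩ j hj
    by_cases hg : j ∈ Set.range g
    · obtain ⟨i, rfl⟩ := hg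
      refine h' i ?_
      rintro ⟨l, rfl⟩
      exact hj ⟨l, rfl⟩
    · exact h j hg

lemma zeroOff_splice (f : ι ↪ W) (a : Cfg ι) (b : Cfg W) :
    ZeroOff f (splice f a b) ↔ ZeroOff f b := by
  refine forall_congr' fun j => forall_congr' fun hj => ?_
  rw [splice_of_notMem f _ _ hj]

lemma place_trans (f : ι ↪ κ) (g : κ ↪ W) (ρ : Op ι) :
    place (f.trans g) ρ = place g (place f ρ) := by
  classical
  ext b b'
  simp only [place_apply, zeroOff_trans]
  by_cases h1 : ZeroOff g b <;> by_cases h2 : ZeroOff g b' <;> simp [h1, h2] <;> rfl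

lemma keepWires_trans (g : μ ↪ κ) (f : κ ↪ W) (σ : Op W) :
    keepWires (g.trans f) σ = keepWires g (keepWires f σ) := by
  ext y y'
  simp only [keepWires_apply]
  have : ∀ c : Cfg κ, (if c ∘ g = y then ∑ b : Cfg W, if b ∘ f = c then
      σ b (splice f (splice g y' c) b) else 0 else 0) =
      ∑ b : Cfg W, if b ∘ f = c then (if (b ∘ f) ∘ g = y then
        σ b (splice (g.trans f) y' b) else 0) else 0 := by
    intro c
    split_ifs with h
    · refine sum_congr rfl fun b _ => ?_
      split_ifs with h' h''
      · rw [splice_trans, h']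
      · exact absurd (h' ▸ h) h''
      · rfl
    · symm
      refine sum_eq_zero fun b _ => ?_
      split_ifs with h' h''
      · exact absurd (h' ▸ h'') h
      · rfl
      · rfl
  simp only [this]
  rw [sum_comm]
  refine sum_congr rfl fun b _ => ?_
  rw [sum_ite_eq]
  simp [Function.comp_def]

lemma keepWires_place (f : κ ↪ W) (g : W ↪ V) (σ : Op W) :
    keepWires (f.trans g) (place g σ) = keepWires f σ := by
  classical
  ext y y'
  simp only [keepWires_apply, place_apply]
  have h := sum_splice g (fun _ => false) fun b : Cfg V =>
    if (b ∘ g) ∘ f = y then σ (b ∘ g) (splice f y' (b ∘ g)) else 0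
  simp only [splice_comp] at h
  rw [← h]
  refine sum_congr rfl fun b _ => ?_
  simp only [splice_trans, splice_comp, zeroOff_splice, and_self]
  have : (∀ j, j ∉ Set.range g → false = b j) ↔ ZeroOff g b :=
    forall_congr' fun j => forall_congr' fun _ => eq_comm
  simp only [this]
  by_cases h1 : ZeroOff g b <;> simp [h1] <;> rfl

lemma applyZ_place (f : ι ↪ W) (g : W ↪ V) (G : (Z → Op ι) → Z → Op ι) (hG : G 0 = 0) (σ : Z → Op W)
    : applyZ (f.trans g) G (fun z => place g (σ z)) = fun z => place g (applyZ f G σ z) := by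
  classical
  funext z
  ext b b'
  simp only [applyZ, of_apply, place_apply, splice_trans, zeroOff_splice, splice_comp]
  by_cases h : ZeroOff g b ∧ ZeroOff g b'
  · simp only [h, and_self, if_true]
    rfl
  · simp only [h, if_false]
    have := congrFun hG z
    exact congrFun (congrFun this _) _

lemma splice_comm_trans (f : ι ↪ W) (g : W ↪ V) (a : Cfg ι) (y : Cfg W) (b : Cfg V) :
    splice g (splice f a y) b = splice (f.trans g) a (splice g y b) := by
  rw [splice_trans, splice_comp, splice_splice]

/-- Partial trace as a sum over the values of the discarded wires. -/
lemma keepWires_apply' (f : κ ↪ W) (σ : Op W) (y y' c : Cfg κ) : keepWires f σ y y' = ∑ b : Cfg W,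
    if b ∘ f = c then σ (splice f y b) (splice f y' b) else 0 := by
  rw [keepWires_apply, ← sum_filter, ← sum_filter]
  symm
  refine Finset.sum_nbij' (fun b => splice f y b) (fun b => splice f c b) ?_ ?_ ?_ ?_ ?_
  · intro b _; simp
  · intro b _; simp
  · intro b hb
    simp only [Finset.mem_filter, mem_univ, true_and] at hb
    rw [splice_splice, ← hb, splice_self]
  · intro b hb
    simp only [Finset.mem_filter, mem_univ, true_and] at hb
    rw [splice_splice, ← hb, splice_self]
  · intro b _
    rw [splice_splice]

lemma applyZ_keepWires (f : ι ↪ W) (g : W ↪ V) (G : (Z → Op ι) →ₗ[ℂ] (Z → Op ι))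
    (σ : Z → Op V) :
    (fun z => keepWires g (applyZ (f.trans g) G σ z)) =
      applyZ f G (fun z => keepWires g (σ z)) := by
  classical
  funext z
  ext y y'
  rw [keepWires_apply' g _ y y' (fun _ => false)]
  simp only [applyZ, of_apply]
  have h2 : (fun z' => of fun a a' => keepWires g (σ z') (splice f a y) (splice f a' y')) =
      ∑ b : Cfg V, if b ∘ g = (fun _ => false) then (fun z' => of fun a a' =>
        σ z' (splice (f.trans g) a (splice g y b)) (splice (f.trans g) a' (splice g y' b)))
        else (0 : Z → Op ι) := by
    funext z'
    ext a a'
    rw [of_apply, keepWires_apply' g _ _ _ (fun _ => false), Finset.sum_apply, Matrix.sum_apply]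
    refine sum_congr rfl fun b _ => ?_
    split_ifs
    · simp only [splice_comm_trans]
      rfl
    · rfl
  rw [h2, map_sum, Finset.sum_apply, Matrix.sum_apply]
  refine sum_congr rfl fun b _ => ?_
  split_ifs
  · have hc : ∀ y : Cfg W, splice g y b ∘ (f.trans g) = y ∘ f := fun y => by
      funext i; simp [Function.comp_def]
    simp only [hc]
  · rw [map_zero]; rfl

/-- Wires allocated after discarding others may as well be allocated before. -/
lemma place_keepWires (f : κ ↪ μ) (g : κ ↪ W) (f' : W ↪ V) (g' : μ ↪ V)
    (h : ∀ i, f' (g i) = g' (f i)) (h1 : ∀ m, m ∉ Set.range f → g' m ∉ Set.range f')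
    (h2 : ∀ v, v ∉ Set.range f' → v ∈ Set.range g') (σ : Op W) :
    keepWires g' (place f' σ) = place f (keepWires g σ) := by
  classical
  ext y y'
  have hc : g.trans f' = f.trans g' := by ext i; exact h i
  rw [place_apply, keepWires_apply, keepWires_apply]
  have key : ∀ (b : Cfg V) (y : Cfg μ), b ∘ g' = y → (ZeroOff f' b ↔ ZeroOff f y) := by
    rintro b y rfl
    constructor
    · intro hb m hm
      exact hb _ (h1 m hm)
    · intro hb v hv
      obtain ⟨m, rfl⟩ := h2 v hv
      refine hb m ?_
      rintro ⟨i, rfl⟩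
      exact hv ⟨g i, h i⟩
  have hs := sum_splice f' (fun _ => false) fun b : Cfg V =>
    if ZeroOff f y ∧ ZeroOff f y' then if (b ∘ f') ∘ g = y ∘ f then σ (b ∘ f')
      (splice g (y' ∘ f) (b ∘ f')) else 0 else 0
  simp only [splice_comp] at hs
  have hr : (if ZeroOff f y ∧ ZeroOff f y' then ∑ b : Cfg W, if b ∘ g = y ∘ f then
      σ b (splice g (y' ∘ f) b) else 0 else 0) = ∑ b : Cfg W, if ZeroOff f y ∧ ZeroOff f y' then
        if b ∘ g = y ∘ f then σ b (splice g (y' ∘ f) b) else 0 else 0 := by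
    split_ifs
    · rfl
    · simp
  rw [hr, ← hs]
  refine sum_congr rfl fun b _ => ?_
  rw [place_apply]
  have hz : (∀ j, j ∉ Set.range f' → false = b j) ↔ ZeroOff f' b :=
    forall_congr' fun j => forall_congr' fun _ => eq_comm
  rw [key (splice g' y' b) y' (splice_comp _ _ _)]
  simp only [hz]
  have hbc : (b ∘ f') ∘ g = (b ∘ g') ∘ f := by
    funext i; simp [h i]
  by_cases hb : b ∘ g' = y
  · rw [if_pos hb, key b y hb, hbc, hb]
    by_cases hy : ZeroOff f y <;> by_cases hy' : ZeroOff f y' <;> simp only [hy, hy', and_self,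
      and_true, and_false, if_true, if_false, true_and]
    congr 1
    symm
    refine splice_ext g ?_ ?_
    · funext i
      simp [h i]
    · intro j hj
      simp only [Function.comp_apply]
      by_cases hm : f' j ∈ Set.range g'
      · obtain ⟨m, hm⟩ := hm
        rw [← hm, splice_apply]
        have hmf : m ∉ Set.range f := by
          rintro ⟨i, rfl⟩
          rw [← h i] at hm
          exact hj ⟨i, f'.injective hm⟩
        exact absurd ⟨j, hm.symm⟩ (h1 m hmf)
      · rw [splice_of_notMem _ _ _ hm]
  · rw [if_neg hb]
    split_ifs with h3 h4 h5
    · exfalso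
      apply hb
      funext m
      by_cases hm : m ∈ Set.range f
      · obtain ⟨i, rfl⟩ := hm
        have := congrFun h5 i
        rw [hbc] at this
        exact this
      · rw [h4.1 m hm]
        exact h3 _ (h1 m hm)
    all_goals rfl

/-! ### Adding wires that are not touched -/

def ext (R : Type) (F : (Z → Op ι) → Z → Op κ) (ρ : Z → Op (ι ⊕ R)) : Z → Op (κ ⊕ R) := fun z =>
  of fun b b' => F (fun z' => of fun a a' =>
    ρ z' (elim a (b ∘ inr)) (elim a' (b' ∘ inr))) z (b ∘ inl) (b' ∘ inl)

def tensorId (R : Type) (F : Op ι → Op κ) (ρ : Op (ι ⊕ R)) : Op (κ ⊕ R) :=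
  of fun b b' => F (of fun a a' =>
    ρ (elim a (b ∘ inr)) (elim a' (b' ∘ inr))) (b ∘ inl) (b' ∘ inl)

lemma tensorId_apply (F : Op ι → Op κ) (ρ : Op (ι ⊕ R)) (b b' : Cfg (κ ⊕ R)) : tensorId R F ρ b b' =
    F (of fun a a' => ρ (elim a (b ∘ inr)) (elim a' (b' ∘ inr))) (b ∘ inl) (b' ∘ inl) :=
  rfl

/-- `f` on the first summand, the identity on the second. -/
def embId (R : Type) (f : ι ↪ κ) : ι ⊕ R ↪ κ ⊕ R := f.sumMap (Embedding.refl R)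

@[simp] lemma embId_inl (f : ι ↪ κ) (i : ι) : embId R f (inl i) = inl (f i) := rfl
@[simp] lemma embId_inr (f : ι ↪ κ) (r : R) : embId R f (inr r) = inr r := rfl

lemma splice_embId (f : ι ↪ κ) (a : Cfg (ι ⊕ R)) (b : Cfg (κ ⊕ R)) :
    splice (embId R f) a b = elim (splice f (a ∘ inl) (b ∘ inl)) (a ∘ inr) := by
  refine splice_ext _ ?_ ?_
  · funext i
    rcases i with i | i <;> simp
  · rintro (j | j) hj
    · rw [elim_inl, splice_of_notMem]
      · rfl
      · rintro ⟨i, rfl⟩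
        exact hj ⟨inl i, rfl⟩
    · exact absurd ⟨inr j, rfl⟩ hj

lemma splice_inl (a : Cfg ι) (b : Cfg (ι ⊕ R)) : splice Embedding.inl a b = elim a (b ∘ inr) := by
  refine splice_ext _ ?_ ?_
  · funext i; simp
  · rintro (j | j) hj
    · exact absurd ⟨j, rfl⟩ hj
    · simp

lemma splice_trans_inl (f : ι ↪ κ) (a : Cfg ι) (b : Cfg (κ ⊕ R)) :
    splice (f.trans Embedding.inl) a b = elim (splice f a (b ∘ inl)) (b ∘ inr) := by
  rw [splice_trans, splice_inl]; rfl

lemma ext_applyZ (f : ι ↪ κ) (G : (Z → Op ι) → Z → Op ι) (ρ : Z → Op (κ ⊕ R)) :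
    ext R (applyZ f G) ρ = applyZ (f.trans Embedding.inl) G ρ := by
  funext z
  ext b b'
  simp only [ext, applyZ, of_apply, splice_trans_inl]
  rfl

lemma ext_place (f : ι ↪ κ) (ρ : Z → Op (ι ⊕ R)) :
    ext R (fun ρ z => place f (ρ z)) ρ = fun z => place (embId R f) (ρ z) := by
  classical
  funext z
  ext b b'
  have h : ∀ b : Cfg (κ ⊕ R), ZeroOff (embId R f) b ↔ ZeroOff f (b ∘ inl) := by
    intro b
    constructor
    · intro h j hj
      refine h _ ?_
      rintro ⟨i | i, hi⟩
      · exact hj ⟨i, Sum.inl_injective hi⟩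
      · exact inr_ne_inl hi
    · rintro h (j | j) hj
      · refine h j ?_
        rintro ⟨i, rfl⟩
        exact hj ⟨inl i, rfl⟩
      · exact absurd ⟨inr j, rfl⟩ hj
  have h' : ∀ b : Cfg (κ ⊕ R), b ∘ embId R f = elim ((b ∘ inl) ∘ f) (b ∘ inr) := by
    intro b
    funext i
    rcases i with i | i <;> rfl
  simp only [ext, of_apply, place_apply, h, h']

def cfgSum (ι κ : Type) : Cfg (ι ⊕ κ) ≃ Cfg ι × Cfg κ := Equiv.sumArrowEquivProdArrow ι κ Bool

lemma sum_cfgSum {M : Type*} [AddCommMonoid M] (g : Cfg (ι ⊕ κ) → M) :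
    ∑ b, g b = ∑ a : Cfg ι, ∑ c : Cfg κ, g (elim a c) := by
  rw [← sum_prod_type']
  exact sum_equiv (cfgSum ι κ) _ _ fun b => by
    congr 1
    exact (elim_comp_inl_inr b).symm

lemma sum_elim_inj {a a' : Cfg ι} {c c' : Cfg κ} :
    (elim a c : Cfg (ι ⊕ κ)) = elim a' c' ↔ a = a' ∧ c = c' := by
  constructor
  · intro h
    exact ⟨congrArg (fun b => b ∘ inl) h, congrArg (fun b => b ∘ inr) h⟩
  · rintro ⟨rfl, rfl⟩
    rfl

lemma ext_keepWires (g : κ ↪ ι) (ρ : Z → Op (ι ⊕ R)) :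
    ext R (fun ρ z => keepWires g (ρ z)) ρ = fun z => keepWires (embId R g) (ρ z) := by
  funext z
  ext b b'
  simp only [ext, of_apply, keepWires_apply]
  rw [sum_cfgSum]
  refine sum_congr rfl fun a _ => ?_
  have h' : ∀ c : Cfg R, (elim a c : Cfg (ι ⊕ R)) ∘ embId R g = b ↔
      a ∘ g = b ∘ inl ∧ c = b ∘ inr := by
    intro c
    conv_lhs => rw [← elim_comp_inl_inr b]
    rw [← sum_elim_inj]
    refine Eq.congr_left ?_
    funext i
    rcases i with i | i <;> rfl
  simp only [h', splice_embId, elim_comp_inl]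
  by_cases h1 : a ∘ g = b ∘ inl
  · simp [h1]
  · simp [h1]

lemma keepWires_inl (σ : Op (κ ⊕ R)) (y y' : Cfg κ) :
    keepWires Embedding.inl σ y y' = ∑ r : Cfg R, σ (elim y r) (elim y' r) := by
  rw [keepWires_apply, sum_cfgSum, sum_eq_single y]
  · refine sum_congr rfl fun r _ => ?_
    rw [if_pos (by rfl), splice_inl, elim_comp_inr]
  · intro a _ ha
    refine sum_eq_zero fun r _ => if_neg ?_
    exact ha
  · simp

open Classical in
lemma place_inl (ρ : Op ι) (b b' : Cfg (ι ⊕ R)) : place Embedding.inl ρ b b' = if b ∘ inr =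
    (fun _ => false) ∧ b' ∘ inr = (fun _ => false) then ρ (b ∘ inl) (b' ∘ inl) else 0 := by
  have h : ∀ b : Cfg (ι ⊕ R), ZeroOff Embedding.inl b ↔ b ∘ inr = fun _ => false := by
    intro b
    constructor
    · intro h
      funext r
      refine h _ ?_
      rintro ⟨i, hi⟩
      exact inl_ne_inr hi
    · rintro h (j | j) hj
      · exact absurd ⟨j, rfl⟩ hj
      · exact congrFun h j
  rw [place_apply]
  simp only [h]
  rfl

lemma keepWires_equiv (e : κ ≃ ι) (σ : Op ι) (y y' : Cfg κ) :
    keepWires e.toEmbedding σ y y' = σ (y ∘ e.symm) (y' ∘ e.symm) := by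
  rw [keepWires_apply, sum_eq_single (y ∘ e.symm)]
  · rw [if_pos]
    · congr 1
      exact splice_ext _ (by funext i; simp) fun j hj => absurd ⟨e.symm j, by simp⟩ hj
    · funext i; simp
  · intro b _ hb
    rw [if_neg]
    rintro rfl
    exact hb (by funext i; simp)
  · simp

end Wires

/-! ### The complement of a set of wires -/

section Rest

variable {ι W : Type}

def Rest (f : ι ↪ W) : Type := {w // w ∉ Set.range f}

instance [Fintype W] (f : ι ↪ W) : Fintype (Rest f) := by
  classical
  exact inferInstanceAs (Fintype {w // w ∉ Set.range f})

instance [DecidableEq W] (f : ι ↪ W) : DecidableEq (Rest f) :=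
  inferInstanceAs (DecidableEq {w // w ∉ Set.range f})

/-- The wires selected by `f`, together with the remaining ones. -/
def splitEquiv (f : ι ↪ W) : ι ⊕ Rest f ≃ W :=
  Equiv.ofBijective (elim f Subtype.val) <| by
    constructor
    · rintro (i | r) (j | r') h
      · exact congrArg _ (f.injective h)
      · exact absurd ⟨i, h⟩ r'.2
      · exact absurd ⟨j, h.symm⟩ r.2
      · exact congrArg _ (Subtype.ext h)
    · intro w
      by_cases h : w ∈ Set.range f
      · obtain ⟨i, rfl⟩ := h
        exact ⟨inl i, rfl⟩
      · exact ⟨inr ⟨w, h⟩, rfl⟩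

@[simp] lemma splitEquiv_inl (f : ι ↪ W) (i : ι) : splitEquiv f (inl i) = f i := rfl

@[simp] lemma splitEquiv_inr (f : ι ↪ W) (r : Rest f) : splitEquiv f (inr r) = r.1 := rfl

lemma card_rest [Fintype ι] [Fintype W] (f : ι ↪ W) : card ι + card (Rest f) = card W := by
  rw [← card_sum]
  exact Fintype.card_congr (splitEquiv f)

end Rest

/-! ### Implementable channels -/

/-- Oracles which can be called in a circuit: `port` labels the wires on which an oracle acts,
`Z` is a classical register held by the oracles, and `Θ` parametrises their behaviour. -/
structure Oracles (Θ Z : Type) where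
  idx : Type
  port : idx → Type
  [fin : ∀ o, Fintype (port o)]
  [dec : ∀ o, DecidableEq (port o)]
  sem : ∀ o, Θ → (Z → Op (port o)) →ₗ[ℂ] (Z → Op (port o))

attribute [instance] Oracles.fin Oracles.dec

variable {Θ Z : Type} {ι κ μ W V : Type}

/-- Instructions of circuits with oracles. -/
inductive Instr (O : Oracles Θ Z) (W : Type) where
  | gate (a : ℕ) (h : a ≤ 3) (f : Fin a ↪ W) (K : Op (Fin a))
    (hK : K ∈ unitaryGroup (Cfg (Fin a)) ℂ)
  | query (o : O.idx) (f : O.port o ↪ W)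

def conjLin {S T : Type} [Fintype S] [Fintype T] (L : Matrix S T ℂ) :
    Matrix T T ℂ →ₗ[ℂ] Matrix S S ℂ where
  toFun := conj L
  map_add' ρ σ := by simp [conj, Matrix.mul_add, Matrix.add_mul]
  map_smul' c ρ := by simp [conj]

namespace Instr

variable {O : Oracles Θ Z}

def sem (θ : Θ) : Instr O W → (Z → Op W) → Z → Op W
  | .gate _ _ f K _ => applyZ f ((conjLin K).compLeft Z)
  | .query o f => applyZ f (O.sem o θ)

def map (g : W ↪ V) : Instr O W → Instr O V
  | .gate a h f K hK => .gate a h (f.trans g) K hK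
  | .query o f => .query o (f.trans g)

lemma sem_map_place [Fintype W] [DecidableEq W] [Fintype V] [DecidableEq V] (g : W ↪ V)
    (i : Instr O W) (θ : Θ) (σ : Z → Op W) :
    (i.map g).sem θ (fun z => place g (σ z)) = fun z => place g (i.sem θ σ z) := by
  cases i with
  | gate a h f K hK => exact applyZ_place f g _ (map_zero _) σ
  | query o f => exact applyZ_place f g _ (map_zero _) σ

lemma sem_map_keepWires [Fintype W] [DecidableEq W] [Fintype V] [DecidableEq V] (g : W ↪ V)
    (i : Instr O W) (θ : Θ) (σ : Z → Op V) :
    (fun z => keepWires g ((i.map g).sem θ σ z)) = i.sem θ (fun z => keepWires g (σ z)) := by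
  cases i with
  | gate a h f K hK => exact applyZ_keepWires f g ((conjLin K).compLeft Z) σ
  | query o f => exact applyZ_keepWires f g _ σ

lemma ext_sem [Fintype W] [DecidableEq W] (R : Type) [Fintype R] [DecidableEq R] (i : Instr O W) (θ
    : Θ) (σ : Z → Op (W ⊕ R)) :
    ext R (i.sem θ) σ = (i.map Embedding.inl).sem θ σ := by
  cases i with
  | gate a h f K hK => exact ext_applyZ f _ σ
  | query o f => exact ext_applyZ f _ σ

end Instr

/-- The channels that can be computed by circuits with oracles of the given size. -/
inductive Impl (O : Oracles Θ Z) {ι : Type} [Fintype ι] [DecidableEq ι] :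
    {κ : Type} → [Fintype κ] → [DecidableEq κ] → ℕ → (Θ → (Z → Op ι) → Z → Op κ) → Prop
  | id : Impl O 0 fun _ ρ => ρ
  | step {κ : Type} [Fintype κ] [DecidableEq κ] {s : ℕ} {F : Θ → (Z → Op ι) → Z → Op κ}
      (i : Instr O κ) (h : Impl O s F) : Impl O (s + 1) fun θ ρ => i.sem θ (F θ ρ)
  | place {κ : Type} [Fintype κ] [DecidableEq κ] {μ : Type} [Fintype μ] [DecidableEq μ] {s : ℕ}
      {F : Θ → (Z → Op ι) → Z → Op κ} (f : κ ↪ μ) (h : Impl O s F) :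
      Impl O (s + (card μ - card κ)) fun θ ρ z => QPK.place f (F θ ρ z)
  | keep {κ : Type} [Fintype κ] [DecidableEq κ] {μ : Type} [Fintype μ] [DecidableEq μ] {s : ℕ}
      {F : Θ → (Z → Op ι) → Z → Op κ} (g : μ ↪ κ) (h : Impl O s F) :
      Impl O s fun θ ρ z => keepWires g (F θ ρ z)
  | weaken {κ : Type} [Fintype κ] [DecidableEq κ] {s s' : ℕ} {F : Θ → (Z → Op ι) → Z → Op κ}
      (hs : s ≤ s') (h : Impl O s F) : Impl O s' F

section Impl

variable [Fintype ι] [DecidableEq ι] [Fintype κ] [DecidableEq κ] [Fintype μ] [DecidableEq μ]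
  [Fintype W] [DecidableEq W] [Fintype V] [DecidableEq V] {O : Oracles Θ Z}

lemma Impl.comp {s s' : ℕ} {F : Θ → (Z → Op ι) → Z → Op κ} {G : Θ → (Z → Op κ) → Z → Op μ}
    (hF : Impl O s F) (hG : Impl O s' G) : Impl O (s + s') fun θ ρ => G θ (F θ ρ) := by
  induction hG with
  | id => exact hF
  | step i _ ih => exact .step i ih
  | place f _ ih =>
    rw [← add_assoc]
    exact .place f ih
  | keep g _ ih => exact .keep g ih
  | weaken hs _ ih => exact .weaken (by omega) ih

lemma Impl.ext (R : Type) [Fintype R] [DecidableEq R] {s : ℕ} {F : Θ → (Z → Op ι) → Z → Op κ}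
    (hF : Impl O s F) : Impl O s fun θ => QPK.ext R (F θ) := by
  induction hF with
  | id =>
    convert Impl.id (O := O) (ι := ι ⊕ R) using 1
    funext θ ρ z
    ext b b'
    simp [QPK.ext, elim_comp_inl_inr]
  | step i _ ih =>
    convert Impl.step (i.map Embedding.inl) ih using 1
    funext θ ρ
    rw [← Instr.ext_sem]
    rfl
  | @place κ _ _ μ _ _ s F f _ ih =>
    have := Impl.place (embId R f) ih
    rw [card_sum, card_sum, Nat.add_sub_add_right] at this
    convert this using 1
    funext θ ρ
    rw [← ext_place]
    rfl
  | keep g _ ih =>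
    convert Impl.keep (embId R g) ih using 1
    funext θ ρ
    rw [← ext_keepWires]
    rfl
  | weaken hs _ ih => exact .weaken hs ih

def keepLin (f : κ ↪ W) : Op W →ₗ[ℂ] Op κ where
  toFun := keepWires f
  map_add' ρ σ := by
    ext y y'
    simp only [keepWires_apply, Matrix.add_apply, ← sum_add_distrib]
    refine sum_congr rfl fun b _ => ?_
    split_ifs <;> simp
  map_smul' c ρ := by
    ext y y'
    simp only [keepWires_apply, Matrix.smul_apply, RingHom.id_apply, smul_sum]
    refine sum_congr rfl fun b _ => ?_
    split_ifs <;> simp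

def applyZLin (f : ι ↪ W) (G : (Z → Op ι) →ₗ[ℂ] (Z → Op ι)) : (Z → Op W) →ₗ[ℂ] (Z → Op W) where
  toFun := applyZ f G
  map_add' ρ σ := by
    funext z
    ext b b'
    have := congrFun (G.map_add
      (fun z' => of fun a a' => ρ z' (splice f a b) (splice f a' b'))
      (fun z' => of fun a a' => σ z' (splice f a b) (splice f a' b'))) z
    exact congrFun (congrFun this _) _
  map_smul' c ρ := by
    funext z
    ext b b'
    have := congrFun (G.map_smul c
      (fun z' => of fun a a' => ρ z' (splice f a b) (splice f a' b'))) z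
    exact congrFun (congrFun this _) _

lemma Impl.linear {s : ℕ} {F : Θ → (Z → Op ι) → Z → Op κ} (hF : Impl O s F) (θ : Θ) :
    ∃ L : (Z → Op ι) →ₗ[ℂ] (Z → Op κ), ∀ ρ, F θ ρ = L ρ := by
  induction hF with
  | id => exact ⟨LinearMap.id, fun _ => rfl⟩
  | step i _ ih =>
    obtain ⟨L, hL⟩ := ih
    cases i with
    | gate a h f K hK =>
      exact ⟨(applyZLin f ((conjLin K).compLeft Z)).comp L, fun ρ => by simp only [hL]; rfl⟩
    | query o f => exact ⟨(applyZLin f (O.sem o θ)).comp L, fun ρ => by simp only [hL]; rfl⟩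
  | place f _ ih =>
    obtain ⟨L, hL⟩ := ih
    exact ⟨((conjLin (placeWires f)).compLeft Z).comp L, fun ρ => by simp only [hL]; rfl⟩
  | keep g _ ih =>
    obtain ⟨L, hL⟩ := ih
    exact ⟨((keepLin g).compLeft Z).comp L, fun ρ => by simp only [hL]; rfl⟩
  | weaken hs _ ih => exact ih

def runInstr (θ : Θ) (l : List (Instr O W)) (σ : Z → Op W) : Z → Op W :=
  l.foldl (fun σ i => i.sem θ σ) σ

lemma runInstr_map_place (g : W ↪ V) (l : List (Instr O W)) (θ : Θ) (σ : Z → Op W) :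
    runInstr θ (l.map (Instr.map g)) (fun z => place g (σ z)) =
      fun z => place g (runInstr θ l σ z) := by
  induction l generalizing σ with
  | nil => rfl
  | cons i l ih =>
    simp only [runInstr, List.map_cons, List.foldl_cons] at ih ⊢
    rw [Instr.sem_map_place, ih]

lemma place_refl (ρ : Op ι) : place (Embedding.refl ι) ρ = ρ := by
  classical
  ext b b'
  have h : ∀ b : Cfg ι, ZeroOff (Embedding.refl ι) b := fun b j hj =>
    absurd ⟨j, rfl⟩ hj
  rw [place_apply, if_pos ⟨h _, h _⟩]
  rfl

lemma keepWires_refl (ρ : Op ι) : keepWires (Embedding.refl ι) ρ = ρ := by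
  ext b b'
  exact keepWires_equiv (Equiv.refl ι) ρ b b'

/-- Every implementable channel is computed by a circuit which first initialises all its wires
and discards wires only at the end. -/
lemma Impl.normalForm {s : ℕ} {F : Θ → (Z → Op ι) → Z → Op κ} (hF : Impl O s F) :
    ∃ (N : ℕ) (inp : ι ↪ Fin N) (out : κ ↪ Fin N) (prog : List (Instr O (Fin N))),
      N + prog.length ≤ card ι + s ∧ ∀ θ ρ, F θ ρ = fun z =>
        keepWires out (runInstr θ prog (fun z => QPK.place inp (ρ z)) z) := by
  have key : ∃ (W : Type) (_ : Fintype W) (_ : DecidableEq W) (inp : ι ↪ W) (out : κ ↪ W)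
      (prog : List (Instr O W)), card W + prog.length ≤ card ι + s ∧ ∀ θ ρ, F θ ρ = fun z =>
          keepWires out (runInstr θ prog (fun z => QPK.place inp (ρ z)) z) := by
    induction hF with
    | id =>
      refine ⟨ι, inferInstance, inferInstance, Embedding.refl ι, Embedding.refl ι, [], by simp, ?_⟩
      intro θ ρ
      simp only [runInstr, List.foldl_nil, place_refl, keepWires_refl]
    | step i _ ih =>
      obtain ⟨W, _, _, inp, out, prog, hc, h⟩ := ih
      refine ⟨W, inferInstance, inferInstance, inp, out, prog ++ [i.map out], ?_, ?_⟩
      · simp; omega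
      · intro θ ρ
        simp only [h, runInstr, List.foldl_append, List.foldl_cons, List.foldl_nil]
        rw [← Instr.sem_map_keepWires]
    | @place κ _ _ μ _ _ s F f _ ih =>
      obtain ⟨W, _, _, inp, out, prog, hc, h⟩ := ih
      let g' : μ ↪ W ⊕ Rest f := (splitEquiv f).symm.toEmbedding.trans
        (out.sumMap (Embedding.refl (Rest f)))
      have hg1 : ∀ i, g' (f i) = inl (out i) := by
        intro i
        have : (splitEquiv f).symm (f i) = inl i := by
          rw [Equiv.symm_apply_eq, splitEquiv_inl]
        simp [g', this]
      have hg2 : ∀ r : Rest f, g' r.1 = inr r := by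
        intro r
        have : (splitEquiv f).symm r.1 = inr r := by
          rw [Equiv.symm_apply_eq, splitEquiv_inr]
        simp [g', this]
      refine ⟨W ⊕ Rest f, inferInstance, inferInstance, inp.trans Embedding.inl, g',
        prog.map (Instr.map Embedding.inl), ?_, ?_⟩
      · have := card_rest f
        rw [card_sum, List.length_map]
        omega
      · intro θ ρ
        simp only [place_trans]
        rw [runInstr_map_place Embedding.inl prog θ fun z => QPK.place inp (ρ z), h]
        funext z
        refine (place_keepWires f out Embedding.inl g' (fun i => (hg1 i).symm) ?_ ?_
          _).symm
        · rintro m hm ⟨w, hw⟩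
          rw [hg2 ⟨m, hm⟩] at hw
          exact inl_ne_inr hw
        · rintro (w | r) hv
          · exact absurd ⟨w, rfl⟩ hv
          · exact ⟨r.1, hg2 r⟩
    | keep g _ ih =>
      obtain ⟨W, _, _, inp, out, prog, hc, h⟩ := ih
      refine ⟨W, inferInstance, inferInstance, inp, g.trans out, prog, hc, ?_⟩
      intro θ ρ
      simp only [h, keepWires_trans]
    | weaken hs _ ih =>
      obtain ⟨W, _, _, inp, out, prog, hc, h⟩ := ih
      exact ⟨W, inferInstance, inferInstance, inp, out, prog, by omega, h⟩
  obtain ⟨W, _, _, inp, out, prog, hc, h⟩ := key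
  let e := (equivFin W).toEmbedding
  refine ⟨card W, inp.trans e, out.trans e, prog.map (Instr.map e), ?_, ?_⟩
  · simpa using hc
  · intro θ ρ
    simp only [place_trans]
    rw [runInstr_map_place e prog θ fun z => QPK.place inp (ρ z), h]
    simp only [keepWires_place]

end Impl

/-! ### Circuits acting on the quantum register only -/

section Circ

variable {Θ Z : Type} {ι κ μ ν W V α β γ δ K R : Type}
variable [Fintype ι] [DecidableEq ι] [Fintype κ] [DecidableEq κ] [Fintype μ] [DecidableEq μ]
  [Fintype ν] [DecidableEq ν]
  [Fintype W] [DecidableEq W] [Fintype V] [DecidableEq V] [Fintype R] [DecidableEq R]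
  [Fintype α] [DecidableEq α] [Fintype β] [DecidableEq β] [Fintype γ] [DecidableEq γ]
  [Fintype δ] [DecidableEq δ] [Fintype K] [DecidableEq K]
  {O : Oracles Θ Z}

/-- Implementable channels which do not touch the register held by the oracles. -/
def Circ (O : Oracles Θ Z) (s : ℕ) (G : Θ → Op ι → Op κ) : Prop :=
  Impl O s fun θ ρ z => G θ (ρ z)

lemma Circ.id : Circ O 0 fun _ (ρ : Op ι) => ρ := Impl.id

lemma Circ.congr {s : ℕ} {G G' : Θ → Op ι → Op κ} (h : Circ O s G)
    (hG : ∀ θ ρ, G' θ ρ = G θ ρ) : Circ O s G' := by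
  have : G' = G := by funext θ ρ; exact hG θ ρ
  rwa [this]

lemma Circ.weaken {s s' : ℕ} {G : Θ → Op ι → Op κ} (h : Circ O s G) (hs : s ≤ s') :
    Circ O s' G := Impl.weaken hs h

lemma Circ.comp {s s' : ℕ} {F : Θ → Op ι → Op κ} {G : Θ → Op κ → Op μ} (hF : Circ O s F)
    (hG : Circ O s' G) : Circ O (s + s') fun θ ρ => G θ (F θ ρ) :=
  Impl.comp hF hG

lemma Circ.place (f : ι ↪ κ) : Circ O (card κ - card ι) fun _ ρ => QPK.place f ρ := by
  have := Impl.place f (Impl.id (O := O) (ι := ι))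
  rwa [zero_add] at this

lemma Circ.place_inl : Circ O (card R) fun _ (ρ : Op ι) =>
    QPK.place (Embedding.inl : ι ↪ ι ⊕ R) ρ := by
  have := Circ.place (O := O) (Embedding.inl : ι ↪ ι ⊕ R)
  simpa using this

lemma Circ.keep (g : κ ↪ ι) : Circ O 0 fun _ (ρ : Op ι) => keepWires g ρ :=
  Impl.keep g Impl.id

lemma Circ.gate {a : ℕ} (h : a ≤ 3) (f : Fin a ↪ W) (U : Op (Fin a))
    (hU : U ∈ unitaryGroup (Cfg (Fin a)) ℂ) : Circ O 1 fun _ (ρ : Op W) => applyOn f (conj U) ρ :=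
  Impl.step (.gate a h f U hU) Impl.id

lemma Circ.tensorId {s : ℕ} {G : Θ → Op ι → Op κ} (h : Circ O s G) :
    Circ O s fun θ => QPK.tensorId R (G θ) :=
  Impl.ext R h

lemma Circ.linear [Nonempty Z] {s : ℕ} {G : Θ → Op ι → Op κ} (h : Circ O s G) (θ : Θ) :
    ∃ L : Op ι →ₗ[ℂ] Op κ, ∀ ρ, G θ ρ = L ρ := by
  obtain ⟨L, hL⟩ := Impl.linear h θ
  obtain ⟨z⟩ := ‹Nonempty Z›
  refine ⟨(LinearMap.proj z).comp (L.comp (LinearMap.pi fun _ => LinearMap.id)), fun ρ => ?_⟩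
  exact congrFun (hL fun _ => ρ) z

lemma applyOn_eq_tensorId (f : ι ↪ W) (F : Op ι → Op ι) (ρ : Op W) :
    applyOn f F ρ = keepWires (splitEquiv f).symm.toEmbedding
      (tensorId (Rest f) F (keepWires (splitEquiv f).toEmbedding ρ)) := by
  ext b b'
  rw [keepWires_equiv, tensorId_apply, applyOn_apply]
  congr 1
  congr 1
  ext a a'
  rw [keepWires_equiv]
  have h : ∀ (a : Cfg ι) (b : Cfg W), splice f a b =
      elim a ((b ∘ (splitEquiv f).symm.symm) ∘ inr) ∘ (splitEquiv f).symm := by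
    intro a b
    refine splice_ext f ?_ ?_
    · funext i
      have : (splitEquiv f).symm (f i) = inl i := by
        rw [Equiv.symm_apply_eq, splitEquiv_inl]
      simp [this]
    · intro j hj
      let r : Rest f := ⟨j, hj⟩
      have : (splitEquiv f).symm j = inr r := by
        rw [Equiv.symm_apply_eq, splitEquiv_inr]
      simp only [Function.comp_apply, this, elim_inr]
      exact congrArg b (splitEquiv_inr f r).symm
  rw [h a b, h a' b']

lemma Circ.applyOn {s : ℕ} {F : Θ → Op ι → Op ι} (hF : Circ O s F) (f : ι ↪ W) :
    Circ O s fun θ => QPK.applyOn f (F θ) := by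
  have := ((Circ.keep (O := O) (splitEquiv f).toEmbedding).comp
    (hF.tensorId (R := Rest f))).comp (Circ.keep (splitEquiv f).symm.toEmbedding)
  simp only [zero_add, add_zero] at this
  exact this.congr fun θ ρ => applyOn_eq_tensorId f (F θ) ρ

lemma Circ.reindex {s : ℕ} {G : Θ → Op ι → Op κ} (h : Circ O s G) (e : μ ≃ ι) (e' : ν ≃ κ) :
    Circ O s fun θ ρ => keepWires e'.toEmbedding (G θ (keepWires e.symm.toEmbedding ρ)) := by
  simpa using ((Circ.keep (O := O) e.symm.toEmbedding).comp h).comp (Circ.keep e'.toEmbedding)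

/-- The channel computed by a circuit is implementable. -/
lemma Circ.run (A : QAlg ι κ) : Circ O A.size fun _ ρ => A.run ρ := by
  have hg : ∀ l : List (Gate A.wires), Circ O l.length fun _ (ρ : Op (Fin A.wires)) =>
      l.foldl (fun σ g => g.apply σ) ρ := by
    intro l
    induction l with
    | nil => exact Circ.id
    | cons g l ih =>
      rw [List.length_cons, add_comm]
      refine ((Circ.gate g.arity_le g.wires g.mat g.unitary).comp ih).congr fun θ ρ => ?_
      rw [List.foldl_cons, Gate.apply, conj_onWires]
  refine Circ.weaken (((Circ.place A.inp).comp (hg A.gates)).comp (Circ.keep A.out)) ?_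
  simp [QAlg.size]

/-! ### Channels given by coefficients -/

def cchan (c : Cfg ι → Cfg ι → Cfg κ → Cfg κ → ℂ) (ρ : Op ι) : Op κ :=
  of fun y y' => ∑ u, ∑ u', ρ u u' * c u u' y y'

lemma cchan_apply (c : Cfg ι → Cfg ι → Cfg κ → Cfg κ → ℂ) (ρ : Op ι) (y y' : Cfg κ) :
    cchan c ρ y y' = ∑ u, ∑ u', ρ u u' * c u u' y y' := rfl

lemma linear_apply (L : Op ι →ₗ[ℂ] Op κ) (ρ : Op ι) (y y' : Cfg κ) :
    L ρ y y' = ∑ u, ∑ u', ρ u u' * L (single u u' 1) y y' := by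
  conv_lhs => rw [matrix_eq_sum_single ρ]
  simp only [map_sum, Matrix.sum_apply]
  refine sum_congr rfl fun u _ => sum_congr rfl fun u' _ => ?_
  have : single u u' (ρ u u') = ρ u u' • single u u' (1 : ℂ) := by
    rw [Matrix.smul_single, smul_eq_mul, mul_one]
  rw [this, map_smul, Matrix.smul_apply, smul_eq_mul]

def coef (G : Op ι → Op κ) (u u' : Cfg ι) (y y' : Cfg κ) : ℂ := G (single u u' 1) y y'

lemma Circ.cchan_coef [Nonempty Z] {s : ℕ} {G : Θ → Op ι → Op κ} (h : Circ O s G) :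
    Circ O s fun θ => cchan (coef (G θ)) := by
  refine h.congr fun θ ρ => ?_
  obtain ⟨L, hL⟩ := h.linear θ
  ext y y'
  rw [hL, cchan_apply, linear_apply]
  simp only [coef, hL]

lemma Circ.eq_cchan [Nonempty Z] {s : ℕ} {G : Θ → Op ι → Op κ} (h : Circ O s G) (θ : Θ)
    (ρ : Op ι) : G θ ρ = cchan (coef (G θ)) ρ := by
  obtain ⟨L, hL⟩ := h.linear θ
  ext y y'
  rw [hL, cchan_apply, linear_apply]
  simp only [coef, hL]

def tensorCoef (c : Cfg α → Cfg α → Cfg β → Cfg β → ℂ) (d : Cfg γ → Cfg γ → Cfg δ → Cfg δ → ℂ)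
    (u u' : Cfg (α ⊕ γ)) (y y' : Cfg (β ⊕ δ)) : ℂ :=
  c (u ∘ inl) (u' ∘ inl) (y ∘ inl) (y' ∘ inl) * d (u ∘ inr) (u' ∘ inr) (y ∘ inr) (y' ∘ inr)

lemma comp_sumComm_inl (b : Cfg (α ⊕ β)) : (b ∘ (Equiv.sumComm α β).symm) ∘ inl = b ∘ inr := rfl

lemma comp_sumComm_inr (b : Cfg (α ⊕ β)) : (b ∘ (Equiv.sumComm α β).symm) ∘ inr = b ∘ inl := rfl

lemma elim_comp_sumComm (a : Cfg α) (b : Cfg β) :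
    (elim a b : Cfg (α ⊕ β)) ∘ (Equiv.sumComm α β).symm = elim b a := by
  funext i; rcases i with i | i <;> rfl

lemma Circ.both {s s' : ℕ} {c : Θ → Cfg α → Cfg α → Cfg β → Cfg β → ℂ}
    {d : Θ → Cfg γ → Cfg γ → Cfg δ → Cfg δ → ℂ} (hc : Circ O s fun θ => cchan (c θ))
    (hd : Circ O s' fun θ => cchan (d θ)) :
    Circ O (s + s') fun θ => cchan (tensorCoef (c θ) (d θ)) := by
  have h1 := ((hc.tensorId (R := γ)).comp
    (Circ.keep (Equiv.sumComm γ β).toEmbedding)).comp (hd.tensorId (R := β))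
  have h2 := h1.comp (Circ.keep (O := O) (Equiv.sumComm β δ).toEmbedding)
  simp only [add_zero] at h2
  refine h2.congr fun θ ρ => ?_
  ext y y'
  simp only [keepWires_equiv, tensorId_apply, cchan_apply, of_apply, tensorCoef, sum_cfgSum,
    comp_sumComm_inl, comp_sumComm_inr, elim_comp_sumComm, elim_comp_inl, elim_comp_inr,
    sum_mul]
  calc _ = ∑ a, ∑ g, ∑ g', ∑ a', ρ (elim a g) (elim a' g') *
        (c θ a a' (y ∘ inl) (y' ∘ inl) * d θ g g' (y ∘ inr) (y' ∘ inr)) :=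
        sum_congr rfl fun a _ => sum_congr rfl fun g _ => sum_comm
    _ = ∑ g, ∑ a, ∑ g', ∑ a', ρ (elim a g) (elim a' g') *
        (c θ a a' (y ∘ inl) (y' ∘ inl) * d θ g g' (y ∘ inr) (y' ∘ inr)) :=
        sum_comm
    _ = ∑ g, ∑ g', ∑ a, ∑ a', ρ (elim a g) (elim a' g') *
        (c θ a a' (y ∘ inl) (y' ∘ inl) * d θ g g' (y ∘ inr) (y' ∘ inr)) :=
        sum_congr rfl fun g _ => sum_comm
    _ = _ := by simp only [mul_assoc]

lemma cchan_reindex (c : Cfg ι → Cfg ι → Cfg κ → Cfg κ → ℂ) (e : μ ≃ ι) (e' : ν ≃ κ) (ρ : Op μ) :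
    keepWires e'.toEmbedding (cchan c (keepWires e.symm.toEmbedding ρ)) =
    cchan (fun u u' y y' => c (u ∘ e.symm) (u' ∘ e.symm) (y ∘ e'.symm) (y' ∘ e'.symm)) ρ := by
  ext y y'
  simp only [keepWires_equiv, cchan_apply]
  refine sum_equiv (e.arrowCongr (Equiv.refl Bool)).symm _ _ fun u =>
    sum_equiv (e.arrowCongr (Equiv.refl Bool)).symm _ _ fun u' => ?_
  have h : ∀ u : Cfg ι, ((e.arrowCongr (Equiv.refl Bool)).symm u) = u ∘ e := fun u => rfl
  have h' : ∀ u : Cfg ι, (u ∘ e) ∘ e.symm = u := fun u => by funext i; simp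
  simp only [h, h', Equiv.symm_symm]

/-- The part of a configuration which belongs to one of several copies of a register. -/
def slot (u : Cfg (K × α)) (i : K) : Cfg α := fun a => u (i, a)

/-- The coefficients of a channel acting on every copy of a register. -/
def piCoef (c : K → Cfg α → Cfg α → Cfg β → Cfg β → ℂ) (u u' : Cfg (K × α)) (y y' : Cfg (K × β)) :
    ℂ := ∏ i, c i (slot u i) (slot u' i) (slot y i) (slot y' i)

/-- The first of several copies of a register, together with the other copies. -/
def slotEquiv (m : ℕ) (α : Type) : Fin (m + 1) × α ≃ α ⊕ (Fin m × α) where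
  toFun p := Fin.cases (motive := fun _ => α ⊕ (Fin m × α)) (inl p.2)
    (fun i => inr (i, p.2)) p.1
  invFun := elim (fun a => (0, a)) fun p => (p.1.succ, p.2)
  left_inv := by
    rintro ⟨i, a⟩
    refine Fin.cases ?_ (fun i => ?_) i <;> rfl
  right_inv := by rintro (a | ⟨i, a⟩) <;> rfl

lemma Circ.pi {s : ℕ} {c : K → Θ → Cfg α → Cfg α → Cfg β → Cfg β → ℂ}
    (hc : ∀ i, Circ O s fun θ => cchan (c i θ)) :
    Circ O (card K * s) fun θ => cchan (piCoef fun i => c i θ) := by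
  have key : ∀ (m : ℕ) (c : Fin m → Θ → Cfg α → Cfg α → Cfg β → Cfg β → ℂ),
      (∀ i, Circ O s fun θ => cchan (c i θ)) →
      Circ O (m * s) fun θ => cchan (piCoef fun i => c i θ) := by
    intro m
    induction m with
    | zero =>
      intro c _
      rw [zero_mul]
      refine (Circ.keep (Equiv.equivOfIsEmpty (Fin 0 × β) (Fin 0 × α)).toEmbedding).congr
        fun θ ρ => ?_
      ext y y'
      rw [keepWires_equiv, cchan_apply]
      simp only [piCoef, Finset.univ_eq_empty, Finset.prod_empty, mul_one]
      rw [Fintype.sum_eq_single (y ∘ (Equiv.equivOfIsEmpty (Fin 0 × β) (Fin 0 × α)).symm),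
        Fintype.sum_eq_single (y' ∘ (Equiv.equivOfIsEmpty (Fin 0 × β) (Fin 0 × α)).symm)]
      · exact fun x hx => absurd (Subsingleton.elim _ _) hx
      · exact fun x hx => absurd (Subsingleton.elim _ _) hx
    | succ m ih =>
      intro c hc
      have h := ((hc 0).both (ih (fun i => c i.succ) fun i => hc i.succ)).reindex
        (slotEquiv m α) (slotEquiv m β)
      refine (h.weaken (le_of_eq (by ring))).congr fun θ ρ => ?_
      rw [cchan_reindex]
      congr 1
      funext u u' y y'
      rw [piCoef, Fin.prod_univ_succ]
      rfl
  have h := (key (card K) (fun i => c ((equivFin K).symm i)) fun i =>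
    hc _).reindex ((equivFin K).prodCongr (Equiv.refl α))
      ((equivFin K).prodCongr (Equiv.refl β))
  refine h.congr fun θ ρ => ?_
  rw [cchan_reindex]
  congr 1
  funext u u' y y'
  simp only [piCoef]
  exact Fintype.prod_equiv (equivFin K) _ _ fun i => by
    simp only [Equiv.symm_apply_apply]
    congr 1 <;> (funext a; simp [slot])

end Circ

/-! ### Reversible classical gates -/

section Gates

variable {Θ Z : Type} {ι κ μ W V α β K : Type}
variable [Fintype ι] [DecidableEq ι] [Fintype κ] [DecidableEq κ] [Fintype μ] [DecidableEq μ]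
  [Fintype W] [DecidableEq W] [Fintype V] [DecidableEq V]
  [Fintype α] [DecidableEq α] [Fintype β] [DecidableEq β] [Fintype K] [DecidableEq K]
  {O : Oracles Θ Z}

def pull {W : Type} (T : Cfg W → Cfg W) (ρ : Op W) : Op W := of fun b b' => ρ (T b) (T b')

lemma pull_pull (S T : Cfg W → Cfg W) (ρ : Op W) : pull S (pull T ρ) = pull (fun b => T (S b)) ρ :=
  rfl

lemma Circ.pull {a : ℕ} (ha : a ≤ 3) (f : Fin a ↪ W) (π : Cfg (Fin a) → Cfg (Fin a))
    (hπ : ∀ c, π (π c) = c) (T : Cfg W → Cfg W) (h1 : ∀ b, T b ∘ f = π (b ∘ f))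
    (h2 : ∀ b j, j ∉ Set.range f → T b j = b j) : Circ O 1 fun _ ρ => QPK.pull T ρ := by
  let U : Op (Fin a) := of fun b c => if c = π b then 1 else 0
  have hU : U ∈ unitaryGroup (Cfg (Fin a)) ℂ := by
    rw [mem_unitaryGroup_iff]
    ext b b'
    rw [star_eq_conjTranspose, mul_apply]
    have hinj : ∀ b b', π b = π b' ↔ b = b' := fun b b' =>
      ⟨fun h => by rw [← hπ b, h, hπ], fun h => by rw [h]⟩
    simp [U, one_apply, hinj, eq_comm]
  refine (Circ.gate ha f U hU).congr fun _ ρ => ?_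
  ext b b'
  rw [applyOn_apply, conj_apply]
  have hT : ∀ b, splice f (π (b ∘ f)) b = T b := fun b =>
    splice_ext f (h1 b) fun j hj => (h2 b j hj).symm
  simp [U, hT, QPK.pull]

def emb2 (x y : W) (h : x ≠ y) : Fin 2 ↪ W :=
  ⟨![x, y], by
    intro i j hij
    fin_cases i <;> fin_cases j <;> simp_all⟩

def emb3 (x y z : W) (hxy : x ≠ y) (hxz : x ≠ z) (hyz : y ≠ z) : Fin 3 ↪ W :=
  ⟨![x, y, z], by
    intro i j hij
    fin_cases i <;> fin_cases j <;> simp_all⟩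

@[simp] lemma emb2_zero (x y : W) (h : x ≠ y) : emb2 x y h 0 = x := rfl
@[simp] lemma emb2_one (x y : W) (h : x ≠ y) : emb2 x y h 1 = y := rfl
@[simp] lemma emb3_zero (x y z : W) (hxy : x ≠ y) (hxz : x ≠ z) (hyz : y ≠ z) :
    emb3 x y z hxy hxz hyz 0 = x := rfl
@[simp] lemma emb3_one (x y z : W) (hxy : x ≠ y) (hxz : x ≠ z) (hyz : y ≠ z) :
    emb3 x y z hxy hxz hyz 1 = y := rfl
@[simp] lemma emb3_two (x y z : W) (hxy : x ≠ y) (hxz : x ≠ z) (hyz : y ≠ z) :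
    emb3 x y z hxy hxz hyz 2 = z := rfl

lemma Circ.not (t : W) : Circ O 1 fun _ ρ => QPK.pull (fun b => update b t (!b t)) ρ := by
  refine Circ.pull (by norm_num) ⟨fun _ : Fin 1 => t, fun i j _ => Subsingleton.elim _ _⟩
    (fun c i => !c i) (fun c => by funext i; simp) _ ?_ ?_
  · intro b
    funext i
    exact update_self _ _ _
  · intro b j hj
    rw [update_of_ne]
    rintro rfl
    exact hj ⟨0, rfl⟩

lemma Circ.cnot (p t : W) (h : p ≠ t) : Circ O 1 fun _ ρ =>
    QPK.pull (fun b => update b t (xor (b t) (b p))) ρ := by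
  refine Circ.pull (by norm_num) (emb2 p t h)
    (fun c i => if i = 1 then xor (c 1) (c 0) else c i)
    (fun c => by funext i; by_cases h : i = 1 <;> simp [h]) _ ?_ ?_
  · intro b
    funext i
    match i with
    | 0 => simp [h]
    | 1 => simp
  · intro b j hj
    rw [update_of_ne]
    rintro rfl
    exact hj ⟨1, rfl⟩

/-- Add `p ∧ ¬ q` to the bit `t`. -/
lemma Circ.andNot (p q t : W) (hpq : p ≠ q) (hp : p ≠ t) (hq : q ≠ t) : Circ O 1 fun _ ρ =>
    QPK.pull (fun b => update b t (xor (b t) (b p && !b q))) ρ := by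
  refine Circ.pull le_rfl (emb3 p q t hpq hp hq)
    (fun c i => if i = 2 then xor (c 2) (c 0 && !c 1) else c i)
    (fun c => by funext i; by_cases h : i = 2 <;> simp [h]) _ ?_ ?_
  · intro b
    funext i
    match i with
    | 0 => simp [hp]
    | 1 => simp [hq]
    | 2 => simp
  · intro b j hj
    rw [update_of_ne]
    rintro rfl
    exact hj ⟨2, rfl⟩

/-- Swap the bits `x` and `y` if the bit `e` is set. -/
def cswapFun {W : Type} [DecidableEq W] (e x y : W) (b : Cfg W) : Cfg W := fun w =>
  if b e = true then (if w = x then b y else if w = y then b x else b w) else b w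

lemma Circ.cswap (e x y : W) (hx : e ≠ x) (hy : e ≠ y) (hxy : x ≠ y) : Circ O 1 fun _ ρ =>
    QPK.pull (cswapFun e x y) ρ := by
  refine Circ.pull le_rfl (emb3 e x y hx hy hxy) (cswapFun 0 1 2) (fun c => ?_) _ ?_ ?_
  · funext i
    by_cases h : c 0 = true
    · fin_cases i <;> simp [cswapFun, h]
    · simp [cswapFun, h]
  · intro b
    funext i
    match i with
    | 0 => simp [cswapFun, hx, hy]
    | 1 => simp [cswapFun]
    | 2 => simp [cswapFun, hxy.symm]
  · intro b j hj
    have h1 : j ≠ x := by rintro rfl; exact hj ⟨1, rfl⟩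
    have h2 : j ≠ y := by rintro rfl; exact hj ⟨2, rfl⟩
    simp [cswapFun, h1, h2]

def hadamard : Op (Fin 1) := of fun b c =>
  ((√2 : ℝ) : ℂ)⁻¹ * if b 0 = true ∧ c 0 = true then -1 else 1

lemma sum_cfg_one {M : Type*} [AddCommMonoid M] (g : Cfg (Fin 1) → M) :
    ∑ b, g b = g (fun _ => true) + g (fun _ => false) := by
  rw [← sum_bool fun v => g fun _ => v]
  exact sum_equiv (Equiv.funUnique (Fin 1) Bool) _ _ fun b => by
    congr 1
    funext i
    simp [Subsingleton.elim i default]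

lemma sqrt_two_inv_mul : (((√2 : ℝ) : ℂ)⁻¹) * (((√2 : ℝ) : ℂ)⁻¹) = 1 / 2 := by
  rw [← mul_inv, ← ofReal_mul, Real.mul_self_sqrt (by norm_num)]
  norm_num

lemma hadamard_mem : hadamard ∈ unitaryGroup (Cfg (Fin 1)) ℂ := by
  rw [mem_unitaryGroup_iff]
  ext b b'
  rw [star_eq_conjTranspose, mul_apply, sum_cfg_one, one_apply]
  have hb : ∀ b : Cfg (Fin 1), b = fun _ => b 0 := fun b => by
    funext i; rw [Subsingleton.elim i 0]
  rw [hb b, hb b']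
  generalize b 0 = x
  generalize b' 0 = y
  have h := sqrt_two_inv_mul
  have hne : ∀ x y : Bool, ((fun _ : Fin 1 => x) = fun _ => y) ↔ x = y := fun x y =>
    ⟨fun h => congrFun h 0, fun h => by rw [h]⟩
  simp only [conjTranspose_apply, hadamard, of_apply, star_mul', hne]
  have hs : star (((√2 : ℝ) : ℂ)⁻¹) = ((√2 : ℝ) : ℂ)⁻¹ := by
    rw [star_inv₀]
    congr 1
    exact Complex.conj_ofReal _
  rw [hs]
  cases x <;> cases y <;> simp <;> linear_combination 2 * h

/-! ### Classical channels -/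

/-- Measure all wires, and replace the outcome `a` by `y` with probability `M a y`. -/
def kchan {ι κ : Type} [Fintype ι] [DecidableEq ι] [Fintype κ] [DecidableEq κ]
    (M : Cfg ι → Cfg κ → ℂ) (ρ : Op ι) : Op κ :=
  of fun y y' => if y = y' then ∑ a, ρ a a * M a y else 0

/-- Kernels which can be sampled by circuits. -/
def KCirc (O : Oracles Θ Z) (s : ℕ) (M : Θ → Cfg ι → Cfg κ → ℂ) : Prop :=
  Circ O s fun θ => kchan (M θ)

def det {ι κ : Type} [Fintype κ] (h : Cfg ι → Cfg κ) (a : Cfg ι) (y : Cfg κ) : ℂ :=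
  if y = h a then 1 else 0

lemma kchan_apply (M : Cfg ι → Cfg κ → ℂ) (ρ : Op ι) (y y' : Cfg κ) :
    kchan M ρ y y' = if y = y' then ∑ a, ρ a a * M a y else 0 := rfl

lemma kchan_kchan (M : Cfg ι → Cfg κ → ℂ) (N : Cfg κ → Cfg μ → ℂ) (ρ : Op ι) :
    kchan N (kchan M ρ) = kchan (fun a c => ∑ y, M a y * N y c) ρ := by
  ext c c'
  simp only [kchan_apply, if_true]
  congr 1
  simp only [sum_mul, mul_sum, mul_assoc]
  exact sum_comm

lemma KCirc.congr {s : ℕ} {M M' : Θ → Cfg ι → Cfg κ → ℂ} (h : KCirc O s M)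
    (h' : ∀ θ a y, M' θ a y = M θ a y) : KCirc O s M' := by
  have : M' = M := by funext θ a y; exact h' θ a y
  rwa [this]

lemma KCirc.weaken {s s' : ℕ} {M : Θ → Cfg ι → Cfg κ → ℂ} (h : KCirc O s M) (hs : s ≤ s') :
    KCirc O s' M := Circ.weaken h hs

lemma KCirc.comp {s s' : ℕ} {M : Θ → Cfg ι → Cfg κ → ℂ} {N : Θ → Cfg κ → Cfg μ → ℂ}
    (hM : KCirc O s M) (hN : KCirc O s' N) : KCirc O (s + s') fun θ a c => ∑ y, M θ a y * N θ y c :=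
  (Circ.comp hM hN).congr fun θ ρ => (kchan_kchan (M θ) (N θ) ρ).symm

lemma Circ.xorInto (p : κ → ι) (l : Finset κ) :
    Circ O l.card fun _ (ρ : Op (ι ⊕ κ)) => QPK.pull (fun b => elim (b ∘ inl) fun j =>
      if j ∈ l then xor (b (inr j)) (b (inl (p j))) else b (inr j)) ρ := by
  induction l using induction_on with
  | empty =>
    refine Circ.id.congr fun _ ρ => ?_
    ext b b'
    have h : ∀ b : Cfg (ι ⊕ κ), (elim (b ∘ inl) fun j => b (inr j)) = b := fun b => by
      funext i; rcases i with i | i <;> rfl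
    simp [QPK.pull, h]
  | insert j l hj ih =>
    rw [Finset.card_insert_of_notMem hj]
    refine (ih.comp (Circ.cnot (inl (p j)) (inr j) inl_ne_inr)).congr fun _ ρ => ?_
    rw [pull_pull]
    congr 1
    funext b w
    rcases w with i | k
    · simp
    · by_cases hk : k = j
      · subst hk
        simp [hj]
      · simp [hk]

lemma KCirc.copy (p : κ → ι) : KCirc O (2 * card κ) fun _ => det fun a : Cfg ι => a ∘ p := by
  have h := ((Circ.place_inl (O := O) (ι := ι) (R := κ)).comp
    (Circ.xorInto p univ)).comp (Circ.keep (Embedding.inr : κ ↪ ι ⊕ κ))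
  rw [card_univ, add_zero, ← two_mul] at h
  refine Circ.congr h fun _ ρ => ?_
  classical
  ext y y'
  have hk : ∀ (σ : Op (ι ⊕ κ)), keepWires (Embedding.inr : κ ↪ ι ⊕ κ) σ y y' =
      ∑ a : Cfg ι, σ (elim a y) (elim a y') := by
    intro σ
    rw [keepWires_apply, sum_cfgSum]
    refine sum_congr rfl fun a _ => ?_
    rw [sum_eq_single y]
    · rw [if_pos (by rfl)]
      congr 1
      refine splice_ext _ rfl ?_
      rintro (j | j) hj
      · rfl
      · exact absurd ⟨j, rfl⟩ hj
    · intro c _ hc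
      exact if_neg hc
    · simp
  rw [hk, kchan_apply]
  simp only [QPK.pull, of_apply, QPK.place_inl, elim_comp_inl, elim_comp_inr, det,
    mem_univ, if_true]
  have hx : ∀ (a : Cfg ι) (y : Cfg κ), ((fun j => xor (y j) (a (p j))) = fun _ => false) ↔
      y = a ∘ p := by
    intro a y
    rw [funext_iff, funext_iff]
    simp
  simp only [elim_inr, elim_inl, hx]
  by_cases hy : y = y'
  · subst hy
    simp
  · rw [if_neg hy]
    symm
    refine sum_eq_zero fun a _ => if_neg ?_
    rintro ⟨h1, h2⟩
    exact hy (h1.trans h2.symm)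

lemma sum_det (h : Cfg ι → Cfg κ) (a : Cfg ι) (N : Cfg κ → ℂ) : ∑ y, det h a y * N y = N (h a) := by
  simp [det]

lemma KCirc.comap {s : ℕ} {N : Θ → Cfg κ → Cfg μ → ℂ} (hN : KCirc O s N) (p : κ → ι) :
    KCirc O (2 * card κ + s) fun θ (a : Cfg ι) c => N θ (a ∘ p) c :=
  ((KCirc.copy p).comp hN).congr fun θ a c => (sum_det (fun a => a ∘ p) a fun y => N θ y c).symm

lemma KCirc.keep {s : ℕ} {M : Θ → Cfg ι → Cfg κ → ℂ} (hM : KCirc O s M) (g : μ → κ) :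
    KCirc O (s + 2 * card μ) fun θ a c => ∑ y, if c = y ∘ g then M θ a y else 0 :=
  (hM.comp (KCirc.copy g)).congr fun θ a c => by simp [det]

/-- Measure, apply a channel, and measure again. -/
lemma KCirc.measured [Nonempty Z] {s : ℕ} {G : Θ → Op ι → Op κ} (hG : Circ O s G) :
    KCirc O (2 * card ι + s + 2 * card κ) fun θ a y => coef (G θ) a a y y := by
  refine Circ.congr ((Circ.comp (KCirc.copy (O := O) (id : ι → ι)) hG).comp
    (KCirc.copy (id : κ → κ))) fun θ ρ => ?_
  rw [hG.eq_cchan θ]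
  ext y y'
  simp only [kchan_apply]
  split_ifs with h
  · simp [cchan_apply, kchan_apply, det, sum_ite_eq, ite_mul]
  · rfl

lemma kchan_eq_cchan (M : Cfg ι → Cfg κ → ℂ) :
    kchan M = cchan fun u u' y y' => if u = u' ∧ y = y' then M u y else 0 := by
  funext ρ
  ext y y'
  simp only [kchan_apply, cchan_apply]
  by_cases h : y = y' <;> simp [h]

lemma cfg_sum_ext_iff {α γ : Type} (u u' : Cfg (α ⊕ γ)) :
    u = u' ↔ u ∘ inl = u' ∘ inl ∧ u ∘ inr = u' ∘ inr := by
  constructor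
  · rintro rfl
    exact ⟨rfl, rfl⟩
  · rintro ⟨h1, h2⟩
    funext i
    rcases i with i | i
    · exact congrFun h1 i
    · exact congrFun h2 i

lemma KCirc.both {γ δ : Type} [Fintype γ] [DecidableEq γ] [Fintype δ] [DecidableEq δ] {s s' : ℕ}
    {M : Θ → Cfg α → Cfg β → ℂ} {N : Θ → Cfg γ → Cfg δ → ℂ} (hM : KCirc O s M) (hN : KCirc O s' N) :
    KCirc O (s + s') fun θ a y => M θ (a ∘ inl) (y ∘ inl) * N θ (a ∘ inr) (y ∘ inr) := by
  unfold KCirc at hM hN ⊢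
  simp only [kchan_eq_cchan] at hM hN ⊢
  refine (hM.both hN).congr fun θ ρ => ?_
  congr 1
  funext u u' y y'
  simp only [tensorCoef, cfg_sum_ext_iff u u', cfg_sum_ext_iff y y', ite_mul, mul_ite, zero_mul,
      mul_zero]
  by_cases h1 : u ∘ inl = u' ∘ inl <;> by_cases h2 : u ∘ inr = u' ∘ inr <;>
    by_cases h3 : y ∘ inl = y' ∘ inl <;> by_cases h4 : y ∘ inr = y' ∘ inr <;>
    simp [h1, h2, h3, h4]

lemma slot_ext_iff (u u' : Cfg (K × α)) : u = u' ↔ ∀ i, slot u i = slot u' i := by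
  constructor
  · rintro rfl i; rfl
  · intro h
    funext ⟨i, a⟩
    exact congrFun (h i) a

lemma KCirc.pi {s : ℕ} {M : K → Θ → Cfg α → Cfg β → ℂ} (hM : ∀ i, KCirc O s (M i)) :
    KCirc O (card K * s) fun θ (a : Cfg (K × α)) (y : Cfg (K × β)) => ∏ i, M i θ (slot a i)
    (slot y i) := by
  unfold KCirc at hM ⊢
  simp only [kchan_eq_cchan] at hM ⊢
  refine (Circ.pi hM).congr fun θ ρ => ?_
  congr 1
  funext u u' y y'
  simp only [piCoef]
  simp only [slot_ext_iff u, slot_ext_iff y]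
  by_cases h1 : ∀ i, slot u i = slot u' i
  · by_cases h2 : ∀ i, slot y i = slot y' i
    · simp [h1, h2]
    · rw [if_neg (by tauto)]
      obtain ⟨i, hi⟩ := not_forall.1 h2
      exact (prod_eq_zero (mem_univ i) (if_neg (by tauto))).symm
  · rw [if_neg (by tauto)]
    obtain ⟨i, hi⟩ := not_forall.1 h1
    exact (prod_eq_zero (mem_univ i) (if_neg (by tauto))).symm

/-- Sample `x` from a kernel, and then the output from a kernel which may also use `x`. -/
lemma KCirc.bind {s s' : ℕ} {M : Θ → Cfg α → Cfg κ → ℂ} {N : Θ → Cfg (ι ⊕ κ) → Cfg μ → ℂ}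
    (hM : KCirc O s M) (hN : KCirc O s' N) (p : α → ι) : KCirc O (4 * card ι + 2 * card α + s + s')
    fun θ (a : Cfg ι) c => ∑ x, M θ (a ∘ p) x * N θ (elim a x) c := by
  have h := ((KCirc.copy (O := O) (elim id p : ι ⊕ α → ι)).comp
    ((KCirc.copy (O := O) (id : ι → ι)).both hM)).comp hN
  refine (h.weaken ?_).congr fun θ a c => ?_
  · rw [card_sum]
    linarith
  · have hs : ∀ y, (∑ b, det (fun a : Cfg ι => a ∘ elim id p) a b *
        (det (fun a : Cfg ι => a ∘ id) (b ∘ inl) (y ∘ inl) * M θ (b ∘ inr) (y ∘ inr))) =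
        det (fun a : Cfg ι => a) a (y ∘ inl) * M θ (a ∘ p) (y ∘ inr) := fun y =>
      sum_det (fun a : Cfg ι => a ∘ elim id p) a fun b =>
        det (fun a : Cfg ι => a ∘ id) (b ∘ inl) (y ∘ inl) * M θ (b ∘ inr) (y ∘ inr)
    simp only [hs]
    rw [sum_cfgSum, sum_comm]
    refine sum_congr rfl fun x _ => ?_
    rw [sum_eq_single a]
    · simp [det]
    · intro b _ hb
      simp [det, hb]
    · simp

end Gates

section Kernels

variable {Θ Z : Type} {ι κ μ W V α β K π : Type}
variable [Fintype ι] [DecidableEq ι] [Fintype κ] [DecidableEq κ] [Fintype μ] [DecidableEq μ]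
  [Fintype W] [DecidableEq W] [Fintype V] [DecidableEq V] [Fintype π] [DecidableEq π]
  [Fintype α] [DecidableEq α] [Fintype β] [DecidableEq β] [Fintype K] [DecidableEq K]
  {O : Oracles Θ Z}

/-! ### Random bits, constants and multiplexers -/

lemma KCirc.piUnit {s : ℕ} {M : κ → Θ → Cfg α → Cfg Unit → ℂ} (hM : ∀ i, KCirc O s (M i))
    (p : κ → α → ι) : KCirc O (2 * (card κ * card α) + card κ * s + 2 * card κ) fun θ (a : Cfg ι)
    y => ∏ i, M i θ (a ∘ p i) (fun _ => y i) := by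
  have h := ((KCirc.pi hM).comap fun q : κ × α => p q.1 q.2).keep fun i : κ => (i, ())
  rw [card_prod] at h
  refine h.congr fun θ a y => ?_
  rw [sum_eq_single fun q : κ × Unit => y q.1]
  · rw [if_pos (by rfl)]
    rfl
  · intro c _ hc
    rw [if_neg]
    rintro rfl
    exact hc rfl
  · simp

lemma coef_pull (T : Cfg ι → Cfg ι) (hT : ∀ b, T (T b) = b) (g : κ ↪ ι) (a : Cfg ι) (y : Cfg κ) :
    coef (fun ρ => keepWires g (pull T ρ)) a a y y = if y = T a ∘ g then 1 else 0 := by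
  have h : ∀ b, a = T b ↔ b = T a := fun b =>
    ⟨fun h => by rw [h, hT], fun h => by rw [h, hT]⟩
  simp only [coef, keepWires_apply, pull, of_apply]
  rw [sum_eq_single (T a)]
  · by_cases hy : T a ∘ g = y
    · subst hy
      simp [hT]
    · rw [if_neg hy, if_neg (fun h => hy h.symm)]
  · intro b _ hb
    split_ifs with h'
    · rw [← h', splice_self, single_apply, if_neg]
      rw [and_self, h]
      exact hb
    · rfl
  · simp

lemma KCirc.mux [Nonempty Z] (e p q : κ → ι) : KCirc O (17 * card κ)
    fun _ => QPK.det fun (a : Cfg ι) j => if a (e j) = true then a (p j) else a (q j) := by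
  have h1 : Circ O 1 fun _ (ρ : Op (Fin 3)) => keepWires
      (⟨fun _ => 1, fun _ _ _ => rfl⟩ : Unit ↪ Fin 3) (pull (cswapFun 0 1 2) ρ) :=
    (Circ.cswap (O := O) (0 : Fin 3) 1 2 (by decide) (by decide) (by decide)).comp (Circ.keep _)
  have h2 := KCirc.piUnit (fun _ : κ => KCirc.measured h1) fun i => ![e i, q i, p i]
  refine (h2.weaken (le_of_eq (by simp; ring))).congr fun θ a y => ?_
  have hT : ∀ b : Cfg (Fin 3), cswapFun 0 1 2 (cswapFun 0 1 2 b) = b := by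
    intro c
    funext i
    by_cases h : c 0 = true
    · fin_cases i <;> simp [cswapFun, h]
    · simp [cswapFun, h]
  simp only [coef_pull _ hT, QPK.det]
  rw [Finset.prod_ite_zero]
  simp only [prod_const_one, mem_univ, true_implies]
  congr 1
  rw [eq_iff_iff, funext_iff]
  refine forall_congr' fun j => ?_
  have h : cswapFun 0 1 2 (a ∘ ![e j, q j, p j]) 1 = if a (e j) = true then a (p j) else a (q j) :=
      by
    simp [cswapFun]
  rw [← h, funext_iff]
  exact ⟨fun h _ => h, fun h => h ()⟩

lemma cfg_empty_eq {ι : Type} [IsEmpty ι] (a b : Cfg ι) : a = b := Subsingleton.elim a b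

abbrev noWire : Empty ↪ Unit := Embedding.ofIsEmpty

lemma place_noWire (a : Cfg Empty) (b b' : Cfg Unit) :
    place noWire (single a a 1) b b' = if b () = false ∧ b' () = false then 1 else 0 := by
  classical
  have hz : ∀ b : Cfg Unit, ZeroOff noWire b ↔ b () = false := fun b =>
    ⟨fun h => h () (by rintro ⟨i, -⟩; exact i.elim), fun h _ _ => h⟩
  rw [place_apply, cfg_empty_eq (b ∘ _) a, cfg_empty_eq (b' ∘ _) a, single_apply_same]
  simp only [hz]

lemma Circ.plusQubit : ∃ G : Op Empty → Op Unit, (Circ O 2 fun _ => G) ∧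
    ∀ a, G (single a a 1) = pureState fun _ => ((√2 : ℝ) : ℂ)⁻¹ := by
  refine ⟨_, (Circ.place (O := O) noWire).comp (Circ.gate (by norm_num)
    (⟨fun _ => (), fun i j _ => Subsingleton.elim i j⟩ : Fin 1 ↪ Unit) hadamard hadamard_mem),
    fun a => ?_⟩
  ext y y'
  have hs : ∀ v b, splice (⟨fun _ => (), fun i j _ => Subsingleton.elim i j⟩ : Fin 1 ↪ Unit)
      (fun _ => v) b = fun _ => v := fun v b => splice_ext _ rfl fun j hj => absurd ⟨0, rfl⟩ hj
  rw [applyOn_apply, conj_apply]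
  simp only [sum_cfg_one, of_apply, hs, place_noWire]
  simp [hadamard, pureState, vecMulVec_apply]

lemma KCirc.uniform [Nonempty Z] :
    KCirc O (6 * card κ) fun _ (_ : Cfg ι) (_ : Cfg κ) => (1 / 2 ^ card κ : ℂ) := by
  obtain ⟨G, hG, h⟩ := Circ.plusQubit (O := O)
  have h2 := KCirc.piUnit (fun _ : κ => KCirc.measured hG) fun _ => (Empty.elim : Empty → ι)
  refine (h2.weaken (le_of_eq (by simp; ring))).congr fun θ a y => ?_
  rw [prod_congr rfl (g := fun _ => (1 / 2 : ℂ))]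
  · simp
  · intro i _
    rw [coef, h, ← sqrt_two_inv_mul]
    simp [pureState, vecMulVec_apply]

lemma KCirc.const [Nonempty Z] (c : Cfg κ) :
    KCirc O (6 * card κ) fun _ => QPK.det fun _ : Cfg ι => c := by
  have h1 : ∀ v : Bool, Circ O 2 fun _ (ρ : Op Empty) => pull (fun b : Cfg Unit => fun _ =>
      xor v (b ())) (place noWire ρ) := by
    intro v
    cases v
    · refine ((Circ.place (O := O) noWire).weaken (by simp)).congr fun _ ρ => ?_
      simp [pull]
      rfl
    · refine ((Circ.place (O := O) noWire).comp (Circ.not ())).congr fun _ ρ => ?_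
      congr 1
      funext b u
      simp
  have h2 := KCirc.piUnit (fun i : κ => KCirc.measured (h1 (c i))) fun _ => (Empty.elim : Empty → ι)
  refine (h2.weaken (le_of_eq (by simp; ring))).congr fun θ a y => ?_
  simp only [coef, pull, of_apply, place_noWire, QPK.det, and_self]
  have h3 : ∀ i, (if (c i ^^ y i) = false then (1 : ℂ) else 0) = if y i = c i then 1 else 0 :=
    fun i => by cases c i <;> cases y i <;> simp
  rw [prod_congr rfl fun i _ => h3 i, Finset.prod_ite_zero]
  simp [funext_iff]

/-! ### Controlled application of a channel -/

/-- The diagonal block in which the control bit has the value `v`. -/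
def blk (v : Bool) (σ : Op (Unit ⊕ V)) : Op V :=
  of fun b b' => σ (elim (fun _ => v) b) (elim (fun _ => v) b')

/-- `G` can be implemented conditioned on a control bit. -/
def CtrlImpl (O : Oracles Θ Z) (s : ℕ) (G : Θ → (Z → Op V) → Z → Op V) : Prop :=
  ∃ C : Θ → (Z → Op (Unit ⊕ V)) → Z → Op (Unit ⊕ V), Impl O s C ∧ ∀ θ σ z v, blk v (C θ σ z) =
      if v = true then G θ (fun z' => blk true (σ z')) z else blk false (σ z)

lemma CtrlImpl.comp {s s' : ℕ} {G G' : Θ → (Z → Op V) → Z → Op V} (h : CtrlImpl O s G)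
    (h' : CtrlImpl O s' G') : CtrlImpl O (s + s') fun θ σ => G' θ (G θ σ) := by
  obtain ⟨C, hC, hG⟩ := h
  obtain ⟨C', hC', hG'⟩ := h'
  refine ⟨_, hC.comp hC', fun θ σ z v => ?_⟩
  rw [hG']
  split_ifs with hv
  · congr 1
    funext z'
    rw [hG, if_pos rfl]
  · rw [hG, if_neg (by simp)]

lemma CtrlImpl.weaken {s s' : ℕ} {G : Θ → (Z → Op V) → Z → Op V} (h : CtrlImpl O s G)
    (hs : s ≤ s') : CtrlImpl O s' G := by
  obtain ⟨C, hC, hG⟩ := h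
  exact ⟨C, .weaken hs hC, hG⟩

/-- Swap the register `π` with the wires selected by `f` if the control bit is set. -/
def cswapAll (f : π ↪ V) (l : Finset π) (b : Cfg ((Unit ⊕ V) ⊕ π)) : Cfg ((Unit ⊕ V) ⊕ π) :=
  if b (inl (inl ())) = true then
    elim (elim (fun _ => true) (splice f (fun j => if j ∈ l then b (inr j)
      else b (inl (inr (f j)))) fun v => b (inl (inr v))))
      fun j => if j ∈ l then b (inl (inr (f j))) else b (inr j)
  else b

lemma Circ.cswapAll (f : π ↪ V) (l : Finset π) :
    Circ O l.card fun _ => QPK.pull (QPK.cswapAll f l) := by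
  induction l using induction_on with
  | empty =>
    refine Circ.id.congr fun _ ρ => ?_
    have h : ∀ b, QPK.cswapAll f ∅ b = b := by
      intro b
      rw [QPK.cswapAll]
      split_ifs with hb
      · funext w
        rcases w with (⟨⟩ | v) | j
        · exact hb.symm
        · simp only [elim_inl, elim_inr, Finset.notMem_empty, if_false]
          exact congrFun (splice_self f fun v => b (inl (inr v))) v
        · simp
      · rfl
    have h' : QPK.cswapAll f ∅ = fun b => b := funext h
    rw [h']
    rfl
  | insert j l hj ih =>
    rw [Finset.card_insert_of_notMem hj]
    refine (ih.comp (Circ.cswap (inl (inl ())) (inl (inr (f j))) (inr j)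
      (by simp) (by simp) (by simp))).congr fun _ ρ => ?_
    rw [pull_pull]
    congr 1
    funext b
    by_cases hb : b (inl (inl ())) = true
    · have hb' : cswapFun (inl (inl ())) (inl (inr (f j))) (inr j) b
          (inl (inl ())) = true := by simp [cswapFun, hb]
      rw [QPK.cswapAll, QPK.cswapAll, if_pos hb, if_pos hb']
      funext w
      rcases w with (⟨⟩ | v) | i
      · rfl
      · simp only [elim_inl, elim_inr]
        by_cases hv : v ∈ Set.range f
        · obtain ⟨i, rfl⟩ := hv
          rw [splice_apply, splice_apply]
          by_cases hi : i = j
          · subst hi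
            simp [hj, cswapFun, hb]
          · simp [hi, cswapFun, hb]
        · rw [splice_of_notMem _ _ _ hv, splice_of_notMem _ _ _ hv]
          have : v ≠ f j := fun h => hv ⟨j, h.symm⟩
          simp [cswapFun, this]
      · simp only [elim_inr]
        by_cases hi : i = j
        · subst hi
          simp [hj, cswapFun, hb]
        · simp [hi, cswapFun, hb]
    · have hb' : ¬ cswapFun (inl (inl ())) (inl (inr (f j))) (inr j) b
          (inl (inl ())) = true := by simp [cswapFun, hb]
      rw [QPK.cswapAll, QPK.cswapAll, if_neg hb, if_neg hb']
      funext w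
      simp only [cswapFun, if_neg hb]

lemma splice_inr (a : Cfg π) (b : Cfg (V ⊕ π)) : splice Embedding.inr a b = elim (b ∘ inl) a := by
  refine splice_ext _ rfl ?_
  rintro (j | j) hj
  · rfl
  · exact absurd ⟨j, rfl⟩ hj

lemma CtrlImpl.of_circ [Nonempty Z] {s : ℕ} {F : Θ → Op π → Op π} (hF : Circ O s F) (f : π ↪ V)
    (htr : ∀ θ, (F θ (single (fun _ => false) (fun _ => false) 1)).trace = 1) :
    CtrlImpl O (3 * card π + s) fun θ σ z => applyOn f (F θ) (σ z) := by
  have h := ((((Circ.place_inl (O := O) (ι := Unit ⊕ V) (R := π)).comp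
    (Circ.cswapAll f univ)).comp (hF.applyOn Embedding.inr)).comp
    (Circ.cswapAll f univ)).comp (Circ.keep Embedding.inl)
  refine ⟨_, h.weaken (by rw [card_univ]; omega), fun θ σ z v => ?_⟩
  classical
  beta_reduce
  ext b b'
  rw [blk, of_apply, keepWires_inl]
  have hT : ∀ (b : Cfg V) (a : Cfg π), QPK.cswapAll f univ
      (elim (elim (fun _ => true) b) a) =
      elim (elim (fun _ => true) (splice f a b)) (b ∘ f) := by
    intro b a
    simp only [QPK.cswapAll, elim_inl, elim_inr, mem_univ, if_true]
    rfl
  have hT' : ∀ (b : Cfg V) (a : Cfg π), QPK.cswapAll f univ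
      (elim (elim (fun _ => false) b) a) = elim (elim (fun _ => false) b) a := by
    intro b a
    simp [QPK.cswapAll]
  obtain ⟨L, hL⟩ := hF.linear θ
  have hsingle : ∀ (x : ℂ) (d : ∀ a a' : Cfg π, Decidable (a = (fun _ => false) ∧
      a' = fun _ => false)), (of fun a a' : Cfg π => @ite _ _ (d a a') x 0) =
      x • single (fun _ => false) (fun _ => false) (1 : ℂ) := by
    intro x d
    ext a a'
    simp [single_apply, eq_comm]
  cases v
  · simp only [pull, of_apply, hT', applyOn_apply, splice_inr, elim_comp_inl]
    simp only [place_inl, elim_comp_inl, elim_comp_inr]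
    erw [hsingle]
    rw [hL, map_smul, ← hL]
    have h1 := htr θ
    rw [trace] at h1
    simp only [Matrix.smul_apply, smul_eq_mul]
    rw [← mul_sum]
    have h2 : ∀ r : Cfg π, ((elim (elim (fun _ => false) b) r :
      Cfg ((Unit ⊕ V) ⊕ π)) ∘ (Embedding.inr : π ↪ (Unit ⊕ V) ⊕ π)) = r := fun r => rfl
    have h3 : ∀ r : Cfg π, ((elim (elim (fun _ => false) b') r :
      Cfg ((Unit ⊕ V) ⊕ π)) ∘ (Embedding.inr : π ↪ (Unit ⊕ V) ⊕ π)) = r := fun r => rfl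
    simp only [h2, h3]
    have h4 : ∑ r, F θ (single (fun _ => false) (fun _ => false) 1) r r = 1 := h1
    rw [h4, mul_one]
    simp [blk]
  · simp only [pull, of_apply, hT, applyOn_apply, splice_inr, elim_comp_inl]
    simp only [place_inl, elim_comp_inl, elim_comp_inr, splice_comp, splice_splice, if_true]
    rw [sum_eq_single fun _ => false]
    · simp only [and_self, if_true]
      rfl
    · intro r _ hr
      simp only [hr, and_self, if_false]
      have : (of fun (_ _ : Cfg π) => (0 : ℂ)) = 0 := rfl
      rw [this, hL, map_zero]
      rfl
    · simp

/-! ### Classically controlled steps -/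

lemma xor_eq_false_iff' (v x : Bool) : (v ^^ x) = false ↔ x = v := by
  revert v x
  decide

lemma place_inr_apply (ρ : Op V) (b b' : Cfg (Unit ⊕ V)) : place (Embedding.inr : V ↪ Unit ⊕ V)
    ρ b b' = if b (inl ()) = false ∧ b' (inl ()) = false then ρ (b ∘ inr) (b' ∘ inr) else 0 := by
  classical
  have h : ∀ b : Cfg (Unit ⊕ V), ZeroOff (Embedding.inr : V ↪ Unit ⊕ V) b ↔ b (inl ()) = false := by
    intro b
    constructor
    · intro h
      refine h _ ?_
      rintro ⟨i, hi⟩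
      exact inr_ne_inl hi
    · rintro h (⟨⟩ | j) hj
      · exact h
      · exact absurd ⟨j, rfl⟩ hj
  rw [place_apply]
  simp only [h]
  rfl

lemma keepWires_inr_unit (σ : Op (Unit ⊕ V)) :
    keepWires (Embedding.inr : V ↪ Unit ⊕ V) σ = blk false σ + blk true σ := by
  ext y y'
  rw [keepWires_apply, sum_cfgSum]
  have h : ∀ u : Cfg Unit, (∑ c : Cfg V, if (elim u c : Cfg (Unit ⊕ V)) ∘
      (Embedding.inr : V ↪ Unit ⊕ V) = y then σ (elim u c)
        (splice Embedding.inr y' (elim u c)) else 0) = σ (elim u y) (elim u y') := by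
    intro u
    rw [sum_eq_single y]
    · rw [if_pos (by rfl), splice_inr, elim_comp_inl]
    · intro c _ hc
      exact if_neg hc
    · simp
  simp only [h]
  rw [Matrix.add_apply, blk, blk, of_apply, of_apply, add_comm,
    ← sum_bool fun v => σ (elim (fun _ => v) y) (elim (fun _ => v) y')]
  exact sum_equiv (Equiv.funUnique Unit Bool) _ _ fun u => rfl

lemma CtrlImpl.enc {s : ℕ} {G : Θ → (Z → Op V) → Z → Op V} (h : CtrlImpl O s G) (ctrl : V) :
    Impl O (s + 2) fun θ ρ z => branch ctrl false (ρ z) + G θ (fun z => branch ctrl true (ρ z))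
    z := by
  obtain ⟨C, hC, hG⟩ := h
  have h1 : Circ O 2 fun _ (ρ : Op V) => pull (fun b => update b (inl ())
      (xor (b (inl ())) (b (inr ctrl)))) (place (Embedding.inr : V ↪ Unit ⊕ V) ρ) :=
    ((Circ.place (O := O) (Embedding.inr : V ↪ Unit ⊕ V)).weaken (s' := 1) (by simp)).comp
      (Circ.cnot _ _ (by simp))
  have h2 := (Impl.comp h1 hC).comp (Impl.keep (Embedding.inr : V ↪ Unit ⊕ V) Impl.id)
  refine Impl.weaken (s := 2 + s + 0) (by omega) ?_
  convert h2 using 1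
  funext θ ρ z
  have hb : ∀ (v : Bool) (ρ : Op V), blk v (pull (fun b => update b (inl ())
      (xor (b (inl ())) (b (inr ctrl)))) (place (Embedding.inr : V ↪ Unit ⊕ V) ρ))
      = branch ctrl v ρ := by
    intro v ρ
    ext b b'
    simp only [blk, of_apply, pull, place_inr_apply, branch]
    have hu : ∀ b : Cfg V, (update (elim (fun _ => v) b : Cfg (Unit ⊕ V)) (inl ())
        (v ^^ b ctrl)) ∘ inr = b := by
      intro b; funext j; exact update_of_ne (inr_ne_inl) _ _
    simp only [elim_inl, elim_inr, hu, update_self]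
    have hx : ∀ b : Cfg V, (v ^^ b ctrl) = false ↔ b ctrl = v := by
      intro b; exact xor_eq_false_iff' _ _
    simp only [hx]
  rw [keepWires_inr_unit, hG, hG, if_neg (by simp), if_pos rfl]
  simp only [hb]

/-- The register in state `ρ`, together with a bit `done`, if the challenge is issued now. -/
def chalStep {V : Type} (done ctrl : V) [DecidableEq V] (ρ : Op V) : Op V :=
  of fun b b' => if (b ctrl && !b done) = true ∧ (b' ctrl && !b' done) = true
    then ρ b b' else 0

/-- The state of the register if the challenge is not issued now. -/
def idleStep {V : Type} (done ctrl : V) (ρ : Op V) : Op V :=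
  of fun b b' => if (b ctrl && !b done) = false ∧ (b' ctrl && !b' done) = false
    then ρ b b' else 0

def flipBit {V : Type} [DecidableEq V] (w : V) (ρ : Op V) : Op V :=
  pull (fun b => update b w (!b w)) ρ

lemma CtrlImpl.chal {s : ℕ} {G : Θ → (Z → Op V) → Z → Op V} (h : CtrlImpl O s G) (done ctrl : V)
    (hne : ctrl ≠ done) : Impl O (s + 3) fun θ ρ z => idleStep done ctrl (ρ z) +
    flipBit done (G θ (fun z => chalStep done ctrl (ρ z)) z) := by
  obtain ⟨C, hC, hG⟩ := h
  have h1 : Circ O 2 fun _ (ρ : Op V) => pull (fun b => update b (inl ())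
      (xor (b (inl ())) (b (inr ctrl) && !b (inr done))))
        (place (Embedding.inr : V ↪ Unit ⊕ V) ρ) :=
    ((Circ.place (O := O) (Embedding.inr : V ↪ Unit ⊕ V)).weaken (s' := 1) (by simp)).comp
      (Circ.andNot _ _ _ (by simpa using hne) (by simp) (by simp))
  have h3 : Circ O 1 fun _ (σ : Op (Unit ⊕ V)) =>
      keepWires (Embedding.inr : V ↪ Unit ⊕ V) (pull (fun b => update b
        (inr done) (xor (b (inr done)) (b (inl ())))) σ) :=
    (Circ.cnot (O := O) (inl ()) (inr done) (by simp)).comp (Circ.keep _)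
  have h2 := (Impl.comp h1 hC).comp h3
  refine Impl.weaken (s := 2 + s + 1) (by omega) ?_
  convert h2 using 1
  funext θ ρ z
  have hb : ∀ (v : Bool) (ρ : Op V), blk v (pull (fun b => update b (inl ())
      (xor (b (inl ())) (b (inr ctrl) && !b (inr done))))
        (place (Embedding.inr : V ↪ Unit ⊕ V) ρ))
      = if v = true then chalStep done ctrl ρ else idleStep done ctrl ρ := by
    intro v ρ
    ext b b'
    simp only [blk, of_apply, pull, place_inr_apply]
    have hu : ∀ b : Cfg V, (update (elim (fun _ => v) b : Cfg (Unit ⊕ V)) (inl ())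
        (v ^^ (b ctrl && !b done))) ∘ inr = b := by
      intro b; funext j; exact update_of_ne (inr_ne_inl) _ _
    simp only [elim_inl, elim_inr, hu, update_self]
    have hx : ∀ b : Cfg V, (v ^^ (b ctrl && !b done)) = false ↔ (b ctrl && !b done) = v := by
      intro b; exact xor_eq_false_iff' _ _
    simp only [hx]
    cases v <;> simp [chalStep, idleStep]
  have hf : ∀ (v : Bool) (σ : Op (Unit ⊕ V)), blk v (pull (fun b => update b
        (inr done) (xor (b (inr done)) (b (inl ())))) σ) =
      if v = true then flipBit done (blk v σ) else blk v σ := by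
    intro v σ
    ext b b'
    have hu : ∀ b : Cfg V, update (elim (fun _ => v) b : Cfg (Unit ⊕ V))
        (inr done) (b done ^^ v) = elim (fun _ => v)
          (update b done (b done ^^ v)) := by
      intro b
      exact Sum.update_elim_inr
    cases v
    · simp [blk, pull]
    · simp only [blk, of_apply, pull, flipBit, elim_inr, elim_inl, hu, if_true]
      simp only [Bool.xor_true]
  beta_reduce
  rw [keepWires_inr_unit, hf, hf, hG, hG, if_neg (by simp), if_neg (by simp), if_pos rfl,
    if_pos rfl]
  simp only [hb, if_true]
  rfl

end Kernels

open scoped ComplexOrder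

section Positivity

variable {ι κ W : Type} [Fintype ι] [DecidableEq ι] [Fintype κ] [DecidableEq κ]
  [Fintype W] [DecidableEq W]

/-! ### Quantum channels -/

/-- Positive and trace-preserving maps. -/
structure IsChan (F : Op ι → Op κ) : Prop where
  pos : ∀ {ρ}, ρ.PosSemidef → (F ρ).PosSemidef
  tr : ∀ ρ, (F ρ).trace = ρ.trace

lemma IsChan.id : IsChan fun ρ : Op ι => ρ := ⟨fun h => h, fun _ => rfl⟩

lemma IsChan.comp {μ : Type} [Fintype μ] [DecidableEq μ] {F : Op ι → Op κ} {G : Op κ → Op μ}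
    (hF : IsChan F) (hG : IsChan G) : IsChan fun ρ => G (F ρ) :=
  ⟨fun h => hG.pos (hF.pos h), fun ρ => (hG.tr _).trans (hF.tr ρ)⟩

lemma posSemidef_conj {S T : Type} [Fintype S] [Fintype T] (L : Matrix S T ℂ)
    {ρ : Matrix T T ℂ} (h : ρ.PosSemidef) : (conj L ρ).PosSemidef :=
  h.mul_mul_conjTranspose_same L

lemma posSemidef_pureState (v : Cfg ι → ℂ) : (pureState v).PosSemidef :=
  posSemidef_vecMulVec_self_star v

lemma pureState_apply (v : Cfg ι → ℂ) (b b' : Cfg ι) : pureState v b b' = v b * star (v b') :=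
  rfl

lemma trace_pureState (v : Cfg ι → ℂ) : (pureState v).trace = ((∑ b, ‖v b‖ ^ 2 : ℝ) : ℂ) := by
  rw [trace, ofReal_sum]
  refine sum_congr rfl fun b _ => ?_
  rw [diag_apply, pureState_apply, Complex.star_def, Complex.mul_conj, Complex.normSq_eq_norm_sq]

lemma pureState_ket (a : Cfg ι) : pureState (ket a) = single a a 1 := by
  ext b b'
  rw [pureState_apply, ket, Pi.single_apply, Pi.single_apply, single_apply]
  by_cases h : b = a
  · subst h
    by_cases h' : b' = b
    · simp [h']
    · simp [h', Ne.symm h']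
  · simp [h, Ne.symm h]

lemma trace_keepWires (f : κ ↪ W) (σ : Op W) : (keepWires f σ).trace = σ.trace := by
  simp only [trace, diag_apply, keepWires_apply]
  rw [sum_comm]
  refine sum_congr rfl fun b _ => ?_
  rw [sum_eq_single (b ∘ f)]
  · simp
  · intro y _ hy
    exact if_neg fun h => hy h.symm
  · simp

lemma posSemidef_keepWires (f : κ ↪ W) {σ : Op W} (h : σ.PosSemidef) :
    (keepWires f σ).PosSemidef := by
  have : keepWires f σ = ∑ b : Cfg W, if b ∘ f = (fun _ => false) then
      σ.submatrix (fun y => splice f y b) (fun y => splice f y b) else 0 := by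
    ext y y'
    rw [keepWires_apply' f σ y y' fun _ => false, Matrix.sum_apply]
    refine sum_congr rfl fun b _ => ?_
    split_ifs <;> rfl
  rw [this]
  refine posSemidef_sum _ fun b _ => ?_
  split_ifs
  · exact h.submatrix _
  · exact PosSemidef.zero

lemma IsChan.keep (f : κ ↪ W) : IsChan (keepWires f) :=
  ⟨posSemidef_keepWires f, trace_keepWires f⟩

lemma keepWires_applyOn (f : ι ↪ W) (F : Op ι →ₗ[ℂ] Op ι) (ρ : Op W) :
    keepWires f (applyOn f F ρ) = F (keepWires f ρ) := by
  have h := applyZ_keepWires (Z := Unit) (Embedding.refl ι) f (F.compLeft Unit) fun _ => ρ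
  have h' := congrFun h ()
  have e : applyZ (Embedding.refl ι) (F.compLeft Unit) = fun (ρ : Unit → Op ι) z => F (ρ z) := by
    funext ρ z
    change applyZ (Embedding.refl ι) (fun ρ z => F (ρ z)) ρ z = _
    rw [applyZ_lift, applyOn_refl]
  rw [e] at h'
  have e2 : applyZ (Embedding.trans (Embedding.refl ι) f) (F.compLeft Unit)
      (fun _ => ρ) () = applyOn f F ρ := by
    change applyZ f (fun ρ z => F (ρ z)) (fun _ => ρ) () = _
    rw [applyZ_lift]
  rw [e2] at h'
  exact h'

lemma trace_applyOn (f : ι ↪ W) {F : Op ι → Op ι} (L : Op ι →ₗ[ℂ] Op ι) (hL : ∀ σ, F σ = L σ)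
    {c : ℂ} (h : ∀ σ, (F σ).trace = c * σ.trace) (ρ : Op W) :
    (applyOn f F ρ).trace = c * ρ.trace := by
  obtain rfl : F = L := funext hL
  rw [← trace_keepWires f, keepWires_applyOn, h, trace_keepWires]

lemma trace_conj_unitary {U : Op ι} (hU : U ∈ unitaryGroup (Cfg ι) ℂ) (ρ : Op ι) :
    (conj U ρ).trace = ρ.trace := by
  rw [conj, Matrix.mul_assoc, Matrix.trace_mul_comm, Matrix.mul_assoc]
  have := (Matrix.mem_unitaryGroup_iff').1 hU
  rw [star_eq_conjTranspose] at this
  rw [this, Matrix.mul_one]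

lemma IsChan.gate {N : ℕ} (g : Gate N) : IsChan g.apply where
  pos h := posSemidef_conj _ h
  tr ρ := by
    rw [Gate.apply, conj_onWires, trace_applyOn g.wires (F := conj g.mat) (conjLin g.mat) (c := 1)
        (fun _ => rfl),
      one_mul]
    intro σ
    rw [trace_conj_unitary g.unitary, one_mul]

lemma IsChan.place (f : ι ↪ W) : IsChan (QPK.place f) where
  pos h := posSemidef_conj _ h
  tr ρ := by
    have : keepWires f (QPK.place f ρ) = ρ := by
      have := keepWires_place (Embedding.refl ι) f ρ
      rwa [keepWires_refl] at this
    rw [← trace_keepWires f, this]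

lemma IsChan.run (A : QAlg ι κ) : IsChan A.run := by
  have hg : ∀ l : List (Gate A.wires), IsChan fun ρ => l.foldl (fun σ g => g.apply σ) ρ := by
    intro l
    induction l with
    | nil => exact .id
    | cons g l ih => exact (IsChan.gate g).comp ih
  exact ((IsChan.place A.inp).comp (hg A.gates)).comp (IsChan.keep A.out)

lemma PosSemidef.re_diag_nonneg {ρ : Op ι} (h : ρ.PosSemidef) (b : Cfg ι) : 0 ≤ (ρ b b).re :=
  (Complex.le_def.1 (h.diag_nonneg (i := b))).1

lemma PosSemidef.diag_eq_re {ρ : Op ι} (h : ρ.PosSemidef) (b : Cfg ι) :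
    ρ b b = ((ρ b b).re : ℂ) := by
  have := (Complex.le_def.1 (h.diag_nonneg (i := b))).2
  exact Complex.ext rfl this.symm

lemma trace_re (ρ : Op ι) : ρ.trace.re = ∑ b, (ρ b b).re := by
  rw [trace, re_sum]; rfl

/-! ### Output probabilities of circuits -/

def noOracle : Oracles Unit Unit where
  idx := Empty
  port := Empty.elim
  fin o := o.elim
  dec o := o.elim
  sem o := o.elim

lemma QAlg.run_eq_cchan (A : QAlg ι κ) (ρ : Op ι) : A.run ρ = cchan (coef A.run) ρ :=
  (Circ.run (O := noOracle) A).eq_cchan () ρ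

lemma QAlg.probPure_nonneg (A : QAlg ι κ) (v : Cfg ι → ℂ) (y : Cfg κ) : 0 ≤ A.probPure v y :=
  PosSemidef.re_diag_nonneg ((IsChan.run A).pos (posSemidef_pureState v)) y

lemma QAlg.sum_probPure (A : QAlg ι κ) (v : Cfg ι → ℂ) : ∑ y, A.probPure v y = ∑ b, ‖v b‖ ^ 2 := by
  have := congrArg Complex.re ((IsChan.run A).tr (pureState v))
  rwa [trace_re, trace_pureState, Complex.ofReal_re] at this

lemma QAlg.probPure_eq (A : QAlg ι κ) (v : Cfg ι → ℂ) (y : Cfg κ) :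
    (A.probPure v y : ℂ) = ∑ u, ∑ u', v u * star (v u') * A.coeff y u u' := by
  rw [QAlg.probPure, ← PosSemidef.diag_eq_re ((IsChan.run A).pos (posSemidef_pureState v)),
    QAlg.run_eq_cchan]
  rfl

lemma sum_norm_ket (a : Cfg ι) : ∑ b, ‖ket a b‖ ^ 2 = 1 := by
  rw [sum_eq_single a]
  · simp [ket]
  · intro b _ hb
    simp [ket, hb]
  · simp

lemma QAlg.prob_nonneg (A : QAlg ι κ) (a : Cfg ι) (y : Cfg κ) : 0 ≤ A.prob a y :=
  A.probPure_nonneg (ket a) y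

lemma QAlg.sum_prob (A : QAlg ι κ) (a : Cfg ι) : ∑ y, A.prob a y = 1 :=
  (A.sum_probPure (ket a)).trans (sum_norm_ket a)

lemma QAlg.prob_le_one (A : QAlg ι κ) (a : Cfg ι) (y : Cfg κ) : A.prob a y ≤ 1 := by
  rw [← A.sum_prob a]
  exact single_le_sum (fun y _ => A.prob_nonneg a y) (mem_univ y)

lemma QAlg.coef_eq_prob (A : QAlg ι κ) (a : Cfg ι) (y : Cfg κ) :
    coef A.run a a y y = (A.prob a y : ℂ) := by
  rw [QAlg.prob, ← PosSemidef.diag_eq_re ((IsChan.run A).pos (posSemidef_pureState _)),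
    pureState_ket]
  rfl

/-- The classical behaviour of a circuit. -/
lemma KCirc.prob {Θ Z : Type} [Nonempty Z] {O : Oracles Θ Z} (A : QAlg ι κ) :
    KCirc O (2 * card ι + A.size + 2 * card κ) fun _ a y => (A.prob a y : ℂ) :=
  (KCirc.measured (Circ.run A)).congr fun _ a y => (A.coef_eq_prob a y).symm

/-- The sum over all outcomes of the measurement coefficients. -/
lemma QAlg.sum_coeff (A : QAlg ι κ) (s s' : Cfg ι) :
    ∑ y, A.coeff y s s' = if s = s' then 1 else 0 := by
  have := (IsChan.run A).tr (single s s' 1)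
  rw [trace] at this
  refine Eq.trans this ?_
  by_cases h : s = s'
  · subst h; simp
  · simp [h]

/-! ### Wire-local forms of the elementary steps -/

lemma applyOn_sum {α : Type} (s : Finset α) (f : ι ↪ W) (F : α → Op ι → Op ι) (ρ : Op W) :
    applyOn f (fun σ => ∑ i ∈ s, F i σ) ρ = ∑ i ∈ s, applyOn f (F i) ρ := by
  ext b b'
  rw [Matrix.sum_apply, applyOn_apply, Matrix.sum_apply]
  rfl

lemma applyOn_smul (c : ℂ) (f : ι ↪ W) (F : Op ι → Op ι) (ρ : Op W) :
    applyOn f (fun σ => c • F σ) ρ = c • applyOn f F ρ := rfl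

lemma applyOn_congr {f : ι ↪ W} {F G : Op ι → Op ι} (h : ∀ σ, F σ = G σ) (ρ : Op W) :
    applyOn f F ρ = applyOn f G ρ := by
  rw [funext h]

lemma overwrite_eq (f : κ ↪ W) (φ : Cfg κ → ℂ) (ρ : Op W) :
    overwrite f φ ρ = applyOn f (fun σ => σ.trace • pureState φ) ρ := by
  rw [overwrite]
  simp only [conj_onWires]
  rw [← applyOn_sum]
  refine applyOn_congr (fun σ => ?_) ρ
  ext b b'
  rw [Matrix.sum_apply, Matrix.smul_apply, pureState_apply, trace, smul_eq_mul, sum_mul]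
  refine sum_congr rfl fun s _ => ?_
  rw [conj_apply, sum_eq_single s, sum_eq_single s]
  · simp; ring
  · intro t _ ht; simp [ht]
  · simp
  · intro t _ ht; simp [ht]
  · simp

/-- The kernel which leaves the first half of its input unchanged and replaces the second one. -/
def encKer (M : Cfg ι → Cfg κ → ℂ) (u b : Cfg (ι ⊕ κ)) : ℂ :=
  if u ∘ inl = b ∘ inl then M (b ∘ inl) (b ∘ inr) else 0

lemma kchan_encKer (M : Cfg ι → Cfg κ → ℂ) (σ : Op (ι ⊕ κ)) (b b' : Cfg (ι ⊕ κ)) : kchan (encKer M)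
    σ b b' = if b = b' then M (b ∘ inl) (b ∘ inr) * ∑ s, σ (elim (b ∘ inl) s) (elim (b ∘ inl) s)
    else 0 := by
  rw [kchan_apply]
  congr 1
  rw [sum_cfgSum, sum_eq_single (b ∘ inl), mul_sum]
  · refine sum_congr rfl fun s _ => ?_
    rw [encKer, elim_comp_inl, if_pos rfl, mul_comm]
  · intro a _ ha
    refine sum_eq_zero fun s _ => ?_
    rw [encKer, elim_comp_inl, if_neg ha, mul_zero]
  · simp

lemma sum_readWrite (M : Cfg ι → Cfg κ → ℂ) (f : ι ⊕ κ ↪ W) (ρ : Op W) :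
    ∑ a, ∑ c, M a c • readWrite f a (ket c) ρ = applyOn f (kchan (encKer M)) ρ := by
  simp only [readWrite, conj_onWires]
  simp only [← applyOn_sum, ← applyOn_smul]
  refine applyOn_congr (fun σ => ?_) ρ
  ext b b'
  rw [kchan_encKer]
  simp only [Matrix.sum_apply, Matrix.smul_apply, conj_apply, smul_eq_mul, of_apply]
  have h : ∀ (a : Cfg ι) (c s : Cfg κ), (∑ t : Cfg (ι ⊕ κ), ∑ t' : Cfg (ι ⊕ κ),
      (if b ∘ inl = a ∧ t ∘ inl = a ∧ t ∘ inr = s then ket c (b ∘ inr) else 0) *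
        σ t t' * star (if b' ∘ inl = a ∧ t' ∘ inl = a ∧ t' ∘ inr = s
          then ket c (b' ∘ inr) else 0)) =
      if b = elim a c ∧ b' = elim a c then σ (elim a s) (elim a s) else 0 := by
    intro a c s
    have e : ∀ t : Cfg (ι ⊕ κ), (t ∘ inl = a ∧ t ∘ inr = s) ↔ t = elim a s := by
      intro t
      rw [cfg_sum_ext_iff t]; rfl
    have e' : ∀ t : Cfg (ι ⊕ κ), t = elim a c ↔ (t ∘ inl = a ∧ t ∘ inr = c) := by
      intro t
      rw [cfg_sum_ext_iff t]; rfl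
    simp only [e, e']
    rw [sum_eq_single (elim a s), sum_eq_single (elim a s)]
    · by_cases h1 : b ∘ inl = a <;> by_cases h2 : b' ∘ inl = a <;>
        by_cases h3 : b ∘ inr = c <;> by_cases h4 : b' ∘ inr = c <;>
        simp [h1, h2, h3, h4, ket]
    · intro t _ ht; simp [ht]
    · simp
    · intro t _ ht; simp [ht]
    · simp
  simp only [h]
  by_cases hb : b = b'
  · subst hb
    rw [if_pos rfl, sum_eq_single (b ∘ inl), sum_eq_single (b ∘ inr)]
    · simp [elim_comp_inl_inr]
    · intro c _ hc
      have : b ≠ elim (b ∘ inl) c := by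
        intro h
        apply hc
        conv_rhs => rw [h]
        rfl
      simp [this]
    · simp
    · intro a _ ha
      have : ∀ c, b ≠ elim a c := by
        intro c h
        apply ha
        conv_rhs => rw [h]
        rfl
      simp [this]
    · simp
  · rw [if_neg hb]
    refine sum_eq_zero fun a _ => sum_eq_zero fun c _ => ?_
    rw [sum_eq_zero, mul_zero]
    intro s _
    rw [if_neg]
    rintro ⟨h1, h2⟩
    exact hb (h1.trans h2.symm)

/-- The superposition query on its own register. -/
def sqChan (φ : Cfg ι → Cfg κ → ℂ) (σ : Op (ι ⊕ κ)) : Op (ι ⊕ κ) :=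
  of fun b b' => φ (b ∘ inl) (b ∘ inr) * star (φ (b' ∘ inl) (b' ∘ inr)) *
    ∑ s, σ (elim (b ∘ inl) s) (elim (b' ∘ inl) s)

lemma superQuery_eq (f : ι ⊕ κ ↪ W) (φ : Cfg ι → Cfg κ → ℂ) (ρ : Op W) :
    superQuery f φ ρ = applyOn f (sqChan φ) ρ := by
  simp only [superQuery, conj_onWires]
  rw [← applyOn_sum]
  refine applyOn_congr (fun σ => ?_) ρ
  ext b b'
  simp only [Matrix.sum_apply, conj_apply, of_apply, sqChan, mul_sum]
  refine sum_congr rfl fun s _ => ?_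
  have e : ∀ b t : Cfg (ι ⊕ κ), (b ∘ inl = t ∘ inl ∧ t ∘ inr = s) ↔ t = elim (b ∘ inl) s := by
    intro b t
    rw [cfg_sum_ext_iff t, eq_comm]; rfl
  simp only [e]
  rw [sum_eq_single (elim (b ∘ inl) s), sum_eq_single (elim (b' ∘ inl) s)]
  · simp; ring
  · intro t _ ht; simp [ht]
  · simp
  · intro t _ ht; simp [ht]
  · simp

/-- The superposition query, as a linear map. -/
def sqLin (φ : Cfg ι → Cfg κ → ℂ) : Op (ι ⊕ κ) →ₗ[ℂ] Op (ι ⊕ κ) where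
  toFun := sqChan φ
  map_add' ρ σ := by
    ext b b'
    simp only [sqChan, of_apply, Matrix.add_apply, sum_add_distrib, mul_add]
  map_smul' c ρ := by
    ext b b'
    simp only [sqChan, of_apply, Matrix.smul_apply, smul_eq_mul, RingHom.id_apply, mul_sum]
    refine sum_congr rfl fun s _ => by ring

lemma trace_sqChan (φ : Cfg ι → Cfg κ → ℂ) (h : ∀ x, ∑ b, ‖φ x b‖ ^ 2 = 1) (σ : Op (ι ⊕ κ)) :
    (sqChan φ σ).trace = σ.trace := by
  simp only [trace, diag_apply, sqChan, of_apply]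
  rw [sum_cfgSum, sum_cfgSum]
  refine sum_congr rfl fun a _ => ?_
  simp only [elim_comp_inl, elim_comp_inr]
  rw [← sum_mul]
  have h2 : ∑ c, φ a c * star (φ a c) = 1 := by
    have := trace_pureState (φ a)
    rw [h, trace] at this
    simpa [pureState_apply] using this
  rw [h2, one_mul]

lemma IsChan.superQuery (f : ι ⊕ κ ↪ W) (φ : Cfg ι → Cfg κ → ℂ)
    (h : ∀ x, ∑ b, ‖φ x b‖ ^ 2 = 1) : IsChan (QPK.superQuery f φ) where
  pos hρ := by
    exact posSemidef_sum _ fun s _ => posSemidef_conj _ hρ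
  tr ρ := by
    rw [superQuery_eq, trace_applyOn f (F := sqChan φ) (sqLin φ) (fun _ => rfl) (c := 1), one_mul]
    intro σ
    rw [trace_sqChan φ h, one_mul]

end Positivity

lemma IsChan.prFinal {d n : ℕ} (A : PRAdv d n) (φ : Amps d n)
    (h : ∀ x, ∑ b, ‖φ x b‖ ^ 2 = 1) : (A.final φ).PosSemidef ∧ (A.final φ).trace = 1 := by
  have : ∀ (l : List (PRInstr d n A.wires)) (ρ : Op (Fin A.wires)), ρ.PosSemidef → ρ.trace = 1 →
      (l.foldl (fun ρ i => match i with
        | .gate g => g.apply ρ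
        | .query f => QPK.superQuery f φ ρ) ρ).PosSemidef ∧
      (l.foldl (fun ρ i => match i with
        | .gate g => g.apply ρ
        | .query f => QPK.superQuery f φ ρ) ρ).trace = 1 := by
    intro l
    induction l with
    | nil => exact fun ρ h1 h2 => ⟨h1, h2⟩
    | cons i l ih =>
      intro ρ h1 h2
      cases i with
      | gate g => exact ih _ ((IsChan.gate g).pos h1) (((IsChan.gate g).tr _).trans h2)
      | query f =>
        exact ih _ ((IsChan.superQuery f φ h).pos h1) (((IsChan.superQuery f φ h).tr _).trans h2)
  refine this _ _ (posSemidef_pureState _) ?_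
  rw [zeroState, trace_pureState, sum_norm_ket]
  simp

lemma PRAdv.accept_mem {d n : ℕ} (A : PRAdv d n) (φ : Amps d n)
    (h : ∀ x, ∑ b, ‖φ x b‖ ^ 2 = 1) : 0 ≤ A.accept φ ∧ A.accept φ ≤ 1 := by
  obtain ⟨h1, h2⟩ := IsChan.prFinal A φ h
  have h3 : ∑ b, (A.final φ b b).re = 1 := by
    rw [← trace_re, h2, Complex.one_re]
  constructor
  · refine sum_nonneg fun b _ => ?_
    split_ifs
    · exact PosSemidef.re_diag_nonneg h1 b
    · exact le_rfl
  · rw [← h3]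
    refine sum_le_sum fun b _ => ?_
    split_ifs
    · exact le_rfl
    · exact PosSemidef.re_diag_nonneg h1 b

lemma PRFSPD.state_norm (P : PRFSPD) (lam : ℕ) (k : P.Seed lam)
    (x : P.Input lam) : ∑ b, ‖P.state lam k x b‖ ^ 2 = 1 := by
  have h := (IsChan.run (P.gen lam)).tr (pureState (ket (elim k x)))
  rw [P.gen_spec, pureState_ket] at h
  simp only [trace, diag_apply] at h
  rw [sum_cfgSum] at h
  have e : ∀ (a : Cfg (Fin (P.keyLen lam) ⊕ Fin (P.inLen lam))) (c : P.Output lam),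
      conj (of fun (b : Cfg ((Fin (P.keyLen lam) ⊕ Fin (P.inLen lam)) ⊕
        Fin (P.outLen lam))) a => if b ∘ inl = a then
        P.state lam (a ∘ inl) (a ∘ inr) (b ∘ inr) else 0)
        (single (elim k x) (elim k x) 1) (elim a c) (elim a c) =
      if a = elim k x then ((‖P.state lam k x c‖ ^ 2 : ℝ) : ℂ) else 0 := by
    intro a c
    rw [conj_apply, sum_eq_single (elim k x), sum_eq_single (elim k x)]
    · simp only [of_apply, elim_comp_inl, elim_comp_inr, single_apply_same]
      by_cases h : a = elim k x
      · subst h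
        simp only [if_true, mul_one]
        rw [Complex.star_def, Complex.mul_conj, Complex.normSq_eq_norm_sq]
      · simp [h]
    · intro t _ ht; simp [ht.symm]
    · simp
    · intro t _ ht; simp [ht.symm]
    · simp
  simp only [e] at h
  rw [sum_eq_single (elim k x)] at h
  · simp only [if_true] at h
    rw [sum_eq_single (elim k x), single_apply_same, ← ofReal_sum] at h
    · exact_mod_cast h
    · intro t _ ht; simp [ht.symm]
    · simp
  · intro t _ ht; simp [ht]
  · simp

/-! ### Asymptotics -/

lemma PolyBounded.of_le {f g : ℕ → ℕ} (hg : PolyBounded g) (h : ∀ n, f n ≤ g n) :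
    PolyBounded f := by
  obtain ⟨p, hp⟩ := hg
  exact ⟨p, fun n => (h n).trans (hp n)⟩

lemma PolyBounded.const (c : ℕ) : PolyBounded fun _ => c :=
  ⟨Polynomial.C c, fun _ => by simp⟩

lemma PolyBounded.poly (p : Polynomial ℕ) : PolyBounded fun n => p.eval n := ⟨p, fun _ => le_rfl⟩

lemma PolyBounded.add {f g : ℕ → ℕ} (hf : PolyBounded f) (hg : PolyBounded g) :
    PolyBounded fun n => f n + g n := by
  obtain ⟨p, hp⟩ := hf
  obtain ⟨q, hq⟩ := hg
  exact ⟨p + q, fun n => by rw [Polynomial.eval_add]; exact add_le_add (hp n) (hq n)⟩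

lemma PolyBounded.mul {f g : ℕ → ℕ} (hf : PolyBounded f) (hg : PolyBounded g) :
    PolyBounded fun n => f n * g n := by
  obtain ⟨p, hp⟩ := hf
  obtain ⟨q, hq⟩ := hg
  exact ⟨p * q, fun n => by rw [Polynomial.eval_mul]; exact Nat.mul_le_mul (hp n) (hq n)⟩

lemma eval_mono (p : Polynomial ℕ) {a b : ℕ} (h : a ≤ b) : p.eval a ≤ p.eval b := by
  rw [Polynomial.eval_eq_sum, Polynomial.eval_eq_sum]
  exact sum_le_sum fun i _ => Nat.mul_le_mul le_rfl (Nat.pow_le_pow_left h i)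

/-- A polynomial evaluated at a polynomially bounded function. -/
lemma PolyBounded.comp (p : Polynomial ℕ) {f : ℕ → ℕ} (hf : PolyBounded f) :
    PolyBounded fun n => p.eval (f n) := by
  obtain ⟨q, hq⟩ := hf
  exact ⟨p.comp q, fun n => by rw [Polynomial.eval_comp]; exact eval_mono p (hq n)⟩

lemma Negligible.mono {f g : ℕ → ℝ} (hg : Negligible g) (h0 : ∀ n, 0 ≤ f n)
    (h : ∀ n, f n ≤ g n) : Negligible f :=
  SuperpolynomialDecay.trans_abs_le hg fun n => by
    rw [abs_of_nonneg (h0 n), abs_of_nonneg ((h0 n).trans (h n))]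
    exact h n

lemma Negligible.add {f g : ℕ → ℝ} (hf : Negligible f) (hg : Negligible g) :
    Negligible fun n => f n + g n := SuperpolynomialDecay.add hf hg

lemma Negligible.const_mul {f : ℕ → ℝ} (hf : Negligible f) (c : ℝ) :
    Negligible fun n => c * f n := SuperpolynomialDecay.const_mul hf c

lemma Negligible.poly_mul {f : ℕ → ℝ} (hf : Negligible f) (h0 : ∀ n, 0 ≤ f n) {g : ℕ → ℕ}
    (hg : PolyBounded g) : Negligible fun n => (g n : ℝ) * f n := by
  obtain ⟨p, hp⟩ := hg
  have h := SuperpolynomialDecay.polynomial_mul hf (p.map (Nat.castRingHom ℝ))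
  refine Negligible.mono h (fun n => mul_nonneg (Nat.cast_nonneg _) (h0 n)) fun n => ?_
  have : (p.map (Nat.castRingHom ℝ)).eval (n : ℝ) = ((p.eval n : ℕ) : ℝ) := by
    rw [Polynomial.eval_natCast_map]
    rfl
  simp only [this]
  exact mul_le_mul_of_nonneg_right (by exact_mod_cast hp n) (h0 n)

/-- A bound for every family of polynomial size gives a bound which is uniform in the members of
polynomial size. -/
lemma exists_uniform_bound {ι : ℕ → Type} (size : ∀ n, ι n → ℕ) (adv : ∀ n, ι n → ℝ) {B : ℝ}
    (hB : ∀ n i, adv n i ≤ B) (dflt : ∀ n, ι n) (hd : ∀ n, size n (dflt n) ≤ 1)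
    (h : ∀ A : ∀ n, ι n, PolyBounded (fun n => size n (A n)) →
      ∃ ε : ℕ → ℝ, Negligible ε ∧ ∀ n, adv n (A n) ≤ ε n) (p : Polynomial ℕ) :
    ∃ ε : ℕ → ℝ, Negligible ε ∧ (∀ n, 0 ≤ ε n) ∧ ∀ n i, size n i ≤ p.eval n → adv n i ≤ ε n := by
  classical
  have hex : ∀ n, ∃ i : ι n, size n i ≤ p.eval n + 1 ∧
      ∀ j, size n j ≤ p.eval n → adv n j ≤ 2 * max (adv n i) 0 := by
    intro n
    by_cases hn : ∃ j, size n j ≤ p.eval n ∧ 0 < adv n j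
    · obtain ⟨j, hj, hj0⟩ := hn
      have hbdd : BddAbove (adv n '' {i | size n i ≤ p.eval n}) := by
        refine ⟨B, ?_⟩
        rintro _ ⟨i, -, rfl⟩
        exact hB n i
      have hpos : 0 < sSup (adv n '' {i | size n i ≤ p.eval n}) :=
        hj0.trans_le (le_csSup hbdd ⟨j, hj, rfl⟩)
      obtain ⟨_, ⟨i, hi, rfl⟩, hlt⟩ := exists_lt_of_lt_csSup (Set.Nonempty.image _ ⟨j, hj⟩)
          (half_lt_self hpos)
      refine ⟨i, Nat.le_succ_of_le hi, fun k hk => ?_⟩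
      have h1 : adv n k ≤ sSup (adv n '' {i | size n i ≤ p.eval n}) := le_csSup hbdd ⟨k, hk, rfl⟩
      have h2 := le_max_left (adv n i) 0
      linarith
    · push Not at hn
      exact ⟨dflt n, (hd n).trans (Nat.le_add_left _ _), fun j hj =>
        (hn j hj).trans (by positivity)⟩
  choose A hA hA' using hex
  obtain ⟨ε, hε, hb⟩ := h A (((PolyBounded.poly p).add (.const 1)).of_le hA)
  refine ⟨fun n => 2 * |ε n|, ?_, fun n => by positivity, fun n i hi => (hA' n i hi).trans ?_⟩
  · exact Negligible.const_mul (SuperpolynomialDecay.trans_abs_le hε fun n => (abs_abs _).le) 2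
  · have := hb n
    have h2 : max (adv n (A n)) 0 ≤ |ε n| := max_le (this.trans (le_abs_self _)) (abs_nonneg _)
    linarith

lemma negligible_inv_sqrt {d : ℕ → ℕ} (h : (fun n : ℕ => Real.log n) =o[atTop] fun n => (d n : ℝ)) :
    Negligible fun n => (√(2 ^ d n))⁻¹ := by
  rw [Negligible, superpolynomialDecay_iff_isBigO _ tendsto_natCast_atTop_atTop]
  intro z
  refine IsBigO.of_bound 1 ?_
  have hc : 0 < Real.log 2 / 2 / (|(z : ℝ)| + 1) := by
    have := Real.log_pos (by norm_num : (1 : ℝ) < 2)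
    positivity
  filter_upwards [h.bound hc, eventually_ge_atTop 1] with n hn h1
  have hn0 : (0 : ℝ) < n := by exact_mod_cast h1
  have hlog : 0 ≤ Real.log n := Real.log_nonneg (by exact_mod_cast h1)
  rw [Real.norm_of_nonneg hlog, Real.norm_of_nonneg (Nat.cast_nonneg _)] at hn
  rw [one_mul, Real.norm_of_nonneg (by positivity), Real.norm_of_nonneg (by positivity)]
  have e1 : (√(2 ^ d n))⁻¹ = Real.exp (-(Real.log 2 / 2 * d n)) := by
    rw [Real.exp_neg, Real.sqrt_eq_rpow, Real.rpow_def_of_pos (by positivity), Real.log_pow]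
    congr 2
    ring
  have e2 : (n : ℝ) ^ z = Real.exp (Real.log n * z) := by
    rw [← Real.rpow_intCast, Real.rpow_def_of_pos hn0]
  rw [e1, e2, Real.exp_le_exp]
  have h3 : (|(z : ℝ)| + 1) * Real.log n ≤ Real.log 2 / 2 * d n := by
    have := mul_le_mul_of_nonneg_left hn (by positivity : 0 ≤ |(z : ℝ)| + 1)
    refine this.trans (le_of_eq ?_)
    field_simp
  have h4 := neg_abs_le (z : ℝ)
  nlinarith

/-! ### Averages -/

lemma card_cfg (w : ℕ) : (card (Cfg (Fin w)) : ℝ) = 2 ^ w := by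
  simp

lemma avg_const {w : ℕ} (c : ℝ) : avg (fun _ : Cfg (Fin w) => c) = c := by
  rw [avg, sum_const, card_univ, nsmul_eq_mul, card_cfg]
  field_simp

lemma avg_mono {w : ℕ} {f g : Cfg (Fin w) → ℝ} (h : ∀ k, f k ≤ g k) : avg f ≤ avg g :=
  div_le_div_of_nonneg_right (sum_le_sum fun k _ => h k) (by positivity)

lemma avg_add {w : ℕ} (f g : Cfg (Fin w) → ℝ) : avg (fun k => f k + g k) = avg f + avg g := by
  rw [avg, avg, avg, sum_add_distrib, add_div]

lemma avg_sub {w : ℕ} (f g : Cfg (Fin w) → ℝ) : avg (fun k => f k - g k) = avg f - avg g := by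
  rw [avg, avg, avg, sum_sub_distrib, sub_div]

lemma avg_sum {w : ℕ} {α : Type} (s : Finset α) (f : α → Cfg (Fin w) → ℝ) :
    avg (fun k => ∑ a ∈ s, f a k) = ∑ a ∈ s, avg (f a) := by
  simp only [avg]
  rw [sum_comm, sum_div]

lemma avg_mul_const {w : ℕ} (f : Cfg (Fin w) → ℝ) (c : ℝ) : avg (fun k => f k * c) = avg f * c := by
  simp only [avg]
  rw [← sum_mul, div_mul_eq_mul_div]

lemma avg_nonneg {w : ℕ} {f : Cfg (Fin w) → ℝ} (h : ∀ k, 0 ≤ f k) : 0 ≤ avg f :=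
  div_nonneg (sum_nonneg fun k _ => h k) (by positivity)

lemma eq_one_of_avg {w : ℕ} {f : Cfg (Fin w) → ℝ} (h : ∀ k, f k ≤ 1) (h' : avg f = 1)
    (k : Cfg (Fin w)) : f k = 1 := by
  have h1 : ∑ k, (1 - f k) = 0 := by
    have h2 := avg_sub (fun _ => 1) f
    rw [avg_const, h', sub_self, avg, div_eq_zero_iff] at h2
    exact h2.resolve_right (by positivity)
  have := (Finset.sum_eq_zero_iff_of_nonneg fun k _ => sub_nonneg.2 (h k)).1 h1 k
    (mem_univ k)
  linarith

/-! ### Haar-random states -/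

instance (n : ℕ) : IsProbabilityMeasure (haarState n) := by
  constructor
  have h1 : (volume : Measure (EuclideanSpace ℂ (Cfg (Fin n)))).toSphere Set.univ ≠ 0 := by
    rw [Ne, Measure.measure_univ_eq_zero]
    exact Measure.toSphere_ne_zero _
  rw [haarState, Measure.smul_apply, smul_eq_mul]
  exact ENNReal.inv_mul_cancel h1 (measure_ne_top _ _)

lemma norm_stateSphere {n : ℕ} (φ : StateSphere n) : ∑ b, ‖φ.1 b‖ ^ 2 = 1 := by
  have h := φ.2
  rw [mem_sphere_zero_iff_norm, EuclideanSpace.norm_eq, Real.sqrt_eq_one] at h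
  exact h

abbrev haarPi (d n : ℕ) : Measure (States d n) :=
  Measure.pi fun _ => haarState n

abbrev vecs {d n : ℕ} (φ : States d n) : Amps d n :=
  fun x s => (φ x).1 s

abbrev PRFSPD.haar (P : PRFSPD) (lam : ℕ) :
    Measure (P.Input lam → StateSphere (P.outLen lam)) := haarPi (P.inLen lam) (P.outLen lam)

/-- Distinguishers of size `s` have advantage at most `ε`. -/
def PRFSPD.HaarBound (P : PRFSPD) (lam s : ℕ) (ε : ℝ) : Prop :=
  ∀ A : PRAdv (P.inLen lam) (P.outLen lam), A.size ≤ s →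
    |avg (fun k => A.accept (P.state lam k)) - ∫ φ, A.accept (vecs φ) ∂P.haar lam| ≤ ε

lemma abs_integral_le_one {α : Type*} [MeasurableSpace α] (μ : Measure α)
    [IsProbabilityMeasure μ] {f : α → ℝ} (h : ∀ a, |f a| ≤ 1) : |∫ a, f a ∂μ| ≤ 1 := by
  have := norm_integral_le_of_norm_le_const (μ := μ) (f := f) (C := 1) (ae_of_all _ h)
  simpa using this

/-! ### Consequences of the security of a PRFSPD -/

namespace PRFSPD

variable {P : PRFSPD}

lemma Pseudorandom.uniform (h : P.Pseudorandom) (p : Polynomial ℕ) : ∃ ε : ℕ → ℝ, Negligible ε ∧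
    (∀ lam, 0 ≤ ε lam) ∧ ∀ lam (A : PRAdv (P.inLen lam) (P.outLen lam)), A.size ≤ p.eval lam →
    |avg (fun k => A.accept (P.state lam k)) - ∫ φ, A.accept (vecs φ) ∂P.haar lam| ≤ ε lam := by
  refine exists_uniform_bound (fun lam (A : PRAdv (P.inLen lam) (P.outLen lam)) => A.size)
    (fun lam A => |avg (fun k => A.accept (P.state lam k)) -
          ∫ φ, A.accept (vecs φ) ∂P.haar lam|) (B := 2) ?_
    (fun _ => ⟨1, [], 0⟩) (fun _ => le_rfl) h p
  intro lam A
  have h1 : |avg (fun k => A.accept (P.state lam k))| ≤ 1 := by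
    have h := fun k => A.accept_mem (P.state lam k) (P.state_norm lam k)
    rw [abs_le]
    constructor
    · linarith [avg_nonneg fun k => (h k).1]
    · exact (avg_mono fun k => (h k).2).trans (avg_const _).le
  have h2 : |∫ φ, A.accept (vecs φ) ∂P.haar lam| ≤ 1 := by
    refine abs_integral_le_one _ fun φ => ?_
    have h := A.accept_mem (vecs φ) fun x => norm_stateSphere (φ x)
    rw [abs_le]
    constructor <;> linarith [h.1, h.2]
  exact (abs_sub _ _).trans (by linarith)

lemma verProb_nonneg (lam : ℕ) (k : P.Seed lam) (x : P.Input lam)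
    (p : P.Proof lam) : 0 ≤ P.verProb lam k x p :=
  (P.ver lam).prob_nonneg _ _

lemma verProb_le_one (lam : ℕ) (k : P.Seed lam) (x : P.Input lam)
    (p : P.Proof lam) : P.verProb lam k x p ≤ 1 :=
  (P.ver lam).prob_le_one _ _

lemma Correct.sum_eq (h : P.Correct) (lam : ℕ) (k : P.Seed lam) (x : P.Input lam) : ∑ p,
    (P.destruct lam).probPure (P.state lam k x) p * P.verProb lam k x p = 1 := by
  refine eq_one_of_avg (fun k => ?_) (h lam x) k
  rw [← P.state_norm lam k x, ← (P.destruct lam).sum_probPure]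
  exact sum_le_sum fun p _ =>
    mul_le_of_le_one_right ((P.destruct lam).probPure_nonneg _ _) (verProb_le_one lam k x p)

end PRFSPD

lemma fakeProof_nonneg (P : PRFSPD) (lam : ℕ) (x : P.Input lam)
    (y : P.Proof lam) : 0 ≤ Construction.fakeProof P lam x y :=
  avg_nonneg fun _ => (P.destruct lam).probPure_nonneg _ _

lemma sum_fakeProof (P : PRFSPD) (lam : ℕ) (x : P.Input lam) :
    ∑ y, Construction.fakeProof P lam x y = 1 := by
  simp only [Construction.fakeProof]
  rw [← avg_sum]
  simp only [QAlg.sum_probPure, P.state_norm, avg_const]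

/-! ### The chosen-plaintext game with classical encryption kernels -/

/-- Classical encryption: `M ℓ m c` is the probability that `m` is encrypted to `c`. -/
abbrev Kernel (ct : ℕ → Type) : Type := ∀ ℓ, Cfg (Fin ℓ) → Cfg (ct ℓ) → ℝ

/-- The message which is encrypted when the challenge bit is `β`. -/
def sel {ℓ : ℕ} (β : Bool) (a : Cfg (Fin ℓ ⊕ Fin ℓ)) : Cfg (Fin ℓ) :=
  if β then a ∘ inr else a ∘ inl

section Game

variable {pk K : Type} {ct : ℕ → Type} [Fintype pk] [DecidableEq pk] [Fintype K] [DecidableEq K]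
  [∀ ℓ, Fintype (ct ℓ)] [∀ ℓ, DecidableEq (ct ℓ)] {N : ℕ}

/-- Measure the wires `f ∘ inl` and write a sample from the kernel on the wires `f ∘ inr`. -/
def kenc {ι κ : Type} [Fintype ι] [DecidableEq ι] [Fintype κ] [DecidableEq κ]
    (M : Cfg ι → Cfg κ → ℝ) (f : ι ⊕ κ ↪ Fin N) (ρ : Op (Fin N)) : Op (Fin N) :=
  ∑ a, ∑ c, (M a c : ℂ) • readWrite f a (ket c) ρ

/-- One step of the game on a pair of states, indexed by whether the challenge was issued. -/
def gstep (v : Cfg pk → ℂ) (M : Kernel ct) (β : Bool) :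
    CPAInstr pk ct N → (Bool → Op (Fin N)) → Bool → Op (Fin N)
  | .gate g, σ => fun z => g.apply (σ z)
  | .key out, σ => fun z => overwrite out v (σ z)
  | .enc ctrl ℓ f, σ => fun z =>
      branch ctrl false (σ z) + kenc (M ℓ) f (branch ctrl true (σ z))
  | .chal ctrl ℓ f, σ => fun z => if z = true
      then σ true + kenc (fun a => M ℓ (sel β a)) f (branch ctrl true (σ false))
      else branch ctrl false (σ false)

/-- The game, in which the `r`-th step uses the kernel `M r`. -/
def gexec (v : Cfg pk → ℂ) (β : Bool) :
    (ℕ → Kernel ct) → List (CPAInstr pk ct N) → (Bool → Op (Fin N)) → Bool → Op (Fin N)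
  | _, [], σ => σ
  | M, i :: l, σ => gexec v β (fun r => M (r + 1)) l (gstep v (M 0) β i σ)

/-- The probability that the wire `out` is measured to be `β`. -/
def gprob (out : Fin N) (β : Bool) (σ : Bool → Op (Fin N)) : ℝ :=
  ∑ z, ∑ b, if b out = β then (σ z b b).re else 0

/-- The initial state of the game. -/
def gzero (N : ℕ) : Bool → Op (Fin N) := Pi.single false (zeroState N)

/-- The winning probability in the game. -/
def gwin (A : CPAAdv pk ct) (v : Cfg pk → ℂ) (M : ℕ → Kernel ct) : ℝ :=
  (1 / 2) * ∑ β, gprob A.out β (gexec v β M A.prog (gzero A.wires))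

/-! ### Linearity -/

lemma IsLinearMap.conj {S T : Type} [Fintype S] [Fintype T] (L : Matrix S T ℂ) :
    IsLinearMap ℂ (QPK.conj L) := (conjLin L).isLinear

lemma IsLinearMap.sum' {E F : Type} [AddCommGroup E] [Module ℂ E] [AddCommGroup F] [Module ℂ F]
    {α : Type} (s : Finset α) {f : α → E → F} (h : ∀ a, IsLinearMap ℂ (f a)) :
    IsLinearMap ℂ fun x => ∑ a ∈ s, f a x :=
  ⟨fun x y => by simp only [(h _).map_add, sum_add_distrib],
    fun c x => by simp only [(h _).map_smul, smul_sum]⟩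

lemma IsLinearMap.smul' {E F : Type} [AddCommGroup E] [Module ℂ E] [AddCommGroup F] [Module ℂ F]
    (c : ℂ) {f : E → F} (h : IsLinearMap ℂ f) : IsLinearMap ℂ fun x => c • f x :=
  ⟨fun x y => by simp only [h.map_add, smul_add], fun c x => by rw [h.map_smul, smul_comm]⟩

lemma IsLinearMap.add' {E F : Type} [AddCommGroup E] [Module ℂ E] [AddCommGroup F] [Module ℂ F]
    {f g : E → F} (h : IsLinearMap ℂ f) (h' : IsLinearMap ℂ g) : IsLinearMap ℂ fun x => f x + g x :=
  ⟨fun x y => by simp only [h.map_add, h'.map_add]; abel,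
    fun c x => by simp only [h.map_smul, h'.map_smul, smul_add]⟩

lemma IsLinearMap.comp' {E F G : Type} [AddCommGroup E] [Module ℂ E] [AddCommGroup F] [Module ℂ F]
    [AddCommGroup G] [Module ℂ G] {f : E → F} {g : F → G} (h : IsLinearMap ℂ f)
    (h' : IsLinearMap ℂ g) : IsLinearMap ℂ fun x => g (f x) :=
  ⟨fun x y => by simp only [h.map_add, h'.map_add],
    fun c x => by simp only [h.map_smul, h'.map_smul]⟩

lemma isLinear_overwrite (out : pk ↪ Fin N) (v : Cfg pk → ℂ) :
    IsLinearMap ℂ (overwrite out v) := IsLinearMap.sum' _ fun _ => IsLinearMap.conj _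

lemma isLinear_readWrite {ι κ : Type} [Fintype ι] [DecidableEq ι] [Fintype κ] [DecidableEq κ]
    (f : ι ⊕ κ ↪ Fin N) (a : Cfg ι) (φ : Cfg κ → ℂ) : IsLinearMap ℂ (readWrite f a φ) :=
  IsLinearMap.sum' _ fun _ => IsLinearMap.conj _

lemma isLinear_kenc {ι κ : Type} [Fintype ι] [DecidableEq ι] [Fintype κ] [DecidableEq κ]
    (M : Cfg ι → Cfg κ → ℝ) (f : ι ⊕ κ ↪ Fin N) : IsLinearMap ℂ (kenc M f) :=
  IsLinearMap.sum' _ fun _ => IsLinearMap.sum' _ fun _ =>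
    IsLinearMap.smul' _ (isLinear_readWrite f _ _)

lemma isLinear_branch (w : Fin N) (v : Bool) : IsLinearMap ℂ (branch w v) := by
  constructor
  · intro ρ σ
    ext b b'
    simp only [branch, of_apply, Matrix.add_apply]
    split_ifs <;> simp
  · intro c ρ
    ext b b'
    simp only [branch, of_apply, Matrix.smul_apply]
    split_ifs <;> simp

lemma isLinear_gate (g : Gate N) : IsLinearMap ℂ g.apply := IsLinearMap.conj _

lemma isLinear_proj (z : Bool) : IsLinearMap ℂ fun σ : Bool → Op (Fin N) => σ z :=
  ⟨fun _ _ => rfl, fun _ _ => rfl⟩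

lemma isLinear_gstep (v : Cfg pk → ℂ) (M : Kernel ct) (β : Bool) (i : CPAInstr pk ct N) :
    IsLinearMap ℂ (gstep v M β i) := by
  suffices h : ∀ z, IsLinearMap ℂ fun σ => gstep v M β i σ z by
    exact ⟨fun σ τ => funext fun z => (h z).map_add σ τ,
      fun c σ => funext fun z => (h z).map_smul c σ⟩
  intro z
  cases i with
  | gate g => exact IsLinearMap.comp' (isLinear_proj z) (isLinear_gate g)
  | key out =>
    exact IsLinearMap.comp' (g := overwrite out v) (isLinear_proj z)
      (isLinear_overwrite out v)
  | enc ctrl ℓ f =>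
    exact IsLinearMap.add' (IsLinearMap.comp' (isLinear_proj z) (isLinear_branch ctrl false))
      (IsLinearMap.comp' (IsLinearMap.comp' (isLinear_proj z) (isLinear_branch ctrl true))
        (isLinear_kenc _ f))
  | chal ctrl ℓ f =>
    cases z
    · exact IsLinearMap.comp' (isLinear_proj false) (isLinear_branch ctrl false)
    · exact IsLinearMap.add' (isLinear_proj true)
        (IsLinearMap.comp' (IsLinearMap.comp' (isLinear_proj false) (isLinear_branch ctrl true))
          (isLinear_kenc _ f))

lemma isLinear_gexec (v : Cfg pk → ℂ) (β : Bool) (M : ℕ → Kernel ct)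
    (l : List (CPAInstr pk ct N)) : IsLinearMap ℂ (gexec v β M l) := by
  induction l generalizing M with
  | nil => exact ⟨fun _ _ => rfl, fun _ _ => rfl⟩
  | cons i l ih =>
    exact IsLinearMap.comp' (g := gexec v β (fun r => M (r + 1)) l) (isLinear_gstep v (M 0) β i)
      (ih _)

lemma gprob_add (out : Fin N) (β : Bool) (σ τ : Bool → Op (Fin N)) :
    gprob out β (σ + τ) = gprob out β σ + gprob out β τ := by
  simp only [gprob, ← sum_add_distrib]
  refine sum_congr rfl fun z _ => sum_congr rfl fun b _ => ?_
  split_ifs <;> simp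

lemma gprob_smul (out : Fin N) (β : Bool) (c : ℝ) (σ : Bool → Op (Fin N)) :
    gprob out β ((c : ℂ) • σ) = c * gprob out β σ := by
  simp only [gprob, mul_sum]
  refine sum_congr rfl fun z _ => sum_congr rfl fun b _ => ?_
  split_ifs <;> simp

lemma gprob_sum {α : Type} (s : Finset α) (out : Fin N) (β : Bool)
    (σ : α → Bool → Op (Fin N)) : gprob out β (∑ a ∈ s, σ a) = ∑ a ∈ s, gprob out β (σ a) := by
  classical
  induction s using induction_on with
  | empty => simp [gprob]
  | insert a s ha ih => rw [sum_insert ha, sum_insert ha, gprob_add, ih]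

/-! ### Reduction of the challenger's register to classical data -/

open CPAAdv in
/-- The state of the adversary's wires, weighted by a functional of the challenger's register. -/
def slice (Φ : Op K →ₗ[ℂ] ℂ) (σ : Joint K N) : Op (Fin N) :=
  of fun s s' => Φ (of fun k k' => σ (k, s) (k', s'))

lemma slice_onRight (Φ : Op K →ₗ[ℂ] ℂ) {F : Op (Fin N) → Op (Fin N)} (hF : IsLinearMap ℂ F)
    (σ : CPAAdv.Joint K N) : slice Φ (CPAAdv.onRight F σ) = F (slice Φ σ) := by
  obtain ⟨L, hL⟩ : ∃ L : Op (Fin N) →ₗ[ℂ] Op (Fin N), ∀ ρ, F ρ = L ρ := ⟨hF.mk' F, fun _ => rfl⟩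
  ext b b'
  simp only [slice, CPAAdv.onRight, of_apply, hL]
  rw [linear_apply]
  simp only [of_apply]
  have : (of fun k k' : Cfg K => L (of fun s s' => σ (k, s) (k', s')) b b') =
      ∑ u, ∑ u', L (single u u' 1) b b' • of fun k k' : Cfg K => σ (k, u) (k', u') := by
    ext k k'
    rw [of_apply, linear_apply]
    simp only [Matrix.sum_apply, Matrix.smul_apply, of_apply, smul_eq_mul]
    refine sum_congr rfl fun u _ => sum_congr rfl fun u' _ => by ring
  rw [this]
  simp only [map_sum, map_smul, smul_eq_mul]
  refine sum_congr rfl fun u _ => sum_congr rfl fun u' _ => by ring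

lemma slice_add (Φ : Op K →ₗ[ℂ] ℂ) (σ τ : CPAAdv.Joint K N) :
    slice Φ (σ + τ) = slice Φ σ + slice Φ τ := by
  ext b b'
  simp only [slice, of_apply, Matrix.add_apply]
  rw [← map_add]
  rfl

lemma slice_sum {α : Type} (s : Finset α) (Φ : Op K →ₗ[ℂ] ℂ) (σ : α → CPAAdv.Joint K N) :
    slice Φ (∑ a ∈ s, σ a) = ∑ a ∈ s, slice Φ (σ a) := by
  classical
  induction s using induction_on with
  | empty =>
    ext b b'
    simp only [slice, Finset.sum_empty, of_apply, Matrix.zero_apply]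
    exact map_zero Φ
  | insert a s ha ih => rw [sum_insert ha, sum_insert ha, slice_add, ih]

lemma slice_encStep (Φ : Op K →ₗ[ℂ] ℂ) {ℓ : ℕ} {ι : Type} [Fintype ι] [DecidableEq ι]
    (E : Cfg (Fin ℓ) → Cfg (ct ℓ) → Op K → Op K) (M : Cfg (Fin ℓ) → Cfg (ct ℓ) → ℝ)
    (h : ∀ m c ρ, Φ (E m c ρ) = M m c * Φ ρ) (s : Cfg ι → Cfg (Fin ℓ)) (f : ι ⊕ ct ℓ ↪ Fin N)
    (σ : CPAAdv.Joint K N) :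
    slice Φ (CPAAdv.encStep E s f σ) = kenc (fun a => M (s a)) f (slice Φ σ) := by
  rw [CPAAdv.encStep, slice_sum, kenc]
  refine sum_congr rfl fun a _ => ?_
  rw [slice_sum]
  refine sum_congr rfl fun c _ => ?_
  rw [← slice_onRight Φ (isLinear_readWrite f a (ket c))]
  ext b b'
  simp only [slice, CPAAdv.onLeft, of_apply, Matrix.smul_apply, smul_eq_mul]
  exact h _ _ _

lemma single_gstep (v : Cfg pk → ℂ) (M : Kernel ct) (β : Bool) (i : CPAInstr pk ct N)
    (done : Bool) (τ : Op (Fin N)) : gstep v M β i (Pi.single done τ) = match i with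
      | .gate g => Pi.single done (g.apply τ)
      | .key out => Pi.single done (overwrite out v τ)
      | .enc ctrl ℓ f => Pi.single done
          (branch ctrl false τ + kenc (M ℓ) f (branch ctrl true τ))
      | .chal ctrl ℓ f => if done = true then Pi.single true τ else
          Pi.single false (branch ctrl false τ) +
            Pi.single true (kenc (fun a => M ℓ (sel β a)) f (branch ctrl true τ)) := by
  funext z
  cases i with
  | gate g =>
    by_cases hz : z = done
    · subst hz; simp [gstep]
    · simp [gstep, hz, (isLinear_gate g).map_zero]
  | key out =>
    by_cases hz : z = done
    · subst hz; simp [gstep]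
    · simp [gstep, hz, (isLinear_overwrite out v).map_zero]
  | enc ctrl ℓ f =>
    by_cases hz : z = done
    · subst hz; simp [gstep]
    · simp [gstep, hz, (isLinear_branch ctrl _).map_zero, (isLinear_kenc (M ℓ) f).map_zero]
  | chal ctrl ℓ f =>
    cases done <;> cases z <;>
      simp [gstep, (isLinear_branch ctrl _).map_zero, (isLinear_kenc _ f).map_zero]

open CPAAdv in
lemma sum_exec_eq {R : Type} [Fintype R] (Φ : R → Op K →ₗ[ℂ] ℂ) (htr : ∀ ρ, ∑ r, Φ r ρ = ρ.trace)
    (v : Cfg pk → ℂ) (E : ∀ ℓ, Cfg (Fin ℓ) → Cfg (ct ℓ) → Op K → Op K) (M : R → Kernel ct)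
    (h : ∀ r ℓ m c ρ, Φ r (E ℓ m c ρ) = M r ℓ m c * Φ r ρ) (β : Bool) (out : Fin N)
    (l : List (CPAInstr pk ct N)) (done : Bool) (σ : Joint K N) :
    (∑ u : Cfg K × Cfg (Fin N), if u.2 out = β then (exec v E β l done σ u u).re else 0) = ∑ r,
    gprob out β (gexec v β (fun _ => M r) l (Pi.single done (slice (Φ r) σ))) := by
  induction l generalizing done σ with
  | nil =>
    have h0 : ∀ r, gprob out β (Pi.single done (slice (Φ r) σ)) =
        ∑ b, if b out = β then (slice (Φ r) σ b b).re else 0 := by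
      intro r
      rw [gprob, sum_eq_single done]
      · simp
      · intro z _ hz; simp [hz]
      · simp
    simp only [exec, gexec, h0]
    rw [Fintype.sum_prod_type_right, sum_comm (s := (univ : Finset R))]
    refine sum_congr rfl fun b _ => ?_
    by_cases hb : b out = β
    · simp only [hb, if_true]
      rw [← re_sum, ← re_sum]
      exact congrArg Complex.re (htr (of fun k k' => σ (k, b) (k', b))).symm
    · simp [hb]
  | cons i l ih =>
    simp only [gexec, single_gstep]
    cases i with
    | gate g =>
      simp only [exec]
      rw [ih]
      simp only [slice_onRight _ (isLinear_gate g)]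
    | key o =>
      simp only [exec]
      rw [ih]
      simp only [slice_onRight _ (isLinear_overwrite o v)]
    | enc ctrl ℓ f =>
      simp only [exec]
      rw [ih]
      simp only [slice_add, slice_onRight _ (isLinear_branch ctrl _)]
      refine sum_congr rfl fun r _ => ?_
      rw [slice_encStep (Φ r) (E ℓ) (M r ℓ) (h r ℓ), slice_onRight _ (isLinear_branch ctrl _)]
      rfl
    | chal ctrl ℓ f =>
      cases done
      · simp only [exec, Bool.false_eq_true, if_false]
        simp only [(isLinear_gexec v β _ l).map_add, gprob_add, sum_add_distrib]
        have e : ∀ (ρ τ : Joint K N), (∑ u : Cfg K × Cfg (Fin N), if u.2 out = β then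
            ((ρ + τ) u u).re else 0) = (∑ u : Cfg K × Cfg (Fin N), if u.2 out = β then
            (ρ u u).re else 0) + ∑ u : Cfg K × Cfg (Fin N), if u.2 out = β then
            (τ u u).re else 0 := by
          intro ρ τ
          rw [← sum_add_distrib]
          refine sum_congr rfl fun u _ => ?_
          split_ifs <;> simp
        rw [e, ih, ih]
        simp only [slice_onRight _ (isLinear_branch ctrl _)]
        congr 1
        refine sum_congr rfl fun r _ => ?_
        rw [slice_encStep (Φ r) (E ℓ) (M r ℓ) (h r ℓ), slice_onRight _ (isLinear_branch ctrl _)]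
        rfl
      · simp only [exec, if_true]
        exact ih true σ

lemma slice_initial (Φ : Op K →ₗ[ℂ] ℂ) (ρ₀ : Op K) (τ : Op (Fin N)) :
    slice Φ (of fun u u' : Cfg K × Cfg (Fin N) => ρ₀ u.1 u'.1 * τ u.2 u'.2) = Φ ρ₀ • τ := by
  ext b b'
  simp only [slice, of_apply, Matrix.smul_apply, smul_eq_mul]
  have : (of fun k k' => ρ₀ k k' * τ b b') = τ b b' • ρ₀ := by
    ext k k'
    simp [mul_comm]
  rw [this, map_smul, smul_eq_mul, mul_comm]

/-- If the challenger's register only matters through finitely many classical values, each of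
which determines an encryption kernel, then the winning probability is an average. -/
lemma CPAAdv.win_eq {R : Type} [Fintype R] (Φ : R → Op K →ₗ[ℂ] ℂ) (htr : ∀ ρ, ∑ r, Φ r ρ = ρ.trace)
    (A : CPAAdv pk ct) (v : Cfg pk → ℂ) (E : ∀ ℓ, Cfg (Fin ℓ) → Cfg (ct ℓ) → Op K → Op K)
    (M : R → Kernel ct) (h : ∀ r ℓ m c ρ, Φ r (E ℓ m c ρ) = M r ℓ m c * Φ r ρ) (ρ₀ : Op K)
    (w : R → ℝ) (hw : ∀ r, Φ r ρ₀ = w r) : A.win v E ρ₀ = ∑ r, w r * gwin A v fun _ => M r := by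
  simp only [CPAAdv.win, gwin]
  simp only [sum_exec_eq Φ htr v E M h, slice_initial, hw, Pi.single_smul, (isLinear_gexec v _ _
      _).map_smul, gprob_smul]
  rw [sum_comm, mul_sum]
  refine sum_congr rfl fun r _ => ?_
  rw [← mul_sum]
  simp only [gzero]
  ring

/-- The game with a stateless challenger. -/
lemma CPAAdv.win_empty (A : CPAAdv pk ct) (v : Cfg pk → ℂ) (M : Kernel ct) :
    A.win (K := Empty) v (fun ℓ m c ρ => (M ℓ m c : ℂ) • ρ) 1 = gwin A v fun _ => M := by
  have h := CPAAdv.win_eq (K := Empty) (R := Unit) (fun _ => Matrix.traceLinearMap (Cfg Empty) ℂ ℂ)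
    (fun ρ => by simp) A v (fun ℓ m c ρ => (M ℓ m c : ℂ) • ρ) (fun _ => M)
    (fun r ℓ m c ρ => by simp) 1 (fun _ => 1) (fun _ => by simp)
  simpa using h

end Game

/-- Every message is encrypted to a probability distribution. -/
def IsProbKernel {ct : ℕ → Type} [∀ ℓ, Fintype (ct ℓ)] [∀ ℓ, DecidableEq (ct ℓ)]
    (M : Kernel ct) : Prop :=
  ∀ ℓ m, (∀ c, 0 ≤ M ℓ m c) ∧ ∑ c, M ℓ m c = 1

section GameBounds

variable {pk : Type} {ct : ℕ → Type} [Fintype pk] [DecidableEq pk]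
  [∀ ℓ, Fintype (ct ℓ)] [∀ ℓ, DecidableEq (ct ℓ)] {N : ℕ}

/-! ### Positivity and normalisation of the game -/

lemma posSemidef_branch (w : Fin N) (v : Bool) {ρ : Op (Fin N)} (h : ρ.PosSemidef) :
    (branch w v ρ).PosSemidef := by
  have : branch w v ρ = conj (Matrix.diagonal fun b : Cfg (Fin N) =>
      if b w = v then (1 : ℂ) else 0) ρ := by
    ext b b'
    rw [conj, diagonal_conjTranspose, mul_diagonal, diagonal_mul, branch, of_apply]
    by_cases h1 : b w = v <;> by_cases h2 : b' w = v <;> simp [h1, h2]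
  rw [this]
  exact posSemidef_conj _ h

lemma trace_branch (w : Fin N) (ρ : Op (Fin N)) :
    (branch w false ρ).trace + (branch w true ρ).trace = ρ.trace := by
  simp only [trace, diag_apply, ← sum_add_distrib]
  refine sum_congr rfl fun b _ => ?_
  simp only [branch, of_apply]
  cases b w <;> simp

lemma isLinear_kchan {ι κ : Type} [Fintype ι] [DecidableEq ι] [Fintype κ] [DecidableEq κ]
    (M : Cfg ι → Cfg κ → ℂ) : IsLinearMap ℂ (kchan M) := by
  constructor
  · intro ρ σ
    ext b b'
    simp only [kchan_apply, Matrix.add_apply]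
    split_ifs
    · simp only [add_mul, sum_add_distrib]
    · simp
  · intro c ρ
    ext b b'
    simp only [kchan_apply, Matrix.smul_apply, smul_eq_mul]
    split_ifs
    · rw [mul_sum]
      exact sum_congr rfl fun a _ => by ring
    · simp

lemma trace_kchan {ι κ : Type} [Fintype ι] [DecidableEq ι] [Fintype κ] [DecidableEq κ]
    {M : Cfg ι → Cfg κ → ℂ} (h : ∀ a, ∑ y, M a y = 1) (ρ : Op ι) : (kchan M ρ).trace = ρ.trace := by
  simp only [trace, diag_apply, kchan_apply, if_true]
  rw [sum_comm]
  simp only [← mul_sum, h, mul_one]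

lemma sum_encKer {ι κ : Type} [Fintype ι] [DecidableEq ι] [Fintype κ] [DecidableEq κ]
    {M : Cfg ι → Cfg κ → ℂ} (h : ∀ a, ∑ c, M a c = 1) (u : Cfg (ι ⊕ κ)) :
    ∑ b, encKer M u b = 1 := by
  rw [sum_cfgSum, sum_eq_single (u ∘ inl)]
  · simp only [encKer, elim_comp_inl, if_true, elim_comp_inr, h]
  · intro a _ ha
    refine sum_eq_zero fun c _ => ?_
    rw [encKer, if_neg]
    exact fun h => ha h.symm
  · simp

lemma kenc_eq {ι κ : Type} [Fintype ι] [DecidableEq ι] [Fintype κ] [DecidableEq κ]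
    (M : Cfg ι → Cfg κ → ℝ) (f : ι ⊕ κ ↪ Fin N) (ρ : Op (Fin N)) :
    kenc M f ρ = applyOn f (kchan (encKer fun a c => (M a c : ℂ))) ρ :=
  sum_readWrite (fun a c => (M a c : ℂ)) f ρ

lemma IsChan.kenc {ι κ : Type} [Fintype ι] [DecidableEq ι] [Fintype κ] [DecidableEq κ]
    {M : Cfg ι → Cfg κ → ℝ} (h0 : ∀ a c, 0 ≤ M a c) (h1 : ∀ a, ∑ c, M a c = 1)
    (f : ι ⊕ κ ↪ Fin N) : IsChan (QPK.kenc M f) where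
  pos h := by
    refine posSemidef_sum _ fun a _ => posSemidef_sum _ fun c _ => ?_
    refine PosSemidef.smul ?_ (by exact_mod_cast h0 a c)
    exact posSemidef_sum _ fun s _ => posSemidef_conj _ h
  tr ρ := by
    rw [kenc_eq, trace_applyOn f (F := kchan _) ((isLinear_kchan _).mk' _) (fun _ => rfl) (c := 1),
      one_mul]
    intro σ
    rw [trace_kchan, one_mul]
    refine sum_encKer fun a => ?_
    exact_mod_cast h1 a

lemma posSemidef_overwrite (out : pk ↪ Fin N) (v : Cfg pk → ℂ) {ρ : Op (Fin N)}
    (h : ρ.PosSemidef) : (overwrite out v ρ).PosSemidef :=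
  posSemidef_sum _ fun _ _ => posSemidef_conj _ h

lemma trace_overwrite (out : pk ↪ Fin N) (v : Cfg pk → ℂ) (ρ : Op (Fin N)) :
    (overwrite out v ρ).trace = ((∑ b, ‖v b‖ ^ 2 : ℝ) : ℂ) * ρ.trace := by
  rw [overwrite_eq]
  refine trace_applyOn out (F := fun σ => σ.trace • pureState v) ((LinearMap.toSpanSingleton ℂ _
      (pureState v)).comp
    (Matrix.traceLinearMap (Cfg pk) ℂ ℂ)) (fun _ => rfl) (fun σ => ?_) ρ
  rw [trace_smul, trace_pureState, smul_eq_mul, mul_comm]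

/-- The total probability of a pair of states. -/
def gtr (σ : Bool → Op (Fin N)) : ℝ := ∑ z, (σ z).trace.re

lemma gstep_pos (v : Cfg pk → ℂ) {M : Kernel ct} (hM : IsProbKernel M) (β : Bool)
    (i : CPAInstr pk ct N) {σ : Bool → Op (Fin N)} (h : ∀ z, (σ z).PosSemidef) (z : Bool) :
    (gstep v M β i σ z).PosSemidef := by
  cases i with
  | gate g => exact (IsChan.gate g).pos (h z)
  | key out => exact posSemidef_overwrite out v (h z)
  | enc ctrl ℓ f =>
    exact (posSemidef_branch ctrl false (h z)).add
      ((IsChan.kenc (fun m c => (hM ℓ m).1 c) (fun m => (hM ℓ m).2) f).pos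
        (posSemidef_branch ctrl true (h z)))
  | chal ctrl ℓ f =>
    cases z
    · exact posSemidef_branch ctrl false (h false)
    · exact (h true).add ((IsChan.kenc (M := fun a => M ℓ (sel β a)) (fun a c => (hM ℓ (sel β a)).1
        c)
        (fun a => (hM ℓ (sel β a)).2) f).pos
        (posSemidef_branch ctrl true (h false)))

lemma gstep_tr {v : Cfg pk → ℂ} (hv : ∑ b, ‖v b‖ ^ 2 = 1) {M : Kernel ct} (hM : IsProbKernel M)
    (β : Bool) (i : CPAInstr pk ct N) (σ : Bool → Op (Fin N)) : gtr (gstep v M β i σ) = gtr σ := by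
  cases i with
  | gate g => simp only [gtr, gstep, (IsChan.gate g).tr]
  | key out => simp only [gtr, gstep, trace_overwrite, hv, Complex.ofReal_one, one_mul]
  | enc ctrl ℓ f =>
    simp only [gtr, gstep, trace_add,
      (IsChan.kenc (fun m c => (hM ℓ m).1 c) (fun m => (hM ℓ m).2) f).tr, trace_branch]
  | chal ctrl ℓ f =>
    have h := trace_branch ctrl (σ false)
    simp only [gtr, gstep, sum_bool, if_true, Bool.false_eq_true, if_false, trace_add,
      (IsChan.kenc (fun m c => (hM ℓ (sel β m)).1 c) (fun m => (hM ℓ (sel β m)).2) f).tr, ← h,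
      Complex.add_re]
    ring

lemma gexec_pos (v : Cfg pk → ℂ) {M : ℕ → Kernel ct} (hM : ∀ r, IsProbKernel (M r)) (β : Bool)
    (l : List (CPAInstr pk ct N)) {σ : Bool → Op (Fin N)} (h : ∀ z, (σ z).PosSemidef) (z : Bool) :
    (gexec v β M l σ z).PosSemidef := by
  induction l generalizing M σ with
  | nil => exact h z
  | cons i l ih => exact ih (fun r => hM (r + 1)) (gstep_pos v (hM 0) β i h)

lemma gexec_tr {v : Cfg pk → ℂ} (hv : ∑ b, ‖v b‖ ^ 2 = 1) {M : ℕ → Kernel ct}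
    (hM : ∀ r, IsProbKernel (M r)) (β : Bool) (l : List (CPAInstr pk ct N))
    (σ : Bool → Op (Fin N)) : gtr (gexec v β M l σ) = gtr σ := by
  induction l generalizing M σ with
  | nil => rfl
  | cons i l ih => exact (ih (fun r => hM (r + 1)) _).trans (gstep_tr hv (hM 0) β i σ)

lemma gprob_nonneg (out : Fin N) (β : Bool) {σ : Bool → Op (Fin N)}
    (h : ∀ z, (σ z).PosSemidef) : 0 ≤ gprob out β σ := by
  refine sum_nonneg fun z _ => sum_nonneg fun b _ => ?_
  split_ifs
  · exact PosSemidef.re_diag_nonneg (h z) b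
  · exact le_rfl

lemma sum_gprob (out : Fin N) (σ : Bool → Op (Fin N)) : ∑ β, gprob out β σ = gtr σ := by
  simp only [gprob, gtr, trace_re]
  rw [sum_comm]
  refine sum_congr rfl fun z _ => ?_
  rw [sum_comm]
  refine sum_congr rfl fun b _ => ?_
  simp

lemma gprob_le_gtr (out : Fin N) (β : Bool) {σ : Bool → Op (Fin N)}
    (h : ∀ z, (σ z).PosSemidef) : gprob out β σ ≤ gtr σ := by
  rw [← sum_gprob out σ]
  exact single_le_sum (fun β _ => gprob_nonneg out β h) (mem_univ β)

lemma gzero_pos (z : Bool) : (gzero N z).PosSemidef := by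
  cases z
  · exact posSemidef_pureState _
  · exact PosSemidef.zero

lemma gtr_gzero : gtr (gzero N) = 1 := by
  simp [gtr, gzero, zeroState, trace_pureState, sum_norm_ket]

lemma gwin_nonneg (A : CPAAdv pk ct) (v : Cfg pk → ℂ) {M : ℕ → Kernel ct}
    (hM : ∀ r, IsProbKernel (M r)) : 0 ≤ gwin A v M :=
  mul_nonneg (by norm_num) (sum_nonneg fun β _ =>
    gprob_nonneg _ _ (gexec_pos v hM β _ gzero_pos))

lemma gwin_le_one (A : CPAAdv pk ct) {v : Cfg pk → ℂ} (hv : ∑ b, ‖v b‖ ^ 2 = 1)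
    {M : ℕ → Kernel ct} (hM : ∀ r, IsProbKernel (M r)) : gwin A v M ≤ 1 := by
  have h : ∀ β, gprob A.out β (gexec v β M A.prog (gzero A.wires)) ≤ 1 := fun β => by
    refine (gprob_le_gtr _ _ (gexec_pos v hM β _ gzero_pos)).trans ?_
    rw [gexec_tr hv hM, gtr_gzero]
  rw [gwin, sum_bool]
  linarith [h true, h false]

/-! ### Dependence on the public key -/

lemma pureState_sub (v v' : Cfg pk → ℂ) {t : ℝ} (ht : 0 < t) :
    pureState v - pureState v' = ((1 / (4 * t) : ℝ) : ℂ) •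
      (pureState (fun b => (v b + v' b) + t * (v b - v' b)) -
        pureState fun b => (v b + v' b) - t * (v b - v' b)) := by
  ext b b'
  have hs : star (t : ℂ) = t := Complex.conj_ofReal t
  have ht' : (t : ℂ) ≠ 0 := by exact_mod_cast ht.ne'
  simp only [Matrix.sub_apply, Matrix.smul_apply, pureState_apply, smul_eq_mul, star_add, star_sub,
    star_mul', hs]
  push_cast
  field_simp
  ring

lemma norm_sq_comb_le (a b : ℂ) : ‖a + b‖ ^ 2 ≤ 2 * ‖a‖ ^ 2 + 2 * ‖b‖ ^ 2 := by
  have := norm_add_le a b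
  nlinarith [norm_nonneg a, norm_nonneg b, norm_nonneg (a + b), sq_nonneg (‖a‖ - ‖b‖)]

lemma sum_norm_comb_le {v v' : Cfg pk → ℂ} (hv : ∑ b, ‖v b‖ ^ 2 = 1)
    (hv' : ∑ b, ‖v' b‖ ^ 2 = 1) {t : ℝ} (h : t ^ 2 * ∑ b, ‖v b - v' b‖ ^ 2 ≤ 4) {s : ℂ}
    (hs : ‖s‖ ≤ t) : ∑ b, ‖(v b + v' b) + s * (v b - v' b)‖ ^ 2 ≤ 16 := by
  calc ∑ b, ‖(v b + v' b) + s * (v b - v' b)‖ ^ 2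
      ≤ ∑ b, (4 * ‖v b‖ ^ 2 + 4 * ‖v' b‖ ^ 2 + 2 * (t ^ 2 * ‖v b - v' b‖ ^ 2)) := by
        refine sum_le_sum fun b _ => ?_
        have h1 := norm_sq_comb_le (v b + v' b) (s * (v b - v' b))
        have h2 := norm_sq_comb_le (v b) (v' b)
        have h3 : ‖s * (v b - v' b)‖ ^ 2 ≤ t ^ 2 * ‖v b - v' b‖ ^ 2 := by
          rw [norm_mul, mul_pow]
          gcongr
        linarith
    _ = 8 + 2 * (t ^ 2 * ∑ b, ‖v b - v' b‖ ^ 2) := by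
        rw [sum_add_distrib, sum_add_distrib, ← mul_sum, ← mul_sum, ← mul_sum, ← mul_sum, hv, hv']
        norm_num
    _ ≤ 16 := by linarith

lemma overwrite_sub (out : pk ↪ Fin N) (v v' : Cfg pk → ℂ) {t : ℝ} (ht : 0 < t)
    (ρ : Op (Fin N)) : overwrite out v ρ = overwrite out v' ρ + ((1 / (4 * t) : ℝ) : ℂ) •
      (overwrite out (fun b => (v b + v' b) + t * (v b - v' b)) ρ -
        overwrite out (fun b => (v b + v' b) - t * (v b - v' b)) ρ) := by
  simp only [overwrite_eq]
  ext b b'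
  have h := congrFun (congrFun (pureState_sub v v' ht) (b ∘ out)) (b' ∘ out)
  simp only [Matrix.sub_apply, Matrix.smul_apply, smul_eq_mul] at h
  simp only [Matrix.add_apply, Matrix.sub_apply, Matrix.smul_apply, applyOn_apply, smul_eq_mul]
  linear_combination (of fun a a' => ρ (splice out a b) (splice out a' b')).trace * h

lemma abs_gexec_sub_le {v v' : Cfg pk → ℂ} (hv : ∑ b, ‖v b‖ ^ 2 = 1) (hv' : ∑ b, ‖v' b‖ ^ 2 = 1)
    {t : ℝ} (ht : 0 < t) (h : t ^ 2 * ∑ b, ‖v b - v' b‖ ^ 2 ≤ 4) (out : Fin N) (β : Bool)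
    {M : ℕ → Kernel ct} (hM : ∀ r, IsProbKernel (M r)) (l : List (CPAInstr pk ct N))
    {σ : Bool → Op (Fin N)} (hσ : ∀ z, (σ z).PosSemidef) (htr : gtr σ ≤ 1) :
    |gprob out β (gexec v β M l σ) - gprob out β (gexec v' β M l σ)| ≤ l.length * (4 / t) := by
  induction l generalizing M σ with
  | nil => simp [gexec]
  | cons i l ih =>
    have hM' : ∀ r, IsProbKernel (M (r + 1)) := fun r => hM (r + 1)
    have h1 := ih hM' (gstep_pos v' (hM 0) β i hσ) (by rwa [gstep_tr hv' (hM 0)])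
    have h2 : |gprob out β (gexec v β (fun r => M (r + 1)) l (gstep v (M 0) β i σ)) -
        gprob out β (gexec v β (fun r => M (r + 1)) l (gstep v' (M 0) β i σ))| ≤ 4 / t := by
      have h4 : 0 ≤ 4 / t := by positivity
      cases i with
      | gate g => simpa [gstep] using h4
      | enc ctrl ℓ f => simpa [gstep] using h4
      | chal ctrl ℓ f => simpa [gstep] using h4
      | key o =>
        have hstep : gstep v (M 0) β (.key o) σ = gstep v' (M 0) β (.key o) σ +
            ((1 / (4 * t) : ℝ) : ℂ) •
            (gstep (fun b => (v b + v' b) + t * (v b - v' b)) (M 0) β (.key o) σ + ((-1 : ℝ) : ℂ) •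
              gstep (fun b => (v b + v' b) - t * (v b - v' b)) (M 0) β (.key o) σ) := by
          funext z
          refine (overwrite_sub o v v' ht (σ z)).trans ?_
          simp [gstep, sub_eq_add_neg]
        have hb : ∀ w : Cfg pk → ℂ, ∑ b, ‖w b‖ ^ 2 ≤ 16 →
            0 ≤ gprob out β (gexec v β (fun r => M (r + 1)) l (gstep w (M 0) β (.key o) σ)) ∧
            gprob out β (gexec v β (fun r => M (r + 1)) l (gstep w (M 0) β (.key o) σ)) ≤ 16 := by
          intro w hw
          have hp := gexec_pos v hM' β l (gstep_pos w (hM 0) β (.key o) hσ)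
          refine ⟨gprob_nonneg _ _ hp, (gprob_le_gtr _ _ hp).trans ?_⟩
          rw [gexec_tr hv hM']
          have : gtr (gstep w (M 0) β (.key o) σ) = (∑ b, ‖w b‖ ^ 2) * gtr σ := by
            simp only [gtr, gstep, trace_overwrite, Complex.re_ofReal_mul, mul_sum]
          rw [this]
          have h0 : 0 ≤ gtr σ := (gprob_nonneg out β hσ).trans (gprob_le_gtr out β hσ)
          calc _ ≤ 16 * gtr σ := by gcongr
            _ ≤ 16 := by linarith
        have hs : ‖(t : ℂ)‖ ≤ t := by rw [Complex.norm_real, Real.norm_of_nonneg ht.le]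
        have b1 := hb _ (sum_norm_comb_le hv hv' h hs)
        have b2 := hb (fun b => (v b + v' b) - t * (v b - v' b)) (by
          simpa [sub_eq_add_neg] using
            sum_norm_comb_le hv hv' h (s := -(t : ℂ)) (by rw [norm_neg]; exact hs))
        rw [hstep, (isLinear_gexec v β _ l).map_add, (isLinear_gexec v β _ l).map_smul,
          (isLinear_gexec v β _ l).map_add, (isLinear_gexec v β _ l).map_smul, gprob_add,
          gprob_smul, gprob_add, gprob_smul, add_sub_cancel_left, abs_mul,
          abs_of_pos (by positivity)]
        calc _ ≤ 1 / (4 * t) * 16 := by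
              gcongr
              rw [abs_le]
              constructor <;> linarith [b1.1, b1.2, b2.1, b2.2]
          _ = 4 / t := by field_simp; norm_num
    rw [List.length_cons, Nat.cast_add, Nat.cast_one, add_mul, one_mul]
    calc _ ≤ _ := abs_sub_le _ (gprob out β
          (gexec v β (fun r => M (r + 1)) l (gstep v' (M 0) β i σ))) _
      _ ≤ 4 / t + l.length * (4 / t) := add_le_add h2 h1
      _ = _ := add_comm _ _

/-- The winning probability depends continuously on the public key. -/
lemma abs_gwin_sub_le {v v' : Cfg pk → ℂ} (hv : ∑ b, ‖v b‖ ^ 2 = 1)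
    (hv' : ∑ b, ‖v' b‖ ^ 2 = 1) {t : ℝ} (ht : 0 < t) (h : t ^ 2 * ∑ b, ‖v b - v' b‖ ^ 2 ≤ 4)
    (A : CPAAdv pk ct) {M : ℕ → Kernel ct} (hM : ∀ r, IsProbKernel (M r)) :
    |gwin A v M - gwin A v' M| ≤ A.prog.length * (4 / t) := by
  have h1 := fun β => abs_gexec_sub_le hv hv' ht h A.out β hM A.prog gzero_pos gtr_gzero.le
  rw [gwin, gwin, ← mul_sub, ← sum_sub_distrib, sum_bool, abs_mul, abs_of_pos (by norm_num)]
  have := abs_add_le (gprob A.out true (gexec v true M A.prog (gzero A.wires)) -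
    gprob A.out true (gexec v' true M A.prog (gzero A.wires)))
    (gprob A.out false (gexec v false M A.prog (gzero A.wires)) -
    gprob A.out false (gexec v' false M A.prog (gzero A.wires)))
  linarith [h1 true, h1 false]

/-! ### Dependence on the encryption kernels -/

lemma gstep_congr (v : Cfg pk → ℂ) {M M' : Kernel ct} (h : ∀ ℓ, ℓ ≤ N → M ℓ = M' ℓ) (β : Bool)
    (i : CPAInstr pk ct N) (σ : Bool → Op (Fin N)) : gstep v M β i σ = gstep v M' β i σ := by
  cases i with
  | gate g => rfl
  | key out => rfl
  | enc ctrl ℓ f =>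
    have : ℓ ≤ N := by
      simpa using card_le_of_embedding (Embedding.inl.trans f)
    simp only [gstep, h ℓ this]
  | chal ctrl ℓ f =>
    have : ℓ ≤ N := by
      simpa using card_le_of_embedding
        ((Embedding.inl.trans Embedding.inl).trans f)
    simp only [gstep, h ℓ this]

lemma gexec_congr (v : Cfg pk → ℂ) {M M' : ℕ → Kernel ct} (h : ∀ r ℓ, ℓ ≤ N → M r ℓ = M' r ℓ)
    (β : Bool) (l : List (CPAInstr pk ct N)) (σ : Bool → Op (Fin N)) : gexec v β M l σ =
    gexec v β M' l σ := by
  induction l generalizing M M' σ with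
  | nil => rfl
  | cons i l ih =>
    rw [gexec, gexec, gstep_congr v (h 0), ih fun r => h (r + 1)]

/-- If the encryption does not depend on the message, then the challenge bit can only be
guessed. -/
lemma gwin_eq_half (A : CPAAdv pk ct) {v : Cfg pk → ℂ} (hv : ∑ b, ‖v b‖ ^ 2 = 1)
    {M : ℕ → Kernel ct} (hM : ∀ r, IsProbKernel (M r))
    (h : ∀ r ℓ, ℓ ≤ A.wires → ∀ m m', M r ℓ m = M r ℓ m') : gwin A v M = 1 / 2 := by
  have hs : ∀ (N : ℕ) (M : ℕ → Kernel ct), (∀ r ℓ, ℓ ≤ N → ∀ m m', M r ℓ m = M r ℓ m') →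
      ∀ (l : List (CPAInstr pk ct N)) (σ : Bool → Op (Fin N)),
        gexec v true M l σ = gexec v false M l σ := by
    intro N M h l
    induction l generalizing M with
    | nil => exact fun _ => rfl
    | cons i l ih =>
      intro σ
      have : gstep v (M 0) true i σ = gstep v (M 0) false i σ := by
        cases i with
        | gate g => rfl
        | key out => rfl
        | enc ctrl ℓ f => rfl
        | chal ctrl ℓ f =>
          have hℓ : ℓ ≤ N := by
            simpa using card_le_of_embedding
              ((Embedding.inl.trans Embedding.inl).trans f)
          simp only [gstep]
          have : (fun a => M 0 ℓ (sel true a)) = fun a => M 0 ℓ (sel false a) :=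
            funext fun a => h 0 ℓ hℓ _ _
          rw [this]
      rw [gexec, gexec, this]
      exact ih _ (fun r => h (r + 1)) _
  rw [gwin]
  have : ∀ β, gexec v β M A.prog (gzero A.wires) = gexec v false M A.prog (gzero A.wires) := by
    intro β
    cases β
    · rfl
    · exact hs _ M h _ _
  simp only [this]
  rw [sum_gprob, gexec_tr hv hM, gtr_gzero, mul_one]

/-- A finite sequence, continued by a default value. -/
def extendSeq {T : Type} [Inhabited T] {n : ℕ} (t : Fin n → T) (r : ℕ) : T :=
  if h : r < n then t ⟨r, h⟩ else default

lemma extendSeq_cons_zero {T : Type} [Inhabited T] {n : ℕ} (a : T) (t : Fin n → T) :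
    extendSeq (Fin.cons a t : Fin (n + 1) → T) 0 = a := by
  simp [extendSeq]

lemma extendSeq_cons_succ {T : Type} [Inhabited T] {n : ℕ} (a : T) (t : Fin n → T) (r : ℕ) :
    extendSeq (Fin.cons a t : Fin (n + 1) → T) (r + 1) = extendSeq t r := by
  by_cases h : r < n
  · rw [extendSeq, extendSeq, dif_pos h, dif_pos (Nat.succ_lt_succ h)]
    exact Fin.cons_succ (α := fun _ => T) a t ⟨r, h⟩
  · rw [extendSeq, extendSeq, dif_neg h, dif_neg fun h' => h (Nat.lt_of_succ_lt_succ h')]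

lemma kenc_sum {T : Type} [Fintype T] {ι κ : Type} [Fintype ι] [DecidableEq ι] [Fintype κ]
    [DecidableEq κ] (p : T → ℝ) (K : T → Cfg ι → Cfg κ → ℝ) (f : ι ⊕ κ ↪ Fin N) (ρ : Op (Fin N)) :
    kenc (fun a c => ∑ t, p t * K t a c) f ρ = ∑ t, (p t : ℂ) • kenc (K t) f ρ := by
  simp only [kenc, smul_sum]
  rw [sum_comm (s := (univ : Finset T))]
  refine sum_congr rfl fun a _ => ?_
  rw [sum_comm (s := (univ : Finset T))]
  refine sum_congr rfl fun c _ => ?_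
  rw [ofReal_sum, Finset.sum_smul]
  refine sum_congr rfl fun t _ => ?_
  rw [ofReal_mul, mul_smul]

lemma gstep_sum {T : Type} [Fintype T] (v : Cfg pk → ℂ) {p : T → ℝ} (hp : ∑ t, p t = 1)
    (K : T → Kernel ct) (β : Bool) (i : CPAInstr pk ct N) (σ : Bool → Op (Fin N)) :
    gstep v (fun ℓ m c => ∑ t, p t * K t ℓ m c) β i σ = ∑ t, (p t : ℂ) • gstep v (K t) β i σ := by
  have hc : ∀ ρ : Op (Fin N), ρ = ∑ t, (p t : ℂ) • ρ := by
    intro ρ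
    rw [← Finset.sum_smul, ← ofReal_sum, hp, Complex.ofReal_one, one_smul]
  funext z
  rw [Finset.sum_apply]
  cases i with
  | gate g => exact hc _
  | key out => exact hc _
  | enc ctrl ℓ f =>
    simp only [gstep, Pi.smul_apply, smul_add, sum_add_distrib, ← hc]
    rw [← kenc_sum]
  | chal ctrl ℓ f =>
    cases z
    · exact hc _
    · simp only [gstep, Pi.smul_apply, if_true, smul_add, sum_add_distrib, ← hc]
      rw [← kenc_sum p (fun t a => K t ℓ (sel β a))]

/-- If every kernel is a convex combination, then the game can be played with the components
sampled in advance. -/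
lemma gexec_expand {T : Type} [Fintype T] [Inhabited T] (v : Cfg pk → ℂ) (β : Bool) {p : T → ℝ}
    (hp : ∑ t, p t = 1) (K : T → Kernel ct) (l : List (CPAInstr pk ct N)) (σ : Bool → Op (Fin N)) :
    gexec v β (fun _ ℓ m c => ∑ t, p t * K t ℓ m c) l σ = ∑ t : Fin l.length → T,
    ((∏ r, p (t r) : ℝ) : ℂ) • gexec v β (fun r => K (extendSeq t r)) l σ := by
  induction l generalizing σ with
  | nil => simp [gexec]
  | cons i l ih =>
    rw [gexec, ih, gstep_sum v hp]
    have hlin := fun M => (isLinear_gexec (N := N) v β M l)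
    have e := sum_equiv (Fin.consEquiv fun _ : Fin (l.length + 1) => T)
      (fun q => ((∏ r, p ((Fin.cons q.1 q.2 : Fin (l.length + 1) → T) r) : ℝ) : ℂ) •
        gexec v β (fun r => K (extendSeq (Fin.cons q.1 q.2 : Fin (l.length + 1) → T) r))
          (i :: l) σ)
      (fun t => ((∏ r, p (t r) : ℝ) : ℂ) •
        gexec v β (fun r => K (extendSeq t r)) (i :: l) σ) (fun q => rfl)
    refine Eq.trans ?_ e
    rw [Fintype.sum_prod_type_right]
    refine sum_congr rfl fun t _ => ?_
    have hsum : ∀ M : ℕ → Kernel ct, gexec v β M l (∑ a, (p a : ℂ) • gstep v (K a) β i σ) =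
        ∑ a, (p a : ℂ) • gexec v β M l (gstep v (K a) β i σ) := by
      intro M
      have := map_sum ((hlin M).mk' _) (fun a => (p a : ℂ) • gstep v (K a) β i σ) univ
      refine this.trans (sum_congr rfl fun a _ => ?_)
      exact (hlin M).map_smul _ _
    rw [hsum, smul_sum]
    refine sum_congr rfl fun a _ => ?_
    rw [gexec, smul_smul, Fin.prod_univ_succ]
    simp only [extendSeq_cons_zero, extendSeq_cons_succ, Fin.cons_zero, Fin.cons_succ]
    congr 1
    push_cast
    ring

lemma gwin_expand {T : Type} [Fintype T] [Inhabited T] (A : CPAAdv pk ct) (v : Cfg pk → ℂ)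
    {p : T → ℝ} (hp : ∑ t, p t = 1) (K : T → Kernel ct) (M : Kernel ct)
    (h : ∀ ℓ, ℓ ≤ A.wires → ∀ m c, M ℓ m c = ∑ t, p t * K t ℓ m c) : gwin A v (fun _ => M) = ∑ t :
    Fin A.prog.length → T, (∏ r, p (t r)) * gwin A v fun r => K (extendSeq t r) := by
  have h1 : ∀ β, gexec v β (fun _ => M) A.prog (gzero A.wires) = _ := fun β =>
    (gexec_congr v (fun _ ℓ hℓ => funext fun m => funext fun c => h ℓ hℓ m c) β A.prog _).trans
      (gexec_expand v β hp K A.prog _)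
  simp only [gwin, h1, gprob_sum, gprob_smul]
  rw [sum_comm, mul_sum]
  refine sum_congr rfl fun t _ => ?_
  rw [← mul_sum]
  ring

end GameBounds

section Simulation

variable {Θ Z : Type} {Tg pk : Type} {ct : ℕ → Type} [Fintype Tg] [DecidableEq Tg]
  [Fintype pk] [DecidableEq pk] [∀ ℓ, Fintype (ct ℓ)] [∀ ℓ, DecidableEq (ct ℓ)]
  {ι κ W : Type} [Fintype ι] [DecidableEq ι] [Fintype κ] [DecidableEq κ]
  [Fintype W] [DecidableEq W] {N : ℕ} {O : Oracles Θ Z}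

/-! ### The register of a simulator of the game -/

/-- Wires of a simulator: a bit which records whether the challenge was issued, a classical
string, and the wires of the adversary. -/
abbrev Sim (Tg : Type) (N : ℕ) : Type := Unit ⊕ (Tg ⊕ Fin N)

/-- The basis state with given contents of the three registers. -/
abbrev simCfg (t : Cfg Tg) (z : Bool) (s : Cfg (Fin N)) : Cfg (Sim Tg N) :=
  elim (fun _ => z) (elim t s)

/-- The block of a state of the simulator in which the classical registers have given values. -/
def simBlk (t : Cfg Tg) (z : Bool) (ρ : Op (Sim Tg N)) : Op (Fin N) :=
  of fun s s' => ρ (simCfg t z s) (simCfg t z s')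

def advEmb (Tg : Type) (N : ℕ) : Fin N ↪ Sim Tg N :=
  Embedding.inr.trans Embedding.inr

/-- The classical string together with some wires of the adversary. -/
def tagEmb (Tg : Type) (f : ι ⊕ κ ↪ Fin N) : (Tg ⊕ ι) ⊕ κ ↪ Sim Tg N :=
  ((Equiv.sumAssoc Tg ι κ).toEmbedding.trans (Embedding.sumMap
    (Embedding.refl Tg) f)).trans Embedding.inr

lemma simBlk_add (t : Cfg Tg) (z : Bool) (ρ σ : Op (Sim Tg N)) :
    simBlk t z (ρ + σ) = simBlk t z ρ + simBlk t z σ := rfl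

lemma splice_advEmb (f : ι ↪ Fin N) (a : Cfg ι) (t : Cfg Tg) (z : Bool) (s : Cfg (Fin N)) :
    splice (f.trans (advEmb Tg N)) a (simCfg t z s) = simCfg t z (splice f a s) := by
  refine splice_ext _ ?_ ?_
  · funext i
    exact splice_apply f a s i
  · rintro (⟨⟩ | j | j) hj
    · rfl
    · rfl
    · change s j = splice f a s j
      rw [splice_of_notMem]
      rintro ⟨i, rfl⟩
      exact hj ⟨i, rfl⟩

lemma simBlk_applyOn (f : ι ↪ Fin N) (G : Op ι → Op ι) (t : Cfg Tg) (z : Bool) (ρ : Op (Sim Tg N)) :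
    simBlk t z (applyOn (f.trans (advEmb Tg N)) G ρ) = applyOn f G (simBlk t z ρ) := by
  ext s s'
  simp only [simBlk, of_apply, applyOn_apply, splice_advEmb]
  rfl

lemma simBlk_branch (w : Fin N) (v : Bool) (t : Cfg Tg) (z : Bool) (ρ : Op (Sim Tg N)) :
    simBlk t z (branch (advEmb Tg N w) v ρ) = branch w v (simBlk t z ρ) := rfl

lemma splice_tagEmb (f : ι ⊕ κ ↪ Fin N) (t : Cfg Tg) (a : Cfg ι) (c : Cfg κ) (z : Bool)
    (s : Cfg (Fin N)) : splice (tagEmb Tg f) (elim (elim t a) c) (simCfg t z s) =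
    simCfg t z (splice f (elim a c) s) := by
  refine splice_ext _ ?_ ?_
  · funext i
    rcases i with (i | i) | i
    · rfl
    · exact splice_apply f (elim a c) s (inl i)
    · exact splice_apply f (elim a c) s (inr i)
  · rintro (⟨⟩ | j | j) hj
    · rfl
    · rfl
    · change s j = splice f _ s j
      rw [splice_of_notMem]
      rintro ⟨i | i, rfl⟩
      · exact hj ⟨inl (inr i), rfl⟩
      · exact hj ⟨inr i, rfl⟩

lemma simBlk_kenc (M : Cfg (Tg ⊕ ι) → Cfg κ → ℝ) (f : ι ⊕ κ ↪ Fin N) (t : Cfg Tg) (z : Bool)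
    (ρ : Op (Sim Tg N)) :
    simBlk t z (applyOn (tagEmb Tg f) (kchan (encKer fun a c => (M a c : ℂ))) ρ) =
    kenc (fun a => M (elim t a)) f (simBlk t z ρ) := by
  rw [kenc_eq]
  ext s s'
  simp only [simBlk, of_apply, applyOn_apply, kchan_encKer]
  have e1 : ∀ s : Cfg (Fin N), (simCfg t z s ∘ tagEmb Tg f) ∘ inl = elim t ((s ∘ f) ∘ inl) := by
    intro s
    funext i
    rcases i with i | i <;> rfl
  have e2 : ∀ s : Cfg (Fin N), (simCfg t z s ∘ tagEmb Tg f) ∘ inr = (s ∘ f) ∘ inr :=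
    fun s => rfl
  have e3 : (simCfg t z s ∘ tagEmb Tg f = simCfg t z s' ∘ tagEmb Tg f) ↔ s ∘ f = s' ∘ f := by
    rw [cfg_sum_ext_iff, e1, e1, e2, e2, sum_elim_inj, cfg_sum_ext_iff (s ∘ f)]
    simp
  simp only [e1, e2, splice_tagEmb]
  by_cases h : s ∘ f = s' ∘ f
  · rw [if_pos (e3.2 h), if_pos h]
  · rw [if_neg fun h' => h (e3.1 h'), if_neg h]

lemma simBlk_idleStep (w : Fin N) (t : Cfg Tg) (z : Bool) (ρ : Op (Sim Tg N)) :
    simBlk t z (idleStep (inl ()) (advEmb Tg N w) ρ) = if z =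
    true then simBlk t true ρ else branch w false (simBlk t false ρ) := by
  ext s s'
  cases z
  · simp [simBlk, idleStep, branch, advEmb]
  · simp [simBlk, idleStep]

lemma simBlk_chalStep (w : Fin N) (t : Cfg Tg) (z : Bool) (ρ : Op (Sim Tg N)) :
    simBlk t z (chalStep (inl ()) (advEmb Tg N w) ρ) = if z =
    true then 0 else branch w true (simBlk t false ρ) := by
  ext s s'
  cases z
  · simp [simBlk, chalStep, branch, advEmb]
  · simp [simBlk, chalStep]

lemma simBlk_flipBit (t : Cfg Tg) (z : Bool) (ρ : Op (Sim Tg N)) :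
    simBlk t z (flipBit (inl ()) ρ) = simBlk t (!z) ρ := by
  ext s s'
  have : ∀ s : Cfg (Fin N), update (simCfg t z s) (inl ()) (!z) = simCfg t (!z) s := by
    intro s
    funext i
    rcases i with ⟨⟩ | j
    · exact update_self _ _ _
    · exact update_of_ne inr_ne_inl _ _
  simp only [simBlk, flipBit, pull, of_apply, elim_inl, this]

/-! ### Building blocks of simulators -/

lemma KCirc.encKer {s : ℕ} {M : Θ → Cfg ι → Cfg κ → ℂ} (hM : KCirc O s M) :
    KCirc O (6 * (card ι + card κ) + 2 * card ι + s) fun θ => QPK.encKer (M θ) := by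
  have h := hM.bind (ι := ι ⊕ κ) (KCirc.copy (O := O) (elim (fun i => inl (inl i))
    (fun j => inr j) : ι ⊕ κ → (ι ⊕ κ) ⊕ κ)) inl
  refine (h.weaken (le_of_eq (by simp only [card_sum]; ring))).congr fun θ a y => ?_
  rw [sum_eq_single (y ∘ inr)]
  · rw [QPK.encKer, det]
    have : (y = elim a (y ∘ inr) ∘
        (elim (fun i => inl (inl i)) (fun j => inr j) : ι ⊕ κ → (ι ⊕ κ) ⊕ κ)) ↔
        a ∘ inl = y ∘ inl := by
      constructor
      · intro h
        rw [h]
        rfl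
      · intro h
        funext i
        rcases i with i | i
        · exact (congrFun h i).symm
        · rfl
    by_cases h : a ∘ inl = y ∘ inl
    · rw [if_pos h, if_pos (this.2 h), h, mul_one]
    · rw [if_neg h, if_neg fun h' => h (this.1 h'), mul_zero]
  · intro c _ hc
    rw [det, if_neg, mul_zero]
    intro h
    apply hc
    rw [h]
    rfl
  · simp

/-- A preparation procedure for the state `σ θ`. -/
def Prep {κ : Type} [Fintype κ] [DecidableEq κ] (O : Oracles Θ Z) (s : ℕ) (σ : Θ → Op κ) : Prop :=
  Circ O s fun θ (ρ : Op Empty) => ρ.trace • σ θ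

/-- Discarding a register and preparing it anew. -/
lemma Circ.replace {s : ℕ} {σ : Θ → Op κ} (h : Prep O s σ) (f : κ ↪ ι) :
    Circ O s fun θ => QPK.applyOn f fun ρ => ρ.trace • σ θ := by
  have e : Empty ↪ κ := ⟨Empty.elim, fun i => i.elim⟩
  have h1 := ((Circ.keep (O := O) e).comp h).applyOn f
  rw [zero_add] at h1
  refine h1.congr fun θ ρ => ?_
  refine applyOn_congr (fun σ' => ?_) ρ
  rw [trace_keepWires]

lemma CtrlImpl.kenc [Nonempty Z] {s : ℕ} {M : Cfg (Tg ⊕ ι) → Cfg κ → ℝ}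
    (hM : KCirc O s fun _ a c => (M a c : ℂ)) (h1 : ∀ a, ∑ c, M a c = 1) (f : ι ⊕ κ ↪ Fin N) :
    CtrlImpl O (3 * (card Tg + N) + (8 * (card Tg + N) + s)) fun _ σ z => applyOn (tagEmb Tg f)
    (kchan (encKer fun a c => (M a c : ℂ))) (σ z) := by
  have hc : card ι + card κ ≤ N := by
    simpa using card_le_of_embedding f
  refine (CtrlImpl.of_circ hM.encKer (tagEmb Tg f) fun _ => ?_).weaken ?_
  · rw [trace_kchan]
    · simp
    · refine sum_encKer fun a => ?_
      exact_mod_cast h1 a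
  · simp only [card_sum]
    omega

lemma KCirc.sel {s ℓ : ℕ} {M : Cfg (Tg ⊕ Fin ℓ) → Cfg κ → ℝ}
    (hM : KCirc O s fun _ a c => (M a c : ℂ)) (β : Bool) :
    KCirc O (2 * (card Tg + ℓ) + s) fun _ (a : Cfg (Tg ⊕ (Fin ℓ ⊕ Fin ℓ))) c =>
      (M (elim (a ∘ inl) (QPK.sel β (a ∘ inr))) c : ℂ) := by
  have h := hM.comap (elim inl fun i => inr (if β then inr i else inl i) :
    Tg ⊕ Fin ℓ → Tg ⊕ (Fin ℓ ⊕ Fin ℓ))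
  refine (h.weaken (by simp)).congr fun θ a y => ?_
  congr 2
  funext i
  rcases i with i | i
  · rfl
  · cases β <;> rfl

def stepCost (tg N sp sM : ℕ) : ℕ := 13 * (tg + N) + sp + sM + 3

/-- A step of the game, for an adversary with access to a classical string. -/
lemma exists_circ_gstep [Nonempty Z] {sp sM : ℕ} {v : Θ → Cfg pk → ℂ}
    (hv : Prep O sp fun θ => pureState (v θ)) {M : Cfg Tg → Kernel ct}
    (hM : ∀ ℓ, ℓ ≤ N → KCirc O sM fun _ (a : Cfg (Tg ⊕ Fin ℓ)) c => (M (a ∘ inl) ℓ (a ∘ inr) c : ℂ))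
    (hM1 : ∀ t, IsProbKernel (M t)) (β : Bool) (i : CPAInstr pk ct N) : ∃ F : Θ → Op (Sim Tg N) →
    Op (Sim Tg N), Circ O (stepCost (card Tg) N sp sM) F ∧ ∀ θ ρ t z, simBlk t z (F θ ρ) =
    gstep (v θ) (M t) β i (fun z => simBlk t z ρ) z := by
  cases i with
  | gate g =>
    refine ⟨_, (Circ.gate g.arity_le (g.wires.trans (advEmb Tg N)) g.mat g.unitary).weaken ?_,
      fun θ ρ t z => ?_⟩
    · rw [stepCost]; omega
    · rw [simBlk_applyOn, ← conj_onWires]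
      rfl
  | key out =>
    refine ⟨_, (Circ.replace hv (out.trans (advEmb Tg N))).weaken ?_, fun θ ρ t z => ?_⟩
    · rw [stepCost]; omega
    · rw [simBlk_applyOn, ← overwrite_eq]
      rfl
  | enc ctrl ℓ f =>
    have hℓ : ℓ ≤ N := by
      simpa using card_le_of_embedding (Embedding.inl.trans f)
    have h : Circ O _ fun _ ρ => branch (advEmb Tg N ctrl) false ρ + applyOn (tagEmb Tg f)
        (kchan (encKer fun a c => (M (a ∘ inl) ℓ (a ∘ inr) c : ℂ)))
          (branch (advEmb Tg N ctrl) true ρ) :=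
      (CtrlImpl.kenc (M := fun a => M (a ∘ inl) ℓ (a ∘ inr)) (hM ℓ hℓ)
      (fun a => ((hM1 _) ℓ _).2) f).enc (advEmb Tg N ctrl)
    refine ⟨_, h.weaken ?_, fun θ ρ t z => ?_⟩
    · rw [stepCost]; omega
    · rw [simBlk_add, simBlk_branch, simBlk_kenc, simBlk_branch]
      rfl
  | chal ctrl ℓ f =>
    have hℓ : ℓ + ℓ ≤ N := by
      simpa using card_le_of_embedding (Embedding.inl.trans f)
    have h : Circ O _ fun _ ρ => idleStep (inl ()) (advEmb Tg N ctrl) ρ + flipBit (inl ())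
        (applyOn (tagEmb Tg f)
          (kchan (encKer fun a c => (M (a ∘ inl) ℓ (QPK.sel β (a ∘ inr)) c : ℂ)))
          (chalStep (inl ()) (advEmb Tg N ctrl) ρ)) :=
      (CtrlImpl.kenc (M := fun a => M (a ∘ inl) ℓ (QPK.sel β (a ∘ inr)))
      (KCirc.sel (M := fun a => M (a ∘ inl) ℓ (a ∘ inr)) (hM ℓ (by omega)) β)
      (fun a => ((hM1 _) ℓ _).2) f).chal (inl ()) (advEmb Tg N ctrl) (by simp [advEmb])
    refine ⟨_, h.weaken ?_, fun θ ρ t z => ?_⟩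
    · rw [stepCost]; omega
    · rw [simBlk_add, simBlk_idleStep, simBlk_flipBit, simBlk_kenc, simBlk_chalStep]
      cases z
      · simp [gstep, (isLinear_kenc _ f).map_zero]
      · simp [gstep]

lemma exists_circ_gexec [Nonempty Z] {sp sM : ℕ} {v : Θ → Cfg pk → ℂ}
    (hv : Prep O sp fun θ => pureState (v θ)) {M : Cfg Tg → ℕ → Kernel ct}
    (hM : ∀ r ℓ, ℓ ≤ N → KCirc O sM fun _ (a : Cfg (Tg ⊕ Fin ℓ)) c =>
      (M (a ∘ inl) r ℓ (a ∘ inr) c : ℂ)) (hM1 : ∀ t r, IsProbKernel (M t r)) (β : Bool)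
    (l : List (CPAInstr pk ct N)) :
    ∃ F : Θ → Op (Sim Tg N) → Op (Sim Tg N),
      Circ O (l.length * stepCost (card Tg) N sp sM) F ∧ ∀ θ ρ t z,
        simBlk t z (F θ ρ) = gexec (v θ) β (M t) l (fun z => simBlk t z ρ) z := by
  induction l generalizing M with
  | nil => exact ⟨_, Circ.id.weaken (by simp), fun θ ρ t z => rfl⟩
  | cons i l ih =>
    obtain ⟨F, hF, h⟩ := exists_circ_gstep hv (hM 0) (fun t => hM1 t 0) β i
    obtain ⟨F', hF', h'⟩ := ih (M := fun t r => M t (r + 1)) (fun r => hM (r + 1))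
      (fun t r => hM1 t (r + 1))
    refine ⟨_, (hF.comp hF').weaken (le_of_eq (by rw [List.length_cons]; ring)), fun θ ρ t z => ?_⟩
    rw [h', gexec]
    congr 1
    funext z
    exact h θ ρ t z

def unitEmb (w : W) : Unit ↪ W := ⟨fun _ => w, fun _ _ _ => rfl⟩

def strEmb (Tg : Type) (N : ℕ) : Tg ↪ Sim Tg N :=
  Embedding.inl.trans Embedding.inr

lemma sum_keepWires_diag (f : κ ↪ W) (ρ : Op W) (g : Cfg κ → ℂ) :
    ∑ y, keepWires f ρ y y * g y = ∑ b, ρ b b * g (b ∘ f) := by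
  simp only [keepWires_apply, sum_mul]
  rw [sum_comm]
  refine sum_congr rfl fun b _ => ?_
  rw [sum_eq_single (b ∘ f)]
  · simp
  · intro y _ hy
    rw [if_neg fun h => hy h.symm, zero_mul]
  · simp

lemma keepWires_diag (f : κ ↪ W) (ρ : Op W) (y : Cfg κ) :
    keepWires f ρ y y = ∑ b, if b ∘ f = y then ρ b b else 0 := by
  rw [keepWires_apply]
  refine sum_congr rfl fun b _ => ?_
  split_ifs with h
  · rw [← h, splice_self]
  · rfl

lemma keepWires_unit_diag (w : W) (ρ : Op W) (x : Bool) :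
    keepWires (unitEmb w) ρ (fun _ => x) (fun _ => x) = ∑ b, if b w = x then ρ b b else 0 := by
  rw [keepWires_diag]
  refine sum_congr rfl fun b _ => ?_
  congr 1
  rw [eq_iff_iff]
  exact ⟨fun h => congrFun h (), fun h => funext fun _ => h⟩

lemma zeroOff_strEmb (t : Cfg Tg) (z : Bool) (s : Cfg (Fin N)) :
    ZeroOff (strEmb Tg N) (simCfg t z s) ↔ z = false ∧ s = fun _ => false := by
  constructor
  · intro h
    refine ⟨h (inl ()) ?_, funext fun j => h (inr (inr j)) ?_⟩
    · rintro ⟨i, hi⟩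
      exact inr_ne_inl hi
    · rintro ⟨i, hi⟩
      exact inl_ne_inr (Sum.inr_injective hi)
  · rintro ⟨rfl, rfl⟩ (⟨⟩ | j | j) hj
    · rfl
    · exact absurd ⟨j, rfl⟩ hj
    · rfl

/-- Simulation of the game by a circuit which samples a classical string at the start. -/
lemma exists_circ_game [Nonempty Z] {sp sM st : ℕ} {v : Θ → Cfg pk → ℂ}
    (hv : Prep O sp fun θ => pureState (v θ)) {p : Θ → Cfg Tg → ℝ}
    (hp : KCirc O st fun θ (_ : Cfg Empty) t => (p θ t : ℂ)) {M : Cfg Tg → ℕ → Kernel ct}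
    (hM : ∀ r ℓ, ℓ ≤ N → KCirc O sM fun _ (a : Cfg (Tg ⊕ Fin ℓ)) c =>
      (M (a ∘ inl) r ℓ (a ∘ inr) c : ℂ)) (hM1 : ∀ t r, IsProbKernel (M t r)) (β : Bool)
    (l : List (CPAInstr pk ct N)) (out : Fin N) :
    ∃ F : Θ → Op Empty → Op Unit,
      Circ O (st + (N + 1) + l.length * stepCost (card Tg) N sp sM + 1) F ∧ ∀ θ,
        (F θ 1 (fun _ => true) (fun _ => true)).re =
          ∑ t, p θ t * gprob out β (gexec (v θ) β (M t) l (gzero N)) := by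
  obtain ⟨F, hF, h⟩ := exists_circ_gexec hv hM hM1 β l
  have hout : ∃ E : Op (Sim Tg N) → Op Unit, Circ O 1 (fun _ => E) ∧ ∀ ρ,
      E ρ (fun _ => true) (fun _ => true) = ∑ b, if b (advEmb Tg N out) = β then ρ b b else 0 := by
    have hk : Circ O 0 fun _ (ρ : Op (Sim Tg N)) => keepWires (unitEmb (advEmb Tg N out)) ρ :=
      Circ.keep _
    cases β
    · refine ⟨_, hk.comp (Circ.not ()), fun ρ => ?_⟩
      rw [← keepWires_unit_diag]
      simp only [pull, of_apply]
      congr 1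
    · exact ⟨_, hk.weaken (by omega), fun ρ => keepWires_unit_diag _ _ _⟩
  obtain ⟨E, hE, hE'⟩ := hout
  have hplace : Circ O (N + 1) fun _ (ρ : Op Tg) => QPK.place (strEmb Tg N) ρ :=
    (Circ.place (O := O) (strEmb Tg N)).weaken (by simp; omega)
  have hp' : Circ O st fun θ => kchan fun (_ : Cfg Empty) t => (p θ t : ℂ) := hp
  refine ⟨_, ((hp'.comp hplace).comp hF).comp hE, fun θ => ?_⟩
  rw [hE', sum_cfgSum]
  have hinit : ∀ t, (fun z => simBlk t z (QPK.place (strEmb Tg N)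
      (kchan (fun (_ : Cfg Empty) t => (p θ t : ℂ)) 1))) = (p θ t : ℂ) • gzero N := by
    intro t
    funext z
    ext s s'
    have ht : ∀ z (s : Cfg (Fin N)), simCfg t z s ∘ strEmb Tg N = t := fun _ _ => rfl
    simp only [simBlk, of_apply, place_apply, zeroOff_strEmb, ht, kchan_apply, if_true,
      Matrix.one_apply_eq, one_mul, sum_const, card_univ, Pi.smul_apply,
      Matrix.smul_apply, gzero, smul_eq_mul]
    cases z
    · rw [Pi.single_eq_same, zeroState, pureState_ket, single_apply]
      by_cases h1 : s = fun _ => false <;> by_cases h2 : s' = fun _ => false <;>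
        simp [h1, h2, eq_comm]
    · simp
  simp only [sum_cfgSum (ι := Tg)]
  have hfin : ∀ z t, (∑ s : Cfg (Fin N), if simCfg t z s (advEmb Tg N out) = β then
      F θ (QPK.place (strEmb Tg N) (kchan (fun (_ : Cfg Empty) t => (p θ t : ℂ)) 1))
        (simCfg t z s) (simCfg t z s) else 0) = ∑ s : Cfg (Fin N), if s out = β then
        ((p θ t : ℂ) • gexec (v θ) β (M t) l (gzero N)) z s s else 0 := by
    intro z t
    rw [← (isLinear_gexec _ _ _ _).map_smul, ← hinit, ← h θ _ t z]
    rfl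
  have hz : ∀ g : Cfg Unit → ℂ, ∑ a, g a = ∑ z : Bool, g fun _ => z := fun g =>
    sum_equiv (Equiv.funUnique Unit Bool) _ _ fun u => rfl
  rw [hz]
  change (∑ z, ∑ t, ∑ s : Cfg (Fin N), if simCfg t z s (advEmb Tg N out) = β then
      F θ (QPK.place (strEmb Tg N) (kchan (fun (_ : Cfg Empty) t => (p θ t : ℂ)) 1))
        (simCfg t z s) (simCfg t z s) else 0).re = _
  simp only [hfin]
  rw [sum_comm, re_sum]
  refine sum_congr rfl fun t _ => ?_
  rw [← gprob_smul, gprob, re_sum]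
  refine sum_congr rfl fun z _ => ?_
  rw [re_sum]
  refine sum_congr rfl fun s _ => ?_
  split_ifs <;> rfl

/-! ### From circuits to algorithms and adversaries -/

lemma applyZ_compLeft (f : ι ↪ W) (G : Op ι →ₗ[ℂ] Op ι) (σ : Z → Op W) :
    applyZ f (G.compLeft Z) σ = fun z => applyOn f G (σ z) := by
  change applyZ f (fun ρ z => G (ρ z)) σ = _
  rw [applyZ_lift]

lemma place_empty (f : Empty ↪ Fin N) : place f 1 = zeroState N := by
  have h : ∀ b : Cfg (Fin N), ZeroOff f b ↔ b = fun _ => false := by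
    intro b
    constructor
    · intro h
      funext j
      refine h j ?_
      rintro ⟨i, -⟩
      exact i.elim
    · rintro rfl j _
      rfl
  ext b b'
  rw [place_apply, zeroState, pureState_ket, single_apply]
  simp only [h]
  rw [cfg_empty_eq (b ∘ f) (b' ∘ f), Matrix.one_apply_eq]
  congr 1
  simp [eq_comm]

lemma exists_qalg {s : ℕ} {G : Op ι → Op κ} (h : Circ noOracle s fun _ => G) :
    ∃ A : QAlg ι κ, A.size ≤ card ι + s ∧ ∀ ρ, A.run ρ = G ρ := by
  obtain ⟨N, inp, out, prog, hs, hF⟩ := Impl.normalForm h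
  have hg : ∀ l : List (Instr noOracle (Fin N)), ∃ gs : List (Gate N), gs.length = l.length ∧
      ∀ ρ, runInstr () l (fun _ => ρ) () = gs.foldl (fun σ g => g.apply σ) ρ := by
    intro l
    induction l with
    | nil => exact ⟨[], rfl, fun _ => rfl⟩
    | cons i l ih =>
      obtain ⟨gs, hl, hgs⟩ := ih
      cases i with
      | gate a ha f K hK =>
        refine ⟨⟨a, ha, f, K, hK⟩ :: gs, by simp [hl], fun ρ => ?_⟩
        rw [List.foldl_cons, ← hgs]
        change runInstr () l (applyZ f ((conjLin K).compLeft Unit) fun _ => ρ) () = _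
        rw [applyZ_compLeft, Gate.apply, conj_onWires]
        rfl
      | query o f => exact (o : Empty).elim
  obtain ⟨gs, hl, hgs⟩ := hg prog
  refine ⟨⟨N, inp, out, gs⟩, by rw [QAlg.size]; simpa [hl] using hs, fun ρ => ?_⟩
  have h1 : G ρ = keepWires out (runInstr () prog (fun _ => place inp ρ) ()) :=
    congrFun (hF () fun _ => ρ) ()
  rw [h1, hgs]
  rfl

/-- The oracle of the pseudorandomness experiment. -/
def prOracle (d n : ℕ) : Oracles (Amps d n) Unit where
  idx := Unit
  port _ := Fin d ⊕ Fin n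
  fin _ := inferInstanceAs (Fintype (Fin d ⊕ Fin n))
  dec _ := inferInstanceAs (DecidableEq (Fin d ⊕ Fin n))
  sem _ φ := (sqLin φ).compLeft Unit

/-- The effect of one instruction of a distinguisher. -/
def PRInstr.apply {d n N : ℕ} (φ : Amps d n) (ρ : Op (Fin N)) :
    PRInstr d n N → Op (Fin N)
  | .gate g => g.apply ρ
  | .query f => superQuery f φ ρ

lemma PRAdv.final_eq {d n : ℕ} (A : PRAdv d n) (φ : Amps d n) :
    A.final φ = A.prog.foldl (PRInstr.apply φ) (zeroState A.wires) := by
  rw [PRAdv.final]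
  congr 1
  funext ρ i
  cases i <;> rfl

lemma exists_prAdv {d n s : ℕ} {G : (Amps d n) → Op Empty → Op Unit}
    (h : Circ (prOracle d n) s G) : ∃ A : PRAdv d n, A.size ≤ s ∧ ∀ φ, A.accept φ =
    (G φ 1 (fun _ => true) (fun _ => true)).re := by
  obtain ⟨N, inp, out, prog, hs, hF⟩ := Impl.normalForm h
  have hg : ∀ l : List (Instr (prOracle d n) (Fin N)), ∃ gs : List (PRInstr d n N),
      gs.length = l.length ∧ ∀ φ ρ, runInstr φ l (fun _ => ρ) () = gs.foldl (PRInstr.apply φ) ρ :=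
          by
    intro l
    induction l with
    | nil => exact ⟨[], rfl, fun _ _ => rfl⟩
    | cons i l ih =>
      obtain ⟨gs, hl, hgs⟩ := ih
      cases i with
      | gate a ha f K hK =>
        refine ⟨.gate ⟨a, ha, f, K, hK⟩ :: gs, by simp [hl], fun φ ρ => ?_⟩
        rw [List.foldl_cons, ← hgs]
        change runInstr φ l (applyZ f ((conjLin K).compLeft Unit) fun _ => ρ) () = _
        rw [applyZ_compLeft, PRInstr.apply, Gate.apply, conj_onWires]
        rfl
      | query o f =>
        change Fin d ⊕ Fin n ↪ Fin N at f
        refine ⟨.query f :: gs, by simp [hl], fun φ ρ => ?_⟩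
        rw [List.foldl_cons, ← hgs]
        have h1 : applyZ (ι := Fin d ⊕ Fin n) f ((sqLin φ).compLeft Unit) (fun _ => ρ) =
            fun _ => superQuery f φ ρ := by
          rw [applyZ_compLeft]
          simp only [superQuery_eq]
          rfl
        exact congrArg (fun σ => runInstr φ l σ ()) h1
  obtain ⟨gs, hl, hgs⟩ := hg prog
  refine ⟨⟨N, gs, out ()⟩, by rw [PRAdv.size]; simpa [hl] using hs, fun φ => ?_⟩
  have h1 := congrFun (hF φ fun _ => 1) ()
  have h2 := congrFun (congrFun h1 fun _ => true) fun _ => true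
  have hu : out = unitEmb (out ()) := by
    ext u
    rfl
  simp only [place_empty, hgs] at h2
  rw [hu, keepWires_unit_diag] at h2
  rw [h2, re_sum]
  refine sum_congr rfl fun b _ => ?_
  change (if b (out ()) = true then _ else _) = _
  by_cases hb : b (out ()) = true
  · rw [if_pos hb, if_pos hb, PRAdv.final_eq]
  · rw [if_neg hb, if_neg hb]; rfl

lemma Circ.query {d n : ℕ} (f : Fin d ⊕ Fin n ↪ W) :
    Circ (prOracle d n) 1 fun φ (ρ : Op W) => QPK.applyOn f (sqChan φ) ρ := by
  have h := Impl.step (O := prOracle d n) (ι := W) (.query () f) Impl.id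
  rw [zero_add] at h
  have he : (fun φ (ρ : Unit → Op W) z => QPK.applyOn f (sqChan φ) (ρ z)) =
      fun φ ρ => applyZ (ι := Fin d ⊕ Fin n) f ((sqLin φ).compLeft Unit) ρ := by
    funext φ ρ
    rw [applyZ_compLeft]
    rfl
  rw [Circ, he]
  exact h

/-- A cloning adversary which makes no queries. -/
def QAlg.toCloneAdv {d c r : ℕ} (n : ℕ) (A : QAlg Empty (Fin d ⊕ (Fin r × Fin c))) :
    CloneAdv d n c where
  wires := A.wires
  prog := A.gates.map .gate
  slots := r
  out := A.out

lemma QAlg.win_toCloneAdv {d n c r : ℕ} (A : QAlg Empty (Fin d ⊕ (Fin r × Fin c)))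
    (ψ : Amps d n) (v : Cfg (Fin d) → Cfg (Fin c) → ℝ) :
    (A.toCloneAdv n).win ψ v = ∑ y, A.prob Empty.elim y * CloneAdv.score v (fun _ => 0)
    (fun j => y (inl j)) (fun i j => y (inr (i, j))) := by
  have hg : ∀ (gs : List (Gate A.wires)) (fin : (Cfg (Fin d) → ℕ) → Op (Fin A.wires) → ℝ)
      (t : Cfg (Fin d) → ℕ) (ρ : Op (Fin A.wires)),
      CloneAdv.exec ψ v fin (gs.map .gate) t ρ = fin t (gs.foldl (fun σ g => g.apply σ) ρ) := by
    intro gs fin t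
    induction gs with
    | nil => exact fun _ => rfl
    | cons g gs ih => exact fun ρ => ih (g.apply ρ)
  refine (hg A.gates _ _ _).trans ?_
  have hp : zeroState A.wires = conj (placeWires A.inp) (pureState (ket Empty.elim)) := by
    rw [← place_empty A.inp, pureState_ket]
    change place A.inp 1 = place A.inp _
    congr 1
  change (∑ b : Cfg (Fin A.wires), (A.gates.foldl (fun σ g => g.apply σ)
    (zeroState A.wires) b b).re * CloneAdv.score v (fun _ => 0)
      (fun j => b (A.out (inl j))) (fun i j => b (A.out (inr (i, j))))) = _
  rw [hp]
  have h := sum_keepWires_diag A.out (A.gates.foldl (fun σ g => g.apply σ)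
    (conj (placeWires A.inp) (pureState (ket Empty.elim)))) fun y => (CloneAdv.score v (fun _ => 0)
      (fun j => y (inl j)) (fun i j => y (inr (i, j))) : ℂ)
  have h' := congrArg Complex.re h
  simp only [re_sum, Complex.re_mul_ofReal] at h'
  exact h'.symm

end Simulation

section Preparation

variable {Θ Z : Type} {ι κ μ W α β K : Type}

variable [Fintype ι] [DecidableEq ι] [Fintype κ] [DecidableEq κ] [Fintype μ] [DecidableEq μ]
  [Fintype W] [DecidableEq W]
  [Fintype α] [DecidableEq α] [Fintype β] [DecidableEq β] [Fintype K] [DecidableEq K]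
  {O : Oracles Θ Z}

/-! ### Preparing pure states -/

lemma conj_pureState {S : Type} [Fintype S] [DecidableEq S] (L : Matrix (Cfg S) (Cfg ι) ℂ)
    (v : Cfg ι → ℂ) : conj L (pureState v) = pureState (L *ᵥ v) := by
  rw [conj, pureState, pureState, Matrix.mul_vecMulVec, Matrix.vecMulVec_mul, Matrix.star_mulVec]

/-- A circuit which maps `|a⟩` to the pure state `u θ a`. -/
def StatePrep (O : Oracles Θ Z) (s : ℕ) (u : Θ → Cfg α → Cfg β → ℂ) : Prop :=
  ∃ G : Θ → Op α → Op β, Circ O s G ∧ ∀ θ a, G θ (pureState (ket a)) = pureState (u θ a)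

lemma StatePrep.weaken {s s' : ℕ} {u : Θ → Cfg α → Cfg β → ℂ} (h : StatePrep O s u)
    (hs : s ≤ s') : StatePrep O s' u := by
  obtain ⟨G, hG, h⟩ := h
  exact ⟨G, hG.weaken hs, h⟩

lemma StatePrep.comp {s s' : ℕ} {u : Θ → Cfg α → Cfg β → ℂ} (h : StatePrep O s u)
    {F : Θ → Op β → Op κ} (hF : Circ O s' F) {v : Θ → Cfg α → Cfg κ → ℂ}
    (hv : ∀ θ a, F θ (pureState (u θ a)) = pureState (v θ a)) : StatePrep O (s + s') v := by
  obtain ⟨G, hG, h⟩ := h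
  exact ⟨_, hG.comp hF, fun θ a => by rw [h, hv]⟩

lemma StatePrep.fix [Nonempty Z] {s : ℕ} {u : Θ → Cfg α → Cfg β → ℂ} (h : StatePrep O s u)
    (a : Cfg α) : Prep O (6 * card α + s) fun θ => pureState (u θ a) := by
  obtain ⟨G, hG, h⟩ := h
  have hc : KCirc O (6 * card α) fun _ => QPK.det fun _ : Cfg Empty => a := KCirc.const a
  refine (Circ.comp hc hG).congr fun θ ρ => ?_
  have hk : kchan (QPK.det fun _ : Cfg Empty => a) ρ = ρ.trace • pureState (ket a) := by
    ext y y'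
    have hd : ∑ c, ρ c c * QPK.det (fun _ : Cfg Empty => a) c y =
        ρ.trace * if y = a then 1 else 0 := by
      rw [trace, sum_mul]
      rfl
    rw [kchan_apply, hd, Matrix.smul_apply, pureState_ket, single_apply]
    by_cases h1 : y = a <;> by_cases h2 : y = y'
    · subst h1; subst h2; simp
    · subst h1; simp [h2]
    · subst h2; simp [h1, Ne.symm h1]
    · simp [h2, Ne.symm h1]
  obtain ⟨L, hL⟩ := hG.linear θ
  rw [hk, hL, map_smul, ← hL, h]

lemma StatePrep.pi [Nonempty Z] {s : ℕ} {u : K → Θ → Cfg α → Cfg β → ℂ}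
    (h : ∀ i, StatePrep O s (u i)) : StatePrep O (card K * s) fun θ (a : Cfg (K × α))
    (b : Cfg (K × β)) => ∏ i, u i θ (slot a i) (slot b i) := by
  choose G hG h using h
  refine ⟨_, Circ.pi fun i => (hG i).cchan_coef, fun θ a => ?_⟩
  ext y y'
  rw [cchan_apply, pureState_ket, sum_eq_single a, sum_eq_single a, single_apply_same,
    one_mul, piCoef, pureState_apply, star_prod, ← prod_mul_distrib]
  · refine prod_congr rfl fun i _ => ?_
    rw [coef, ← pureState_ket, h, pureState_apply]
  · intro b _ hb
    simp [Ne.symm hb]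
  · simp
  · intro b _ hb
    refine sum_eq_zero fun c _ => ?_
    simp [Ne.symm hb]
  · simp

lemma StatePrep.of_empty [Nonempty Z] {s : ℕ} [IsEmpty μ] {u : Θ → Cfg μ → Cfg β → ℂ}
    (h : StatePrep O s u) (a : Cfg μ) : StatePrep O s fun θ (_ : Cfg Empty) => u θ a := by
  obtain ⟨G, hG, h⟩ := h
  refine ⟨_, (((Circ.place (O := O) (⟨Empty.elim, fun i => i.elim⟩ : Empty ↪ μ)).comp
    hG).weaken (by simp)), fun θ b => ?_⟩
  have : place (⟨Empty.elim, fun i => i.elim⟩ : Empty ↪ μ) (pureState (ket b)) =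
      pureState (ket a) := by
    ext c c'
    have h0 : ∀ c : Cfg μ, ZeroOff (⟨Empty.elim, fun i => i.elim⟩ : Empty ↪ μ) c :=
      fun c j => (IsEmpty.false j).elim
    rw [place_apply, if_pos ⟨h0 c, h0 c'⟩, pureState_ket, pureState_ket, cfg_empty_eq c a,
      cfg_empty_eq c' a, single_apply_same]
    exact (congrArg₂ (single b b (1 : ℂ)) (cfg_empty_eq _ b) (cfg_empty_eq _ b)).trans
      (single_apply_same b b 1)
  rw [this, h]

lemma StatePrep.prep [Nonempty Z] {s : ℕ} {u : Θ → Cfg Empty → Cfg β → ℂ}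
    (h : StatePrep O s u) (a : Cfg Empty) : Prep O s fun θ => pureState (u θ a) :=
  (h.fix a).weaken (by simp)

lemma place_pureState (f : ι ↪ W) (v : Cfg ι → ℂ) [DecidablePred (ZeroOff f)] :
    place f (pureState v) = pureState fun b => if ZeroOff f b then v (b ∘ f) else 0 := by
  ext b b'
  rw [place_apply, pureState_apply, pureState_apply]
  by_cases h : ZeroOff f b <;> by_cases h' : ZeroOff f b' <;> simp [h, h']

lemma keepWires_equiv_pureState (e : κ ≃ ι) (v : Cfg ι → ℂ) :
    keepWires e.toEmbedding (pureState v) = pureState fun y => v (y ∘ e.symm) := by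
  ext y y'
  rw [keepWires_equiv, pureState_apply, pureState_apply]

lemma keepWires_inr_pureState (a : Cfg ι) (ψ : Cfg ι → Cfg κ → ℂ) :
    keepWires (Embedding.inr : κ ↪ ι ⊕ κ)
    (pureState fun b => ket a (b ∘ inl) * ψ (b ∘ inl) (b ∘ inr)) = pureState (ψ a) := by
  ext y y'
  rw [keepWires_apply, sum_cfgSum, sum_eq_single a]
  · rw [sum_eq_single y]
    · rw [if_pos (by rfl), splice_inr, pureState_apply, pureState_apply]
      simp [ket]
    · intro b _ hb
      exact if_neg hb
    · simp
  · intro b _ hb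
    refine sum_eq_zero fun c _ => ?_
    rw [pureState_apply]
    simp [ket, hb]
  · simp

lemma StatePrep.plusQubit [Nonempty Z] :
    StatePrep O 2 fun _ (_ : Cfg Empty) (_ : Cfg Unit) => (((√2 : ℝ) : ℂ)⁻¹) := by
  obtain ⟨G, hG, h⟩ := Circ.plusQubit (O := O)
  exact ⟨_, hG, fun _ a => by rw [pureState_ket, h]⟩

lemma StatePrep.plus [Nonempty Z] : StatePrep O (2 * card κ) fun _ (_ : Cfg Empty) (_ : Cfg κ)
    => (((√(2 ^ card κ))⁻¹ : ℝ) : ℂ) := by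
  have h := (StatePrep.pi (O := O) fun _ : κ => StatePrep.plusQubit).of_empty
    (fun p => p.2.elim)
  refine ((h.comp (Circ.keep (Equiv.prodPUnit κ).symm.toEmbedding) (v := fun _ _ _ =>
    (((√(2 ^ card κ))⁻¹ : ℝ) : ℂ)) fun _ _ => ?_).weaken (by linarith))
  rw [keepWires_equiv_pureState]
  congr 1
  funext y
  have h2 : √(2 ^ card κ) = √2 ^ card κ := by
    rw [Real.sqrt_eq_iff_mul_self_eq (by positivity) (by positivity), ← mul_pow,
      Real.mul_self_sqrt (by norm_num)]
  rw [prod_const, card_univ, h2]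
  push_cast
  rw [inv_pow]

/-! ### Oracle queries and the generation circuit -/

lemma sqChan_place_inl (φ : Cfg ι → Cfg κ → ℂ) (p : Cfg ι → ℂ) :
    sqChan φ (place Embedding.inl (pureState p)) = pureState fun b => p (b ∘ inl) * φ (b ∘ inl)
    (b ∘ inr) := by
  classical
  ext b b'
  rw [sqChan, of_apply, pureState_apply, sum_eq_single fun _ => false]
  · rw [place_inl, if_pos ⟨rfl, rfl⟩, pureState_apply]
    simp only [elim_comp_inl, star_mul']
    ring
  · intro s _ hs
    rw [place_inl, if_neg]
    exact fun h => hs h.1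
  · simp

lemma StatePrep.query {d n s : ℕ} {p : Cfg (Fin d) → ℂ}
    (h : StatePrep (prOracle d n) s fun _ (_ : Cfg Empty) => p) : StatePrep (prOracle d n)
    (s + n + 1) fun φ (_ : Cfg Empty) (b : Cfg (Fin d ⊕ Fin n)) => p (b ∘ inl) * φ (b ∘ inl)
    (b ∘ inr) := by
  have hq : Circ (prOracle d n) (n + 1) fun φ (ρ : Op (Fin d)) =>
      sqChan φ (place (Embedding.inl : Fin d ↪ Fin d ⊕ Fin n) ρ) :=
    (((Circ.place_inl (R := Fin n)).comp (Circ.query (Embedding.refl _))).weaken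
      (by simp)).congr fun φ ρ => by rw [applyOn_refl]
  exact (h.comp hq fun φ _ => sqChan_place_inl φ p).weaken (by omega)

/-- The uniform superposition of all the states of an oracle. -/
def slotState {d n : ℕ} (φ : Amps d n) (b : Cfg (Fin d ⊕ Fin n)) : ℂ :=
  (((√(2 ^ d))⁻¹ : ℝ) : ℂ) * φ (b ∘ inl) (b ∘ inr)

lemma StatePrep.slotOracle (d n : ℕ) :
    StatePrep (prOracle d n) (2 * d + n + 1) fun φ (_ : Cfg Empty) => slotState φ := by
  have h := (StatePrep.plus (O := prOracle d n) (κ := Fin d)).query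
  simp only [card_fin] at h
  exact h

lemma KCirc.destructOracle {d n c : ℕ} (D : QAlg (Fin n) (Fin c)) : KCirc (prOracle d n)
    (2 * d + (n + 1 + D.size) + 2 * c) fun φ (a : Cfg (Fin d)) y => (D.probPure (φ a) y : ℂ) := by
  have hq : Circ (prOracle d n) (n + 1 + D.size) fun φ (ρ : Op (Fin d)) =>
      D.run (keepWires Embedding.inr
        (sqChan φ (place (Embedding.inl : Fin d ↪ Fin d ⊕ Fin n) ρ))) :=
    (((((Circ.place_inl (R := Fin n)).comp (Circ.query (Embedding.refl _))).comp
      (Circ.keep Embedding.inr)).comp (Circ.run D)).weaken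
      (by simp)).congr fun φ ρ => by rw [applyOn_refl]
  refine ((KCirc.measured hq).weaken (by simp)).congr fun φ a y => ?_
  rw [coef, ← pureState_ket, sqChan_place_inl, keepWires_inr_pureState, QAlg.probPure]
  exact PosSemidef.diag_eq_re ((IsChan.run D).pos (posSemidef_pureState _)) y |>.symm

end Preparation

section Scheme

variable {Θ Z : Type} [Nonempty Z] {O : Oracles Θ Z} (P : PRFSPD)

lemma PRFSPD.gen_pureState (lam : ℕ) (v : Cfg (Fin (P.keyLen lam) ⊕ Fin (P.inLen lam)) → ℂ) :
    (P.gen lam).run (pureState v) = pureState fun b => v (b ∘ inl) * P.state lam (b ∘ inl ∘ inl)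
    (b ∘ inl ∘ inr) (b ∘ inr) := by
  rw [P.gen_spec, conj_pureState]
  congr 1
  funext b
  rw [mulVec, dotProduct, sum_eq_single (b ∘ inl)]
  · rw [of_apply, if_pos (by rfl), mul_comm]
    rfl
  · intro a _ ha
    rw [of_apply, if_neg (Ne.symm ha), zero_mul]
  · simp

lemma KCirc.destructGen (lam : ℕ) :
    KCirc O (2 * (P.keyLen lam + P.inLen lam) + ((P.gen lam).size + (P.destruct lam).size) +
        2 * P.proofLen lam)
      fun _ (a : Cfg (Fin (P.keyLen lam) ⊕ Fin (P.inLen lam))) y =>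
        ((P.destruct lam).probPure (P.state lam (a ∘ inl) (a ∘ inr)) y : ℂ) := by
  have hq : Circ O ((P.gen lam).size + (P.destruct lam).size) fun _ ρ =>
      (P.destruct lam).run (keepWires Embedding.inr ((P.gen lam).run ρ)) :=
    ((Circ.run _).comp (Circ.keep Embedding.inr)).comp (Circ.run _)
  refine ((KCirc.measured hq).weaken (by simp)).congr fun φ a y => ?_
  have hg : (P.gen lam).run (pureState (ket a)) = pureState fun b => ket a (b ∘ inl) *
      (fun x : Cfg (Fin (P.keyLen lam) ⊕ Fin (P.inLen lam)) =>
        P.state lam (x ∘ inl) (x ∘ inr)) (b ∘ inl) (b ∘ inr) :=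
    P.gen_pureState lam _
  rw [coef, ← pureState_ket]
  rw [hg]
  have hk := keepWires_inr_pureState a
    (fun x : Cfg (Fin (P.keyLen lam) ⊕ Fin (P.inLen lam)) =>
        P.state lam (x ∘ inl) (x ∘ inr))
  erw [hk]
  exact PosSemidef.diag_eq_re ((IsChan.run _).pos (posSemidef_pureState _)) y |>.symm

/-- A bound for the sizes of the building blocks of the scheme. -/
def PRFSPD.cost (lam : ℕ) : ℕ :=
  8 * (P.keyLen lam + P.inLen lam + P.outLen lam + P.proofLen lam) + (P.gen lam).size +
    (P.destruct lam).size + (P.ver lam).size + 1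

lemma KCirc.fakeProof (lam : ℕ) : KCirc O (2 * P.cost lam) fun _ (a : P.Input lam)
    y => (Construction.fakeProof P lam a y : ℂ) := by
  have h1 := KCirc.uniform (O := O) (ι := Empty) (κ := Fin (P.keyLen lam))
  have h2 := (KCirc.destructGen (O := O) P lam).comap (Equiv.sumComm _ _)
  refine ((h1.bind h2 (Empty.elim : Empty → Fin (P.inLen lam))).weaken ?_).congr fun _ a y => ?_
  · simp only [card_sum, card_fin, card_empty, PRFSPD.cost]
    omega
  · rw [Construction.fakeProof, avg]
    push_cast
    rw [sum_div]
    refine sum_congr rfl fun k _ => ?_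
    rw [card_fin, div_eq_mul_one_div, mul_comm]
    rfl

lemma StatePrep.slotGen (lam : ℕ) : StatePrep O (P.cost lam) fun _ (k : P.Seed lam)
    => slotState (P.state lam k) := by
  have hp : Prep O (2 * P.inLen lam) fun _ => pureState fun _ : P.Input lam =>
      (((√(2 ^ P.inLen lam))⁻¹ : ℝ) : ℂ) := by
    have h := (StatePrep.plus (O := O) (κ := Fin (P.inLen lam))).prep Empty.elim
    simp only [card_fin] at h
    exact h
  have h1 := ((((Circ.place_inl (O := O) (ι := Fin (P.keyLen lam)) (R := Fin (P.inLen lam))).comp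
    (Circ.replace hp Embedding.inr)).comp (Circ.run (P.gen lam))).comp
      (Circ.keep (Equiv.sumAssoc _ _ _).symm.toEmbedding)).comp
      (Circ.keep Embedding.inr)
  refine ⟨_, h1.weaken ?_, fun _ k => ?_⟩
  · simp only [card_fin, PRFSPD.cost]
    omega
  · have h2 : applyOn Embedding.inr (fun ρ => ρ.trace • pureState
        fun _ : P.Input lam => (((√(2 ^ P.inLen lam))⁻¹ : ℝ) : ℂ))
        (place (Embedding.inl : _ ↪ _ ⊕ Fin (P.inLen lam)) (pureState (ket k))) =
        pureState fun b => ket k (b ∘ inl) * (((√(2 ^ P.inLen lam))⁻¹ : ℝ) : ℂ) := by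
      classical
      ext b b'
      rw [applyOn_apply, Matrix.smul_apply, trace, sum_eq_single fun _ => false]
      · rw [diag_apply, of_apply, splice_inr, splice_inr, place_inl, if_pos ⟨rfl, rfl⟩,
          pureState_apply, pureState_apply, pureState_apply, smul_eq_mul]
        simp only [elim_comp_inl, star_mul']
        ring
      · intro s _ hs
        rw [diag_apply, of_apply, splice_inr, splice_inr, place_inl, if_neg]
        exact fun h => hs h.1
      · simp
    beta_reduce
    rw [h2, P.gen_pureState, keepWires_equiv_pureState]
    exact (congrArg (fun v => keepWires Embedding.inr (pureState v))
      (funext fun b => mul_assoc _ _ _)).trans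
        (keepWires_inr_pureState k fun k => slotState (P.state lam k))

end Scheme

open Construction

section Products

variable {E T X : Type} [Fintype E] [DecidableEq E] [Fintype T] [Fintype X]

/-! ### Sums over product distributions -/

lemma sum_update_swap {M : Type*} [AddCommMonoid M] (e : E) (F : (E → T) → T → M) :
    ∑ f, ∑ y, F f y = ∑ f, ∑ y, F (update f e y) (f e) := by
  rw [← sum_prod_type', ← sum_prod_type']
  let s : (E → T) × T → (E → T) × T := fun p => (update p.1 e p.2, p.1 e)
  have hs : Function.Involutive s := fun p => by simp [s]
  exact (Equiv.sum_comp hs.toPerm fun p : (E → T) × T => F p.1 p.2).symm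

lemma sum_prod_eq_one {p : E → T → ℝ} (hp : ∀ e, ∑ t, p e t = 1) :
    ∑ f : E → T, ∏ e, p e (f e) = 1 := by
  classical
  rw [← Fintype.piFinset_univ, ← Finset.prod_univ_sum]
  exact prod_eq_one fun e _ => hp e

lemma sum_prod_mul (c : E → T → ℝ) (e : E) (hc : ∑ t, c e t = 1) (d : T → ℝ) (g : (E → T) → ℝ) :
    ∑ f, (∏ i, c i (f i)) * ∑ y, d y * g (update f e y) = ∑ f, (∏ i ∈ univ.erase e, c i (f i)) *
    (d (f e) * g f) := by
  simp only [mul_sum]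
  rw [sum_update_swap e]
  refine sum_congr rfl fun f _ => ?_
  have h : ∀ y, ∏ i, c i (update f e y i) = c e y * ∏ i ∈ univ.erase e, c i (f i) := by
    intro y
    rw [← mul_prod_erase _ _ (mem_univ e), update_self]
    congr 1
    refine prod_congr rfl fun i hi => ?_
    rw [update_of_ne (ne_of_mem_erase hi)]
  simp only [h, Function.update_idem, Function.update_eq_self]
  rw [← sum_mul, ← sum_mul, hc, one_mul]

/-- Replacing the factors of a product distribution one by one. -/
lemma abs_sum_prod_sub_le {a b : E → T → ℝ} (ha : ∀ e t, 0 ≤ a e t) (ha1 : ∀ e, ∑ t, a e t = 1)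
    (hb : ∀ e t, 0 ≤ b e t) (hb1 : ∀ e, ∑ t, b e t = 1) (g : (E → T) → ℝ) {ε : ℝ}
    (h : ∀ e f, |∑ y, (a e y - b e y) * g (update f e y)| ≤ ε) :
    |∑ f, (∏ e, a e (f e)) * g f - ∑ f, (∏ e, b e (f e)) * g f| ≤ card E * ε := by
  have key : ∀ S : Finset E, |∑ f, (∏ e, a e (f e)) * g f -
      ∑ f, (∏ e, (if e ∈ S then b e else a e) (f e)) * g f| ≤ S.card * ε := by
    intro S
    induction S using induction_on with
    | empty => simp
    | insert e S he ih =>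
      set c : E → T → ℝ := fun i => if i ∈ S then b i else a i
      have hc0 : ∀ i t, 0 ≤ c i t := fun i t => by
        simp only [c]
        split_ifs
        exacts [hb i t, ha i t]
      have hc1 : ∀ i, ∑ t, c i t = 1 := fun i => by
        simp only [c]
        split_ifs
        exacts [hb1 i, ha1 i]
      have hce : c e = a e := if_neg he
      have h1 : ∑ f, (∏ i, c i (f i)) * g f -
          ∑ f, (∏ i, (if i ∈ insert e S then b i else a i) (f i)) * g f =
          ∑ f, (∏ i, c i (f i)) * ∑ y, (a e y - b e y) * g (update f e y) := by
        rw [sum_prod_mul c e (hc1 e), ← sum_sub_distrib]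
        refine sum_congr rfl fun f _ => ?_
        rw [← mul_prod_erase _ _ (mem_univ e), ← mul_prod_erase (a := e) univ
            (fun i : E => (if i ∈ insert e S then b i else a i : T → ℝ) (f i)) (mem_univ e), hce,
                if_pos (Finset.mem_insert_self e S)]
        have h2 : ∏ i ∈ univ.erase e, (if i ∈ insert e S then b i else a i) (f i) =
            ∏ i ∈ univ.erase e, c i (f i) := by
          refine prod_congr rfl fun i hi => ?_
          simp only [c, Finset.mem_insert, ne_of_mem_erase hi, false_or]
        rw [h2]
        ring
      have h2 : |∑ f, (∏ i, c i (f i)) * ∑ y, (a e y - b e y) * g (update f e y)| ≤ ε := by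
        calc _ ≤ ∑ f, |(∏ i, c i (f i)) * ∑ y, (a e y - b e y) * g (update f e y)| :=
              abs_sum_le_sum_abs _ _
          _ ≤ ∑ f : E → T, (∏ i, c i (f i)) * ε := by
              refine sum_le_sum fun f _ => ?_
              have h0 : 0 ≤ ∏ i, c i (f i) := prod_nonneg fun i _ => hc0 i _
              rw [abs_mul, abs_of_nonneg h0]
              exact mul_le_mul_of_nonneg_left (h e f) h0
          _ = ε := by rw [← sum_mul, sum_prod_eq_one hc1, one_mul]
      rw [← h1] at h2
      have h3 := abs_sub_le (∑ f, (∏ e, a e (f e)) * g f) (∑ f, (∏ i, c i (f i)) * g f)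
        (∑ f, (∏ i, (if i ∈ insert e S then b i else a i) (f i)) * g f)
      rw [Finset.card_insert_of_notMem he]
      push_cast
      linarith [h3.trans (add_le_add ih h2)]
  simpa using key univ

/-- The probability of a collision among independent uniform strings. -/
lemma sum_not_injective_le [DecidableEq X] [Nonempty X] : ∑ x : E → X,
    (if Injective x then 0 else (1 / card X : ℝ) ^ card E) ≤ (card E : ℝ) ^ 2 * (1 / card X) := by
  classical
  set q : ℝ := 1 / card X
  have hX : (card X : ℝ) ≠ 0 := Nat.cast_ne_zero.mpr card_ne_zero
  have hq : 0 ≤ q := by positivity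
  have h1 : ∀ e e' : E, e ≠ e' → ∑ x : E → X, (if x e = x e' then q ^ card E else 0) = q := by
    intro e e' hne
    have h2 : ∑ x : E → X, ∑ _y : X, (if x e = x e' then q ^ card E else 0) =
        ∑ x : E → X, ∑ y : X, (if y = x e' then q ^ card E else 0) := by
      rw [sum_update_swap e]
      refine sum_congr rfl fun x _ => sum_congr rfl fun y _ => ?_
      rw [update_self, update_of_ne hne.symm]
    simp only [sum_const, card_univ, sum_ite_eq', mem_univ, if_true,
      card_fun, nsmul_eq_mul, Nat.cast_pow] at h2
    rw [← mul_sum, ← mul_pow, mul_one_div_cancel hX, one_pow] at h2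
    exact eq_one_div_of_mul_eq_one_right h2
  calc _ ≤ ∑ x : E → X, ∑ e : E, ∑ e' : E, (if e ≠ e' ∧ x e = x e' then q ^ card E else 0) := by
        refine sum_le_sum fun x _ => ?_
        have hn : ∀ e e' : E, 0 ≤ if e ≠ e' ∧ x e = x e' then q ^ card E else 0 :=
          fun e e' => by split_ifs <;> positivity
        split_ifs with hx
        · exact sum_nonneg fun e _ => sum_nonneg fun e' _ => hn e e'
        · obtain ⟨e, e', h, hne⟩ := by
            simpa only [Injective, not_forall] using hx
          refine le_trans ?_ (single_le_sum (fun e _ => sum_nonneg fun e' _ =>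
            hn e e') (mem_univ e))
          refine le_trans ?_ (single_le_sum (fun e' _ => hn e e') (mem_univ e'))
          rw [if_pos ⟨hne, h⟩]
    _ = ∑ e : E, ∑ e' : E, ∑ x : E → X, (if e ≠ e' ∧ x e = x e' then q ^ card E else 0) := by
        rw [sum_comm]
        exact sum_congr rfl fun e _ => sum_comm
    _ ≤ ∑ e : E, ∑ e' : E, q := by
        refine sum_le_sum fun e _ => sum_le_sum fun e' _ => ?_
        by_cases hne : e = e'
        · simp [hne, hq]
        · simp only [ne_eq, hne, not_false_eq_true, true_and]
          exact (h1 e e' hne).le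
    _ = _ := by simp [sq, mul_assoc]

lemma one_sub_sum_le_prod (s : Finset E) {a : E → ℝ} (h0 : ∀ e, 0 ≤ a e) (h1 : ∀ e, a e ≤ 1) :
    1 - ∑ e ∈ s, a e ≤ ∏ e ∈ s, (1 - a e) := by
  induction s using induction_on with
  | empty => simp
  | insert e s he ih =>
    rw [sum_insert he, prod_insert he]
    have h2 : ∏ i ∈ s, (1 - a i) ≤ 1 :=
      prod_le_one (fun i _ => by linarith [h1 i]) fun i _ => by linarith [h0 i]
    nlinarith [h0 e, h1 e]

end Products

/-! ### Public-key states -/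

section PublicKey

variable {s d n c : ℕ}

/-- The public key with the states `u i x` in slot `i`. -/
def pkVec (u : Fin s → Amps d n) (b : Cfg (KeyW s d n c)) : ℂ :=
  if flag b = false ∧ bit b = (fun _ => false) ∧ prf b = (fun _ _ => false) then
    ∏ i, (((√(2 ^ d))⁻¹ : ℝ) : ℂ) * u i (str b i) (sys b i)
  else 0

/-- The wires of the strings and states. -/
def slotWires (s d n c : ℕ) : Fin s × (Fin d ⊕ Fin n) ↪ KeyW s d n c :=
  ⟨fun p => inr (p.1, inl p.2), fun p q h => by
    have h' := inr.inj h
    rw [Prod.mk.injEq] at h'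
    exact Prod.ext h'.1 (inl.inj h'.2)⟩

lemma zeroOff_slotWires (b : Cfg (KeyW s d n c)) : ZeroOff (slotWires s d n c) b ↔
    flag b = false ∧ bit b = (fun _ => false) ∧ prf b = (fun _ _ => false) := by
  constructor
  · intro h
    refine ⟨h _ ?_, funext fun i => h _ ?_, funext fun i => funext fun j => h _ ?_⟩
    · rintro ⟨q, hq⟩
      exact absurd hq inr_ne_inl
    all_goals
      rintro ⟨q, hq⟩
      have hq' := inr.inj hq
      simp at hq'
  · rintro ⟨h1, h2, h3⟩ w hw
    rcases w with _ | ⟨i, (w | (_ | j))⟩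
    · exact h1
    · exact absurd ⟨(i, w), rfl⟩ hw
    · exact congrFun h2 i
    · exact congrFun (congrFun h3 i) j

lemma pureState_pkVec (u : Fin s → Amps d n) : place (slotWires s d n c)
    (pureState fun b => ∏ i, slotState (u i) (slot b i)) = pureState (pkVec (c := c) u) := by
  classical
  rw [place_pureState]
  congr 1
  funext b
  rw [pkVec]
  simp only [zeroOff_slotWires]
  rfl

variable {Θ Z : Type} [Nonempty Z] {O : Oracles Θ Z}

lemma Prep.pkVec {t : ℕ} {u : Fin s → Θ → Amps d n}
    (h : ∀ i, StatePrep O t fun θ (_ : Cfg Empty) => slotState (u i θ)) :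
    Prep O (s * t + (1 + s * (d + n + 1 + c))) fun θ => pureState (QPK.pkVec (c :=
    c) fun i => u i θ) := by
  have h1 := (StatePrep.pi (O := O) h).of_empty fun p => p.2.elim
  have h2 := h1.comp (Circ.place (slotWires s d n c)) (v := fun θ _ => QPK.pkVec fun i => u i θ)
    fun θ _ => pureState_pkVec _
  refine Circ.weaken (h2.prep Empty.elim) ?_
  simp only [card_fin, card_sum, card_prod, card_unit]
  have e : s * (d + n + 1 + c) = s * (d + n + (1 + c)) := by ring
  omega

lemma sum_norm_pkVec (u : Fin s → Amps d n) :
    ∑ b, ‖pkVec (c := c) u b‖ ^ 2 = ∏ i, ((2 ^ d)⁻¹ * ∑ x, ∑ b, ‖u i x b‖ ^ 2) := by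
  have h := trace_pureState (pkVec (c := c) u)
  rw [← pureState_pkVec, (IsChan.place _).tr, trace_pureState] at h
  rw [← Complex.ofReal_inj.mp h]
  have e : ∀ b : Cfg (Fin s × (Fin d ⊕ Fin n)), ‖∏ i, slotState (u i) (slot b i)‖ ^ 2 =
      ∏ i, ‖slotState (u i) (slot b i)‖ ^ 2 := fun b => by
    rw [norm_prod, Finset.prod_pow]
  simp only [e]
  rw [← Equiv.sum_comp (Equiv.curry (Fin s) (Fin d ⊕ Fin n) Bool).symm]
  change ∑ f : Fin s → Cfg (Fin d ⊕ Fin n), ∏ i, ‖slotState (u i) (f i)‖ ^ 2 = _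
  have e2 := Finset.prod_univ_sum (fun _ : Fin s => (univ : Finset (Cfg (Fin d ⊕ Fin n))))
    fun i f => ‖slotState (u i) f‖ ^ 2
  rw [Fintype.piFinset_univ] at e2
  rw [← e2]
  refine prod_congr rfl fun i _ => ?_
  rw [sum_cfgSum, mul_sum]
  refine sum_congr rfl fun x _ => ?_
  rw [mul_sum]
  refine sum_congr rfl fun b _ => ?_
  rw [slotState, norm_mul, mul_pow]
  congr 1
  rw [Complex.norm_real, Real.norm_of_nonneg (by positivity), inv_pow, Real.sq_sqrt (by positivity)]

lemma pkVec_norm {u : Fin s → Amps d n}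
    (h : ∀ i x, ∑ b, ‖u i x b‖ ^ 2 = 1) : ∑ b, ‖pkVec (c := c) u b‖ ^ 2 = 1 := by
  rw [sum_norm_pkVec]
  refine prod_eq_one fun i _ => ?_
  simp [h]

/-- Changing a single state of a single slot hardly changes the public key. -/
lemma sum_norm_pkVec_sub_le {u u' : Fin s → Amps d n}
    (h : ∀ i x, ∑ b, ‖u i x b‖ ^ 2 = 1) (h' : ∀ i x, ∑ b, ‖u' i x b‖ ^ 2 = 1) (i : Fin s)
    (x : Cfg (Fin d)) (he : ∀ j y, (j = i → y ≠ x) → u j y = u' j y) :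
    (√(2 ^ d)) ^ 2 * ∑ b, ‖pkVec (c := c) u b - pkVec u' b‖ ^ 2 ≤ 4 := by
  have hsub : ∀ b : Cfg (KeyW s d n c), pkVec u b - pkVec u' b =
      pkVec (fun j => if j = i then fun y b => u i y b - u' i y b else u j) b := by
    intro b
    simp only [pkVec]
    split_ifs
    · rw [← mul_prod_erase _ _ (mem_univ i),
        ← mul_prod_erase _ (fun j => _ * u' j (str b j) (sys b j)) (mem_univ i),
        ← mul_prod_erase (a := i) _ _ (mem_univ i), if_pos rfl]
      have e1 : ∏ j ∈ univ.erase i, (((√(2 ^ d))⁻¹ : ℝ) : ℂ) * u' j (str b j) (sys b j) =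
          ∏ j ∈ univ.erase i, (((√(2 ^ d))⁻¹ : ℝ) : ℂ) * u j (str b j) (sys b j) :=
        prod_congr rfl fun j hj => by
          rw [he j _ fun h => absurd h (ne_of_mem_erase hj)]
      have e2 : ∏ j ∈ univ.erase i, (((√(2 ^ d))⁻¹ : ℝ) : ℂ) *
          (if j = i then fun y b => u i y b - u' i y b else u j) (str b j) (sys b j) =
          ∏ j ∈ univ.erase i, (((√(2 ^ d))⁻¹ : ℝ) : ℂ) * u j (str b j) (sys b j) :=
        prod_congr rfl fun j hj => by
          rw [if_neg (ne_of_mem_erase hj)]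
      rw [e1, e2]
      ring
    · simp
  simp only [hsub]
  rw [sum_norm_pkVec, ← mul_prod_erase _ _ (mem_univ i), prod_eq_one, mul_one,
    Real.sq_sqrt (by positivity), ← mul_assoc, mul_inv_cancel₀ (by positivity), one_mul,
    sum_eq_single x]
  · simp only [if_true]
    calc _ ≤ ∑ b, (2 * ‖u i x b‖ ^ 2 + 2 * ‖u' i x b‖ ^ 2) := by
          refine sum_le_sum fun b _ => ?_
          have := norm_sq_comb_le (u i x b) (-u' i x b)
          rwa [norm_neg, ← sub_eq_add_neg] at this
      _ = 4 := by
          rw [sum_add_distrib, ← mul_sum, ← mul_sum, h, h']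
          norm_num
  · intro y _ hy
    simp only [if_true]
    refine sum_eq_zero fun b _ => ?_
    rw [he i y fun _ => hy]
    simp
  · simp
  · intro j hj
    simp [ne_of_mem_erase hj, h]

end PublicKey

section Observables

variable {d n : ℕ} {pk : Type} {ct : ℕ → Type} {Tg : Type} [Fintype Tg] [DecidableEq Tg]
  [Fintype pk] [DecidableEq pk] [∀ ℓ, Fintype (ct ℓ)] [∀ ℓ, DecidableEq (ct ℓ)]

/-! ### Quantities which are accessible to distinguishers -/

/-- `F φ` is a winning probability, averaged over a random bit, of oracle programs of size `s`. -/
def Observable (s : ℕ) (F : (Amps d n) → ℝ) : Prop :=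
  ∃ B : Bool → PRAdv d n, (∀ β, (B β).size ≤ s) ∧ ∀ φ, F φ = 1 / 2 * ∑ β, (B β).accept φ

lemma Observable.weaken {s s' : ℕ} {F : (Amps d n) → ℝ}
    (h : Observable s F) (hs : s ≤ s') : Observable s' F := by
  obtain ⟨B, hB, h⟩ := h
  exact ⟨B, fun β => (hB β).trans hs, h⟩

/-- A bound for the size of the programs which simulate the game. -/
def gameCost (tg N L st sp sM : ℕ) : ℕ := st + (N + 1) + L * stepCost tg N sp sM + 1

lemma Observable.game {sp sM st : ℕ} {v : (Amps d n) → Cfg pk → ℂ}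
    (hv : Prep (prOracle d n) sp fun φ => pureState (v φ))
    {p : (Amps d n) → Cfg Tg → ℝ}
    (hp : KCirc (prOracle d n) st fun φ (_ : Cfg Empty) t => (p φ t : ℂ))
    (A : CPAAdv pk ct) {M : Cfg Tg → ℕ → Kernel ct}
    (hM : ∀ r ℓ, ℓ ≤ A.wires → KCirc (prOracle d n) sM fun _ (a : Cfg (Tg ⊕ Fin ℓ)) c =>
      (M (a ∘ inl) r ℓ (a ∘ inr) c : ℂ)) (hM1 : ∀ t r, IsProbKernel (M t r)) :
    Observable (gameCost (card Tg) A.wires A.prog.length st sp sM)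
      fun φ => ∑ t, p φ t * gwin A (v φ) (M t) := by
  choose G hG h using fun β => exists_circ_game hv hp hM hM1 β A.prog A.out
  choose B hB hB' using fun β => exists_prAdv (hG β)
  refine ⟨B, hB, fun φ => ?_⟩
  simp only [hB', h]
  rw [sum_comm, mul_sum]
  refine sum_congr rfl fun t _ => ?_
  rw [gwin, ← mul_sum]
  ring

lemma continuous_onWires {X : Type*} [TopologicalSpace X] {ι W : Type} [Fintype ι]
    [DecidableEq ι] [Fintype W] [DecidableEq W] (f : ι ↪ W) {K : X → Op ι} (hK : Continuous K) :
    Continuous fun x => onWires f (K x) := by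
  refine continuous_matrix fun b b' => ?_
  simp only [onWires, of_apply]
  split_ifs
  · exact hK.matrix_elem _ _
  · exact continuous_const

lemma continuous_accept (A : PRAdv d n) :
    Continuous fun φ : States d n => A.accept (vecs φ) := by
  have hvec : ∀ x s, Continuous fun φ : States d n => vecs φ x s := by
    intro x s
    have h : Continuous fun φ : States d n => (φ x).1 :=
      continuous_subtype_val.comp (continuous_apply x)
    exact (PiLp.continuous_apply 2 _ s).comp h
  have key : ∀ (l : List (PRInstr d n A.wires))
      (g : (States d n) → Op (Fin A.wires)), Continuous g →
      Continuous fun φ => l.foldl (PRInstr.apply (vecs φ)) (g φ) := by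
    intro l
    induction l with
    | nil => exact fun g hg => hg
    | cons i l ih =>
      intro g hg
      refine ih _ ?_
      cases i with
      | gate U =>
        simp only [PRInstr.apply, Gate.apply, QPK.conj]
        exact (continuous_const.matrix_mul hg).matrix_mul continuous_const
      | query f =>
        simp only [PRInstr.apply, superQuery, QPK.conj]
        refine continuous_finsetSum _ fun s _ => ?_
        have hL := continuous_onWires f (K := fun φ : States d n =>
            (of fun b b' : Cfg (Fin d ⊕ Fin n) =>
              if b ∘ inl = b' ∘ inl ∧ b' ∘ inr = s
              then vecs φ (b ∘ inl) (b ∘ inr) else 0)) (by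
          refine continuous_matrix fun b b' => ?_
          simp only [of_apply]
          split_ifs
          · exact hvec _ _
          · exact continuous_const)
        exact (hL.matrix_mul hg).matrix_mul hL.matrix_conjTranspose
  simp only [PRAdv.accept, PRAdv.final_eq]
  refine continuous_finsetSum _ fun b _ => ?_
  split_ifs
  · exact Complex.continuous_re.comp ((key _ _ continuous_const).matrix_elem b b)
  · exact continuous_const

lemma Observable.continuous {s : ℕ} {F : (Amps d n) → ℝ}
    (h : Observable s F) : Continuous fun φ : States d n => F (vecs φ) := by
  obtain ⟨B, -, hB⟩ := h
  simp only [hB]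
  exact continuous_const.mul (continuous_finsetSum _ fun β _ => continuous_accept _)

lemma integrable_of_continuous {X : Type*} [TopologicalSpace X] [CompactSpace X]
    [MeasurableSpace X] [OpensMeasurableSpace X] (μ : Measure X) [IsFiniteMeasure μ] {F : X → ℝ}
    (h : Continuous F) : Integrable F μ :=
  h.integrable_of_hasCompactSupport (HasCompactSupport.of_compactSpace F)

lemma Observable.abs_sub_le {P : PRFSPD} {lam s : ℕ} {ε : ℝ} (hε : P.HaarBound lam s ε)
    {F : (P.Input lam → P.Output lam → ℂ) → ℝ} (h : Observable s F) :
    |avg (fun k => F (P.state lam k)) - ∫ φ, F (vecs φ) ∂P.haar lam| ≤ ε := by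
  obtain ⟨B, hs', hB⟩ := h
  have h1 := hε (B true) (hs' _)
  have h2 := hε (B false) (hs' _)
  simp only [hB, sum_bool]
  rw [integral_const_mul, integral_add (integrable_of_continuous _ (continuous_accept _))
    (integrable_of_continuous _ (continuous_accept _))]
  have e : avg (fun k => 1 / 2 * ((B true).accept (P.state lam k) +
      (B false).accept (P.state lam k))) = 1 / 2 * (avg (fun k => (B true).accept (P.state lam k)) +
        avg fun k => (B false).accept (P.state lam k)) := by
    rw [← avg_add, mul_comm, ← avg_mul_const]
    simp only [mul_comm]
  rw [e]
  rw [abs_le] at *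
  constructor <;> linarith [h1.1, h1.2, h2.1, h2.2]

/-! ### Resampling one of the Haar-random states -/

lemma measurePreserving_resample (x : Cfg (Fin d)) :
    MeasurePreserving (fun p : (States d n) × (States d n) =>
      update p.1 x (p.2 x)) ((haarPi d n).prod (haarPi d n)) (haarPi d n) := by
  have hm : Measurable fun p : (States d n) × (States d n) =>
      update p.1 x (p.2 x) := by
    refine measurable_pi_lambda _ fun y => ?_
    by_cases hy : y = x
    · subst hy
      simp only [update_self]
      exact (measurable_pi_apply y).comp measurable_snd
    · simp only [update_of_ne hy]
      exact (measurable_pi_apply y).comp measurable_fst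
  refine ⟨hm, ?_⟩
  refine (Measure.pi_eq fun s hs => ?_).symm
  rw [Measure.map_apply hm (MeasurableSet.univ_pi hs)]
  have e : (fun p : (States d n) × (States d n) =>
      update p.1 x (p.2 x)) ⁻¹' Set.univ.pi s = (Set.univ.pi (update s x Set.univ)) ×ˢ
        (Set.univ.pi (update (fun _ => Set.univ) x (s x))) := by
    ext p
    simp only [Set.mem_preimage, Set.mem_pi, Set.mem_univ, true_implies, Set.mem_prod]
    constructor
    · intro h
      refine ⟨fun y => ?_, fun y => ?_⟩
      · by_cases hy : y = x
        · subst hy; simp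
        · simpa [update_of_ne hy] using h y
      · by_cases hy : y = x
        · subst hy; simpa using h y
        · simp [update_of_ne hy]
    · rintro ⟨h1, h2⟩ y
      by_cases hy : y = x
      · subst hy; simpa using h2 y
      · simpa [update_of_ne hy] using h1 y
  rw [e, Measure.prod_prod, Measure.pi_pi, Measure.pi_pi, ← mul_prod_erase _ _ (mem_univ x),
    ← mul_prod_erase _ (fun y => haarState n (update (fun _ => Set.univ) x (s x) y))
      (mem_univ x), ← mul_prod_erase _ (fun y => haarState n (s y))
      (mem_univ x)]
  have e1 : ∏ y ∈ univ.erase x, haarState n (update s x Set.univ y) =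
      ∏ y ∈ univ.erase x, haarState n (s y) :=
    prod_congr rfl fun y hy => by rw [update_of_ne (ne_of_mem_erase hy)]
  have e2 : ∏ y ∈ univ.erase x, haarState n (update (fun _ => Set.univ) x (s x) y) = 1 :=
    prod_eq_one fun y hy => by
      rw [update_of_ne (ne_of_mem_erase hy), measure_univ]
  rw [e1, e2, update_self, update_self, measure_univ, one_mul, mul_one, mul_comm]

lemma abs_integral_resample_le {T : Type} [Fintype T] (x : Cfg (Fin d)) {D : T → StateSphere n → ℝ}
    (hD : ∀ t, Continuous (D t)) (hD0 : ∀ t s, 0 ≤ D t s) (hD1 : ∀ s, ∑ t, D t s = 1)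
    {F : T → (States d n) → ℝ} (hF : ∀ t, Continuous (F t)) {δ : ℝ}
    (hδ : ∀ t φ s, |F t (update φ x s) - F t φ| ≤ δ) : |∫ φ, ∑ t, D t (φ x) * F t φ ∂(haarPi d n)
    - ∑ t, (∫ φ, D t (φ x) ∂(haarPi d n)) * ∫ φ, F t φ ∂(haarPi d n)| ≤ δ := by
  have hx : Continuous fun p : (States d n) × (States d n) =>
      p.2 x := (continuous_apply x).comp continuous_snd
  have hu : Continuous fun p : (States d n) × (States d n) =>
      update p.1 x (p.2 x) := continuous_fst.update x hx
  have hc1 : Continuous fun φ : States d n => ∑ t, D t (φ x) * F t φ :=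
    continuous_finsetSum _ fun t _ => ((hD t).comp (continuous_apply x)).mul (hF t)
  have hi1 : ∀ t, Integrable (fun p : (States d n) ×
      (States d n) => D t (p.2 x) * F t p.1)
      ((haarPi d n).prod (haarPi d n)) := fun t =>
    integrable_of_continuous _ (((hD t).comp hx).mul ((hF t).comp continuous_fst))
  have hi2 : ∀ t, Integrable (fun p : (States d n) ×
      (States d n) => D t (p.2 x) * F t (update p.1 x (p.2 x)))
      ((haarPi d n).prod (haarPi d n)) := fun t =>
    integrable_of_continuous _ (((hD t).comp hx).mul ((hF t).comp hu))
  have e1 : ∫ φ, ∑ t, D t (φ x) * F t φ ∂(haarPi d n) =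
      ∫ p, ∑ t, D t (p.2 x) * F t (update p.1 x (p.2 x))
        ∂((haarPi d n).prod (haarPi d n)) := by
    have h1 := integral_map (μ := (haarPi d n).prod (haarPi d n)) (measurePreserving_resample (n :=
        n) x).measurable.aemeasurable
      hc1.aestronglyMeasurable
    rw [(measurePreserving_resample x).map_eq] at h1
    rw [h1]
    simp only [update_self]
  have e2 : ∑ t, (∫ φ, D t (φ x) ∂(haarPi d n)) * ∫ φ, F t φ ∂(haarPi d n) =
      ∫ p, ∑ t, D t (p.2 x) * F t p.1 ∂((haarPi d n).prod (haarPi d n)) := by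
    rw [integral_finsetSum _ fun t _ => hi1 t]
    refine sum_congr rfl fun t _ => ?_
    rw [mul_comm, ← integral_prod_mul]
    simp only [mul_comm]
  rw [e1, e2, ← integral_sub (integrable_finsetSum _ fun t _ => hi2 t)
    (integrable_finsetSum _ fun t _ => hi1 t)]
  have hb : ∀ p : (States d n) × (States d n),
      ‖∑ t, D t (p.2 x) * F t (update p.1 x (p.2 x)) - ∑ t, D t (p.2 x) * F t p.1‖ ≤ δ := by
    intro p
    rw [Real.norm_eq_abs, ← sum_sub_distrib]
    calc _ ≤ ∑ t, |D t (p.2 x) * F t (update p.1 x (p.2 x)) - D t (p.2 x) * F t p.1| :=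
          abs_sum_le_sum_abs _ _
      _ ≤ ∑ t, D t (p.2 x) * δ := by
          refine sum_le_sum fun t _ => ?_
          rw [← mul_sub, abs_mul, abs_of_nonneg (hD0 t _)]
          exact mul_le_mul_of_nonneg_left (hδ _ _ _) (hD0 t _)
      _ = δ := by rw [← sum_mul, hD1, one_mul]
  have := norm_integral_le_of_norm_le_const (μ := (haarPi d n).prod (haarPi d n))
    (Filter.Eventually.of_forall hb)
  simpa using this

lemma continuous_probPure {κ : Type} [Fintype κ] [DecidableEq κ] (D : QAlg (Fin n) κ)
    (y : Cfg κ) : Continuous fun s : StateSphere n => D.probPure (fun b => s.1 b) y := by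
  have h : ∀ b, Continuous fun s : StateSphere n => s.1 b := fun b =>
    (PiLp.continuous_apply 2 _ b).comp continuous_subtype_val
  have e : ∀ s : StateSphere n, D.probPure (fun b => s.1 b) y =
      (∑ u, ∑ u', s.1 u * star (s.1 u') * D.coeff y u u').re := fun s => by
    rw [← D.probPure_eq, Complex.ofReal_re]
  simp only [e]
  exact Complex.continuous_re.comp (continuous_finsetSum _ fun u _ =>
    continuous_finsetSum _ fun u' _ => ((h u).mul (h u').star).mul continuous_const)

/-- Distinct inputs give independent states. -/
lemma integral_prod_injective {E : Type} [Fintype E] {x : E → Cfg (Fin d)}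
    (hx : Injective x) {D : E → StateSphere n → ℝ}
    (hD : ∀ e, Continuous (D e)) :
    ∫ φ, ∏ e, D e (φ (x e)) ∂(haarPi d n) = ∏ e, ∫ φ, D e (φ (x e)) ∂(haarPi d n) := by
  classical
  let D' : Cfg (Fin d) → StateSphere n → ℝ := fun z s => ∏ e, if x e = z then D e s else 1
  have h1 : ∀ φ : States d n, ∏ e, D e (φ (x e)) = ∏ z, D' z (φ z) := by
    intro φ
    simp only [D']
    rw [Finset.prod_comm]
    exact prod_congr rfl fun e _ => by simp
  have h2 : ∀ z e, ∫ φ, D e (φ z) ∂(haarPi d n) = ∫ s, D e s ∂(haarState n) := fun z e =>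
    integral_comp_eval (μ := fun _ => haarState n) (i := z) (hD e).aestronglyMeasurable
  simp only [h1]
  rw [integral_fintype_prod_eq_prod]
  simp only [h2]
  have h3 : ∀ z, ∫ s, D' z s ∂(haarState n) =
      ∏ e, if x e = z then ∫ s, D e s ∂(haarState n) else 1 := by
    intro z
    by_cases hz : ∃ e, x e = z
    · obtain ⟨e, rfl⟩ := hz
      simp only [D', hx.eq_iff, Finset.prod_ite_eq', mem_univ, if_true]
    · push Not at hz
      simp [D', hz]
  simp only [h3]
  rw [Finset.prod_comm]
  exact prod_congr rfl fun e _ => by simp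

end Observables

section Wiring

variable {Θ Z : Type} [Nonempty Z] {ι κ μ : Type}

variable [Fintype ι] [DecidableEq ι] [Fintype κ] [DecidableEq κ] [Fintype μ] [DecidableEq μ]
  {O : Oracles Θ Z}

/-- Every bit of the output is a constant or a copy of a bit of `a`. -/
def rewire (p : κ → ι ⊕ Bool) (a : Cfg ι) : Cfg κ := fun j => elim a id (p j)

lemma KCirc.rewire {s : ℕ} {N : Θ → Cfg κ → Cfg μ → ℂ} (hN : KCirc O s N) (p : κ → ι ⊕ Bool) :
    KCirc O (4 * card ι + 8 * card κ + s) fun θ (a : Cfg ι) c => N θ (QPK.rewire p a) c := by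
  have h1 := KCirc.const (O := O) (ι := Empty) fun j => elim (fun _ => false) id (p j)
  have h2 := hN.comap fun j => elim (fun i => (inl i : ι ⊕ κ)) (fun _ => inr j) (p j)
  refine ((h1.bind h2 (Empty.elim : Empty → ι)).weaken ?_).congr fun θ a c => ?_
  · simp only [card_empty]
    omega
  · rw [sum_det (fun _ : Cfg Empty => fun j => elim (fun _ => false) id (p j)) _ fun x =>
      N θ (elim a x ∘ fun j => elim (fun i => inl i) (fun _ => inr j) (p j)) c]
    congr 1
    funext j
    simp only [QPK.rewire, Function.comp_apply]
    rcases hj : p j with i | v <;> simp [hj]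

lemma KCirc.wiring (p : κ → ι ⊕ Bool) :
    KCirc O (4 * card ι + 10 * card κ) fun _ => det (QPK.rewire p) :=
  ((KCirc.copy (O := O) (id : κ → κ)).rewire p).weaken (by omega)

end Wiring

section SlotStep

variable {P : PRFSPD} {S : SKE} {lam : ℕ}

/-- Encryption under a recycled public key: the symmetric key is `k`, and `r` is appended to the
symmetric ciphertext. -/
def recKernel (P : PRFSPD) (S : SKE) (lam : ℕ) (k : Cfg (S.Slot lam))
    (r : Cfg (S.Slot lam × (Fin (P.inLen lam) ⊕ Fin (P.proofLen lam)))) :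
    Kernel (Ct P S lam) := fun ℓ m z =>
  if z ∘ inr = r then S.encProb lam ℓ k m (z ∘ inl) else 0

lemma isProbKernel_recKernel (k : Cfg (S.Slot lam))
    (r : Cfg (S.Slot lam × (Fin (P.inLen lam) ⊕ Fin (P.proofLen lam)))) :
    IsProbKernel (recKernel P S lam k r) := by
  intro ℓ m
  constructor
  · intro z
    rw [recKernel]
    split_ifs
    exacts [QAlg.prob_nonneg _ _ _, le_rfl]
  · rw [sum_cfgSum, ← QAlg.sum_prob (S.enc lam ℓ) (elim k m)]
    refine sum_congr rfl fun c _ => ?_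
    have h : ∀ y, recKernel P S lam k r ℓ m (elim c y) =
        if y = r then S.encProb lam ℓ k m c else 0 := fun y => rfl
    simp only [h, sum_ite_eq', mem_univ, if_true]
    rfl

lemma card_le_size_inp {ι κ : Type} [Fintype ι] [Fintype κ] (A : QAlg ι κ) : card ι ≤ A.size := by
  have := card_le_of_embedding A.inp
  rw [card_fin] at this
  exact this.trans (Nat.le_add_right _ _)

lemma card_le_size_out {ι κ : Type} [Fintype ι] [Fintype κ] (A : QAlg ι κ) : card κ ≤ A.size := by
  have := card_le_of_embedding A.out
  rw [card_fin] at this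
  exact this.trans (Nat.le_add_right _ _)

/-- A bound for the size of the circuits for `recKernel`. -/
def recCost (P : PRFSPD) (S : SKE) (lam tg e : ℕ) : ℕ :=
  6 * tg + 20 * e + 10 * (S.keyLen lam * (P.inLen lam + P.proofLen lam))

variable {Θ Z : Type} [Nonempty Z] {O : Oracles Θ Z}

lemma KCirc.recKernel {Tg : Type} [Fintype Tg] [DecidableEq Tg] (k : Cfg (S.Slot lam))
    (q : S.Slot lam × (Fin (P.inLen lam) ⊕ Fin (P.proofLen lam)) → Tg ⊕ Bool) {ℓ e : ℕ}
    (he : (S.enc lam ℓ).size ≤ e) : KCirc O (recCost P S lam (card Tg) e)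
    fun _ (a : Cfg (Tg ⊕ Fin ℓ))
    c => (QPK.recKernel P S lam k (QPK.rewire q (a ∘ inl)) ℓ (a ∘ inr) c : ℂ) := by
  have h1 := (KCirc.prob (O := O) (S.enc lam ℓ)).rewire (elim (fun j => inr (k j)) inl :
    S.Slot lam ⊕ Fin ℓ → Fin ℓ ⊕ Bool)
  have h2 := (h1.both (KCirc.wiring (O := O) q)).comap (elim inr inl :
    Fin ℓ ⊕ Tg → Tg ⊕ Fin ℓ)
  have hi := card_le_size_inp (S.enc lam ℓ)
  have ho := card_le_size_out (S.enc lam ℓ)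
  refine (h2.weaken ?_).congr fun θ a z => ?_
  · simp only [card_sum, card_fin, card_prod, recCost] at *
    omega
  · rw [QPK.recKernel, det]
    have e1 : QPK.rewire (elim (fun j => inr (k j)) inl :
        S.Slot lam ⊕ Fin ℓ → Fin ℓ ⊕ Bool)
        ((a ∘ (elim inr inl : Fin ℓ ⊕ Tg → Tg ⊕ Fin ℓ)) ∘ inl) = elim k (a ∘ inr) := by
      funext j
      cases j <;> rfl
    have e2 : (a ∘ (elim inr inl : Fin ℓ ⊕ Tg → Tg ⊕ Fin ℓ)) ∘ inr = a ∘ inl := rfl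
    rw [e1, e2]
    split_ifs <;> simp [SKE.encProb]

def setPrf {s d c : ℕ} (r : Cfg (Fin s × (Fin d ⊕ Fin c))) (i : Fin s) (y : Cfg (Fin c)) :
    Cfg (Fin s × (Fin d ⊕ Fin c)) := fun p =>
  elim (fun l => r (p.1, inl l)) (fun l => if p.1 = i then y l else r (p.1, inr l)) p.2

lemma setPrf_eq_rewire {s d c : ℕ} (r : Cfg (Fin s × (Fin d ⊕ Fin c))) (i : Fin s)
    (y : Cfg (Fin c)) : setPrf r i y = rewire (fun p => elim (fun l => inr (r (p.1, inl l)))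
      (fun l => if p.1 = i then inl l else inr (r (p.1, inr l))) p.2) y := by
  funext ⟨j, l⟩
  cases l with
  | inl l => rfl
  | inr l =>
    simp only [setPrf, rewire, elim_inr]
    split_ifs <;> rfl

lemma StatePrep.slotFix {Θ Z : Type} [Nonempty Z] {O : Oracles Θ Z} (P : PRFSPD) (lam : ℕ)
    (k : P.Seed lam) :
    StatePrep O (8 * P.cost lam) fun _ (_ : Cfg Empty) => slotState (P.state lam k) := by
  refine ⟨_, (((StatePrep.slotGen P lam).fix k).weaken ?_), fun φ a => ?_⟩
  · rw [card_fin, PRFSPD.cost]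
    omega
  · rw [pureState_ket, trace_single_eq_same, one_smul]

def qpkCost (P : PRFSPD) (S : SKE) (lam : ℕ) : ℕ := S.keyLen lam * (8 * P.cost lam) +
  (1 + S.keyLen lam * (P.inLen lam + P.outLen lam + 1 + P.proofLen lam))

lemma sum_probPure_sphere {n c : ℕ} (D : QAlg (Fin n) (Fin c)) (s : StateSphere n) :
    ∑ y, D.probPure (fun b => s.1 b) y = 1 := by
  rw [QAlg.sum_probPure]
  exact norm_stateSphere s

/-- The distribution of the destruction proof of a Haar-random state. -/
def haarProof (P : PRFSPD) (lam : ℕ) (x : P.Input lam) (y : P.Proof lam) : ℝ :=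
  ∫ φ, (P.destruct lam).probPure (vecs φ x) y ∂P.haar lam

lemma continuous_probPure_eval (x : P.Input lam) (y : P.Proof lam) : Continuous fun φ :
    P.Input lam → StateSphere (P.outLen lam) => (P.destruct lam).probPure (vecs φ x) y :=
  (continuous_probPure (P.destruct lam) y).comp (continuous_apply x)

lemma haarProof_nonneg (x : P.Input lam) (y : P.Proof lam) :
    0 ≤ haarProof P lam x y := integral_nonneg fun _ => QAlg.probPure_nonneg _ _ _

lemma sum_haarProof (x : P.Input lam) : ∑ y, haarProof P lam x y = 1 := by
  simp only [haarProof]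
  rw [← integral_finsetSum _ fun y _ => integrable_of_continuous _ (continuous_probPure_eval x y)]
  have : ∀ φ : P.Input lam → StateSphere (P.outLen lam),
      ∑ y, (P.destruct lam).probPure (vecs φ x) y = 1 := fun φ => sum_probPure_sphere _ (φ x)
  simp [this]

lemma Observable.abs_sum_haarProof_sub_le {ε : ℝ} {s : ℕ} (hε : P.HaarBound lam s ε)
    {x : P.Input lam} {c : P.Proof lam → ℝ}
    (h : Observable s fun φ => ∑ y, (P.destruct lam).probPure (φ x) y * c y) :
    |∑ y, (haarProof P lam x y - fakeProof P lam x y) * c y| ≤ ε := by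
  have h := h.abs_sub_le hε
  rw [integral_finsetSum _ fun y _ => (integrable_of_continuous _
    (continuous_probPure_eval x y)).mul_const _, avg_sum] at h
  simp only [integral_mul_const, avg_mul_const] at h
  rw [abs_sub_comm, ← sum_sub_distrib] at h
  simp only [← sub_mul] at h
  exact h

/-- A bound for the size of the distinguishers which interpolate between real and fake proofs. -/
def slotCost (P : PRFSPD) (S : SKE) (lam N L e : ℕ) : ℕ :=
  gameCost (P.proofLen lam) N L (20 * P.cost lam)
    (qpkCost P S lam) (recCost P S lam (P.proofLen lam) e)

lemma abs_slot_le {ε : ℝ} {s : ℕ} (hε : P.HaarBound lam s ε) (A : CPAAdv (Key P S lam) (Ct P S lam))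
    {e : ℕ} (he : ∀ ℓ, ℓ ≤ A.wires → (S.enc lam ℓ).size ≤ e)
    (hs : slotCost P S lam A.wires A.prog.length e ≤ s) (i : S.Slot lam)
    (dk : S.Slot lam → P.Seed lam) (k : Cfg (S.Slot lam))
    (r : Cfg (S.Slot lam × (Fin (P.inLen lam) ⊕ Fin (P.proofLen lam)))) (x : P.Input lam) :
    |avg fun k' => ∑ y, ((P.destruct lam).probPure (P.state lam k' x) y - fakeProof P lam x y) *
    gwin A (pkVec fun j => P.state lam (update dk i k' j))
    (fun _ => recKernel P S lam k (setPrf r i y))| ≤ 3 * ε + A.prog.length *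
    (4 / √(2 ^ P.inLen lam)) := by
  set D : P.Proof lam → (P.Output lam → ℂ) → ℝ :=
    fun y s => (P.destruct lam).probPure s y with hD
  set u : (P.Input lam → P.Output lam → ℂ) → S.Slot lam → P.Input lam → P.Output lam → ℂ :=
    fun φ j => if j = i then φ else P.state lam (dk j) with hu
  set F : (P.Input lam → P.Output lam → ℂ) → P.Proof lam → ℝ :=
    fun φ y => gwin A (pkVec (u φ)) fun _ => recKernel P S lam k (setPrf r i y) with hF
  have hupd : ∀ k', (fun j => P.state lam (update dk i k' j)) = u (P.state lam k') := by
    intro k'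
    funext j
    simp only [hu]
    split_ifs with h
    · subst h; rw [update_self]
    · rw [update_of_ne h]
  have hunit : ∀ φ, (∀ x, ∑ b, ‖φ x b‖ ^ 2 = 1) → ∀ j x, ∑ b, ‖u φ j x b‖ ^ 2 = 1 := by
    intro φ hφ j x
    simp only [hu]
    split_ifs
    exacts [hφ x, P.state_norm lam _ x]
  have hcost : 2 * P.inLen lam + P.outLen lam + 1 ≤ 8 * P.cost lam ∧
      4 * 0 + 8 * P.inLen lam + (2 * P.inLen lam + (P.outLen lam + 1 + (P.destruct lam).size) +
        2 * P.proofLen lam) ≤ 20 * P.cost lam ∧ 6 * P.proofLen lam ≤ 20 * P.cost lam := by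
    simp only [PRFSPD.cost]
    omega
  obtain ⟨hc1, hc3, hc4⟩ := hcost
  have hv : Prep (prOracle (P.inLen lam) (P.outLen lam)) (qpkCost P S lam)
      fun φ => pureState (pkVec (c := P.proofLen lam) (u φ)) := by
    refine Prep.pkVec (u := fun j φ => u φ j) fun j => ?_
    simp only [hu]
    split_ifs
    · exact (StatePrep.slotOracle _ _).weaken hc1
    · exact StatePrep.slotFix _ _ _
  have hv' : ∀ k', Prep (prOracle (P.inLen lam) (P.outLen lam)) (qpkCost P S lam)
      fun _ => pureState (pkVec (c := P.proofLen lam) (u (P.state lam k'))) := by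
    intro k'
    refine Prep.pkVec (u := fun j _ => u (P.state lam k') j) fun j => ?_
    simp only [hu]
    split_ifs <;> exact StatePrep.slotFix _ _ _
  have hp : KCirc (prOracle (P.inLen lam) (P.outLen lam)) (20 * P.cost lam)
      fun φ (_ : Cfg Empty) y => (D y (φ x) : ℂ) :=
    ((KCirc.destructOracle (P.destruct lam)).rewire (ι := Empty) fun j => inr (x j)).weaken
      (by simpa using hc3)
  have hp' : ∀ y : P.Proof lam, KCirc (prOracle (P.inLen lam) (P.outLen lam))
      (20 * P.cost lam) fun _ (_ : Cfg Empty) t => ((if t = y then 1 else 0 : ℝ) : ℂ) := by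
    intro y
    refine ((KCirc.const y).weaken (by simpa using hc4)).congr fun φ a t => ?_
    simp only [det]
    split_ifs <;> simp
  have hM : ∀ ℓ, ℓ ≤ A.wires → KCirc (prOracle (P.inLen lam) (P.outLen lam))
      (recCost P S lam (card (Fin (P.proofLen lam))) e)
      fun _ (a : Cfg (Fin (P.proofLen lam) ⊕ Fin ℓ)) c =>
        (recKernel P S lam k (setPrf r i (a ∘ inl)) ℓ (a ∘ inr) c : ℂ) := by
    intro ℓ hℓ
    simp only [setPrf_eq_rewire]
    exact KCirc.recKernel k _ (he ℓ hℓ)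
  have hM1 : ∀ (t : P.Proof lam) (_ : ℕ),
      IsProbKernel (recKernel P S lam k (setPrf r i t)) := fun t _ => isProbKernel_recKernel k _
  have hs' : gameCost (card (Fin (P.proofLen lam))) A.wires A.prog.length (20 * P.cost lam)
      (qpkCost P S lam) (recCost P S lam (card (Fin (P.proofLen lam))) e) ≤ s := by
    rw [card_fin]
    exact hs
  have o1 : Observable s fun φ => ∑ y, D y (φ x) * F φ y :=
    (Observable.game hv hp A (M := fun t _ => recKernel P S lam k (setPrf r i t))
      (fun _ => hM) hM1).weaken hs'
  have o2 : ∀ y, Observable s fun φ => F φ y := by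
    intro y
    have h := (Observable.game hv (hp' y) A (M := fun t _ => recKernel P S lam k (setPrf r i t))
      (fun _ => hM) hM1).weaken hs'
    simp only [ite_mul, one_mul, zero_mul, sum_ite_eq', mem_univ, if_true] at h
    exact h
  have o3 : ∀ k', Observable s fun φ => ∑ y, D y (φ x) * F (P.state lam k') y := fun k' =>
    (Observable.game (hv' k') hp A (M := fun t _ => recKernel P S lam k (setPrf r i t))
      (fun _ => hM) hM1).weaken hs'
  have h1 := o1.abs_sub_le hε
  have h2 := abs_integral_resample_le x (D := fun y s => D y fun b => s.1 b)
    (fun y => continuous_probPure (P.destruct lam) y) (fun y s => QAlg.probPure_nonneg _ _ _)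
    (sum_probPure_sphere _) (F := fun y φ => F (vecs φ) y) (fun y => (o2 y).continuous)
    (δ := A.prog.length * (4 / √(2 ^ P.inLen lam))) (by
      intro y φ s
      refine abs_gwin_sub_le (pkVec_norm (hunit _ fun z => norm_stateSphere _))
        (pkVec_norm (hunit _ fun z => norm_stateSphere _)) (by positivity)
        (sum_norm_pkVec_sub_le (hunit _ fun z => norm_stateSphere _)
          (hunit _ fun z => norm_stateSphere _) i x fun j z hz => ?_) A
        fun _ => isProbKernel_recKernel k _
      simp only [hu]
      split_ifs with hj
      · funext b
        simp only [update_of_ne (hz hj)]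
      · rfl)
  have h3 : |∑ y, haarProof P lam x y * (∫ φ, F (vecs φ) y ∂P.haar lam -
      avg fun k' => F (P.state lam k') y)| ≤ ε := by
    refine (abs_sum_le_sum_abs _ _).trans ((sum_le_sum (g := fun y => haarProof P lam x y * ε)
      fun y _ => ?_).trans_eq (by rw [← sum_mul, sum_haarProof, one_mul]))
    rw [abs_mul, abs_of_nonneg (haarProof_nonneg x y), abs_sub_comm]
    exact mul_le_mul_of_nonneg_left ((o2 y).abs_sub_le hε) (haarProof_nonneg x y)
  have h4 := fun k' => abs_le.1 (Observable.abs_sum_haarProof_sub_le hε (o3 k'))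
  have h5 := (avg_const (w := P.keyLen lam) (-ε)).symm.le.trans (avg_mono fun k' => (h4 k').1)
  have h6 := (avg_mono fun k' => (h4 k').2).trans_eq (avg_const (w := P.keyLen lam) ε)
  have h7 : (avg fun k' => ∑ y, ((P.destruct lam).probPure (P.state lam k' x) y -
      fakeProof P lam x y) * gwin A (pkVec fun j => P.state lam (update dk i k' j))
        (fun _ => recKernel P S lam k (setPrf r i y))) =
      avg (fun k' => ∑ y, D y (P.state lam k' x) * F (P.state lam k') y) -
        avg (fun k' => ∑ y, fakeProof P lam x y * F (P.state lam k') y) := by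
    rw [← avg_sub]
    congr 1
    funext k'
    rw [hupd, ← sum_sub_distrib]
    exact sum_congr rfl fun y _ => sub_mul _ _ _
  have h8 : ∑ y, haarProof P lam x y * avg (fun k' => F (P.state lam k') y) =
      avg fun k' => ∑ y, haarProof P lam x y * F (P.state lam k') y := by
    rw [avg_sum]
    simp only [mul_comm (haarProof P lam x _), avg_mul_const]
  rw [h7]
  simp only [mul_sub, sub_mul, sum_sub_distrib, avg_sub] at h3 h5 h6
  rw [h8] at h3
  change |_ - ∑ y, haarProof P lam x y * ∫ φ, F (vecs φ) y ∂P.haar lam| ≤ _ at h2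
  change |(∫ φ, ∑ y, D y (vecs φ x) * F (vecs φ) y ∂P.haar lam) - _| ≤ _ at h2
  rw [abs_le] at *
  constructor <;> linarith [h1.1, h1.2, h2.1, h2.2, h3.1, h3.2]

end SlotStep

section Reduction

variable {pk τ : Type} {ct : ℕ → Type} {ι κ W V : Type} [Fintype pk] [DecidableEq pk]
  [Fintype τ] [DecidableEq τ] [∀ ℓ, Fintype (ct ℓ)] [∀ ℓ, DecidableEq (ct ℓ)]
  [Fintype ι] [DecidableEq ι] [Fintype κ] [DecidableEq κ]
  [Fintype W] [DecidableEq W] [Fintype V] [DecidableEq V] {N : ℕ}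

/-! ### Classical access to an encryption oracle -/

lemma isLinear_kchan_encKer (M : Cfg ι → Cfg κ → ℝ) :
    IsLinearMap ℂ (kchan (encKer fun a c => (M a c : ℂ))) := isLinear_kchan _

lemma applyOn_branch (f : ι ↪ W) (w : ι) (v : Bool) (ρ : Op W) :
    applyOn f (branch w v) ρ = branch (f w) v ρ := by
  ext b b'
  rw [applyOn_apply]
  simp only [branch, of_apply, splice_self]
  rfl

lemma isLinear_branch' (w : W) (v : Bool) : IsLinearMap ℂ (branch w v) :=
  ⟨fun ρ σ => by
    ext b b'
    simp only [branch, of_apply, Matrix.add_apply]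
    split_ifs <;> simp, fun c ρ => by
    ext b b'
    simp only [branch, of_apply, Matrix.smul_apply]
    split_ifs <;> simp⟩

lemma isLinear_applyOn (f : ι ↪ W) {F : Op ι → Op ι} (hF : IsLinearMap ℂ F) :
    IsLinearMap ℂ (applyOn f F) :=
  ⟨fun ρ σ => by
    ext b b'
    rw [Matrix.add_apply, applyOn_apply, applyOn_apply, applyOn_apply, ← Matrix.add_apply,
      ← hF.map_add]
    rfl, fun c ρ => by
    ext b b'
    rw [Matrix.smul_apply, applyOn_apply, applyOn_apply, ← Matrix.smul_apply, ← hF.map_smul]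
    rfl⟩

/-- An encryption query, with control bit `inl ()`. -/
def encSem (M : Cfg ι → Cfg κ → ℝ) (σ : Bool → Op (Unit ⊕ (ι ⊕ κ))) :
    Bool → Op (Unit ⊕ (ι ⊕ κ)) := fun z =>
  branch (inl ()) false (σ z) + applyOn Embedding.inr
    (kchan (encKer fun a c => (M a c : ℂ))) (branch (inl ()) true (σ z))

/-- A challenge query, with control bit `inl ()`. -/
def chalSem (M : Cfg ι → Cfg κ → ℝ) (σ : Bool → Op (Unit ⊕ (ι ⊕ κ))) :
    Bool → Op (Unit ⊕ (ι ⊕ κ)) := fun z =>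
  if z = true then σ true + applyOn Embedding.inr
    (kchan (encKer fun a c => (M a c : ℂ))) (branch (inl ()) true (σ false))
  else branch (inl ()) false (σ false)

lemma isLinear_pi_proj (z : Bool) : IsLinearMap ℂ fun σ : Bool → Op W => σ z :=
  ⟨fun _ _ => rfl, fun _ _ => rfl⟩

lemma isLinear_query (M : Cfg ι → Cfg κ → ℝ) (z : Bool) : IsLinearMap ℂ fun σ : Bool →
    Op (Unit ⊕ (ι ⊕ κ)) => applyOn Embedding.inr (kchan (encKer fun a c => (M a c : ℂ)))
    (branch (inl ()) true (σ z)) :=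
  IsLinearMap.comp' (IsLinearMap.comp' (isLinear_pi_proj z) (isLinear_branch' (inl ()) true))
    (isLinear_applyOn Embedding.inr (isLinear_kchan_encKer M))

lemma isLinear_of_apply {E : Type} [AddCommGroup E] [Module ℂ E] {F : E → Bool → Op W}
    (h : ∀ z, IsLinearMap ℂ fun σ => F σ z) : IsLinearMap ℂ F :=
  ⟨fun x y => funext fun z => (h z).map_add x y, fun c x => funext fun z => (h z).map_smul c x⟩

lemma isLinear_encSem (M : Cfg ι → Cfg κ → ℝ) : IsLinearMap ℂ (encSem M) :=
  isLinear_of_apply fun z => IsLinearMap.add'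
    (IsLinearMap.comp' (isLinear_pi_proj z) (isLinear_branch' _ _)) (isLinear_query M z)

lemma isLinear_chalSem (M : Cfg ι → Cfg κ → ℝ) : IsLinearMap ℂ (chalSem M) := by
  refine isLinear_of_apply fun z => ?_
  cases z
  · exact IsLinearMap.comp' (isLinear_pi_proj false) (isLinear_branch' _ _)
  · exact IsLinearMap.add' (isLinear_pi_proj true) (isLinear_query M false)

/-- The oracle of the chosen-plaintext game: the parameters are the encryption kernel and the
challenge bit, and states are indexed by whether the challenge was issued. -/
def cpaOracle (ct : ℕ → Type) [∀ ℓ, Fintype (ct ℓ)] [∀ ℓ, DecidableEq (ct ℓ)] :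
    Oracles (Kernel ct × Bool) Bool where
  idx := ℕ ⊕ ℕ
  port := elim (fun ℓ => Unit ⊕ (Fin ℓ ⊕ ct ℓ)) fun ℓ => Unit ⊕ ((Fin ℓ ⊕ Fin ℓ) ⊕ ct ℓ)
  fin o := match o with
    | .inl ℓ => inferInstanceAs (Fintype (Unit ⊕ (Fin ℓ ⊕ ct ℓ)))
    | .inr ℓ => inferInstanceAs (Fintype (Unit ⊕ ((Fin ℓ ⊕ Fin ℓ) ⊕ ct ℓ)))
  dec o := match o with
    | .inl ℓ => inferInstanceAs (DecidableEq (Unit ⊕ (Fin ℓ ⊕ ct ℓ)))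
    | .inr ℓ => inferInstanceAs (DecidableEq (Unit ⊕ ((Fin ℓ ⊕ Fin ℓ) ⊕ ct ℓ)))
  sem o θ := match o with
    | .inl ℓ => (isLinear_encSem (θ.1 ℓ)).mk' _
    | .inr ℓ => (isLinear_chalSem fun a => θ.1 ℓ (sel θ.2 a)).mk' _

lemma applyZ_encSem (M : Cfg ι → Cfg κ → ℝ) (f : Unit ⊕ (ι ⊕ κ) ↪ W) (σ : Bool → Op W) (z : Bool) :
    applyZ f (encSem M) σ z = branch (f (inl ())) false (σ z) + applyOn (Embedding.inr.trans f)
    (kchan (encKer fun a c => (M a c : ℂ))) (branch (f (inl ())) true (σ z)) := by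
  rw [applyOn_trans, ← applyOn_branch, ← applyOn_branch, applyOn_comp]
  rfl

lemma applyZ_chalSem (M : Cfg ι → Cfg κ → ℝ) (f : Unit ⊕ (ι ⊕ κ) ↪ W) (σ : Bool → Op W) (z : Bool) :
    applyZ f (chalSem M) σ z = if z = true then σ true + applyOn (Embedding.inr.trans f)
    (kchan (encKer fun a c => (M a c : ℂ))) (branch (f (inl ())) true (σ false))
    else branch (f (inl ())) false (σ false) := by
  rw [applyOn_trans, ← applyOn_branch, ← applyOn_branch, applyOn_comp]
  cases z
  · rfl
  · ext b b'
    rw [if_pos rfl, Matrix.add_apply]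
    change σ true (splice f (b ∘ f) b) (splice f (b' ∘ f) b') + _ = _
    rw [splice_self, splice_self]
    rfl

def ctrlEmb (g : ι ↪ V) : Unit ⊕ ι ↪ Unit ⊕ V := (Embedding.refl Unit).sumMap g

lemma blk_branch (v w : Bool) (ρ : Op (Unit ⊕ V)) :
    blk v (branch (inl ()) w ρ) = if v = w then blk v ρ else 0 := by
  ext b b'
  simp only [blk, branch, of_apply, elim_inl, and_self]
  split_ifs <;> rfl

lemma blk_add (v : Bool) (ρ σ : Op (Unit ⊕ V)) : blk v (ρ + σ) = blk v ρ + blk v σ := rfl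

lemma blk_applyOn (g : ι ↪ V) (F : Op ι → Op ι) (v : Bool) (ρ : Op (Unit ⊕ V)) :
    blk v (applyOn (Embedding.inr.trans (ctrlEmb g)) F ρ) = applyOn g F (blk v ρ) := by
  ext b b'
  have h : ∀ (a : Cfg ι) (b : Cfg V),
      splice (Embedding.inr.trans (ctrlEmb g)) a (elim (fun _ => v) b) =
        elim (fun _ => v) (splice g a b) := by
    intro a b
    refine splice_ext _ ?_ ?_
    · funext i
      exact splice_apply g a b i
    · rintro (j | j) hj
      · rfl
      · refine (splice_of_notMem g a b ?_).symm
        rintro ⟨i, rfl⟩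
        exact hj ⟨i, rfl⟩
  simp only [blk, of_apply, applyOn_apply, h]
  rfl

lemma CtrlImpl.encQuery {ℓ : ℕ} (g : Fin ℓ ⊕ ct ℓ ↪ V) : CtrlImpl (cpaOracle ct)
    1 fun θ σ z => applyOn g (kchan (encKer fun a c => (θ.1 ℓ a c : ℂ))) (σ z) := by
  refine ⟨_, Impl.step (.query (.inl ℓ : ℕ ⊕ ℕ) (ctrlEmb g)) Impl.id, fun θ σ z v => ?_⟩
  have h := applyZ_encSem (θ.1 ℓ) (ctrlEmb g) σ z
  refine (congrArg (blk v) h).trans ?_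
  have hc : ctrlEmb g (inl ()) = inl () := rfl
  rw [blk_add, blk_applyOn, hc, blk_branch, blk_branch]
  cases v
  · simp [(isLinear_applyOn g (isLinear_kchan_encKer _)).map_zero]
  · simp

lemma CtrlImpl.chalQuery {ℓ : ℕ} (g : (Fin ℓ ⊕ Fin ℓ) ⊕ ct ℓ ↪ V) : CtrlImpl (cpaOracle ct)
    1 fun θ σ z => if z = true then σ true +
    applyOn g (kchan (encKer fun a c => (θ.1 ℓ (QPK.sel θ.2 a) c : ℂ))) (σ false) else 0 := by
  refine ⟨_, Impl.step (.query (.inr ℓ : ℕ ⊕ ℕ) (ctrlEmb g)) Impl.id, fun θ σ z v => ?_⟩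
  have h := applyZ_chalSem (fun a => θ.1 ℓ (QPK.sel θ.2 a)) (ctrlEmb g) σ z
  refine (congrArg (blk v) h).trans ?_
  cases z
  · rw [if_neg (by simp)]
    change blk v (branch (inl ()) false (σ false)) = _
    rw [blk_branch]
    cases v <;> simp
  · rw [if_pos rfl]
    have hc : ctrlEmb g (inl ()) = inl () := rfl
    rw [blk_add, blk_applyOn, hc, blk_branch]
    cases v
    · simp [(isLinear_applyOn g (isLinear_kchan_encKer _)).map_zero]
    · simp

/-! ### Simulating encryptions to which a fixed string is appended -/

/-- Append the string `r` to the ciphertext. -/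
def appendKernel (K : Kernel ct) (r : Cfg τ) : Kernel fun ℓ => ct ℓ ⊕ τ := fun ℓ m c =>
  if c ∘ inr = r then K ℓ m (c ∘ inl) else 0

def symEmb (f : ι ⊕ (κ ⊕ τ) ↪ W) : ι ⊕ κ ↪ W :=
  ((Embedding.refl ι).sumMap Embedding.inl).trans f

def tailEmb (f : ι ⊕ (κ ⊕ τ) ↪ W) : τ ↪ W :=
  (Embedding.inr.trans Embedding.inr).trans f

lemma kchan_append (M : Cfg ι → Cfg κ → ℝ) (r : Cfg τ) (f : ι ⊕ (κ ⊕ τ) ↪ W) (ρ : Op W) :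
    applyOn f (kchan (encKer fun a (c : Cfg (κ ⊕ τ)) =>
      ((if c ∘ inr = r then M a (c ∘ inl) else 0 : ℝ) : ℂ))) ρ =
    applyOn (tailEmb f) (fun σ => σ.trace • pureState (ket r))
      (applyOn (symEmb f) (kchan (encKer fun a c => (M a c : ℂ))) ρ) := by
  rw [tailEmb, symEmb, applyOn_trans (Embedding.inr.trans Embedding.inr) f,
    applyOn_trans ((Embedding.refl ι).sumMap Embedding.inl) f, applyOn_comp]
  refine applyOn_congr (fun σ => ?_) ρ
  ext b b'
  rw [kchan_encKer, applyOn_apply, Matrix.smul_apply, trace, pureState_ket]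
  have h1 : ∀ (t : Cfg τ) (b : Cfg (ι ⊕ (κ ⊕ τ))), splice (Embedding.inr.trans Embedding.inr) t b =
        elim (b ∘ inl) (elim (b ∘ inr ∘ inl) t) := by
    intro t b
    refine splice_ext _ rfl ?_
    rintro (j | j | j) hj
    · rfl
    · rfl
    · exact absurd ⟨j, rfl⟩ hj
  have h2 : ∀ (a : Cfg (ι ⊕ κ)) (i : Cfg ι) (c : Cfg κ) (t : Cfg τ),
      splice ((Embedding.refl ι).sumMap Embedding.inl : ι ⊕ κ ↪ ι ⊕ (κ ⊕ τ)) a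
        (elim i (elim c t)) = elim (a ∘ inl) (elim (a ∘ inr) t) := by
    intro a i c t
    refine splice_ext _ ?_ ?_
    · funext j
      cases j <;> rfl
    · rintro (j | j | j) hj
      · exact absurd ⟨inl j, rfl⟩ hj
      · exact absurd ⟨inr j, rfl⟩ hj
      · rfl
  have h3 : ∀ (i : Cfg ι) (c : Cfg κ) (t : Cfg τ), (elim i (elim c t) : Cfg (ι ⊕ (κ ⊕ τ))) ∘
        ((Embedding.refl ι).sumMap Embedding.inl : ι ⊕ κ ↪ ι ⊕ (κ ⊕ τ)) = elim i c := by
    intro i c t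
    funext j
    cases j <;> rfl
  simp only [diag_apply, of_apply, h1, applyOn_apply, h2, h3, kchan_encKer, elim_comp_inl,
    elim_comp_inr, sum_elim_inj]
  have h4 : b = b' ↔ (b ∘ inl = b' ∘ inl ∧ b ∘ inr ∘ inl = b' ∘ inr ∘ inl) ∧
      b ∘ inr ∘ inr = b' ∘ inr ∘ inr := by
    rw [cfg_sum_ext_iff b b', cfg_sum_ext_iff (b ∘ inr) (b' ∘ inr), and_assoc]
    rfl
  have h5 : single r r (1 : ℂ) (b ∘ (Embedding.inr.trans Embedding.inr :
      τ ↪ ι ⊕ (κ ⊕ τ))) (b' ∘ (Embedding.inr.trans Embedding.inr :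
      τ ↪ ι ⊕ (κ ⊕ τ))) = if b ∘ inr ∘ inr = r ∧ b ∘ inr ∘ inr = b' ∘ inr ∘ inr then 1 else 0 := by
    rw [single_apply]
    refine if_congr ?_ rfl rfl
    change r = b ∘ inr ∘ inr ∧ r = b' ∘ inr ∘ inr ↔ _
    constructor
    · rintro ⟨h, h'⟩
      exact ⟨h.symm, h.symm.trans h'⟩
    · rintro ⟨h, h'⟩
      exact ⟨h.symm, h.symm.trans h'⟩
  have hS : ∑ s, σ (elim (b ∘ inl) s) (elim (b ∘ inl) s) =
      ∑ t, ∑ c, σ (elim (b ∘ inl) (elim c t)) (elim (b ∘ inl) (elim c t)) := by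
    rw [sum_cfgSum, sum_comm]
  have hF : (b ∘ inr) ∘ inr = b ∘ inr ∘ inr := rfl
  have hG : (b ∘ inr) ∘ inl = b ∘ inr ∘ inl := rfl
  rw [if_congr h4 rfl rfl, h5, hS, hF, hG, smul_eq_mul, sum_mul]
  by_cases e1 : b ∘ inl = b' ∘ inl ∧ b ∘ inr ∘ inl = b' ∘ inr ∘ inl
  · by_cases e2 : b ∘ inr ∘ inr = b' ∘ inr ∘ inr
    · by_cases e3 : b ∘ inr ∘ inr = r
      · rw [if_pos ⟨e1, e2⟩, if_pos e3, if_pos ⟨e3, e2⟩, mul_sum]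
        refine sum_congr rfl fun t _ => ?_
        rw [if_pos e1, mul_one]
      · rw [if_pos ⟨e1, e2⟩, if_neg e3, if_neg fun h => e3 h.1]
        simp
    · rw [if_neg fun h => e2 h.2, if_neg fun h => e2 h.2]
      simp
  · rw [if_neg fun h => e1 h.1]
    simp only [if_neg e1, zero_mul, sum_const_zero]

/-- The flag of the simulator agrees with the oracle's record of whether the challenge was
issued, and the wires of the adversary are in the state `σ`. -/
def Synced (ρ : Bool → Op (Sim Empty N)) (σ : Bool → Op (Fin N)) : Prop :=
  ∀ t z z', simBlk t z' (ρ z) = if z = z' then σ z else 0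

lemma CtrlImpl.write {Θ Z : Type} [Nonempty Z] {O : Oracles Θ Z} (f : τ ↪ V) (r : Cfg τ) :
    CtrlImpl O (9 * card τ) fun _ σ z =>
      applyOn f (fun ρ => ρ.trace • pureState (ket r)) (σ z) := by
  have h : Circ O (6 * card τ) fun _ (ρ : Op τ) => ρ.trace • pureState (ket r) := by
    refine Circ.congr (KCirc.const (O := O) (ι := τ) r) fun θ ρ => ?_
    ext y y'
    rw [kchan_apply, Matrix.smul_apply, pureState_ket, single_apply, trace, smul_eq_mul]
    simp only [det, diag_apply]
    by_cases h : y = y'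
    · subst h
      by_cases h' : y = r
      · subst h'; simp
      · simp [h', Ne.symm h']
    · rw [if_neg h, if_neg fun h' => h (h'.1.symm.trans h'.2), mul_zero]
  refine (CtrlImpl.of_circ h f fun θ => ?_).weaken (by omega)
  rw [trace_smul, trace_pureState, sum_norm_ket]
  simp

lemma exists_impl_gstep (v : Cfg pk → ℂ) (r : Cfg τ) {sp : ℕ}
    (hv : Prep (cpaOracle ct) sp fun _ => pureState v) (i : CPAInstr pk (fun ℓ => ct ℓ ⊕ τ) N) :
    ∃ F : Kernel ct × Bool → (Bool → Op (Sim Empty N)) → Bool → Op (Sim Empty N),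
    Impl (cpaOracle ct) (sp + 9 * card τ + 4) F ∧ ∀ θ ρ σ, Synced ρ σ → Synced (F θ ρ)
    (gstep v (appendKernel θ.1 r) θ.2 i σ) := by
  cases i with
  | gate g =>
    refine ⟨_, Impl.weaken ?_ (Circ.gate (O := cpaOracle ct) g.arity_le
      (g.wires.trans (advEmb Empty N)) g.mat g.unitary), fun θ ρ σ h t z z' => ?_⟩
    · omega
    · rw [simBlk_applyOn, ← conj_onWires, h]
      split_ifs
      · rfl
      · exact (IsLinearMap.conj _).map_zero
  | key out =>
    refine ⟨_, Impl.weaken ?_ (Circ.replace hv (out.trans (advEmb Empty N))),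
      fun θ ρ σ h t z z' => ?_⟩
    · omega
    · rw [simBlk_applyOn, ← overwrite_eq, h]
      split_ifs
      · rfl
      · exact (isLinear_overwrite _ _).map_zero
  | enc ctrl ℓ f =>
    have h := ((CtrlImpl.encQuery (symEmb (f.trans (advEmb Empty N)))).comp
      (CtrlImpl.write (tailEmb (f.trans (advEmb Empty N))) r)).enc (advEmb Empty N ctrl)
    refine ⟨_, Impl.weaken ?_ h, fun θ ρ σ h t z z' => ?_⟩
    · omega
    · beta_reduce
      rw [← kchan_append, simBlk_add, simBlk_branch, simBlk_applyOn, simBlk_branch, h]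
      split_ifs
      · change _ = branch ctrl false (σ z) + kenc _ f (branch ctrl true (σ z))
        rw [kenc_eq]
        rfl
      · rw [(isLinear_branch _ _).map_zero, (isLinear_branch _ _).map_zero,
          (isLinear_applyOn f (isLinear_kchan_encKer _)).map_zero, add_zero]
  | chal ctrl ℓ f =>
    have h := ((CtrlImpl.chalQuery (symEmb (f.trans (advEmb Empty N)))).comp
      (CtrlImpl.write (tailEmb (f.trans (advEmb Empty N))) r)).chal (inl ())
        (advEmb Empty N ctrl) (by simp [advEmb])
    refine ⟨_, Impl.weaken ?_ h, fun θ ρ σ h t z z' => ?_⟩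
    · omega
    · have hw : IsLinearMap ℂ fun ρ : Op τ => ρ.trace • pureState (ket r) :=
        ⟨fun _ _ => by rw [trace_add, add_smul], fun _ _ => by rw [trace_smul, smul_assoc]⟩
      have h0 : ∀ u, simBlk t u (chalStep (inl ()) (advEmb Empty N ctrl) (ρ true)) = 0 := by
        intro u
        rw [simBlk_chalStep, h]
        cases u
        · exact (isLinear_branch _ _).map_zero
        · rfl
      beta_reduce
      rw [simBlk_add, simBlk_idleStep, simBlk_flipBit, h, h]
      cases z
      · change _ + simBlk t (!z') (applyOn _ _ 0) = _
        rw [(isLinear_applyOn (tailEmb (f.trans (advEmb Empty N))) hw).map_zero]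
        refine (add_zero _).trans ?_
        cases z' <;> rfl
      · change _ + simBlk t (!z') (applyOn _ _ (chalStep (inl ()) (advEmb Empty N ctrl) (ρ true) +
          applyOn _ _ (chalStep (inl ()) (advEmb Empty N ctrl) (ρ false)))) = _
        rw [(isLinear_applyOn _ hw).map_add, simBlk_add, ← kchan_append,
          simBlk_applyOn, simBlk_chalStep, h]
        have e : tailEmb (f.trans (advEmb Empty N)) = (tailEmb f).trans (advEmb Empty N) := rfl
        rw [e, simBlk_applyOn, h0, (isLinear_applyOn _ hw).map_zero, zero_add]
        cases z'
        · change branch ctrl false 0 + applyOn f _ 0 = 0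
          rw [(isLinear_branch _ _).map_zero,
            (isLinear_applyOn f (isLinear_kchan_encKer _)).map_zero, add_zero]
        · change σ true + applyOn f _ (branch ctrl true (σ false)) =
            σ true + kenc _ f (branch ctrl true (σ false))
          rw [kenc_eq]
          rfl

lemma exists_impl_gexec (v : Cfg pk → ℂ) (r : Cfg τ) {sp : ℕ}
    (hv : Prep (cpaOracle ct) sp fun _ => pureState v)
    (l : List (CPAInstr pk (fun ℓ => ct ℓ ⊕ τ) N)) : ∃ F : Kernel ct × Bool →
    (Bool → Op (Sim Empty N)) → Bool → Op (Sim Empty N), Impl (cpaOracle ct)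
    (l.length * (sp + 9 * card τ + 4)) F ∧ ∀ θ ρ σ, Synced ρ σ → Synced (F θ ρ)
    (gexec v θ.2 (fun _ => appendKernel θ.1 r) l σ) := by
  induction l with
  | nil => exact ⟨_, Impl.weaken (Nat.zero_le _) Impl.id, fun θ ρ σ h => h⟩
  | cons i l ih =>
    obtain ⟨F, hF, h⟩ := exists_impl_gstep v r hv i
    obtain ⟨F', hF', h'⟩ := ih
    exact ⟨_, Impl.weaken (le_of_eq (by rw [List.length_cons]; ring)) (hF.comp hF'),
      fun θ ρ σ hσ => h' θ _ _ (h θ ρ σ hσ)⟩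

lemma exists_cpaInstr {N : ℕ} (l : List (Instr (cpaOracle ct) (Fin N))) : ∃ gs :
    List (CPAInstr Empty ct N), gs.length = l.length ∧ ∀ θ σ, runInstr θ l σ = gexec (fun _ => 1)
    θ.2 (fun _ => θ.1) gs σ := by
  induction l with
  | nil => exact ⟨[], rfl, fun _ _ => rfl⟩
  | cons i l ih =>
    obtain ⟨gs, hl, hgs⟩ := ih
    cases i with
    | gate a ha f K hK =>
      refine ⟨.gate ⟨a, ha, f, K, hK⟩ :: gs, by simp [hl], fun θ σ => ?_⟩
      rw [gexec, ← hgs]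
      change runInstr θ l (applyZ f ((conjLin K).compLeft Bool) σ) = _
      congr 1
      funext z
      rw [applyZ_compLeft]
      exact (conj_onWires _ _ _).symm
    | query o f =>
      rcases o with ℓ | ℓ
      · change Unit ⊕ (Fin ℓ ⊕ ct ℓ) ↪ Fin N at f
        refine ⟨.enc (f (inl ())) ℓ (Embedding.inr.trans f) :: gs, by simp [hl], fun θ σ => ?_⟩
        rw [gexec, ← hgs]
        change runInstr θ l (applyZ f (encSem (θ.1 ℓ)) σ) = _
        congr 1
        funext z
        rw [applyZ_encSem, gstep]
        beta_reduce
        rw [kenc_eq]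
      · change Unit ⊕ ((Fin ℓ ⊕ Fin ℓ) ⊕ ct ℓ) ↪ Fin N at f
        refine ⟨.chal (f (inl ())) ℓ (Embedding.inr.trans f) :: gs, by simp [hl], fun θ σ => ?_⟩
        rw [gexec, ← hgs]
        change runInstr θ l (applyZ f (chalSem fun a => θ.1 ℓ (sel θ.2 a)) σ) = _
        congr 1
        funext z
        rw [applyZ_chalSem, gstep]
        beta_reduce
        rw [kenc_eq]

lemma gprob_eq_sum_keepWires {ρ : Bool → Op (Sim Empty N)} {σ : Bool → Op (Fin N)} (h : Synced ρ σ)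
    (out : Fin N) (β : Bool) : gprob out β σ = ∑ z,
    (keepWires (unitEmb (advEmb Empty N out)) (ρ z) (fun _ => β) (fun _ => β)).re := by
  refine sum_congr rfl fun z _ => ?_
  have e : ∀ t z', ∑ s, (if s out = β then ρ z (simCfg t z' s) (simCfg t z' s) else 0) =
      ∑ s, if s out = β then (if z = z' then σ z else 0 : Op (Fin N)) s s else 0 := by
    intro t z'
    rw [← h t z z']
    rfl
  have e2 : ∀ g : Cfg (Sim Empty N) → ℂ, ∑ b, g b = ∑ z', ∑ s, g (simCfg Empty.elim z' s) := by
    intro g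
    rw [sum_cfgSum, ← (Equiv.funUnique Unit Bool).symm.sum_comp]
    refine sum_congr rfl fun z' _ => ?_
    rw [sum_cfgSum, Fintype.sum_unique]
    refine sum_congr rfl fun s _ => ?_
    congr 2
    funext i
    rcases i with i | i
    · exact i.elim
    · rfl
  rw [keepWires_unit_diag, e2]
  change _ = (∑ z', ∑ s : Cfg (Fin N), if s out = β then
    ρ z (simCfg Empty.elim z' s) (simCfg Empty.elim z' s) else 0).re
  simp only [e]
  rw [sum_eq_single z (fun z' _ hz => by simp [Ne.symm hz]) (by simp), re_sum, if_pos rfl]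
  refine sum_congr rfl fun s _ => ?_
  split_ifs <;> simp

/-- An adversary against a scheme which appends the string `r` to the ciphertexts of a symmetric
scheme, and publishes the fixed state `v`, can be turned into an adversary against the symmetric
scheme. -/
lemma exists_cpaAdv (A : CPAAdv pk fun ℓ => ct ℓ ⊕ τ) (v : Cfg pk → ℂ) (r : Cfg τ) {sp : ℕ}
    (hv : Prep (cpaOracle ct) sp fun _ => pureState v) : ∃ B : CPAAdv Empty ct, B.size ≤ A.wires +
    1 + A.prog.length * (sp + 9 * card τ + 4) ∧ ∀ K : Kernel ct, gwin B (fun _ => 1) (fun _ => K) =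
    gwin A v fun _ => appendKernel K r := by
  obtain ⟨F, hF, h⟩ := exists_impl_gexec v r hv A.prog
  have h1 := (Impl.place (strEmb Empty A.wires) (Impl.id (O := cpaOracle ct))).comp hF
  have h2 := Impl.keep (unitEmb (advEmb Empty A.wires A.out)) h1
  obtain ⟨N, inp, out, prog, hs, hN⟩ := Impl.normalForm h2
  obtain ⟨gs, hl, hgs⟩ := exists_cpaInstr prog
  let ρ₀ : Bool → Op Empty := fun z => if z = true then 0 else 1
  have hz : ∀ (M : ℕ) (f : Empty ↪ Fin M), (fun z => place f (ρ₀ z)) = gzero M := by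
    intro M f
    funext z
    cases z
    · exact place_empty f
    · exact (IsLinearMap.conj _).map_zero
  have hsync : Synced (fun z => place (strEmb Empty A.wires) (ρ₀ z)) (gzero A.wires) := by
    intro t z z'
    ext s s'
    simp only [simBlk, of_apply, place_apply, zeroOff_strEmb]
    have e : simCfg t z' s ∘ strEmb Empty A.wires = simCfg t z' s' ∘ strEmb Empty A.wires :=
      cfg_empty_eq _ _
    rw [e]
    cases z <;> cases z' <;>
      simp [ρ₀, gzero, zeroState, pureState_ket, single_apply, eq_comm]
  refine ⟨⟨N, gs, out ()⟩, ?_, fun K => ?_⟩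
  · have : N + prog.length ≤ _ := hs
    simp only [card_sum, card_unit, card_fin, card_empty] at this
    simp only [CPAAdv.size, hl]
    omega
  · refine congrArg (1 / 2 * ·) (sum_congr rfl fun β _ => ?_)
    rw [gprob_eq_sum_keepWires (h (K, β) _ _ hsync), gprob]
    refine sum_congr rfl fun z _ => ?_
    have e := congrFun (congrFun (congrFun (hN (K, β) ρ₀) z) (fun _ => β)) (fun _ => β)
    rw [hz, hgs] at e
    refine Eq.trans ?_ (congrArg Complex.re e).symm
    have ho : out = unitEmb (out ()) := by ext x; rfl
    rw [ho, keepWires_unit_diag, re_sum]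
    refine sum_congr rfl fun b _ => ?_
    change (if b (out ()) = β then _ else _) = (if b (out ()) = β then _ else _ : ℂ).re
    split_ifs <;> rfl

end Reduction

/-! ### The classical part of the public-key register -/

section KeyRegister

variable {s d n c : ℕ}

/-- The basis state of the public-key register with given contents. -/
def mkKey (fl : Bool) (x : Fin s → Cfg (Fin d)) (q : Fin s → Cfg (Fin n)) (k : Cfg (Fin s))
    (y : Fin s → Cfg (Fin c)) : Cfg (KeyW s d n c) :=
  elim (fun _ => fl) fun p =>
    elim (elim (x p.1) (q p.1)) (elim (fun _ => k p.1) (y p.1)) p.2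

lemma mkKey_self (b : Cfg (KeyW s d n c)) : mkKey (flag b) (str b) (sys b) (bit b) (prf b) = b := by
  funext j
  rcases j with ⟨⟩ | ⟨i, (j | j) | ⟨⟩ | j⟩ <;> rfl

lemma key_ext {b b' : Cfg (KeyW s d n c)} (h1 : flag b = flag b') (h2 : str b = str b')
    (h3 : sys b = sys b') (h4 : bit b = bit b') (h5 : prf b = prf b') : b = b' := by
  rw [← mkKey_self b, ← mkKey_self b', h1, h2, h3, h4, h5]

/-- The strings and proofs of all slots. -/
def mkRec (x : Fin s → Cfg (Fin d)) (y : Fin s → Cfg (Fin c)) :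
    Cfg (Fin s × (Fin d ⊕ Fin c)) := fun p => elim (x p.1) (y p.1) p.2

lemma prod_univ_sum_pi {R E T : Type} [CommSemiring R] [Fintype E] [DecidableEq E] [Fintype T]
    (F : E → T → R) : ∏ e, ∑ t, F e t = ∑ f : E → T, ∏ e, F e (f e) := by
  rw [← Fintype.piFinset_univ, ← Finset.prod_univ_sum]

lemma prod_univ_sum_pi₂ {R E T : Type} [CommSemiring R] [Fintype E] [DecidableEq E] [Fintype T]
    (F : E → T → T → R) :
    ∏ e, ∑ t, ∑ t', F e t t' = ∑ f : E → T, ∑ f' : E → T, ∏ e, F e (f e) (f' e) := by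
  rw [prod_univ_sum_pi fun e t => ∑ t', F e t t']
  exact sum_congr rfl fun f _ => prod_univ_sum_pi fun e t' => F e (f e) t'

lemma sum_comm_pairs {R X Y U V : Type} [AddCommMonoid R] [Fintype X] [Fintype Y] [Fintype U]
    [Fintype V] (F : X → Y → U → V → R) :
    ∑ x, ∑ y, ∑ u, ∑ v, F x y u v = ∑ u, ∑ v, ∑ x, ∑ y, F x y u v := by
  rw [sum_congr rfl fun x _ => sum_comm, sum_comm]
  refine sum_congr rfl fun u _ => ?_
  rw [sum_congr rfl fun x _ => sum_comm, sum_comm]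

end KeyRegister

section Weights

variable (P : PRFSPD) (S : SKE) (lam : ℕ)

/-- Symmetric keys, strings and proofs. -/
abbrev Rec : Type := Cfg (S.Slot lam) × (S.Slot lam → P.Input lam) ×
  (S.Slot lam → P.Proof lam)

variable {P S lam}

/-- The recycled key with the given contents. -/
def recCfg (r : Rec P S lam) : Cfg (Key P S lam) :=
  mkKey true r.2.1 (fun _ _ => false) r.1 r.2.2

/-- The weight of the event that encryption leads to the given recycled key. -/
def recWeight (r : Rec P S lam) (ρ : Op (Key P S lam)) : ℂ :=
  freshWeight P S lam ρ (recCfg r) + recycledWeight P S lam ρ (recCfg r)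

lemma isLinear_recWeight (r : Rec P S lam) : IsLinearMap ℂ (recWeight r) := by
  refine IsLinearMap.add' ?_ ?_
  · refine IsLinearMap.smul' _ (IsLinearMap.sum' _ fun u => IsLinearMap.sum' _ fun u' => ?_)
    refine ⟨fun ρ σ => ?_, fun a ρ => ?_⟩
    · split_ifs
      · rw [Matrix.add_apply, add_mul]
      · rw [add_zero]
    · split_ifs
      · rw [Matrix.smul_apply, smul_eq_mul, smul_eq_mul, mul_assoc]
      · rw [smul_zero]
  · refine IsLinearMap.sum' _ fun u => ⟨fun ρ σ => ?_, fun a ρ => ?_⟩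
    · split_ifs
      · rfl
      · rw [add_zero]
    · split_ifs
      · rfl
      · rw [smul_zero]

/-- The matrix elements of the measurement of the proof in a slot of a fresh key. -/
def slotCoeff (b : Bool) (x : P.Input lam) (y : P.Proof lam) (q q' : P.Output lam) : ℂ :=
  if b = true then (P.destruct lam).coeff y q q'
  else (∑ y, (P.destruct lam).coeff y q q') * (fakeProof P lam x y : ℂ)

lemma sum_slotCoeff (b : Bool) (x : P.Input lam) (q q' : P.Output lam) : ∑ y, slotCoeff b x y q q' =
    if q = q' then 1 else 0 := by
  cases b
  · simp only [slotCoeff, Bool.false_eq_true, if_false]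
    rw [← mul_sum, QAlg.sum_coeff, ← ofReal_sum, sum_fakeProof, Complex.ofReal_one, mul_one]
  · simp only [slotCoeff, if_true]
    exact QAlg.sum_coeff _ _ _

lemma freshWeight_recCfg (r : Rec P S lam) (ρ : Op (Key P S lam)) :
    freshWeight P S lam ρ (recCfg r) = (1 / 2 ^ S.keyLen lam) * ∑ u : Cfg (Key P S lam),
      ∑ u' : Cfg (Key P S lam), if flag u = false ∧ flag u' = false ∧ str u = r.2.1 ∧
        str u' = r.2.1 ∧ bit u = bit u' ∧ prf u = prf u' then
      ρ u u' * ∏ i, slotCoeff (r.1 i) (r.2.1 i) (r.2.2 i) (sys u i) (sys u' i) else 0 := rfl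

lemma sum_freshWeight (ρ : Op (Key P S lam)) : ∑ r : Rec P S lam, freshWeight P S lam ρ (recCfg r) =
    ∑ u, if flag u = false then ρ u u else 0 := by
  have e : ∀ (k : Cfg (S.Slot lam)) (u u' : Cfg (Key P S lam)),
      (∑ x, ∑ y : S.Slot lam → P.Proof lam,
        if flag u = false ∧ flag u' = false ∧ str u = x ∧ str u' = x ∧ bit u = bit u' ∧
          prf u = prf u' then ρ u u' * ∏ i, slotCoeff (k i) (x i) (y i) (sys u i) (sys u' i)
        else 0) = if u' = u then (if flag u = false then ρ u u else 0) else 0 := by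
    intro k u u'
    rw [sum_eq_single (str u) (fun x _ hx => ?_) (by simp)]
    · by_cases h : flag u = false ∧ flag u' = false ∧ str u = str u ∧ str u' = str u ∧
        bit u = bit u' ∧ prf u = prf u'
      · rw [sum_congr rfl fun y _ => if_pos h, ← mul_sum, ← prod_univ_sum_pi fun i y =>
          slotCoeff (k i) (str u i) y (sys u i) (sys u' i)]
        simp only [sum_slotCoeff]
        by_cases h' : u' = u
        · subst h'
          simp [h.1]
        · have : sys u ≠ sys u' := fun hs => h' (key_ext (h.2.1.trans h.1.symm) h.2.2.2.1 hs.symm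
            h.2.2.2.2.1.symm h.2.2.2.2.2.symm)
          obtain ⟨i, hi⟩ := Function.ne_iff.mp this
          rw [prod_eq_zero (mem_univ i) (if_neg hi), mul_zero, if_neg h']
      · rw [sum_congr rfl fun y _ => if_neg h, sum_const_zero]
        by_cases h' : u' = u
        · subst h'
          rw [if_pos rfl, eq_comm, if_neg]
          exact fun hf => h ⟨hf, hf, rfl, rfl, rfl, rfl⟩
        · rw [if_neg h']
    · refine sum_eq_zero fun y _ => if_neg fun h => hx h.2.2.1.symm
  rw [sum_prod_type]
  simp only [freshWeight_recCfg, sum_prod_type, ← mul_sum]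
  have e2 : ∀ k : Cfg (S.Slot lam), (∑ x, ∑ y : S.Slot lam → P.Proof lam, ∑ u, ∑ u',
        if flag u = false ∧ flag u' = false ∧ str u = x ∧ str u' = x ∧ bit u = bit u' ∧
          prf u = prf u' then ρ u u' * ∏ i, slotCoeff (k i) (x i) (y i) (sys u i) (sys u' i)
        else 0) = ∑ u, if flag u = false then ρ u u else 0 := by
    intro k
    rw [sum_comm_pairs]
    simp only [e]
    simp
  simp only [e2]
  rw [sum_const, card_univ, nsmul_eq_mul, ← mul_assoc]
  have : ((card (Cfg (S.Slot lam)) : ℕ) : ℂ) = 2 ^ S.keyLen lam := by simp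
  rw [this]
  have h2 : (2 : ℂ) ^ S.keyLen lam ≠ 0 := by positivity
  field_simp

lemma sum_recycledWeight (ρ : Op (Key P S lam)) : ∑ r : Rec P S lam,
    recycledWeight P S lam ρ (recCfg r) = ∑ u, if flag u = true then ρ u u else 0 := by
  simp only [recycledWeight]
  rw [sum_comm]
  refine sum_congr rfl fun u _ => ?_
  rw [sum_eq_single (bit u, str u, prf u)]
  · refine if_congr ?_ rfl rfl
    exact ⟨fun h => h.1, fun h => ⟨h, rfl, rfl, rfl⟩⟩
  · intro r _ hr
    refine if_neg fun h => hr ?_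
    exact (Prod.ext h.2.2.1 (Prod.ext h.2.1 h.2.2.2)).symm
  · simp

lemma sum_recWeight (ρ : Op (Key P S lam)) : ∑ r : Rec P S lam, recWeight r ρ = ρ.trace := by
  simp only [recWeight]
  rw [sum_add_distrib, sum_freshWeight, sum_recycledWeight, ← sum_add_distrib, trace]
  refine sum_congr rfl fun u _ => ?_
  cases h : flag u <;> simp

/-- The ciphertexts produced with a recycled key. -/
def Rec.kernel (r : Rec P S lam) : Kernel (Ct P S lam) :=
  recKernel P S lam r.1 (mkRec r.2.1 r.2.2)

lemma recWeight_enc (r : Rec P S lam) (ℓ : ℕ) (m : Cfg (Fin ℓ)) (z : Cfg (Ct P S lam ℓ))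
    (ρ : Op (Key P S lam)) :
    recWeight r (Construction.enc P S lam ℓ m z ρ) = r.kernel ℓ m z * recWeight r ρ := by
  have h0 : freshWeight P S lam (Construction.enc P S lam ℓ m z ρ) (recCfg r) = 0 := by
    rw [freshWeight_recCfg]
    refine mul_eq_zero_of_right _ (sum_eq_zero fun u _ => sum_eq_zero fun u' _ => ?_)
    split_ifs with h
    · rw [Construction.enc, of_apply, if_neg, zero_mul]
      intro h'
      exact absurd (h.1.symm.trans h'.2.1) Bool.false_ne_true
    · rfl
  rw [recWeight, h0, zero_add, recycledWeight, sum_eq_single (recCfg r)]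
  · rw [if_pos ⟨rfl, rfl, rfl, rfl⟩, Construction.enc, of_apply, Rec.kernel, recKernel]
    have hz : (z ∘ inr = mkRec r.2.1 r.2.2) ↔ r.2.1 = ctStr z ∧ r.2.2 = ctPrf z := by
      constructor
      · intro h
        exact ⟨funext fun i => funext fun j => (congrFun h (i, inl j)).symm,
          funext fun i => funext fun j => (congrFun h (i, inr j)).symm⟩
      · rintro ⟨h, h'⟩
        funext ⟨i, j⟩
        rw [mkRec, h, h']
        rcases j with j | j <;> rfl
    by_cases h : z ∘ inr = mkRec r.2.1 r.2.2
    · rw [if_pos h, if_pos ⟨rfl, rfl, rfl, (hz.1 h).1, (hz.1 h).2⟩, mul_comm]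
      rfl
    · rw [if_neg h, if_neg fun h' => h (hz.2 ⟨h'.2.2.2.1, h'.2.2.2.2⟩)]
      simp
  · intro u _ hu
    split_ifs with h
    · rw [Construction.enc, of_apply, if_neg]
      intro h'
      exact hu (key_ext h.1 h.2.1 h'.2.2.1 h.2.2.1 h.2.2.2)
    · rfl
  · simp

/-- The probability of the proof `y` in a slot of a fresh key which holds the string `x`. -/
def slotProb (b : Bool) (k : P.Seed lam) (x : P.Input lam) (y : P.Proof lam) : ℝ :=
  if b = true then (P.destruct lam).probPure (P.state lam k x) y else fakeProof P lam x y

lemma sum_state_slotCoeff (b : Bool) (k : P.Seed lam) (x : P.Input lam) (y : P.Proof lam) : ∑ q,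
    ∑ q', P.state lam k x q * star (P.state lam k x q') * slotCoeff b x y q q' =
    (slotProb b k x y : ℂ) := by
  cases b
  · simp only [slotCoeff, slotProb, Bool.false_eq_true, if_false, QAlg.sum_coeff]
    have : ∀ q, ∑ q', P.state lam k x q * star (P.state lam k x q') *
        ((if q = q' then 1 else 0) * (fakeProof P lam x y : ℂ)) =
        ((‖P.state lam k x q‖ ^ 2 : ℝ) : ℂ) * (fakeProof P lam x y : ℂ) := by
      intro q
      rw [sum_eq_single q (fun q' _ h => by simp [Ne.symm h]) (by simp), if_pos rfl, one_mul]
      congr 1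
      rw [Complex.ofReal_pow]
      exact Complex.mul_conj' _
    simp only [this]
    rw [← sum_mul, ← ofReal_sum, P.state_norm, Complex.ofReal_one, one_mul]
  · simp only [slotCoeff, slotProb, if_true]
    exact (QAlg.probPure_eq _ _ _).symm

lemma recWeight_qpk (r : Rec P S lam) (dk : Cfg (Dk P S lam)) :
    recWeight r (pureState (qpk P S lam dk)) = (((1 / 2 ^ S.keyLen lam) *
      ∏ i, ((2 ^ P.inLen lam)⁻¹ * slotProb (r.1 i) (slotKey dk i) (r.2.1 i) (r.2.2 i)) : ℝ) : ℂ) :=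
          by
  have h0 : recycledWeight P S lam (pureState (qpk P S lam dk)) (recCfg r) = 0 := by
    refine sum_eq_zero fun u _ => ?_
    split_ifs with h
    · rw [pureState_apply, qpk, if_neg fun h' => Bool.false_ne_true (h'.1.symm.trans h.1), zero_mul]
    · rfl
  let mk : (S.Slot lam → P.Output lam) → Cfg (Key P S lam) := fun q =>
    mkKey false r.2.1 q (fun _ => false) (fun _ _ => false)
  have hmk : Injective mk := fun q q' h => congrArg sys h
  have hr : ∀ u : Cfg (Key P S lam), u ∉ Set.range mk →
      ¬ (flag u = false ∧ str u = r.2.1) ∨ qpk P S lam dk u = 0 := by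
    intro u hu
    by_contra! h
    refine hu ⟨sys u, ?_⟩
    have h2 : flag u = false ∧ bit u = (fun _ => false) ∧ prf u = (fun _ _ => false) := by
      by_contra h'
      exact h.2 (if_neg h')
    exact key_ext h.1.1.symm h.1.2.symm rfl h2.2.1.symm h2.2.2.symm
  rw [recWeight, h0, add_zero, freshWeight_recCfg, ofReal_mul, Complex.ofReal_prod]
  congr 1
  · simp
  · rw [← sum_of_injective mk hmk (fun q => ∑ q' : S.Slot lam → P.Output lam, (∏ i, ((((√(2 ^
      P.inLen lam))⁻¹ : ℝ) : ℂ) *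
        P.state lam (slotKey dk i) (r.2.1 i) (q i))) *
        star (∏ i, ((((√(2 ^ P.inLen lam))⁻¹ : ℝ) : ℂ) *
          P.state lam (slotKey dk i) (r.2.1 i) (q' i))) *
        ∏ i, slotCoeff (r.1 i) (r.2.1 i) (r.2.2 i) (q i) (q' i))]
    · simp only [Complex.star_def, map_prod, ← prod_mul_distrib]
      refine (prod_univ_sum_pi₂ fun i q q' => (((√(2 ^ P.inLen lam))⁻¹ : ℝ) : ℂ) *
        P.state lam (slotKey dk i) (r.2.1 i) q * (starRingEnd ℂ) ((((√(2 ^ P.inLen lam))⁻¹ : ℝ) :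
            ℂ) *
        P.state lam (slotKey dk i) (r.2.1 i) q') *
        slotCoeff (r.1 i) (r.2.1 i) (r.2.2 i) q q').symm.trans ?_
      refine prod_congr rfl fun i _ => ?_
      rw [ofReal_mul, ← sum_state_slotCoeff, mul_sum]
      refine sum_congr rfl fun q _ => ?_
      rw [mul_sum]
      refine sum_congr rfl fun q' _ => ?_
      have : (((2 ^ P.inLen lam)⁻¹ : ℝ) : ℂ) = (((√(2 ^ P.inLen lam))⁻¹ : ℝ) : ℂ) *
          (((√(2 ^ P.inLen lam))⁻¹ : ℝ) : ℂ) := by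
        rw [← ofReal_mul, ← mul_inv, Real.mul_self_sqrt (by positivity)]
      rw [this, map_mul, Complex.conj_ofReal, Complex.star_def]
      ring
    · intro u hu
      refine sum_eq_zero fun u' _ => ?_
      rcases hr u hu with h | h
      · exact if_neg fun h' => h ⟨h'.1, h'.2.2.1⟩
      · rw [pureState_apply, h]
        simp
    · intro q
      refine (sum_of_injective mk hmk _ _ (fun u hu => ?_) fun q' => ?_)
      · rcases hr u hu with h | h
        · exact if_neg fun h' => h ⟨h'.2.1, h'.2.2.2.1⟩
        · rw [pureState_apply, h]
          simp
      · rw [if_pos ⟨rfl, rfl, rfl, rfl, rfl, rfl⟩, pureState_apply]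
        have hq : ∀ q, qpk P S lam dk (mk q) = ∏ i, ((((√(2 ^ P.inLen lam))⁻¹ : ℝ) : ℂ) *
            P.state lam (slotKey dk i) (r.2.1 i) (q i)) := fun q => if_pos ⟨rfl, rfl, rfl⟩
        rw [hq, hq]
        rfl

end Weights

/-! ### Slots of the public key as independent random variables -/

section Slots

variable (P : PRFSPD) (S : SKE) (lam : ℕ)

/-- A PRFSPD key, a string and a proof. -/
abbrev SlotVal : Type :=
  P.Seed lam × P.Input lam × P.Proof lam

abbrev SlotVals : Type := S.Slot lam → Bool × SlotVal P lam

variable {P S lam}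

lemma slotProb_nonneg (b : Bool) (k : P.Seed lam) (x : P.Input lam)
    (y : P.Proof lam) : 0 ≤ slotProb b k x y := by
  rw [slotProb]
  split_ifs
  · exact QAlg.probPure_nonneg _ _ _
  · exact fakeProof_nonneg P lam x y

lemma sum_slotProb (b : Bool) (k : P.Seed lam) (x : P.Input lam) : ∑ y, slotProb b k x y = 1 := by
  cases b
  · exact sum_fakeProof P lam x
  · exact (QAlg.sum_probPure _ _).trans (P.state_norm lam k x)

/-- The distribution of the values in a slot, given the bit of the symmetric key. -/
def valProb (b : Bool) (t : SlotVal P lam) : ℝ :=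
  (1 / 2 ^ P.keyLen lam) * ((1 / 2 ^ P.inLen lam) * slotProb b t.1 t.2.1 t.2.2)

lemma valProb_nonneg (b : Bool) (t : SlotVal P lam) : 0 ≤ valProb b t := by
  have := slotProb_nonneg b t.1 t.2.1 t.2.2
  rw [valProb]
  positivity

lemma sum_valProb_mul (b : Bool) (g : SlotVal P lam → ℝ) :
    ∑ t, valProb b t * g t = avg fun k => avg fun x => ∑ y, slotProb b k x y * g (k, x, y) := by
  simp only [sum_prod_type, avg, sum_div]
  refine sum_congr rfl fun k _ => sum_congr rfl fun x _ =>
    sum_congr rfl fun y _ => ?_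
  rw [valProb]
  ring

lemma sum_valProb (b : Bool) : ∑ t : SlotVal P lam, valProb b t = 1 := by
  have h := sum_valProb_mul (P := P) (lam := lam) b fun _ => 1
  simp only [mul_one, sum_slotProb, avg_const] at h
  exact h

/-- The distribution of the bit of the symmetric key and the values in a slot. -/
def slotWeight (h : Bool → Bool) (t : Bool × SlotVal P lam) : ℝ := 1 / 2 * valProb (h t.1) t.2

lemma slotWeight_nonneg (h : Bool → Bool) (t : Bool × SlotVal P lam) : 0 ≤ slotWeight h t :=
  mul_nonneg (by norm_num) (valProb_nonneg _ _)

lemma sum_slotWeight (h : Bool → Bool) : ∑ t : Bool × SlotVal P lam, slotWeight h t = 1 := by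
  rw [sum_prod_type]
  simp only [slotWeight, ← mul_sum, sum_valProb]
  simp

/-- The decryption key determined by the values in the slots. -/
def slotsDk (f : SlotVals P S lam) : Cfg (Dk P S lam) :=
  fun p => (f p.1).2.1 p.2

/-- The classical part of the recycled key determined by the values in the slots. -/
def slotsRec (f : SlotVals P S lam) : Rec P S lam :=
  (fun i => (f i).1, fun i => (f i).2.2.1, fun i => (f i).2.2.2)

/-- Slotwise description of decryption keys and recycled keys. -/
def slotsEquiv :
    (SlotVals P S lam) ≃ Cfg (Dk P S lam) × Rec P S lam where
  toFun f := (slotsDk f, slotsRec f)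
  invFun p i := (p.2.1 i, slotKey p.1 i, p.2.2.1 i, p.2.2.2 i)
  left_inv _ := rfl
  right_inv _ := rfl

lemma sum_slots (F : Cfg (Dk P S lam) → Rec P S lam → ℝ) :
    ∑ dk : Cfg (Dk P S lam), 1 / 2 ^ (S.keyLen lam * P.keyLen lam) * ∑ r : Rec P S lam, ((1 / 2 ^
        S.keyLen lam) *
      ∏ i, ((2 ^ P.inLen lam)⁻¹ * slotProb (r.1 i) (slotKey dk i) (r.2.1 i) (r.2.2 i))) * F dk r =
    ∑ f : SlotVals P S lam,
      (∏ i, slotWeight id (f i)) * F (slotsDk f) (slotsRec f) := by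
  simp only [mul_sum]
  rw [← sum_prod_type', ← slotsEquiv.sum_comp]
  refine sum_congr rfl fun f _ => ?_
  rw [← mul_assoc]
  refine congrArg (· * F (slotsDk f) (slotsRec f)) ?_
  have e : ∀ a : ℝ, a ^ S.keyLen lam = ∏ _i : S.Slot lam, a := fun a => by simp
  rw [mul_comm (S.keyLen lam), pow_mul, ← _root_.one_div_pow, ← _root_.one_div_pow, e,
    ← _root_.one_div_pow, e, ← prod_mul_distrib, ← prod_mul_distrib]
  refine prod_congr rfl fun i _ => ?_
  rw [slotWeight, valProb, one_div (2 ^ P.inLen lam), _root_.one_div_pow]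
  change _ * (_ * (_ * slotProb (f i).1 (f i).2.1 (f i).2.2.1 (f i).2.2.2)) = _
  simp only [id]
  ring

lemma sum_slotWeight_split (h : Bool → Bool)
    (F : Cfg (S.Slot lam) → (S.Slot lam → SlotVal P lam) → ℝ) : ∑ f :
    SlotVals P S lam, (∏ i, slotWeight h (f i)) * F (fun i => (f i).1)
    (fun i => (f i).2) = avg fun k => ∑ u : S.Slot lam → SlotVal P lam,
    (∏ i, valProb (h (k i)) (u i)) * F k u := by
  rw [← (Equiv.arrowProdEquivProdArrow (S.Slot lam) (fun _ => Bool)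
    (fun _ => SlotVal P lam)).symm.sum_comp, sum_prod_type, avg, sum_div]
  refine sum_congr rfl fun k _ => ?_
  rw [sum_div]
  refine sum_congr rfl fun u _ => ?_
  change (∏ i, 1 / 2 * valProb (h (k i)) (u i)) * F k u = _
  rw [prod_mul_distrib, prod_const, card_univ, card_fin, _root_.one_div_pow]
  ring

/-- The winning probability against the construction, as an average over independent slots. -/
lemma sum_win_eq (A : CPAAdv (Key P S lam) (Ct P S lam)) : ∑ dk : Cfg (Dk P S lam),
    1 / 2 ^ (S.keyLen lam * P.keyLen lam) * A.win (qpk P S lam dk) (Construction.enc P S lam)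
    (pureState (qpk P S lam dk)) = ∑ f : SlotVals P S lam,
    (∏ i, slotWeight id (f i)) * gwin A (qpk P S lam (slotsDk f)) fun _ => (slotsRec f).kernel := by
  rw [← sum_slots fun dk r => gwin A (qpk P S lam dk) fun _ => r.kernel]
  refine sum_congr rfl fun dk _ =>
    congrArg (1 / 2 ^ (S.keyLen lam * P.keyLen lam) * ·) ?_
  exact CPAAdv.win_eq (fun r => (isLinear_recWeight r).mk' _) sum_recWeight A _ _
    (fun r => r.kernel) recWeight_enc _ _ fun r => recWeight_qpk r dk

end Slots

/-! ### Security of the construction -/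

section Security

variable {P : PRFSPD} {S : SKE} {lam : ℕ}

lemma Prep.qpk {Θ Z : Type} [Nonempty Z] {O : Oracles Θ Z} (dk : Cfg (Dk P S lam)) :
    Prep O (qpkCost P S lam) fun _ => pureState (Construction.qpk P S lam dk) :=
  Prep.pkVec (u := fun i _ => P.state lam (slotKey dk i)) fun _ => StatePrep.slotFix P lam _

/-- Cost of the adversary against the symmetric scheme. -/
def symCost (P : PRFSPD) (S : SKE) (lam N L : ℕ) : ℕ := N + 1 + L * (qpkCost P S lam +
  9 * (S.keyLen lam * (P.inLen lam + P.proofLen lam)) + 4)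

lemma win_hybrid_le {ε δ : ℝ} {s : ℕ}
    (hε : P.HaarBound lam s ε)
    (hδ : ∀ B : CPAAdv Empty (fun ℓ => Fin (S.ctLen lam ℓ)), B.size ≤ s →
      avg (fun k => gwin B (fun _ => 1) fun _ ℓ => S.encProb lam ℓ k) ≤ 1 / 2 + δ)
    (A : CPAAdv (Key P S lam) (Ct P S lam)) {e : ℕ}
    (he : ∀ ℓ, ℓ ≤ A.wires → (S.enc lam ℓ).size ≤ e)
    (hs : slotCost P S lam A.wires A.prog.length e ≤ s)
    (hs' : symCost P S lam A.wires A.prog.length ≤ s) :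
    ∑ dk : Cfg (Dk P S lam), 1 / 2 ^ (S.keyLen lam * P.keyLen lam) * A.win (qpk P S lam dk)
        (Construction.enc P S lam)
      (pureState (qpk P S lam dk)) ≤ 1 / 2 + (δ + S.keyLen lam *
        (1 / 2 * (3 * ε + A.prog.length * (4 / √(2 ^ P.inLen lam))))) := by
  rw [sum_win_eq]
  set g : (SlotVals P S lam) → ℝ := fun f =>
    gwin A (qpk P S lam (slotsDk f)) fun _ => (slotsRec f).kernel with hg
  have h1 := abs_sum_prod_sub_le (a := fun _ : S.Slot lam => slotWeight (P := P) (lam := lam) id)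
    (b := fun _ => slotWeight fun _ => false) (fun _ => slotWeight_nonneg _)
    (fun _ => sum_slotWeight _) (fun _ => slotWeight_nonneg _) (fun _ => sum_slotWeight _) g
    (ε := 1 / 2 * (3 * ε + A.prog.length * (4 / √(2 ^ P.inLen lam)))) (by
      intro i f
      have hslot := fun x => abs_slot_le hε A he hs i (fun j => (f j).2.1)
        (update (fun j => (f j).1) i true)
        (mkRec (update (fun j => (f j).2.2.1) i x) fun j => (f j).2.2.2) x
      have hgu : ∀ k' x y, g (update f i (true, k', x, y)) =
          gwin A (pkVec fun j => P.state lam (update (fun j => (f j).2.1) i k' j))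
            fun _ => recKernel P S lam (update (fun j => (f j).1) i true)
              (setPrf (mkRec (update (fun j => (f j).2.2.1) i x) fun j => (f j).2.2.2)
                i y) := by
        intro k' x y
        have e1 : qpk P S lam (slotsDk (update f i (true, k', x, y))) =
            pkVec fun j => P.state lam (update (fun j => (f j).2.1) i k' j) := by
          change pkVec (fun j => P.state lam (update f i (true, k', x, y) j).2.1) = _
          congr 1
          funext j
          by_cases hj : j = i
          · subst hj; simp
          · simp [hj]
        have e2 : (fun j => (update f i (true, k', x, y) j).1) =
            update (fun j => (f j).1) i true := by
          funext j
          by_cases hj : j = i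
          · subst hj; simp
          · simp [hj]
        have e3 : mkRec (fun j => (update f i (true, k', x, y) j).2.2.1)
            (fun j => (update f i (true, k', x, y) j).2.2.2) =
            setPrf (mkRec (update (fun j => (f j).2.2.1) i x) fun j => (f j).2.2.2) i y := by
          funext ⟨j, l⟩
          by_cases hj : j = i
          · subst hj
            rcases l with l | l <;> simp [mkRec, setPrf]
          · rcases l with l | l <;> simp [mkRec, setPrf, hj]
        rw [hg]
        beta_reduce
        rw [e1, ← e2, ← e3]
        rfl
      rw [sum_prod_type, sum_bool]
      have hf : ∑ t : SlotVal P lam, (slotWeight id (false, t) - slotWeight (fun _ => false)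
          (false, t)) * g (update f i (false, t)) = 0 :=
        sum_eq_zero fun t _ => by rw [slotWeight, slotWeight]; simp
      have ht : ∑ t : SlotVal P lam, (slotWeight id (true, t) - slotWeight (fun _ => false)
          (true, t)) * g (update f i (true, t)) = 1 / 2 * avg fun x => avg fun k' =>
            ∑ y, ((P.destruct lam).probPure (P.state lam k' x) y - fakeProof P lam x y) *
              g (update f i (true, k', x, y)) := by
        rw [sum_prod_type]
        simp only [sum_prod_type, avg, sum_div, mul_sum]
        rw [sum_comm]
        refine sum_congr rfl fun x _ => sum_congr rfl fun k' _ =>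
          sum_congr rfl fun y _ => ?_
        simp only [slotWeight, valProb, id, slotProb, if_true, Bool.false_eq_true, if_false]
        ring
      rw [hf, ht, add_zero, abs_mul, abs_of_pos (by norm_num : (0 : ℝ) < 1 / 2)]
      refine mul_le_mul_of_nonneg_left ?_ (by norm_num)
      simp only [hgu]
      rw [avg, abs_div, abs_of_pos (by positivity : (0 : ℝ) < 2 ^ P.inLen lam),
        div_le_iff₀ (by positivity)]
      refine (abs_sum_le_sum_abs _ _).trans ((sum_le_sum fun x _ => hslot x).trans ?_)
      rw [sum_const, card_univ, nsmul_eq_mul, card_cfg, mul_comm])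
  rw [card_fin] at h1
  have h2 : ∑ f, (∏ i : S.Slot lam, slotWeight (fun _ => false) (f i)) * g f ≤ 1 / 2 + δ := by
    have e := sum_slotWeight_split (P := P) (S := S) (lam := lam) (fun _ => false) fun k u =>
      g fun i => (k i, u i)
    refine e.trans_le ?_
    rw [avg_sum]
    have hu : ∀ u : S.Slot lam → SlotVal P lam,
        avg (fun k => (∏ i, valProb false (u i)) * g fun i => (k i, u i)) ≤
          (∏ i, valProb false (u i)) * (1 / 2 + δ) := by
      intro u
      obtain ⟨B, hB, hBg⟩ := exists_cpaAdv A (qpk P S lam fun p => (u p.1).1 p.2)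
        (mkRec (fun i => (u i).2.1) fun i => (u i).2.2)
        (Prep.qpk (O := cpaOracle fun ℓ => Fin (S.ctLen lam ℓ)) _)
      have hsB : B.size ≤ s := by
        refine hB.trans (le_trans (le_of_eq ?_) hs')
        simp [symCost]
      have := hδ B hsB
      simp only [hBg] at this
      simp only [mul_comm (∏ i, valProb false (u i))]
      rw [avg_mul_const]
      exact mul_le_mul_of_nonneg_right this (prod_nonneg fun i _ => valProb_nonneg _ _)
    refine (sum_le_sum fun u _ => hu u).trans ?_
    rw [← sum_mul, sum_prod_eq_one fun _ => sum_valProb false, one_mul]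
  have h3 := (abs_le.mp h1).2
  linarith

lemma INDCPA.uniform (h : S.INDCPA) (p : Polynomial ℕ) : ∃ ε : ℕ → ℝ, Negligible ε ∧
    (∀ lam, 0 ≤ ε lam) ∧ ∀ lam (B : CPAAdv Empty fun ℓ => Fin (S.ctLen lam ℓ)), B.size ≤
    p.eval lam → avg (fun k => gwin B (fun _ => 1) fun _ ℓ => S.encProb lam ℓ k) ≤ 1 / 2 +
    ε lam := by
  have hu := exists_uniform_bound (fun lam (B : CPAAdv Empty fun ℓ => Fin (S.ctLen lam ℓ)) =>
      B.size)
    (fun lam B => avg (fun k => gwin B (fun _ => 1) fun _ ℓ => S.encProb lam ℓ k) - 1 / 2) (B := 1)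
    (fun lam B => ?_) (fun _ => ⟨1, [], 0⟩) (fun _ => le_rfl) (fun A hA => ?_) p
  · obtain ⟨ε, h1, h2, h3⟩ := hu
    exact ⟨ε, h1, h2, fun lam B hB => by linarith [h3 lam B hB]⟩
  · have := avg_mono (f := fun k => gwin B (fun _ => 1) fun _ ℓ => S.encProb lam ℓ k)
      (g := fun _ => 1) fun k => gwin_le_one B (by simp) fun _ ℓ m =>
        ⟨fun c => QAlg.prob_nonneg _ _ _, QAlg.sum_prob _ _⟩
    rw [avg_const] at this
    linarith
  · obtain ⟨ε, h1, h2⟩ := h A hA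
    refine ⟨ε, h1, fun lam => ?_⟩
    have := h2 lam
    have e : ∀ k, (A lam).win (K := Empty) (fun _ => 1)
        (fun ℓ m c ρ => (S.encProb lam ℓ k m c : ℂ) • ρ) 1 =
        gwin (A lam) (fun _ => 1) fun _ ℓ => S.encProb lam ℓ k :=
      fun k => CPAAdv.win_empty _ _ fun ℓ => S.encProb lam ℓ k
    simp only [e] at this
    linarith

/-! ### Polynomial bounds -/

lemma PolyBounded.lengths (h : P.IsQPT) : PolyBounded P.keyLen ∧ PolyBounded P.inLen ∧
    PolyBounded P.outLen ∧ PolyBounded P.proofLen := by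
  refine ⟨h.1.of_le fun lam => ?_, h.1.of_le fun lam => ?_, h.2.1.of_le fun lam => ?_,
    h.2.1.of_le fun lam => ?_⟩
  · have := card_le_size_inp (P.gen lam)
    simp at this
    omega
  · have := card_le_size_inp (P.gen lam)
    simp at this
    omega
  · simpa using card_le_size_inp (P.destruct lam)
  · simpa using card_le_size_out (P.destruct lam)

lemma PolyBounded.cost (h : P.IsQPT) : PolyBounded P.cost := by
  obtain ⟨h1, h2, h3, h4⟩ := PolyBounded.lengths h
  exact (((((PolyBounded.const 8).mul (((h1.add h2).add h3).add h4)).add h.1).add h.2.1).add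
    h.2.2).add (.const 1)

lemma PolyBounded.encSize (h : S.IsQPT) {N : ℕ → ℕ} (hN : PolyBounded N) : ∃ e : ℕ → ℕ,
    PolyBounded e ∧ ∀ lam ℓ, ℓ ≤ N lam → (S.enc lam ℓ).size ≤ e lam ∧ (S.dec lam ℓ).size ≤
    e lam := by
  obtain ⟨p, hp⟩ := h
  have hid : PolyBounded fun n => n := ⟨Polynomial.X, fun n => by simp⟩
  refine ⟨_, (hid.add hN).comp p, fun lam ℓ hℓ => ?_⟩
  have := eval_mono p (Nat.add_le_add_left hℓ lam)
  exact ⟨(hp lam ℓ).1.trans this, (hp lam ℓ).2.trans this⟩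

lemma PolyBounded.symKeyLen (h : S.IsQPT) : PolyBounded S.keyLen := by
  obtain ⟨e, he, h'⟩ := PolyBounded.encSize h (PolyBounded.const 0)
  refine he.of_le fun lam => le_trans ?_ (h' lam 0 le_rfl).1
  simpa using card_le_size_inp (S.enc lam 0)

lemma PolyBounded.qpkCost (hP : P.IsQPT) (hS : S.IsQPT) : PolyBounded (QPK.qpkCost P S) := by
  obtain ⟨h1, h2, h3, h4⟩ := PolyBounded.lengths hP
  have hk := PolyBounded.symKeyLen hS
  exact (hk.mul ((PolyBounded.const 8).mul (PolyBounded.cost hP))).add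
    ((PolyBounded.const 1).add (hk.mul (((h2.add h3).add (.const 1)).add h4)))

lemma indcpaeo (hP : P.QuantumSecure) (hd : P.SuperlogInput) (hS : S.QuantumSecure) :
    (construction P S).INDCPAEO := by
  intro A hA
  have hN : PolyBounded fun lam => (A lam).wires := hA.of_le fun _ => Nat.le_add_right _ _
  have hL : PolyBounded fun lam => (A lam).prog.length := hA.of_le fun _ => Nat.le_add_left _ _
  obtain ⟨h1, h2, h3, h4⟩ := PolyBounded.lengths hP.qpt
  have hk := PolyBounded.symKeyLen hS.qpt
  have hc := PolyBounded.cost hP.qpt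
  have hq := PolyBounded.qpkCost hP.qpt hS.qpt
  obtain ⟨e, he, heS⟩ := PolyBounded.encSize hS.qpt hN
  have hrec : PolyBounded fun lam => recCost P S lam (P.proofLen lam) (e lam) :=
    ((((PolyBounded.const 6).mul h4).add ((PolyBounded.const 20).mul he)).add
      ((PolyBounded.const 10).mul (hk.mul (h2.add h4))))
  have hslot : PolyBounded fun lam =>
      slotCost P S lam (A lam).wires (A lam).prog.length (e lam) :=
    ((((PolyBounded.const 20).mul hc).add (hN.add (.const 1))).add (hL.mul
      (((((PolyBounded.const 13).mul (h4.add hN)).add hq).add hrec).add (.const 3)))).add (.const 1)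
  have hsym : PolyBounded fun lam => symCost P S lam (A lam).wires (A lam).prog.length :=
    (hN.add (.const 1)).add (hL.mul ((hq.add
      ((PolyBounded.const 9).mul (hk.mul (h2.add h4)))).add (.const 4)))
  obtain ⟨p, hp⟩ := hslot.add hsym
  obtain ⟨ε, hε, hε0, hεA⟩ := PRFSPD.Pseudorandom.uniform hP.pseudorandom p
  obtain ⟨δ, hδ, hδ0, hδA⟩ := INDCPA.uniform hS.indcpa p
  refine ⟨fun lam => δ lam + S.keyLen lam *
    (1 / 2 * (3 * ε lam + (A lam).prog.length * (4 / √(2 ^ P.inLen lam)))), ?_, fun lam => ?_⟩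
  · refine hδ.add (Negligible.poly_mul (((hε.const_mul 3).add (Negligible.poly_mul
      ((negligible_inv_sqrt hd).const_mul 4) (fun n => by positivity) hL)).const_mul _)
      (fun n => ?_) hk)
    have := hε0 n
    positivity
  · have h0 : _ + _ ≤ _ := hp lam
    exact win_hybrid_le (hεA lam) (hδA lam) (A lam) (fun ℓ hℓ => (heS lam ℓ hℓ).1)
      ((Nat.le_add_right _ _).trans h0) ((Nat.le_add_left _ _).trans h0)

end Security

/-! ### Fake proofs are rejected -/

section FakeProofs

variable {P : PRFSPD} {lam : ℕ}

/-- Probability that a proof for an independent key is accepted. -/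
def fakeAccept (P : PRFSPD) (lam : ℕ) : ℝ :=
  avg fun k => avg fun x => ∑ y, fakeProof P lam x y * P.verProb lam k x y

lemma fakeAccept_nonneg : 0 ≤ fakeAccept P lam :=
  avg_nonneg fun _ => avg_nonneg fun _ => sum_nonneg fun _ _ =>
    mul_nonneg (fakeProof_nonneg P lam _ _) (PRFSPD.verProb_nonneg _ _ _ _)

lemma exists_cloneAdv (P : PRFSPD) (lam : ℕ) : ∃ A : CloneAdv (P.inLen lam) (P.outLen lam)
    (P.proofLen lam), A.size ≤ 20 * P.cost lam ∧ ∀ ψ v, A.win ψ v = avg fun x => ∑ y,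
    fakeProof P lam x y * v x y := by
  let e : Fin (P.inLen lam) ⊕ (Fin 1 × Fin (P.proofLen lam)) ≃
      Fin (P.inLen lam) ⊕ Fin (P.proofLen lam) :=
    Equiv.sumCongr (Equiv.refl _) (Equiv.uniqueProd _ _)
  have h1 := (KCirc.uniform (O := noOracle) (ι := Empty)
    (κ := Fin (P.inLen lam) ⊕ Fin (P.proofLen lam))).comp
      (KCirc.encKer (KCirc.fakeProof (O := noOracle) P lam))
  obtain ⟨A, hA, hrun⟩ := exists_qalg (Circ.comp h1 (Circ.keep e.toEmbedding))
  refine ⟨A.toCloneAdv _, ?_, fun ψ v => ?_⟩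
  · have hs : (A.toCloneAdv (P.outLen lam) :
      CloneAdv (P.inLen lam) (P.outLen lam) (P.proofLen lam)).size = A.size := by
      simp [CloneAdv.size, QAlg.size, QAlg.toCloneAdv]
    rw [hs]
    refine hA.trans ?_
    simp only [card_sum, card_fin, card_empty]
    have : 8 * (P.keyLen lam + P.inLen lam + P.outLen lam + P.proofLen lam) + 1 ≤ P.cost lam := by
      rw [PRFSPD.cost]
      omega
    omega
  · have hp : ∀ (x : P.Input lam) (p : Cfg (Fin 1 × Fin (P.proofLen lam))),
        A.prob Empty.elim (elim x p) =
          (1 / 2 ^ P.inLen lam) * fakeProof P lam x fun j => p (0, j) := by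
      intro x p
      have he : (elim x p : Cfg _) ∘ e.symm = elim x fun j => p (0, j) := by
        funext i
        rcases i with i | i <;> rfl
      rw [QAlg.prob, hrun, keepWires_equiv, he, kchan_apply, if_pos rfl, Fintype.sum_unique,
        pureState_ket]
      erw [single_apply]
      rw [if_pos ⟨cfg_empty_eq _ _, cfg_empty_eq _ _⟩, one_mul, sum_cfgSum, sum_eq_single x]
      · simp only [encKer, elim_comp_inl, elim_comp_inr, if_true]
        rw [sum_const, card_univ, nsmul_eq_mul]
        have hc : (((card (P.Proof lam) : ℕ) : ℂ) * (1 / 2 ^ card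
            (Fin (P.inLen lam) ⊕ Fin (P.proofLen lam)) *
              (fakeProof P lam x fun j => p (0, j) : ℂ))) =
            (((1 / 2 ^ P.inLen lam) * fakeProof P lam x fun j => p (0, j) : ℝ) : ℂ) := by
          push_cast
          simp only [Fintype.card_pi, Fintype.card_bool, prod_const, card_univ,
            card_sum, card_fin, pow_add]
          push_cast
          have h2 : (2 : ℂ) ^ P.proofLen lam ≠ 0 := by positivity
          have h3 : (2 : ℂ) ^ P.inLen lam ≠ 0 := by positivity
          field_simp
        rw [hc, Complex.ofReal_re]
      · intro x' _ hx
        refine sum_eq_zero fun y _ => ?_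
        rw [encKer, if_neg, mul_zero]
        simpa using hx
      · simp
    have hsc : ∀ (x : P.Input lam) (p : Fin 1 → P.Proof lam),
        CloneAdv.score v (fun _ => 0) x p = v x (p 0) := by
      intro x p
      rw [CloneAdv.score, if_pos ⟨le_rfl, fun i j _ _ _ => Subsingleton.elim i j⟩]
      simp
    rw [QAlg.win_toCloneAdv, sum_cfgSum, avg, sum_div]
    refine sum_congr rfl fun x _ => ?_
    rw [sum_div]
    refine sum_equiv ((Equiv.uniqueProd (Fin (P.proofLen lam)) (Fin 1)).arrowCongr
      (Equiv.refl Bool)) _ _ fun p => ?_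
    rw [hp, hsc]
    change 1 / 2 ^ P.inLen lam * fakeProof P lam x (fun j => p (0, j)) *
      v x (fun j => p (0, j)) = fakeProof P lam x (fun j => p (default, j)) *
      v x (fun j => p (default, j)) / 2 ^ P.inLen lam
    have h0 : (default : Fin 1) = 0 := rfl
    rw [h0]
    ring

lemma negligible_fakeAccept (hP : P.QuantumSecure) : Negligible (fakeAccept P) := by
  choose A hA hwin using exists_cloneAdv P
  obtain ⟨ε, hε, h⟩ := hP.unclonable A
    (((PolyBounded.const 20).mul (PolyBounded.cost hP.qpt)).of_le hA)
  refine hε.mono (fun lam => fakeAccept_nonneg) fun lam => ?_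
  have := h lam
  simp only [hwin] at this
  exact this

end FakeProofs

/-! ### Correctness of the construction -/

section Correctness

variable {P : PRFSPD} {S : SKE} {lam : ℕ}

lemma one_sub_list_sum_le_prod {α : Type} (x : α → ℝ) (h0 : ∀ a, 0 ≤ x a) (h1 : ∀ a, x a ≤ 1)
    (l : List α) : 1 - (l.map fun a => 1 - x a).sum ≤ (l.map x).prod := by
  have h : ∀ l : List α, 0 ≤ (l.map x).prod ∧ (l.map x).prod ≤ 1 := by
    intro l
    induction l with
    | nil => simp
    | cons a l ih =>
      rw [List.map_cons, List.prod_cons]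
      exact ⟨mul_nonneg (h0 a) ih.1, mul_le_one₀ (h1 a) ih.1 ih.2⟩
  induction l with
  | nil => simp
  | cons a l ih =>
    rw [List.map_cons, List.sum_cons, List.map_cons, List.prod_cons]
    nlinarith [h0 a, h1 a, h l]

lemma list_prod_le_prod {α : Type} (x y : α → ℝ) (h0 : ∀ a, 0 ≤ x a) (h : ∀ a, x a ≤ y a)
    (l : List α) : (l.map x).prod ≤ (l.map y).prod ∧ 0 ≤ (l.map x).prod := by
  induction l with
  | nil => simp
  | cons a l ih =>
    rw [List.map_cons, List.map_cons, List.prod_cons, List.prod_cons]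
    exact ⟨mul_le_mul (h a) ih.1 ih.2 ((h0 a).trans (h a)), mul_nonneg (h0 a) ih.2⟩

lemma sum_prod_apply {E T : Type} [Fintype E] [DecidableEq E] [Fintype T] {w : T → ℝ}
    (hw : ∑ t, w t = 1) (e : E) (h : T → ℝ) :
    ∑ f : E → T, (∏ i, w (f i)) * h (f e) = ∑ t, w t * h t := by
  have e1 : ∀ f : E → T, (∏ i, w (f i)) * h (f e) =
      ∏ i, w (f i) * if i = e then h (f i) else 1 := by
    intro f
    rw [prod_mul_distrib, Finset.prod_ite_eq' _ _ fun i => h (f i), if_pos (mem_univ e)]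
  simp only [e1]
  rw [← prod_univ_sum_pi fun i t => w t * if i = e then h t else 1, Finset.prod_eq_single e]
  · simp
  · intro i _ hi
    simp [hi, hw]
  · simp

/-- Probability that a message is decrypted correctly when encrypted with a recycled key. -/
def recSuccess (dk : Cfg (Dk P S lam)) (r : Rec P S lam) (m : Σ ℓ : ℕ, Cfg (Fin ℓ)) : ℝ :=
  ∑ z, r.kernel m.1 m.2 z * Construction.dec P S lam m.1 dk z m.2

lemma successFrom_eq (dk : Cfg (Dk P S lam)) (ms : List (Σ ℓ : ℕ, Cfg (Fin ℓ)))
    (ρ : Op (Key P S lam)) : (construction P S).successFrom lam dk ms ρ = ∑ r : Rec P S lam,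
    (recWeight r ρ).re * (ms.map (recSuccess dk r)).prod := by
  induction ms generalizing ρ with
  | nil =>
    change ρ.trace.re = _
    rw [← sum_recWeight, re_sum]
    simp
  | cons m ms ih =>
    change ∑ z, Construction.dec P S lam m.1 dk z m.2 * (construction P S).successFrom lam dk ms
      (Construction.enc P S lam m.1 m.2 z ρ) = _
    simp only [ih, mul_sum]
    rw [sum_comm]
    refine sum_congr rfl fun r _ => ?_
    rw [List.map_cons, List.prod_cons, recSuccess, sum_mul, mul_sum]
    refine sum_congr rfl fun z _ => ?_
    rw [recWeight_enc, Complex.re_ofReal_mul]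
    ring

/-- Probability that the bit of a slot is recovered. -/
def bitSuccess (t : Bool × SlotVal P lam) : ℝ :=
  if t.1 = true then P.verProb lam t.2.1 t.2.2.1 t.2.2.2
  else 1 - P.verProb lam t.2.1 t.2.2.1 t.2.2.2

lemma bitSuccess_mem (t : Bool × SlotVal P lam) : 0 ≤ bitSuccess t ∧ bitSuccess t ≤ 1 := by
  have h0 := PRFSPD.verProb_nonneg (P := P) lam t.2.1 t.2.2.1 t.2.2.2
  have h1 := PRFSPD.verProb_le_one (P := P) lam t.2.1 t.2.2.1 t.2.2.2
  rw [bitSuccess]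
  split_ifs <;> constructor <;> linarith

/-- Probability that a symmetric ciphertext is decrypted correctly. -/
def SKE.success (S : SKE) (lam : ℕ) (m : Σ ℓ : ℕ, Cfg (Fin ℓ)) (k : Cfg (S.Slot lam)) : ℝ :=
  ∑ c, S.encProb lam m.1 k m.2 c * S.decProb lam m.1 k c m.2

lemma SKE.success_mem (m : Σ ℓ : ℕ, Cfg (Fin ℓ)) (k : Cfg (S.Slot lam)) :
    0 ≤ S.success lam m k ∧ S.success lam m k ≤ 1 := by
  refine ⟨sum_nonneg fun c _ => mul_nonneg (QAlg.prob_nonneg _ _ _) (QAlg.prob_nonneg _ _ _),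
    (sum_le_sum fun c _ => mul_le_of_le_one_right (QAlg.prob_nonneg _ _ _)
      (QAlg.prob_le_one _ _ _)).trans_eq (QAlg.sum_prob _ _)⟩

lemma le_recSuccess (f : SlotVals P S lam) (m : Σ ℓ : ℕ, Cfg (Fin ℓ)) :
    (∏ i, bitSuccess (f i)) * S.success lam m (fun i => (f i).1) ≤ recSuccess (slotsDk f)
    (slotsRec f) m := by
  rw [recSuccess, sum_cfgSum, SKE.success, mul_sum]
  refine sum_le_sum fun c _ => ?_
  rw [sum_eq_single (mkRec (slotsRec f).2.1 (slotsRec f).2.2)]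
  · have hc : (slotsRec f).kernel m.1 m.2 (elim c (mkRec (slotsRec f).2.1 (slotsRec f).2.2)) =
        S.encProb lam m.1 (fun i => (f i).1) m.2 c := if_pos rfl
    rw [hc, mul_left_comm]
    refine mul_le_mul_of_nonneg_left ?_ (QAlg.prob_nonneg _ _ _)
    refine le_trans (le_of_eq ?_) (single_le_sum (fun k _ => mul_nonneg
      (prod_nonneg fun i _ => ?_) (QAlg.prob_nonneg _ _ _))
      (mem_univ fun i => (f i).1))
    · rfl
    · split_ifs
      · exact PRFSPD.verProb_nonneg _ _ _ _
      · exact sub_nonneg.2 (PRFSPD.verProb_le_one _ _ _ _)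
  · intro r _ hr
    rw [Rec.kernel, recKernel, if_neg, zero_mul]
    simpa using hr
  · simp

lemma sum_slotWeight_fail (hP : P.Correct) : ∑ t : Bool × SlotVal P lam,
    slotWeight id t * (1 - bitSuccess t) = 1 / 2 * fakeAccept P lam := by
  have h1 : ∑ t : SlotVal P lam, valProb true t * (1 - bitSuccess (true, t)) = 0 := by
    rw [sum_valProb_mul]
    simp only [slotProb, bitSuccess, if_true, mul_sub, mul_one, sum_sub_distrib]
    have : ∀ k x, ∑ y, (P.destruct lam).probPure (P.state lam k x) y = 1 := fun k x =>
      sum_slotProb true k x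
    simp only [this, PRFSPD.Correct.sum_eq hP, sub_self, avg_const]
  have h2 : ∑ t : SlotVal P lam, valProb false t * (1 - bitSuccess (false, t)) =
      fakeAccept P lam := by
    rw [sum_valProb_mul]
    simp only [slotProb, bitSuccess, Bool.false_eq_true, if_false, sub_sub_cancel]
    rfl
  rw [sum_prod_type, sum_bool]
  simp only [slotWeight, mul_assoc, ← mul_sum, id]
  rw [h1, h2]
  ring

lemma le_success (hP : P.Correct) {ε : ℝ} (ms : List (Σ ℓ : ℕ, Cfg (Fin ℓ)))
    (hε : ∀ m ∈ ms, 1 - ε ≤ avg (S.success lam m)) : 1 - ms.length *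
    (S.keyLen lam * (1 / 2 * fakeAccept P lam) + ε) ≤ (construction P S).success lam ms := by
  have hsum : (construction P S).success lam ms =
      ∑ f : SlotVals P S lam, (∏ i, slotWeight id (f i)) *
        (ms.map (recSuccess (slotsDk f) (slotsRec f))).prod := by
    rw [← sum_slots fun dk r => (ms.map (recSuccess dk r)).prod]
    refine sum_congr rfl fun dk _ =>
      congrArg (1 / 2 ^ (S.keyLen lam * P.keyLen lam) * ·) ?_
    refine (successFrom_eq dk ms _).trans (sum_congr rfl fun r _ => ?_)
    exact (congrArg (fun c : ℂ => c.re * (ms.map (recSuccess dk r)).prod)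
      (recWeight_qpk r dk)).trans (by rw [Complex.ofReal_re])
  have hb : ∀ f : SlotVals P S lam,
      0 ≤ ∏ i, bitSuccess (f i) ∧ ∏ i, bitSuccess (f i) ≤ 1 := fun f =>
    ⟨prod_nonneg fun i _ => (bitSuccess_mem _).1,
      prod_le_one (fun i _ => (bitSuccess_mem _).1) fun i _ => (bitSuccess_mem _).2⟩
  have hle : ∀ f : SlotVals P S lam,
      1 - (ms.map fun m => ∑ i, (1 - bitSuccess (f i)) +
        (1 - S.success lam m fun i => (f i).1)).sum ≤
        (ms.map (recSuccess (slotsDk f) (slotsRec f))).prod := by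
    intro f
    have hs := fun m => S.success_mem (lam := lam) m fun i => (f i).1
    have h1 := one_sub_list_sum_le_prod
      (fun m => (∏ i, bitSuccess (f i)) * S.success lam m fun i => (f i).1)
      (fun m => mul_nonneg (hb f).1 (hs m).1)
      (fun m => mul_le_one₀ (hb f).2 (hs m).1 (hs m).2) ms
    have h2 := (list_prod_le_prod _ _ (fun m => mul_nonneg (hb f).1 (hs m).1) (le_recSuccess f)
        ms).1
    refine le_trans (sub_le_sub_left (List.sum_le_sum fun m _ => ?_) 1) (h1.trans h2)
    have h3 := one_sub_sum_le_prod univ (a := fun i => 1 - bitSuccess (f i))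
      (fun i => sub_nonneg.2 (bitSuccess_mem _).2) fun i => by linarith [(bitSuccess_mem (f i)).1]
    simp only [sub_sub_cancel] at h3
    nlinarith [hs m, hb f]
  have hE : ∀ m ∈ ms, ∑ f : SlotVals P S lam,
      (∏ i, slotWeight id (f i)) * (∑ i, (1 - bitSuccess (f i)) +
        (1 - S.success lam m fun i => (f i).1)) ≤
      S.keyLen lam * (1 / 2 * fakeAccept P lam) + ε := by
    intro m hm
    simp only [mul_add, mul_sum, sum_add_distrib]
    refine add_le_add (le_of_eq ?_) ?_
    · rw [sum_comm]
      have e0 := fun i : S.Slot lam => (sum_prod_apply (sum_slotWeight id) i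
        fun t : Bool × SlotVal P lam => 1 - bitSuccess t).trans (sum_slotWeight_fail hP)
      rw [sum_congr rfl fun i _ => e0 i]
      simp
    · have e := sum_slotWeight_split (P := P) (S := S) (lam := lam) id fun k _ =>
        1 - S.success lam m k
      have h1 : avg (fun k => 1 - S.success lam m k) ≤ ε := by
        rw [avg_sub, avg_const]
        linarith [hε m hm]
      refine (e.trans (congrArg avg (funext fun k => ?_))).trans_le h1
      rw [← sum_mul, sum_prod_eq_one fun i => sum_valProb _, one_mul]
  rw [hsum]
  refine le_trans ?_ (sum_le_sum fun f _ => mul_le_mul_of_nonneg_left (hle f)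
    (prod_nonneg fun i _ => slotWeight_nonneg _ _))
  rw [sum_congr rfl fun f _ => mul_one_sub _ _, sum_sub_distrib,
    sum_prod_eq_one fun _ => sum_slotWeight id]
  refine sub_le_sub_left ?_ 1
  have hl : ∀ l : List (Σ ℓ : ℕ, Cfg (Fin ℓ)), (∀ m ∈ l, m ∈ ms) →
      ∑ f : SlotVals P S lam, (∏ i, slotWeight id (f i)) *
        (l.map fun m => ∑ i, (1 - bitSuccess (f i)) + (1 - S.success lam m fun i => (f i).1)).sum ≤
      l.length * (S.keyLen lam * (1 / 2 * fakeAccept P lam) + ε) := by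
    intro l
    induction l with
    | nil => simp
    | cons m l ih =>
      intro h
      simp only [List.map_cons, List.sum_cons, mul_add _ (_ + _) (List.sum _),
        sum_add_distrib, List.length_cons, Nat.cast_add, Nat.cast_one]
      have h1 := hE m (h m List.mem_cons_self)
      have h2 := ih fun m' hm' => h m' (List.mem_cons_of_mem _ hm')
      linarith
  exact hl ms fun _ h => h

lemma reusable (hP : P.QuantumSecure) (hS : S.QuantumSecure) : (construction P S).Reusable := by
  intro p
  obtain ⟨ε, hε, h⟩ := hS.correct p
  have hε0 : ∀ lam, 0 ≤ ε lam := by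
    intro lam
    have h1 := h lam 0 (Nat.zero_le _) Fin.elim0
    have h2 := avg_mono fun k => (S.success_mem (lam := lam) ⟨0, Fin.elim0⟩ k).2
    rw [avg_const] at h2
    have h3 := h1.trans h2
    linarith
  have hk := PolyBounded.symKeyLen hS.qpt
  refine ⟨fun lam => (p.eval lam : ℕ) * (S.keyLen lam * (1 / 2 * fakeAccept P lam) + ε lam),
    Negligible.poly_mul ((Negligible.poly_mul ((negligible_fakeAccept hP).const_mul _)
      (fun lam => ?_) hk).add hε) (fun lam => ?_) (.poly p), fun lam ms hl hm => ?_⟩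
  · have := fakeAccept_nonneg (P := P) (lam := lam)
    positivity
  · have := fakeAccept_nonneg (P := P) (lam := lam)
    have := hε0 lam
    positivity
  · refine le_trans (sub_le_sub_left (mul_le_mul_of_nonneg_right (Nat.cast_le.2 hl) ?_) 1)
      (le_success hP.correct ms fun m hm' => h lam m.1 (hm m hm') m.2)
    have := fakeAccept_nonneg (P := P) (lam := lam)
    have := hε0 lam
    positivity

lemma QPKE.Reusable.correct {Q : QPKE} (h : Q.Reusable) : Q.Correct := by
  intro p
  obtain ⟨ε, hε, h'⟩ := h (p + 1)
  refine ⟨ε, hε, fun lam ℓ hℓ m => h' lam [⟨ℓ, m⟩] (by simp) fun m' hm' => ?_⟩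
  rw [List.mem_singleton] at hm'
  subst hm'
  simp
  omega

end Correctness

/-! ### Classical post-processing -/

section Postprocessing

variable {Θ Z : Type} [Nonempty Z] {ι κ : Type}
variable [Fintype ι] [DecidableEq ι] [Fintype κ] [DecidableEq κ] {O : Oracles Θ Z}

lemma KCirc.ite {s s' : ℕ} {M M' : Θ → Cfg ι → Cfg κ → ℂ} (hM : KCirc O s M) (hM' : KCirc O s' M')
    (h : ∀ θ a, ∑ y, M θ a y = 1) (h' : ∀ θ a, ∑ y, M' θ a y = 1) (e : ι) :
    KCirc O (12 * card ι + 21 * card κ + s + s') fun θ a y => if a e =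
    true then M θ a y else M' θ a y := by
  have hmux := KCirc.mux (O := O) (fun _ : κ => (inl (inl e) : (ι ⊕ κ) ⊕ κ))
    (fun j => inl (inr j)) fun j => inr j
  have h1 := hM.bind (hM'.bind hmux (inl : ι → ι ⊕ κ)) (id : ι → ι)
  refine (h1.weaken (by simp only [card_sum]; omega)).congr fun θ a y => ?_
  change _ = ∑ x, M θ a x * ∑ x', M' θ a x' *
    QPK.det (fun b : Cfg ((ι ⊕ κ) ⊕ κ) => fun j : κ => if b (inl (inl e)) = true
      then b (inl (inr j)) else b (inr j)) (elim (elim a x) x') y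
  simp only [QPK.det, elim_inl, elim_inr]
  by_cases he : a e = true
  · simp only [he, if_true]
    have e1 : ∀ x, ∑ x', M' θ a x' * (if y = fun j => x j then (1 : ℂ) else 0) =
        if y = x then 1 else 0 := fun x => by rw [← sum_mul, h', one_mul]
    simp only [e1]
    simp
  · simp only [he]
    have e1 : ∑ x', M' θ a x' * (if y = fun j => x' j then (1 : ℂ) else 0) = M' θ a y := by
      simp [sum_ite_eq]
    simp only [Bool.false_eq_true, if_false]
    rw [e1, ← sum_mul, h, one_mul]

lemma exists_qalg_kernel {s : ℕ} {M : Cfg ι → Cfg κ → ℝ}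
    (h : KCirc noOracle s fun _ a y => (M a y : ℂ)) :
    ∃ A : QAlg ι κ, A.size ≤ card ι + s ∧ ∀ a y, A.prob a y = M a y := by
  obtain ⟨A, hA, hrun⟩ := exists_qalg h
  refine ⟨A, hA, fun a y => ?_⟩
  rw [QAlg.prob, hrun, kchan_apply, if_pos rfl, pureState_ket, sum_eq_single a]
  · simp
  · intro b _ hb
    rw [single_apply, if_neg fun h => hb h.1.symm, zero_mul]
  · simp

/-- A function of security parameter and message length which is polynomially bounded. -/
def PolyBoundedLen (f : ℕ → ℕ → ℕ) : Prop :=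
  ∃ p : Polynomial ℕ, ∀ lam ℓ, f lam ℓ ≤ p.eval (lam + ℓ)

lemma PolyBoundedLen.add {f g : ℕ → ℕ → ℕ} (hf : PolyBoundedLen f) (hg : PolyBoundedLen g) :
    PolyBoundedLen fun lam ℓ => f lam ℓ + g lam ℓ := by
  obtain ⟨p, hp⟩ := hf
  obtain ⟨q, hq⟩ := hg
  exact ⟨p + q, fun lam ℓ => by rw [Polynomial.eval_add]; exact add_le_add (hp _ _) (hq _ _)⟩

lemma PolyBoundedLen.mul {f g : ℕ → ℕ → ℕ} (hf : PolyBoundedLen f) (hg : PolyBoundedLen g) :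
    PolyBoundedLen fun lam ℓ => f lam ℓ * g lam ℓ := by
  obtain ⟨p, hp⟩ := hf
  obtain ⟨q, hq⟩ := hg
  exact ⟨p * q, fun lam ℓ => by rw [Polynomial.eval_mul]; exact Nat.mul_le_mul (hp _ _) (hq _ _)⟩

lemma PolyBounded.len {f : ℕ → ℕ} (hf : PolyBounded f) : PolyBoundedLen fun lam _ => f lam := by
  obtain ⟨p, hp⟩ := hf
  exact ⟨p, fun lam ℓ => (hp lam).trans (eval_mono p (Nat.le_add_right _ _))⟩

lemma PolyBoundedLen.length : PolyBoundedLen fun _ ℓ => ℓ :=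
  ⟨Polynomial.X, fun lam ℓ => by simp⟩

variable {P : PRFSPD} {lam : ℕ}

lemma PRFSPD.le_cost (P : PRFSPD) (lam : ℕ) : 8 *
    (P.keyLen lam + P.inLen lam + P.outLen lam + P.proofLen lam) + (P.gen lam).size +
    (P.destruct lam).size + (P.ver lam).size + 1 ≤ P.cost lam := le_rfl

/-- Verify a proof in each slot. -/
lemma KCirc.verify {s : ℕ}
    (p : Fin s → Fin (P.keyLen lam) ⊕ (Fin (P.inLen lam) ⊕ Fin (P.proofLen lam)) → ι) :
    KCirc O (s * (4 * P.cost lam)) fun _ (a : Cfg ι) (m : Cfg (Fin s)) => ((∏ i, bitSuccess (P :=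
    P) (lam := lam) (m i, fun j => a (p i (inl j)),
        fun j => a (p i (inr (inl j))), fun j => a (p i (inr (inr j)))) : ℝ) : ℂ) := by
  have h := KCirc.piUnit (O := O) (fun _ : Fin s => KCirc.prob (P.ver lam)) p
  refine (h.weaken ?_).congr fun θ a m => ?_
  · have := P.le_cost lam
    simp only [card_sum, card_fin, card_unit]
    rw [show ∀ A B : ℕ, 2 * (s * A) + s * B + 2 * s = s * (2 * A + B + 2) from fun A B => by ring]
    exact Nat.mul_le_mul_left s (by omega)
  · rw [Complex.ofReal_prod]
    refine prod_congr rfl fun i _ => ?_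
    have e : a ∘ p i = elim (fun j => a (p i (inl j))) (elim
        (fun j => a (p i (inr (inl j)))) fun j => a (p i (inr (inr j)))) := by
      funext j
      rcases j with j | j | j <;> rfl
    have h1 := QAlg.sum_prob (P.ver lam) (a ∘ p i)
    rw [← (Equiv.funUnique Unit Bool).symm.sum_comp, sum_bool] at h1
    change (P.ver lam).prob (a ∘ p i) (fun _ => true) +
      (P.ver lam).prob (a ∘ p i) (fun _ => false) = 1 at h1
    rw [bitSuccess]
    cases m i
    · simp only [Bool.false_eq_true, if_false]
      rw [PRFSPD.verProb, ← e]
      congr 1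
      linarith
    · simp only [if_true]
      rw [PRFSPD.verProb, ← e]

end Postprocessing

/-! ### A symmetric scheme from a PRFSPD -/

section SymmetricScheme

/-- The bits of the `ℓ` blocks of a ciphertext. -/
def blockEquiv (ℓ d c : ℕ) : Fin ℓ × (Fin d ⊕ Fin c) ≃ Fin (ℓ * (d + c)) :=
  (Equiv.prodCongr (Equiv.refl _) finSumFinEquiv).trans finProdFinEquiv

/-- Ciphertexts as sequences of blocks. -/
def blocks (ℓ d c : ℕ) : Cfg (Fin (ℓ * (d + c))) ≃ (Fin ℓ → Cfg (Fin d) × Cfg (Fin c)) where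
  toFun z j := (fun i => z (blockEquiv ℓ d c (j, inl i)), fun i => z (blockEquiv ℓ d c (j, inr i)))
  invFun f i := elim (f ((blockEquiv ℓ d c).symm i).1).1 (f ((blockEquiv ℓ d c).symm i).1).2
    ((blockEquiv ℓ d c).symm i).2
  left_inv z := by
    funext i
    obtain ⟨⟨j, i⟩, rfl⟩ := (blockEquiv ℓ d c).surjective i
    rcases i with i | i <;> simp
  right_inv f := by
    funext j
    simp

variable {P : PRFSPD} {lam : ℕ}

/-- Encryption of a message bit `b`: a proof for a random string, with the right key if `b = 1`
and with an independent key if `b = 0`. -/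
def blockProb (Q : P.Input lam → P.Proof lam → ℝ) (b : Bool) (z : P.Input lam × P.Proof lam) : ℝ :=
  (1 / 2 ^ P.inLen lam) * if b = true then Q z.1 z.2 else fakeProof P lam z.1 z.2

/-- The destruction proofs for a given key. -/
def keyProof (P : PRFSPD) (lam : ℕ) (k : P.Seed lam) (x : P.Input lam)
    (y : P.Proof lam) : ℝ := (P.destruct lam).probPure (P.state lam k x) y

lemma keyProof_nonneg (k : P.Seed lam) (x : P.Input lam)
    (y : P.Proof lam) : 0 ≤ keyProof P lam k x y := QAlg.probPure_nonneg _ _ _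

lemma sum_keyProof (k : P.Seed lam) (x : P.Input lam) :
    ∑ y, keyProof P lam k x y = 1 := sum_slotProb true k x

lemma KCirc.block {Θ Z : Type} [Nonempty Z] {O : Oracles Θ Z} (P : PRFSPD) (lam : ℕ) :
    KCirc O (50 * P.cost lam) fun _ (a : Cfg (Fin (P.keyLen lam) ⊕ Unit))
    (z : Cfg (Fin (P.inLen lam) ⊕ Fin (P.proofLen lam)))
    => (blockProb (keyProof P lam (a ∘ inl)) (a (inr ())) (z ∘ inl, z ∘ inr) : ℂ) := by
  have h1 := (KCirc.destructGen (O := O) P lam).comap (elim (fun j => inl (inl j))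
    inr : _ → (Fin (P.keyLen lam) ⊕ Unit) ⊕ Fin (P.inLen lam))
  have h0 := (KCirc.fakeProof (O := O) P lam).comap
    (inr : _ → (Fin (P.keyLen lam) ⊕ Unit) ⊕ Fin (P.inLen lam))
  have hite := h1.ite h0 (fun _ a => by exact_mod_cast sum_keyProof _ _)
    (fun _ a => by exact_mod_cast sum_fakeProof P lam _) (inl (inr ()))
  have hcopy := hite.bind (KCirc.copy (O := O) (elim (fun i => inl (inr i)) inr :
    Fin (P.inLen lam) ⊕ Fin (P.proofLen lam) → ((Fin (P.keyLen lam) ⊕ Unit) ⊕ Fin (P.inLen lam)) ⊕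
      Fin (P.proofLen lam))) id
  have h := (KCirc.uniform (O := O) (ι := Fin (P.keyLen lam) ⊕ Unit)
    (κ := Fin (P.inLen lam))).bind hcopy id
  refine (h.weaken ?_).congr fun θ a z => ?_
  · have := P.le_cost lam
    simp only [card_sum, card_fin, card_unit]
    omega
  · rw [sum_eq_single (z ∘ inl), sum_eq_single (z ∘ inr)]
    · have hz : QPK.det (fun v => v ∘ (elim (fun i => inl (inr i)) inr :
          Fin (P.inLen lam) ⊕ Fin (P.proofLen lam) →
            ((Fin (P.keyLen lam) ⊕ Unit) ⊕ Fin (P.inLen lam)) ⊕ Fin (P.proofLen lam)))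
          (elim (elim a (z ∘ inl)) (z ∘ inr)) z = 1 := by
        refine if_pos ?_
        funext i
        rcases i with i | i <;> rfl
      simp only [Function.comp_id, elim_inl, card_fin, blockProb]
      rw [hz, mul_one]
      push_cast
      congr 1
      by_cases hb : a (inr ()) = true
      · exact (congrArg Complex.ofReal (if_pos hb)).trans (if_pos hb).symm
      · exact (congrArg Complex.ofReal (if_neg hb)).trans (if_neg hb).symm
    · intro y _ hy
      refine mul_eq_zero_of_right _ (if_neg fun h => hy ?_)
      rw [h]
      rfl
    · simp
    · intro x _ hx
      refine mul_eq_zero_of_right _ (sum_eq_zero fun y _ => ?_)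
      refine mul_eq_zero_of_right _ (if_neg fun h => hx ?_)
      rw [h]
      rfl
    · simp

/-- Encryption of the bits of the message, one after the other. -/
def blockKernel (Q : P.Input lam → P.Proof lam → ℝ) :
    Kernel fun ℓ => Fin (ℓ * (P.inLen lam + P.proofLen lam)) :=
  fun ℓ m z => ∏ j, blockProb Q (m j) (blocks ℓ _ _ z j)

lemma sum_blockProb {Q : P.Input lam → P.Proof lam → ℝ}
    (hQ : ∀ x, ∑ y, Q x y = 1) (b : Bool) : ∑ z, blockProb Q b z = 1 := by
  have : ∀ x, ∑ y, blockProb Q b (x, y) = 1 / 2 ^ P.inLen lam := by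
    intro x
    simp only [blockProb]
    rw [← mul_sum]
    cases b
    · simp [sum_fakeProof]
    · simp [hQ]
  rw [sum_prod_type, sum_congr rfl fun x _ => this x, sum_const,
    card_univ, nsmul_eq_mul, card_cfg]
  field_simp

lemma blockProb_nonneg {Q : P.Input lam → P.Proof lam → ℝ} (hQ : ∀ x y, 0 ≤ Q x y) (b : Bool)
    (z : P.Input lam × P.Proof lam) : 0 ≤ blockProb Q b z := by
  have h0 := fakeProof_nonneg P lam z.1 z.2
  have h1 := hQ z.1 z.2
  rw [blockProb]
  split_ifs <;> positivity

lemma exists_blockEnc (P : PRFSPD) (lam ℓ : ℕ) : ∃ A : QAlg (Fin (P.keyLen lam) ⊕ Fin ℓ)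
    (Fin (ℓ * (P.inLen lam + P.proofLen lam))), A.size ≤ P.keyLen lam + ℓ + ℓ * (52 * P.cost lam) ∧
    ∀ k m z, A.prob (elim k m) z = blockKernel (keyProof P lam k) ℓ m z := by
  have h1 := (KCirc.pi (O := noOracle) fun _ : Fin ℓ => KCirc.block P lam).comap
    (fun q => elim inl (fun _ => inr q.1) q.2 :
      Fin ℓ × (Fin (P.keyLen lam) ⊕ Unit) → Fin (P.keyLen lam) ⊕ Fin ℓ)
  have h2 := Circ.comp h1 (Circ.keep (blockEquiv ℓ (P.inLen lam) (P.proofLen lam)).symm.toEmbedding)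
  have h3 : KCirc noOracle (2 * card (Fin ℓ × (Fin (P.keyLen lam) ⊕ Unit)) +
      card (Fin ℓ) * (50 * P.cost lam) + 0) fun _ (a : Cfg (Fin (P.keyLen lam) ⊕ Fin ℓ)) z =>
      (blockKernel (keyProof P lam (a ∘ inl)) ℓ (a ∘ inr) z : ℂ) := by
    refine Circ.congr h2 fun θ ρ => ?_
    ext z z'
    rw [keepWires_equiv, kchan_apply, kchan_apply]
    refine if_congr ?_ (sum_congr rfl fun a _ => ?_) rfl
    · exact ⟨fun h => by rw [h], fun h => (blockEquiv ℓ _ _).surjective.injective_comp_right h⟩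
    · exact congrArg (ρ a a * ·) (Complex.ofReal_prod _ _)
  obtain ⟨A, hA, hp⟩ := exists_qalg_kernel h3
  refine ⟨A, hA.trans ?_, fun k m z => hp _ _⟩
  have := P.le_cost lam
  simp only [card_sum, card_prod, card_fin, card_unit, add_zero]
  rw [show 2 * (ℓ * (P.keyLen lam + 1)) + ℓ * (50 * P.cost lam) =
    ℓ * (2 * (P.keyLen lam + 1) + 50 * P.cost lam) by ring]
  refine Nat.add_le_add_left (Nat.mul_le_mul_left _ ?_) _
  omega

lemma exists_blockDec (P : PRFSPD) (lam ℓ : ℕ) : ∃ A :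
    QAlg (Fin (P.keyLen lam) ⊕ Fin (ℓ * (P.inLen lam + P.proofLen lam))) (Fin ℓ), A.size ≤
    P.keyLen lam + ℓ * (P.inLen lam + P.proofLen lam) + ℓ * (4 * P.cost lam) ∧ ∀ k z m,
    A.prob (elim k z) m = ∏ j, bitSuccess (m j, k, blocks ℓ _ _ z j) := by
  obtain ⟨A, hA, hp⟩ := exists_qalg_kernel (KCirc.verify (O := noOracle) (P := P) (lam := lam)
    fun j : Fin ℓ => (elim inl fun i => inr (blockEquiv ℓ _ _ (j, i)) :
      _ → Fin (P.keyLen lam) ⊕ Fin (ℓ * (P.inLen lam + P.proofLen lam))))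
  exact ⟨A, by simpa using hA, fun k z m => hp _ _⟩

/-- The symmetric scheme whose ciphertexts are sequences of right or fake proofs. -/
def symScheme (P : PRFSPD) : SKE where
  keyLen := P.keyLen
  ctLen lam ℓ := ℓ * (P.inLen lam + P.proofLen lam)
  enc lam ℓ := (exists_blockEnc P lam ℓ).choose
  dec lam ℓ := (exists_blockDec P lam ℓ).choose

lemma symScheme_encProb (ℓ : ℕ) (k : P.Seed lam) (m : Cfg (Fin ℓ))
    (z : Cfg (Fin (ℓ * (P.inLen lam + P.proofLen lam)))) :
    (symScheme P).encProb lam ℓ k m z = blockKernel (keyProof P lam k) ℓ m z :=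
  (exists_blockEnc P lam ℓ).choose_spec.2 k m z

lemma symScheme_decProb (ℓ : ℕ) (k : P.Seed lam) (m : Cfg (Fin ℓ))
    (z : Cfg (Fin (ℓ * (P.inLen lam + P.proofLen lam)))) :
    (symScheme P).decProb lam ℓ k z m = ∏ j, bitSuccess (m j, k, blocks ℓ _ _ z j) :=
  (exists_blockDec P lam ℓ).choose_spec.2 k z m

lemma symScheme_isQPT (hP : P.IsQPT) : (symScheme P).IsQPT := by
  obtain ⟨h1, h2, h3, h4⟩ := PolyBounded.lengths hP
  have hc := PolyBounded.cost hP
  have hl := PolyBoundedLen.length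
  obtain ⟨p, hp⟩ := (h1.len.add hl).add (hl.mul ((PolyBounded.const 52).mul hc).len)
  obtain ⟨q, hq⟩ := (h1.len.add (hl.mul (h2.add h4).len)).add
    (hl.mul ((PolyBounded.const 4).mul hc).len)
  refine ⟨p + q, fun lam ℓ => ?_⟩
  rw [Polynomial.eval_add]
  exact ⟨(exists_blockEnc P lam ℓ).choose_spec.1.trans ((hp lam ℓ).trans (Nat.le_add_right _ _)),
    (exists_blockDec P lam ℓ).choose_spec.1.trans ((hq lam ℓ).trans (Nat.le_add_left _ _))⟩

lemma symScheme_correct (hP : P.QuantumSecure) : (symScheme P).Correct := by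
  intro p
  refine ⟨fun lam => (p.eval lam : ℕ) * fakeAccept P lam, Negligible.poly_mul
    (negligible_fakeAccept hP) (fun _ => fakeAccept_nonneg) (.poly p), fun lam ℓ hℓ m => ?_⟩
  set a : P.Seed lam → ℝ := fun k =>
    avg fun x => ∑ y, fakeProof P lam x y * P.verProb lam k x y with ha
  have hz : ∀ k x y, 0 ≤ P.verProb lam k x y ∧ P.verProb lam k x y ≤ 1 := fun k x y =>
    ⟨PRFSPD.verProb_nonneg _ _ _ _, PRFSPD.verProb_le_one _ _ _ _⟩
  have ha0 : ∀ k, 0 ≤ a k := fun k => avg_nonneg fun x => sum_nonneg fun y _ =>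
    mul_nonneg (fakeProof_nonneg P lam x y) (hz k x y).1
  have ha1 : ∀ k, a k ≤ 1 := by
    intro k
    refine (avg_mono fun x => (sum_le_sum fun y _ => mul_le_of_le_one_right
      (fakeProof_nonneg P lam x y) (hz k x y).2).trans_eq (sum_fakeProof P lam x)).trans_eq ?_
    exact avg_const 1
  have hbit : ∀ k b, ∑ z, blockProb (keyProof P lam k) b z * bitSuccess (b, k, z) =
      1 - if b = true then 0 else a k := by
    intro k b
    have e : ∀ x, ∑ y, blockProb (keyProof P lam k) b (x, y) * bitSuccess (b, k, (x, y)) =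
        (1 - if b = true then 0 else ∑ y, fakeProof P lam x y * P.verProb lam k x y) /
          2 ^ P.inLen lam := by
      intro x
      cases b
      · simp only [blockProb, bitSuccess, Bool.false_eq_true, if_false, mul_sub, mul_one, mul_assoc,
          sum_sub_distrib, ← mul_sum, sum_fakeProof]
        ring
      · simp only [blockProb, bitSuccess, if_true, mul_assoc, ← mul_sum, keyProof,
          PRFSPD.Correct.sum_eq hP.correct, sub_zero, mul_one]
    rw [sum_prod_type, sum_congr rfl fun x _ => e x, ← sum_div]
    change avg (fun x => 1 - _) = _
    rw [avg_sub, avg_const]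
    cases b
    · simp [ha]
    · simp [avg_const]
  have hk : ∀ k : P.Seed lam, 1 - ℓ * a k ≤ ∑ z, (symScheme P).encProb lam ℓ k m z *
      (symScheme P).decProb lam ℓ k z m := by
    intro k
    refine le_of_le_of_eq ?_ (sum_congr rfl fun z _ => ((congrArg₂ (· * ·)
      (symScheme_encProb ℓ k m z) (symScheme_decProb ℓ k m z)).trans
      Finset.prod_mul_distrib.symm).symm)
    refine le_of_le_of_eq ?_ ((prod_univ_sum_pi fun j z =>
      blockProb (keyProof P lam k) (m j) z * bitSuccess (m j, k, z)).trans
      ((blocks ℓ (P.inLen lam) (P.proofLen lam)).sum_comp fun f => ∏ j,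
        blockProb (keyProof P lam k) (m j) (f j) * bitSuccess (m j, k, f j)).symm)
    simp only [hbit]
    refine le_trans ?_ (one_sub_sum_le_prod univ (fun j => ?_) fun j => ?_)
    · refine sub_le_sub_left ((sum_le_sum fun j _ => ?_).trans_eq
        (b := ∑ _j : Fin ℓ, a k) (by simp)) 1
      split_ifs
      · exact ha0 k
      · exact le_rfl
    · split_ifs
      · exact le_rfl
      · exact ha0 k
    · split_ifs
      · exact zero_le_one
      · exact ha1 k
  refine le_trans ?_ (avg_mono hk)
  rw [avg_sub, avg_const]
  refine sub_le_sub_left ?_ 1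
  have e : avg (fun k => (ℓ : ℝ) * a k) = ℓ * fakeAccept P lam := by
    simp only [mul_comm (ℓ : ℝ)]
    rw [avg_mul_const]
    rfl
  exact e.trans_le (mul_le_mul_of_nonneg_right (Nat.cast_le.2 hℓ) fakeAccept_nonneg)

end SymmetricScheme

section BlockGame

abbrev BlockAdv (P : PRFSPD) (lam : ℕ) : Type :=
  CPAAdv Empty fun ℓ => Fin (ℓ * (P.inLen lam + P.proofLen lam))

variable {Θ Z : Type} {ι κ : Type} [Fintype ι] [DecidableEq ι] [Fintype κ] [DecidableEq κ]
  {O : Oracles Θ Z}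

lemma KCirc.select [Nonempty Z] (p : κ ⊕ (κ ⊕ κ) → ι ⊕ Bool) : KCirc O (4 * card ι + 41 * card κ)
    fun _ => QPK.det fun (a : Cfg ι) j => if QPK.rewire p a (inl j) =
    true then QPK.rewire p a (inr (inl j)) else QPK.rewire p a (inr (inr j)) := by
  refine ((KCirc.mux (O := O) (inl : κ → κ ⊕ (κ ⊕ κ)) (inr ∘ inl)
    (inr ∘ inr)).rewire p).weaken ?_
  simp only [card_sum]
  omega

/-- A ciphertext made of given strings and proofs, where the bits of the message select between
two sequences of proofs. -/
def blockVal {d c ℓ : ℕ} (x : ℕ → Cfg (Fin d)) (y₀ y₁ : ℕ → Cfg (Fin c)) (m : Cfg (Fin ℓ)) :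
    Cfg (Fin (ℓ * (d + c))) := (blocks ℓ d c).symm fun j => (x j, if m j = true then y₁ j else y₀ j)

/-- Encryption with given randomness. -/
def blockDet {d c : ℕ} (x : ℕ → Cfg (Fin d)) (y₀ y₁ : ℕ → Cfg (Fin c)) :
    Kernel fun ℓ => Fin (ℓ * (d + c)) := fun _ m z => if z = blockVal x y₀ y₁ m then 1 else 0

lemma isProbKernel_blockDet {d c : ℕ} (x : ℕ → Cfg (Fin d)) (y₀ y₁ : ℕ → Cfg (Fin c)) :
    IsProbKernel (blockDet x y₀ y₁) := by
  intro ℓ m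
  refine ⟨fun z => ?_, ?_⟩
  · rw [blockDet]
    split_ifs <;> norm_num
  · simp [blockDet]

/-- A function on a grid, continued by zero. -/
def grid {L N d : ℕ} (f : Fin L × Fin N → Cfg (Fin d)) (r j : ℕ) : Cfg (Fin d) :=
  if h : r < L ∧ j < N then f (⟨r, h.1⟩, ⟨j, h.2⟩) else fun _ => false

/-- The success probability of an adversary for given randomness. -/
def blockGame {d c : ℕ} (A : CPAAdv Empty fun ℓ => Fin (ℓ * (d + c)))
    (x : Fin A.prog.length × Fin A.wires → Cfg (Fin d))
    (y₀ y₁ : Fin A.prog.length × Fin A.wires → Cfg (Fin c)) : ℝ :=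
  gwin A (fun _ => 1) fun r => blockDet (grid x r) (grid y₀ r) (grid y₁ r)

lemma blockGame_mem {d c : ℕ} (A : CPAAdv Empty fun ℓ => Fin (ℓ * (d + c)))
    (x : Fin A.prog.length × Fin A.wires → Cfg (Fin d))
    (y₀ y₁ : Fin A.prog.length × Fin A.wires → Cfg (Fin c)) :
    0 ≤ blockGame A x y₀ y₁ ∧ blockGame A x y₀ y₁ ≤ 1 :=
  ⟨gwin_nonneg _ _ fun _ => isProbKernel_blockDet _ _ _,
    gwin_le_one _ (by simp) fun _ => isProbKernel_blockDet _ _ _⟩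

lemma sum_prod_prefix {T : Type} [Fintype T] [Inhabited T] {w : T → ℝ} (hw : ∑ t, w t = 1)
    {ℓ N : ℕ} (hℓ : ℓ ≤ N) (g : Fin ℓ → T → ℝ) :
    ∑ τ : Fin N → T, (∏ j, w (τ j)) * ∏ j : Fin ℓ, g j (extendSeq τ j) = ∏ j, ∑ u, w u * g j u := by
  obtain ⟨k, rfl⟩ := Nat.exists_eq_add_of_le hℓ
  have h := prod_univ_sum_pi (Fin.addCases (fun j u => w u * g j u) fun _ u => w u :
    Fin (ℓ + k) → T → ℝ)
  rw [Fin.prod_univ_add] at h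
  simp only [Fin.addCases_left, Fin.addCases_right, hw, prod_const_one, mul_one] at h
  rw [h]
  refine sum_congr rfl fun τ _ => ?_
  rw [Fin.prod_univ_add, Fin.prod_univ_add]
  simp only [Fin.addCases_left, Fin.addCases_right, prod_mul_distrib]
  rw [mul_right_comm]
  refine congrArg (_ * · * _) (prod_congr rfl fun j _ => ?_)
  rw [extendSeq, dif_pos (j.2.trans_le hℓ)]
  rfl

variable {P : PRFSPD} {lam : ℕ}

lemma gwin_blockKernel (A : BlockAdv P lam) {Q : P.Input lam → P.Proof lam → ℝ}
    (hQ : ∀ x, ∑ y, Q x y = 1) : gwin A (fun _ => 1) (fun _ => blockKernel Q) = ∑ x,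
    (1 / 2 ^ P.inLen lam) ^ card (Fin A.prog.length × Fin A.wires) * ∑ y₀,
    (∏ e, fakeProof P lam (x e) (y₀ e)) * ∑ y₁, (∏ e, Q (x e) (y₁ e)) * blockGame A x y₀ y₁ := by
  let w : P.Input lam × (P.Proof lam × P.Proof lam) → ℝ := fun u =>
    1 / 2 ^ P.inLen lam * (fakeProof P lam u.1 u.2.1 * Q u.1 u.2.2)
  have hw : ∑ u, w u = 1 := by
    have : ∀ x, ∑ y : P.Proof lam × P.Proof lam, w (x, y) = 1 / 2 ^ P.inLen lam := by
      intro x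
      simp only [w]
      rw [← mul_sum, sum_prod_type]
      simp only [← mul_sum, hQ, mul_one, sum_fakeProof]
    rw [sum_prod_type, sum_congr rfl fun x _ => this x, sum_const,
      card_univ, nsmul_eq_mul, card_cfg]
    field_simp
  have hg : ∀ (b : Bool) (z : P.Input lam × P.Proof lam),
      ∑ u, w u * (if z = (u.1, if b = true then u.2.2 else u.2.1) then 1 else 0) =
        blockProb Q b z := by
    rintro b ⟨x, y⟩
    rw [sum_prod_type, sum_eq_single x, sum_prod_type]
    · cases b
      · simp only [Prod.mk.injEq, true_and, Bool.false_eq_true, if_false, mul_ite, mul_one,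
          mul_zero, w,
          blockProb]
        rw [sum_eq_single y]
        · simp only [if_true, ← mul_sum, hQ, mul_one]
        · intro y' _ h
          simp [h.symm]
        · simp
      · simp only [Prod.mk.injEq, true_and, if_true, mul_ite, mul_one, mul_zero, w, blockProb]
        simp only [sum_ite_eq, mem_univ, if_true]
        rw [← mul_sum, ← sum_mul, sum_fakeProof, one_mul]
    · intro x' _ h
      simp [h.symm]
    · simp
  rw [gwin_expand (T := Fin A.wires → P.Input lam × (P.Proof lam × P.Proof lam)) A (fun _ => 1)
    (p := fun τ => ∏ j, w (τ j)) (sum_prod_eq_one fun _ => hw)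
    (fun τ => blockDet (fun j => (extendSeq τ j).1) (fun j => (extendSeq τ j).2.1)
      fun j => (extendSeq τ j).2.2) (blockKernel Q)]
  · let e : (Fin A.prog.length → Fin A.wires → P.Input lam × (P.Proof lam × P.Proof lam)) ≃
      (Fin A.prog.length × Fin A.wires → P.Input lam) ×
      ((Fin A.prog.length × Fin A.wires → P.Proof lam) ×
        (Fin A.prog.length × Fin A.wires → P.Proof lam)) :=
      (Equiv.curry _ _ _).symm.trans ((Equiv.arrowProdEquivProdArrow _ _ _).trans
        ((Equiv.refl _).prodCongr (Equiv.arrowProdEquivProdArrow _ _ _)))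
    rw [sum_equiv e _ (fun u =>
      (1 / 2 ^ P.inLen lam) ^ card (Fin A.prog.length × Fin A.wires) *
      ((∏ e, fakeProof P lam (u.1 e) (u.2.1 e)) *
        ((∏ e, Q (u.1 e) (u.2.2 e)) * blockGame A u.1 u.2.1 u.2.2)))]
    · simp only [sum_prod_type, mul_sum]
    · intro t
      rw [← Fintype.prod_prod_type' (f := fun r j => w (t r j))]
      simp only [w, prod_mul_distrib, prod_const, card_univ, mul_assoc]
      refine congrArg (_ * ·) (congrArg (_ * ·) (congrArg (_ * ·) ?_))
      rw [blockGame]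
      congr 1
      funext r
      have hx : ∀ j, extendSeq (extendSeq t r) j = (grid (e t).1 r j, grid (e t).2.1 r j,
          grid (e t).2.2 r j) := by
        intro j
        by_cases hr : r < A.prog.length <;> by_cases hj : j < A.wires <;>
          simp [extendSeq, grid, hr, hj] <;> rfl
      simp only [hx]
  · intro ℓ hℓ m z
    have := sum_prod_prefix hw hℓ fun j u =>
      if blocks ℓ _ _ z j = (u.1, if m j = true then u.2.2 else u.2.1) then (1 : ℝ) else 0
    simp only [hg] at this
    rw [blockKernel, ← this]
    refine sum_congr rfl fun τ _ => congrArg (_ * ·) ?_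
    have hz : z = blockVal (fun j => (extendSeq τ j).1) (fun j => (extendSeq τ j).2.1)
        (fun j => (extendSeq τ j).2.2) m ↔ ∀ j, blocks ℓ _ _ z j = ((extendSeq τ j).1,
          if m j = true then (extendSeq τ j).2.2 else (extendSeq τ j).2.1) := by
      rw [blockVal, Equiv.eq_symm_apply, funext_iff]
    by_cases h : z = blockVal (fun j => (extendSeq τ j).1) (fun j => (extendSeq τ j).2.1)
        (fun j => (extendSeq τ j).2.2) m
    · exact (prod_eq_one fun j _ => if_pos (hz.1 h j)).trans (if_pos h).symm
    · obtain ⟨j, hj⟩ := not_forall.1 (mt hz.2 h)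
      exact (prod_eq_zero (mem_univ j) (if_neg hj)).trans (if_neg h).symm

/-- A bound for the size of the distinguishers that run the game for given randomness. -/
def blockCost (P : PRFSPD) (lam N L : ℕ) : ℕ :=
  gameCost (L * N * P.proofLen lam) N L
    (L * N * (8 * P.inLen lam + (2 * P.inLen lam + (P.outLen lam + 1 + (P.destruct lam).size) +
      2 * P.proofLen lam))) 0
    (4 * (L * N * P.proofLen lam + N) + 41 * (N * (P.inLen lam + P.proofLen lam)))

lemma Observable.blockGame
    (A : BlockAdv P lam)
    (x : Fin A.prog.length × Fin A.wires → P.Input lam)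
    (y₀ : Fin A.prog.length × Fin A.wires → P.Proof lam) {E : Type} [Fintype E]
    [DecidableEq E] (hE : card E ≤ A.prog.length * A.wires)
    (x' : E → P.Input lam)
    (q : (Fin A.prog.length × Fin A.wires) × Fin (P.proofLen lam) →
      (E × Fin (P.proofLen lam)) ⊕ Bool) :
    Observable (blockCost P lam A.wires A.prog.length) fun φ =>
      ∑ t : E → P.Proof lam, (∏ e, (P.destruct lam).probPure (φ (x' e)) (t e)) *
        QPK.blockGame A x y₀ fun e => slot (QPK.rewire q fun p => t p.1 p.2) e := by
  have hv : Prep (prOracle (P.inLen lam) (P.outLen lam)) 0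
      fun _ => pureState (fun _ : Cfg Empty => (1 : ℂ)) := by
    have h := (StatePrep.plus (O := prOracle (P.inLen lam) (P.outLen lam)) (κ := Empty)).prep
      Empty.elim
    simpa using h
  have hp := (KCirc.pi fun e : E => (KCirc.destructOracle (d := P.inLen lam)
    (P.destruct lam)).rewire (ι := Empty) fun i => inr (x' e i)).comap
      (Prod.snd : E × Empty → Empty)
  have h := Observable.game hv (p := fun φ (t : Cfg (E × Fin (P.proofLen lam))) =>
      ∏ e, (P.destruct lam).probPure (φ (x' e)) (slot t e)) (hp.congr fun φ a t => ?_) A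
    (M := fun t r => blockDet (grid x r) (grid y₀ r) (grid (fun e => slot (QPK.rewire q t) e) r))
    (sM := 4 * (card E * P.proofLen lam + A.wires) +
      41 * (A.wires * (P.inLen lam + P.proofLen lam)))
    (fun r ℓ hℓ => ?_) fun t r => isProbKernel_blockDet _ _ _
  · obtain ⟨B, hB, hF⟩ := h
    refine ⟨B, fun β => (hB β).trans ?_, fun φ => ?_⟩
    · simp only [gameCost, blockCost, stepCost, card_prod, card_fin,
        card_empty, mul_zero, zero_add]
      gcongr
    · rw [← hF]
      exact sum_equiv (Equiv.curry E (Fin (P.proofLen lam)) Bool).symm _ _ fun t => rfl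
  · exact Complex.ofReal_prod _ _
  · have hs := KCirc.select (O := prOracle (P.inLen lam) (P.outLen lam))
      (ι := (E × Fin (P.proofLen lam)) ⊕ Fin ℓ) (κ := Fin (ℓ * (P.inLen lam + P.proofLen lam)))
      (elim
        (fun o => elim (fun _ => inr true)
          (fun _ => inl (inr ((blockEquiv ℓ _ _).symm o).1)) ((blockEquiv ℓ _ _).symm o).2)
        (elim
          (fun o => elim (fun i => inr (grid x r ((blockEquiv ℓ _ _).symm o).1 i))
            (fun i => if h : r < A.prog.length ∧ (((blockEquiv ℓ _ _).symm o).1 : ℕ) < A.wires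
              then (q ((⟨r, h.1⟩, ⟨_, h.2⟩), i)).map inl id else inr false)
            ((blockEquiv ℓ _ _).symm o).2)
          fun o => elim (fun _ => inr false)
            (fun i => inr (grid y₀ r ((blockEquiv ℓ _ _).symm o).1 i))
            ((blockEquiv ℓ _ _).symm o).2))
    refine (hs.weaken ?_).congr fun θ a z => ?_
    · simp only [card_sum, card_prod, card_fin]
      gcongr
    · have e : ∀ v w : Cfg (Fin (ℓ * (P.inLen lam + P.proofLen lam))), v = w →
          ((if z = v then 1 else 0 : ℝ) : ℂ) = if z = w then 1 else 0 := by
        rintro v _ rfl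
        split_ifs <;> simp
      refine e _ _ ?_
      funext o
      obtain ⟨⟨j, i⟩, rfl⟩ := (blockEquiv ℓ _ _).surjective o
      rcases i with i | i
      · simp [blockVal, blocks, QPK.rewire]
      · have hg : grid (fun e => slot (QPK.rewire q (a ∘ inl)) e) r j i =
            elim a id (if h : r < A.prog.length ∧ (j : ℕ) < A.wires
              then (q ((⟨r, h.1⟩, ⟨_, h.2⟩), i)).map inl id else inr false) := by
          rw [grid]
          split_ifs with h
          · rw [slot, QPK.rewire]
            rcases q _ with t | b <;> rfl
          · rfl
        simp only [blockVal, blocks, Equiv.coe_fn_symm_mk, Equiv.symm_apply_apply, elim_inr]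
        by_cases hb : a (inr j) = true
        · simp only [QPK.rewire, elim_inl, elim_inr, Equiv.symm_apply_apply, ← hg]
          simp only [Function.comp_apply, hb, if_true]
        · simp only [QPK.rewire, elim_inl, elim_inr, Equiv.symm_apply_apply, ← hg]
          simp only [Function.comp_apply, hb, id, Bool.false_eq_true, if_false]

end BlockGame

section BlockSecurity

variable {P : PRFSPD} {lam : ℕ}

variable {ε : ℝ} {s : ℕ}

/-- The success probability for given strings and fake proofs, when the right proofs are
distributed according to `Q`. -/
def proofGame (A : BlockAdv P lam) (Q : P.Input lam → P.Proof lam → ℝ)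
    (x : Fin A.prog.length × Fin A.wires → P.Input lam)
    (y₀ : Fin A.prog.length × Fin A.wires → P.Proof lam) : ℝ :=
  ∑ y₁, (∏ e, Q (x e) (y₁ e)) * blockGame A x y₀ y₁

lemma proofGame_mem (A : BlockAdv P lam) {Q : P.Input lam → P.Proof lam → ℝ} (h0 : ∀ x y, 0 ≤ Q x y)
    (h1 : ∀ x, ∑ y, Q x y = 1) (x : Fin A.prog.length × Fin A.wires → P.Input lam)
    (y₀ : Fin A.prog.length × Fin A.wires → P.Proof lam) : 0 ≤ proofGame A Q x y₀ ∧
    proofGame A Q x y₀ ≤ 1 := by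
  have hp : ∀ y₁ : Fin A.prog.length × Fin A.wires → P.Proof lam,
      0 ≤ ∏ e, Q (x e) (y₁ e) := fun y₁ => prod_nonneg fun e _ => h0 _ _
  refine ⟨sum_nonneg fun y₁ _ => mul_nonneg (hp y₁) (blockGame_mem A x y₀ y₁).1, ?_⟩
  rw [← sum_prod_eq_one fun e => h1 (x e)]
  exact sum_le_sum fun y₁ _ =>
    mul_le_of_le_one_right (hp y₁) (blockGame_mem A x y₀ y₁).2

lemma abs_haarProof_sub_le (hε : P.HaarBound lam s ε) (A : BlockAdv P lam)
    (hs : blockCost P lam A.wires A.prog.length ≤ s)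
    (x : Fin A.prog.length × Fin A.wires → P.Input lam)
    (y₀ y₁ : Fin A.prog.length × Fin A.wires → P.Proof lam) (e : Fin A.prog.length × Fin A.wires) :
    |∑ y, (haarProof P lam (x e) y - fakeProof P lam (x e) y) * blockGame A x y₀ (update y₁ e y)| ≤
    ε := by
  have hcard : card Unit ≤ A.prog.length * A.wires := by
    have := Fintype.card_pos_iff.2 ⟨e⟩
    rwa [card_prod, card_fin, card_fin] at this
  have hO := ((Observable.blockGame A x y₀ hcard (fun _ => x e)
    (fun p => if p.1 = e then inl ((), p.2) else inr (y₁ p.1 p.2))).weaken hs)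
  have hF : ∀ φ : P.Input lam → P.Output lam → ℂ,
      (∑ t : Unit → P.Proof lam, (∏ i, (P.destruct lam).probPure (φ (x e)) (t i)) *
        blockGame A x y₀ fun e' => slot (rewire (fun p : (Fin A.prog.length × Fin A.wires) ×
          Fin (P.proofLen lam) => if p.1 = e then inl ((), p.2) else inr (y₁ p.1 p.2))
          fun p => t p.1 p.2) e') =
      ∑ y, (P.destruct lam).probPure (φ (x e)) y * blockGame A x y₀ (update y₁ e y) := by
    intro φ
    rw [← (Equiv.funUnique Unit (P.Proof lam)).symm.sum_comp]
    refine sum_congr rfl fun y _ => ?_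
    rw [prod_unique]
    refine congrArg (_ * ·) (congrArg (blockGame A x y₀) ?_)
    funext e' i
    by_cases h : e' = e
    · subst h
      simp [slot, rewire]
    · simp [slot, rewire, h]
  exact Observable.abs_sum_haarProof_sub_le hε (by simpa only [hF] using hO)

lemma abs_proofGame_sub_le (h0 : 0 ≤ ε) (hε : P.HaarBound lam s ε) (A : BlockAdv P lam)
    (hs : blockCost P lam A.wires A.prog.length ≤ s)
    (x : Fin A.prog.length × Fin A.wires → P.Input lam)
    (y₀ : Fin A.prog.length × Fin A.wires → P.Proof lam) :
    |avg (fun k => proofGame A (keyProof P lam k) x y₀) - proofGame A (fakeProof P lam) x y₀| ≤ ε +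
    A.prog.length * A.wires * ε + if Injective x then 0 else 1 := by
  by_cases hx : Injective x
  · rw [if_pos hx, add_zero]
    have hO := ((Observable.blockGame A x y₀ (by simp) x fun p => inl p).weaken hs).abs_sub_le hε
    have h1 : ∫ φ, proofGame A (fun x y => (P.destruct lam).probPure (vecs φ x) y) x y₀
        ∂P.haar lam = proofGame A (haarProof P lam) x y₀ := by
      simp only [proofGame]
      rw [integral_finsetSum]
      · refine sum_congr rfl fun y₁ _ => ?_
        rw [integral_mul_const]
        exact congrArg (· * _) (integral_prod_injective hx fun e =>
          continuous_probPure (P.destruct lam) (y₁ e))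
      · intro y₁ _
        exact integrable_of_continuous _ ((continuous_finsetProd _ fun e _ =>
          continuous_probPure_eval (x e) (y₁ e)).mul continuous_const)
    have h2 := abs_sum_prod_sub_le (fun e => haarProof_nonneg (x e)) (fun e => sum_haarProof (x e))
      (fun e => fakeProof_nonneg P lam (x e)) (fun e => sum_fakeProof P lam (x e))
      (blockGame A x y₀) fun e f => abs_haarProof_sub_le hε A hs x y₀ f e
    rw [card_prod, card_fin, card_fin, Nat.cast_mul] at h2
    refine (abs_sub_le _ (proofGame A (haarProof P lam) x y₀) _).trans (add_le_add ?_ h2)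
    rw [← h1]
    exact hO
  · rw [if_neg hx]
    have h1 := proofGame_mem A (fakeProof_nonneg P lam) (sum_fakeProof P lam) x y₀
    have h2 : 0 ≤ avg (fun k => proofGame A (keyProof P lam k) x y₀) :=
      avg_nonneg fun k => (proofGame_mem A (keyProof_nonneg k) (sum_keyProof k) x y₀).1
    have h3 : avg (fun k => proofGame A (keyProof P lam k) x y₀) ≤ 1 :=
      (avg_mono fun k => (proofGame_mem A (keyProof_nonneg k) (sum_keyProof k) x y₀).2).trans_eq
        (avg_const 1)
    have h4 : 0 ≤ ε + A.prog.length * A.wires * ε := by positivity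
    rw [abs_le]
    constructor <;> linarith [h1.1, h1.2]

lemma isProbKernel_blockKernel {Q : P.Input lam → P.Proof lam → ℝ} (h0 : ∀ x y, 0 ≤ Q x y)
    (h1 : ∀ x, ∑ y, Q x y = 1) : IsProbKernel (blockKernel Q) := by
  intro ℓ m
  refine ⟨fun z => prod_nonneg fun j _ => blockProb_nonneg h0 _ _, ?_⟩
  refine ((blocks ℓ (P.inLen lam) (P.proofLen lam)).sum_comp fun f => ∏ j,
    blockProb Q (m j) (f j)).trans ?_
  rw [← prod_univ_sum_pi fun j => blockProb Q (m j)]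
  exact prod_eq_one fun j _ => sum_blockProb h1 _

lemma avg_const_mul {w : ℕ} (c : ℝ) (f : Cfg (Fin w) → ℝ) : avg (fun k => c * f k) = c * avg f := by
  simp only [mul_comm c, avg_mul_const]

lemma avg_sum_sum {w : ℕ} {X Y : Type} [Fintype X] [Fintype Y] (c : ℝ) (p : X → Y → ℝ)
    (F : Cfg (Fin w) → X → Y → ℝ) : avg (fun k => ∑ x, c * ∑ y, p x y * F k x y) = ∑ x, c * ∑ y,
    p x y * avg fun k => F k x y := by
  simp only [avg_sum, avg_const_mul]

lemma sum_sub_le_of_injective {E X Y : Type} [Fintype E] [DecidableEq E] [Fintype X] [DecidableEq X]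
    [Nonempty X] [Fintype Y] {w : ℕ} (p : (E → X) → Y → ℝ) (F : Cfg (Fin w) → (E → X) → Y → ℝ)
    (G : (E → X) → Y → ℝ) {δ : ℝ} (h0 : ∀ x y, 0 ≤ p x y) (h1 : ∀ x, ∑ y, p x y = 1)
    (h : ∀ x y, |avg (fun k => F k x y) - G x y| ≤ δ + if Injective x then 0 else 1) :
    avg (fun k => ∑ x, (1 / card X : ℝ) ^ card E * ∑ y, p x y * F k x y) - ∑ x, (1 / card X : ℝ)
    ^ card E * ∑ y, p x y * G x y ≤ δ + (card E : ℝ) ^ 2 * (1 / card X) := by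
  set C : ℝ := (1 / card X : ℝ) ^ card E with hC
  have hC0 : 0 ≤ C := by positivity
  have hX : (card X : ℝ) ≠ 0 := Nat.cast_ne_zero.2 card_ne_zero
  have hcard : C * card (E → X) = 1 := by
    rw [card_fun, Nat.cast_pow, hC, ← mul_pow, one_div_mul_cancel hX, one_pow]
  rw [avg_sum_sum, ← sum_sub_distrib]
  calc _ ≤ ∑ x : E → X, (C * δ + if Injective x then 0 else C) := by
        refine sum_le_sum fun x _ => ?_
        rw [← mul_sub, ← sum_sub_distrib]
        calc _ ≤ C * ∑ y, p x y * (δ + if Injective x then 0 else 1) := by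
              refine mul_le_mul_of_nonneg_left (sum_le_sum fun y _ => ?_) hC0
              rw [← mul_sub]
              exact mul_le_mul_of_nonneg_left ((le_abs_self _).trans (h x y)) (h0 x y)
          _ = _ := by
              rw [← sum_mul, h1, one_mul, mul_add]
              split_ifs <;> simp
    _ = δ + ∑ x : E → X, (if Injective x then 0 else C) := by
        rw [sum_add_distrib, sum_const, card_univ, nsmul_eq_mul,
          ← mul_assoc, mul_comm (Nat.cast _), hcard, one_mul]
    _ ≤ _ := add_le_add_right sum_not_injective_le δ

lemma gwin_blockKernel_le (h0 : 0 ≤ ε)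
    (hε : P.HaarBound lam s ε)
    (A : BlockAdv P lam)
    (hs : blockCost P lam A.wires A.prog.length ≤ s) :
    avg (fun k => gwin A (fun _ => 1) fun _ => blockKernel (keyProof P lam k)) ≤
      1 / 2 + (ε + A.prog.length * A.wires * ε +
        (A.prog.length * A.wires : ℝ) ^ 2 * (1 / 2 ^ P.inLen lam)) := by
  have hf : gwin A (fun _ => 1) (fun _ => blockKernel (fakeProof P lam)) = 1 / 2 := by
    refine gwin_eq_half A (by simp) (fun _ => isProbKernel_blockKernel (fakeProof_nonneg P lam)
      (sum_fakeProof P lam)) fun _ ℓ _ m m' => ?_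
    funext z
    refine prod_congr rfl fun j _ => ?_
    simp [blockProb]
  have hk := fun k => gwin_blockKernel A (sum_keyProof (P := P) (lam := lam) k)
  rw [gwin_blockKernel A (sum_fakeProof P lam)] at hf
  simp only [hk]
  rw [← hf, ← sub_le_iff_le_add']
  have h := sum_sub_le_of_injective (E := Fin A.prog.length × Fin A.wires)
    (X := P.Input lam)
    (Y := Fin A.prog.length × Fin A.wires → P.Proof lam)
    (fun x y₀ => ∏ e, fakeProof P lam (x e) (y₀ e))
    (fun k x y₀ => proofGame A (keyProof P lam k) x y₀)
    (fun x y₀ => proofGame A (fakeProof P lam) x y₀)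
    (fun x y₀ => prod_nonneg fun e _ => fakeProof_nonneg _ _ _ _)
    (fun x => sum_prod_eq_one fun e => sum_fakeProof P lam (x e))
    (fun x y₀ => abs_proofGame_sub_le h0 hε A hs x y₀)
  rw [card_cfg] at h
  refine h.trans_eq ?_
  rw [card_prod, card_fin, card_fin, Nat.cast_mul]

lemma symScheme_indcpa (hP : P.QuantumSecure) (hd : P.SuperlogInput) : (symScheme P).INDCPA := by
  intro A hA
  have hN : PolyBounded fun lam => (A lam).wires := hA.of_le fun _ => Nat.le_add_right _ _
  have hL : PolyBounded fun lam => (A lam).prog.length := hA.of_le fun _ => Nat.le_add_left _ _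
  obtain ⟨h1, h2, h3, h4⟩ := PolyBounded.lengths hP.qpt
  have hb : PolyBounded fun lam => blockCost P lam (A lam).wires (A lam).prog.length := by
    have hLN := hL.mul hN
    exact ((((hLN.mul (((PolyBounded.const 8).mul h2).add ((((PolyBounded.const 2).mul h2).add
      ((h3.add (.const 1)).add hP.qpt.2.1)).add ((PolyBounded.const 2).mul h4)))).add
      (hN.add (.const 1))).add (hL.mul (((((PolyBounded.const 13).mul ((hLN.mul h4).add hN)).add
      (.const 0)).add (((PolyBounded.const 4).mul ((hLN.mul h4).add hN)).add
      ((PolyBounded.const 41).mul (hN.mul (h2.add h4))))).add (.const 3)))).add (.const 1))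
  obtain ⟨p, hp⟩ := hb
  obtain ⟨ε, hε, hε0, hεA⟩ := PRFSPD.Pseudorandom.uniform hP.pseudorandom p
  refine ⟨fun lam => ε lam + (((A lam).prog.length * (A lam).wires : ℕ) : ℝ) * ε lam +
    (((A lam).prog.length * (A lam).wires * ((A lam).prog.length * (A lam).wires) : ℕ) : ℝ) *
      (√(2 ^ P.inLen lam))⁻¹, ?_, fun lam => ?_⟩
  · exact (hε.add (Negligible.poly_mul hε hε0 (hL.mul hN))).add
      (Negligible.poly_mul (negligible_inv_sqrt hd) (fun n => by positivity)
        ((hL.mul hN).mul (hL.mul hN)))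
  · have h := gwin_blockKernel_le (hε0 lam) (hεA lam) (A lam) (hp lam)
    have hkey : avg (fun k => (A lam).win (K := Empty) (fun _ => 1)
        (fun ℓ m c ρ => ((symScheme P).encProb lam ℓ k m c : ℂ) • ρ) 1) =
        avg (fun k => gwin (A lam) (fun _ => 1) fun _ => blockKernel (keyProof P lam k)) := by
      refine congrArg avg (funext fun k => (CPAAdv.win_empty _ _ _).trans ?_)
      refine congrArg (gwin (A lam) _) (funext fun _ => ?_)
      funext ℓ m z
      exact symScheme_encProb ℓ k m z
    refine hkey.trans_le (h.trans (add_le_add_right (add_le_add ?_ ?_) _))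
    · push_cast
      exact le_rfl
    · push_cast
      rw [sq, one_div]
      refine mul_le_mul_of_nonneg_left (inv_anti₀ (by positivity) ?_) (by positivity)
      exact Real.sqrt_le_iff.2 ⟨by positivity, by
        have : (1 : ℝ) ≤ 2 ^ P.inLen lam := one_le_pow₀ (by norm_num)
        nlinarith⟩

lemma symScheme_quantumSecure (hP : P.QuantumSecure) (hd : P.SuperlogInput) :
    (symScheme P).QuantumSecure where
  qpt := symScheme_isQPT hP.qpt
  correct := symScheme_correct hP
  indcpa := symScheme_indcpa hP hd

end BlockSecurity

section Algorithms

variable {Θ Z : Type} [Nonempty Z] {O : Oracles Θ Z} {ι κ μ α K β : Type}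
variable [Fintype ι] [DecidableEq ι] [Fintype κ] [DecidableEq κ] [Fintype μ] [DecidableEq μ]
  [Fintype α] [DecidableEq α] [Fintype K] [DecidableEq K] [Fintype β] [DecidableEq β]

lemma KCirc.bindPair {s s' : ℕ} {M : Θ → Cfg α → Cfg κ → ℂ} {N : Θ → Cfg (ι ⊕ κ) → Cfg μ → ℂ}
    (hM : KCirc O s M) (hN : KCirc O s' N) (p : α → ι) :
    KCirc O (6 * card ι + 2 * card α + 6 * card κ + s + s') fun θ (a : Cfg ι) (c : Cfg (κ ⊕ μ))
    => M θ (a ∘ p) (c ∘ inl) * N θ (elim a (c ∘ inl)) (c ∘ inr) := by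
  have h := hM.bind (((KCirc.copy (O := O) (id : κ → κ)).both hN).comap
    (elim inr id : κ ⊕ (ι ⊕ κ) → ι ⊕ κ)) p
  refine (h.weaken ?_).congr fun θ a c => ?_
  · simp only [card_sum]
    omega
  · rw [sum_eq_single (c ∘ inl)]
    · refine congrArg (_ * ·) ((one_mul _).symm.trans (congrArg (· * _) (if_pos rfl).symm))
    · intro x _ hx
      exact mul_eq_zero_of_right _ (mul_eq_zero_of_left (if_neg fun h => hx h.symm) _)
    · simp

lemma sum_slot_prod {R : Type} [CommSemiring R] (F : K → Cfg β → R) :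
    ∑ y : Cfg (K × β), ∏ i, F i (slot y i) = ∏ i, ∑ b, F i b := by
  rw [prod_univ_sum_pi]
  exact sum_equiv (Equiv.curry K β Bool) _ _ fun y => rfl

variable {P : PRFSPD} {S : SKE} {lam : ℕ}

lemma sum_pair_eq_one {M : Cfg κ → ℂ} {N : Cfg κ → Cfg μ → ℂ} (hM : ∑ x, M x = 1)
    (hN : ∀ x, ∑ y, N x y = 1) : ∑ c : Cfg (κ ⊕ μ), M (c ∘ inl) * N (c ∘ inl) (c ∘ inr) = 1 := by
  rw [sum_cfgSum]
  refine (sum_congr rfl fun x _ => ?_).trans hM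
  refine (mul_sum _ _ _).symm.trans ((congrArg (M x * ·) (hN x)).trans (mul_one _))

/-- The proof that is stored in a slot. -/
def slotStore (P : PRFSPD) (lam : ℕ) (b : Bool) (x : P.Input lam) (y y' : P.Proof lam) : ℂ :=
  if b = true then if y' = y then 1 else 0 else (fakeProof P lam x y' : ℂ)

lemma sum_slotStore (b : Bool) (x : P.Input lam) (y : P.Proof lam) :
    ∑ y', slotStore P lam b x y y' = 1 := by
  cases b
  · simp only [slotStore, Bool.false_eq_true, if_false]
    exact_mod_cast sum_fakeProof P lam x
  · simp [slotStore]

/-- The symmetric key and the proofs that are stored in the recycled key, when the states of the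
register have been replaced by their destruction proofs. -/
def storeKernel {s : ℕ} (P : PRFSPD) (lam : ℕ)
    (a : Cfg (KeyW s (P.inLen lam) (P.proofLen lam) (P.proofLen lam)))
    (t : Cfg (Fin s ⊕ Fin s × Fin (P.proofLen lam))) : ℂ :=
  if flag a = true then if t ∘ inl = bit a ∧ slot (t ∘ inr) = prf a then 1 else 0
  else (1 / 2 ^ s) * ∏ i, slotStore P lam (t (inl i)) (str a i) (sys a i) (slot (t ∘ inr) i)

lemma KCirc.store (P : PRFSPD) (lam s : ℕ) :
    KCirc O (100 * (s * P.cost lam) + 20) fun _ => storeKernel (s := s) P lam := by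
  have hslot := (KCirc.copy (O := O) (fun j => inl (inr j) :
    Fin (P.proofLen lam) → (Unit ⊕ Fin (P.proofLen lam)) ⊕ Fin (P.inLen lam))).ite
    ((KCirc.fakeProof P lam).comap inr) (fun _ a => by simp [QPK.det])
    (fun _ a => by exact_mod_cast sum_fakeProof P lam _) (inl (inl ()))
  have hpi : KCirc O _ fun _
      (a : Cfg (KeyW s (P.inLen lam) (P.proofLen lam) (P.proofLen lam) ⊕ Fin s)) y =>
        ∏ i, slotStore P lam (a (inr i)) (str (a ∘ inl) i) (sys (a ∘ inl) i)
          (slot y i) := ((KCirc.pi fun _ : Fin s => hslot).comap (fun q => elim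
    (elim (fun _ => inr q.1) fun j => inl (inr (q.1, inl (inr j))))
    (fun j => inl (inr (q.1, inl (inl j)))) q.2))
  have hfresh := (KCirc.uniform (O := O)
    (ι := KeyW s (P.inLen lam) (P.proofLen lam) (P.proofLen lam))
    (κ := Fin s)).bindPair hpi id
  have h := (KCirc.copy (O := O) (elim (fun i => inr (i, inr (inl ())))
    fun q => inr (q.1, inr (inr q.2)) : Fin s ⊕ Fin s × Fin (P.proofLen lam) →
      KeyW s (P.inLen lam) (P.proofLen lam) (P.proofLen lam))).ite hfresh
    (fun _ a => by simp [QPK.det]) (fun _ a => ?_) (inl ())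
  · refine (h.weaken ?_).congr fun θ a t => ?_
    · have := P.le_cost lam
      simp only [card_sum, card_prod, card_fin, card_unit]
      have e1 : s * ((P.inLen lam + P.proofLen lam) + (1 + P.proofLen lam)) ≤ s * P.cost lam :=
        Nat.mul_le_mul_left s (by omega)
      have e2 : s * (1 + P.proofLen lam + P.inLen lam) ≤ s * P.cost lam :=
        Nat.mul_le_mul_left s (by omega)
      have e3 : s * (12 * (1 + P.proofLen lam + P.inLen lam) + 21 * P.proofLen lam +
          2 * P.proofLen lam + (2 * P.inLen lam + 2 * P.cost lam)) ≤ s * (19 * P.cost lam) :=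
        Nat.mul_le_mul_left s (by omega)
      rw [mul_left_comm s 19] at e3
      have e4 : s * P.proofLen lam ≤ s * P.cost lam := Nat.mul_le_mul_left s (by omega)
      have e5 : s * 1 ≤ s * P.cost lam := Nat.mul_le_mul_left s (by omega)
      omega
    · rw [storeKernel]
      refine if_congr Iff.rfl (if_congr ?_ rfl rfl) ?_
      · rw [cfg_sum_ext_iff]
        refine and_congr Iff.rfl ?_
        exact ⟨fun h => funext fun q => congrFun (congrFun h q.1) q.2, fun h => funext fun i =>
          funext fun j => congrFun h (i, j)⟩
      · rw [card_fin]
        rfl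
  · refine sum_pair_eq_one (M := fun _ => 1 / 2 ^ card (Fin s))
      (N := fun x y => ∏ i, slotStore P lam (x i) (str a i) (sys a i) (slot y i)) ?_ fun x => ?_
    · simp
    · rw [sum_slot_prod]
      exact prod_eq_one fun i _ => sum_slotStore _ _ _

lemma KCirc.encrypt (P : PRFSPD) (S : SKE) (lam ℓ : ℕ) :
    KCirc O (200 * (S.keyLen lam * P.cost lam) + 100 * (S.enc lam ℓ).size + 200)
    fun _ (a : Cfg (KeyW (S.keyLen lam) (P.inLen lam) (P.proofLen lam) (P.proofLen lam) ⊕ Fin ℓ))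
    (b : Cfg (Key P S lam ⊕ Ct P S lam ℓ)) => if flag (b ∘ inl) = true ∧ sys (b ∘ inl) =
    (fun _ _ => false) ∧ str (b ∘ inl) = ctStr (b ∘ inr) ∧ prf (b ∘ inl) = ctPrf (b ∘ inr) ∧
    str (a ∘ inl) = str (b ∘ inl) then storeKernel P lam (a ∘ inl)
    (elim (bit (b ∘ inl)) fun q => prf (b ∘ inl) q.1 q.2) *
    (S.encProb lam ℓ (bit (b ∘ inl)) (a ∘ inr) (ctSym (b ∘ inr)) : ℂ) else 0 := by
  let w : Key P S lam ⊕ Ct P S lam ℓ →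
      ((KeyW (S.keyLen lam) (P.inLen lam) (P.proofLen lam) (P.proofLen lam) ⊕ Fin ℓ) ⊕
        ((S.Slot lam ⊕ S.Slot lam × Fin (P.proofLen lam)) ⊕
          Fin (S.ctLen lam ℓ))) ⊕ Bool :=
    elim (elim (fun _ => inr true) fun q => elim
        (elim (fun j => inl (inl (inl (inr (q.1, inl (inl j))))))
          fun _ => inr false)
        (elim (fun _ => inl (inr (inl (inl q.1))))
          fun j => inl (inr (inl (inr (q.1, j))))) q.2)
      (elim (fun j => inl (inr (inr j))) fun q => elim
        (fun j => inl (inl (inl (inr (q.1, inl (inl j))))))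
        (fun j => inl (inr (inl (inr (q.1, j))))) q.2)
  have hw : ∀ (a : Cfg (KeyW (S.keyLen lam) (P.inLen lam) (P.proofLen lam) (P.proofLen lam) ⊕
      Fin ℓ)) (b : Cfg (Key P S lam ⊕ Ct P S lam ℓ)) x, b = QPK.rewire w (elim a x) ↔
      (flag (b ∘ inl) = true ∧ sys (b ∘ inl) = (fun _ _ => false) ∧
        str (b ∘ inl) = ctStr (b ∘ inr) ∧ prf (b ∘ inl) = ctPrf (b ∘ inr) ∧
        str (a ∘ inl) = str (b ∘ inl)) ∧
      x = elim (elim (bit (b ∘ inl)) fun q => prf (b ∘ inl) q.1 q.2)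
        (ctSym (b ∘ inr)) := by
    intro a b x
    constructor
    · rintro rfl
      refine ⟨⟨rfl, rfl, rfl, rfl, rfl⟩, ?_⟩
      funext j
      rcases j with (j | j) | j <;> rfl
    · rintro ⟨⟨h1, h2, h3, h4, h5⟩, rfl⟩
      funext j
      rcases j with (⟨⟩ | ⟨i, (j | j) | ⟨⟩ | j⟩) | j | ⟨i, j | j⟩
      · exact h1
      · exact (congrFun (congrFun h5 i) j).symm
      · exact congrFun (congrFun h2 i) j
      · rfl
      · rfl
      · rfl
      · exact (congrFun (congrFun (h5.trans h3) i) j).symm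
      · exact (congrFun (congrFun h4 i) j).symm
  have h1 := ((KCirc.store (O := O) P lam (S.keyLen lam)).bindPair
    ((KCirc.prob (S.enc lam ℓ)).comap (elim (fun i => inr (inl i))
      fun j => inl (inr j) : S.Slot lam ⊕ Fin ℓ →
        (KeyW (S.keyLen lam) (P.inLen lam) (P.proofLen lam) (P.proofLen lam) ⊕ Fin ℓ) ⊕
          (S.Slot lam ⊕ S.Slot lam × Fin (P.proofLen lam)))) inl).bind
    (KCirc.wiring w) id
  refine (h1.weaken ?_).congr fun θ a b => ?_
  · have := P.le_cost lam
    have c a (h : a ≤ P.cost lam) := Nat.mul_le_mul_left (S.keyLen lam) h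
    have e1 := card_le_size_inp (S.enc lam ℓ)
    have e2 := card_le_size_out (S.enc lam ℓ)
    simp only [card_sum, card_prod, card_fin, card_unit] at e1 e2 ⊢
    have e3 := c ((P.inLen lam + P.proofLen lam) + (1 + P.proofLen lam)) (by omega)
    have e4 := c ((P.inLen lam + P.outLen lam) + (1 + P.proofLen lam)) (by omega)
    have e5 := c (P.inLen lam + P.proofLen lam) (by omega)
    have e6 := c (P.proofLen lam) (by omega)
    have e7 := c 1 (by omega)
    omega
  · rw [sum_eq_single (elim (elim (bit (b ∘ inl)) fun q => prf (b ∘ inl) q.1 q.2)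
      (ctSym (b ∘ inr)))]
    · by_cases h : flag (b ∘ inl) = true ∧ sys (b ∘ inl) = (fun _ _ => false) ∧
        str (b ∘ inl) = ctStr (b ∘ inr) ∧ prf (b ∘ inl) = ctPrf (b ∘ inr) ∧
        str (a ∘ inl) = str (b ∘ inl)
      · rw [if_pos h]
        refine Eq.symm ((congrArg (_ * ·) (if_pos ((hw a b _).2 ⟨h, rfl⟩))).trans
          ((mul_one _).trans (congrArg (storeKernel P lam _ _ * ·) ?_)))
        rw [SKE.encProb]
        congr 2
        funext j
        rcases j with j | j <;> rfl
      · rw [if_neg h]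
        exact (mul_eq_zero_of_right _ (if_neg fun h' => h ((hw a b _).1 h').1)).symm
    · intro x _ hx
      exact mul_eq_zero_of_right _ (if_neg fun h' => hx ((hw a b x).1 h').2)
    · simp

end Algorithms

section DestructStage

variable {Θ Z : Type} [Nonempty Z] {O : Oracles Θ Z} {s d n c : ℕ}

/-- The coefficients of the map that runs `A` on the state of every slot of the key register. -/
def slotwiseCoef (A : QAlg (Fin n) (Fin c)) : Cfg (KeyW s d n c) → Cfg (KeyW s d n c) →
    Cfg (KeyW s d c c) → Cfg (KeyW s d c c) → ℂ :=
  tensorCoef (coef fun ρ => ρ) (piCoef fun _ => tensorCoef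
    (tensorCoef (coef fun ρ => ρ) (coef A.run)) (coef fun ρ => ρ))

lemma Circ.slotwise (A : QAlg (Fin n) (Fin c)) :
    Circ O (s * A.size) fun _ => cchan (slotwiseCoef (s := s) (d := d) A) := by
  have h := (Circ.id (O := O) (ι := Unit)).cchan_coef.both (Circ.pi fun _ : Fin s =>
    ((Circ.id (O := O) (ι := Fin d)).cchan_coef.both (Circ.run A).cchan_coef).both
      (Circ.id (ι := Unit ⊕ Fin c)).cchan_coef)
  simp only [card_fin, zero_add, add_zero] at h
  exact h

lemma coef_id_diag {ι : Type} [Fintype ι] [DecidableEq ι] (u u' y : Cfg ι) :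
    coef (fun ρ => ρ) u u' y y = if u = y ∧ u' = y then 1 else 0 := single_apply _ _ _ _ _

lemma eq_of_coef_id_ne_zero {ι : Type} [Fintype ι] [DecidableEq ι] {u u' y : Cfg ι}
    (h : coef (fun ρ => ρ) u u' y y ≠ 0) : u = y ∧ u' = y := by
  rw [coef_id_diag] at h
  exact (ite_ne_right_iff.1 h).1

lemma slotwiseCoef_diag (A : QAlg (Fin n) (Fin c)) (u u' : Cfg (KeyW s d n c))
    (a : Cfg (KeyW s d c c)) : slotwiseCoef A u u' a a =
    if (flag u = flag u' ∧ str u = str u' ∧ bit u = bit u' ∧ prf u = prf u') ∧ a = mkKey (flag u)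
    (str u) (sys a) (bit u) (prf u) then ∏ i, A.coeff (sys a i) (sys u i) (sys u' i) else 0 := by
  split_ifs with h
  · obtain ⟨⟨h1, h2, h3, h4⟩, h5⟩ := h
    have e1 : flag u = flag a := by rw [h5]; rfl
    have e2 : str u = str a := by rw [h5]; rfl
    have e3 : bit u = bit a := by rw [h5]; rfl
    have e4 : prf u = prf a := by rw [h5]; rfl
    have g1 := h1.symm.trans e1
    have g2 := h2.symm.trans e2
    have g3 := h3.symm.trans e3
    have g4 := h4.symm.trans e4
    refine (congrArg₂ (· * ·) ((coef_id_diag _ _ _).trans (if_pos ⟨funext fun _ => e1,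
      funext fun _ => g1⟩)) (prod_congr rfl fun i _ => ?_)).trans (one_mul _)
    refine (congrArg₂ (· * ·) (congrArg₂ (· * ·) ((coef_id_diag _ _ _).trans (if_pos
      ⟨congrFun e2 i, congrFun g2 i⟩)) rfl) ((coef_id_diag _ _ _).trans (if_pos ⟨?_, ?_⟩))).trans
      ((mul_one _).trans (one_mul _))
    · funext j
      rcases j with ⟨⟩ | j
      · exact congrFun e3 i
      · exact congrFun (congrFun e4 i) j
    · funext j
      rcases j with ⟨⟩ | j
      · exact congrFun g3 i
      · exact congrFun (congrFun g4 i) j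
  · by_contra hne
    have hr := Finset.prod_ne_zero_iff.1 (right_ne_zero_of_mul hne)
    have e1 := eq_of_coef_id_ne_zero (left_ne_zero_of_mul hne)
    have e2 : ∀ i, _ := fun i =>
      eq_of_coef_id_ne_zero (left_ne_zero_of_mul (left_ne_zero_of_mul (hr i (mem_univ i))))
    have e3 : ∀ i, _ := fun i =>
      eq_of_coef_id_ne_zero (right_ne_zero_of_mul (hr i (mem_univ i)))
    have f1 : flag u = flag a ∧ flag u' = flag a := ⟨congrFun e1.1 (), congrFun e1.2 ()⟩
    have f2 : str u = str a ∧ str u' = str a := ⟨funext fun i => (e2 i).1, funext fun i => (e2 i).2⟩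
    have f3 : bit u = bit a ∧ bit u' = bit a := ⟨funext fun i => congrFun (e3 i).1 (inl ()),
      funext fun i => congrFun (e3 i).2 (inl ())⟩
    have f4 : prf u = prf a ∧ prf u' = prf a :=
      ⟨funext fun i => funext fun j => congrFun (e3 i).1 (inr j),
        funext fun i => funext fun j => congrFun (e3 i).2 (inr j)⟩
    refine h ⟨⟨f1.1.trans f1.2.symm, f2.1.trans f2.2.symm, f3.1.trans f3.2.symm,
      f4.1.trans f4.2.symm⟩, ?_⟩
    rw [f1.1, f2.1, f3.1, f4.1, mkKey_self]

lemma sum_slotwise (A : QAlg (Fin n) (Fin c)) (ρ : Op (KeyW s d n c)) (f : Cfg (KeyW s d c c) → ℂ) :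
    ∑ a, cchan (slotwiseCoef A) ρ a a * f a = ∑ u, ∑ u', if flag u = flag u' ∧ str u = str u' ∧
    bit u = bit u' ∧ prf u = prf u' then ρ u u' * ∑ y : Fin s → Cfg (Fin c),
    (∏ i, A.coeff (y i) (sys u i) (sys u' i)) * f (mkKey (flag u) (str u) y (bit u) (prf u))
    else 0 := by
  simp only [cchan_apply, sum_mul]
  rw [sum_comm]
  refine sum_congr rfl fun u _ => ?_
  rw [sum_comm]
  refine sum_congr rfl fun u' _ => ?_
  simp only [slotwiseCoef_diag, mul_assoc]
  rw [← mul_sum]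
  split_ifs with h
  · refine congrArg (ρ u u' * ·) (Eq.symm ?_)
    refine sum_of_injective (fun y => mkKey (flag u) (str u) y (bit u) (prf u))
      (fun y y' h => congrArg sys h) _ _ (fun a ha => ?_) fun y => ?_
    · rw [if_neg fun h' => ha ⟨_, h'.2.symm⟩, zero_mul]
    · exact congrArg (· * _) (if_pos ⟨h, rfl⟩).symm
  · simp only [h, false_and, if_false, zero_mul, sum_const_zero, mul_zero]

end DestructStage

section Encryption

variable {P : PRFSPD} {S : SKE} {lam : ℕ}

lemma sum_coeff_slotStore (b : Bool) (x : P.Input lam) (q q' : P.Output lam) (y' : P.Proof lam) :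
    ∑ y, (P.destruct lam).coeff y q q' * slotStore P lam b x y y' = slotCoeff b x y' q q' := by
  cases b
  · simp only [slotStore, slotCoeff, Bool.false_eq_true, if_false, sum_mul]
  · simp [slotStore, slotCoeff]

lemma sum_storeKernel (ρ : Op (Key P S lam)) (r : Cfg (Key P S lam)) : ∑ a,
    cchan (slotwiseCoef (P.destruct lam)) ρ a a *
    (if str a = str r then storeKernel P lam a (elim (bit r) fun q => prf r q.1 q.2) else 0) =
    freshWeight P S lam ρ r + recycledWeight P S lam ρ r := by
  have hrec : recycledWeight P S lam ρ r = ∑ u : Cfg (Key P S lam), ∑ u' : Cfg (Key P S lam),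
      if u = u' then if flag u = true ∧ str u = str r ∧ bit u = bit r ∧ prf u = prf r then ρ u u
        else 0 else 0 := by
    simp [recycledWeight]
  rw [sum_slotwise, hrec, freshWeight, mul_sum, ← sum_add_distrib]
  refine sum_congr rfl fun u _ => ?_
  rw [mul_sum, ← sum_add_distrib]
  refine sum_congr rfl fun u' _ => ?_
  by_cases h : flag u = flag u' ∧ str u = str u' ∧ bit u = bit u' ∧ prf u = prf u'
  swap
  · rw [if_neg h, if_neg fun h' => h ⟨h'.1.trans h'.2.1.symm, h'.2.2.1.trans h'.2.2.2.1.symm,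
      h'.2.2.2.2⟩, if_neg fun h' => h ⟨congrArg _ h', congrArg _ h', congrArg _ h', congrArg _ h'⟩]
    ring
  rw [if_pos h]
  by_cases hs : str u = str r
  swap
  · rw [if_neg fun h' => hs h'.2.2.1, if_neg (c := flag u = true ∧ _) fun h' => hs h'.2.1, ite_self,
      sum_eq_zero fun y _ => mul_eq_zero_of_right _ (if_neg hs)]
    ring
  have hstr : ∀ y : S.Slot lam → P.Proof lam,
      (if str (mkKey (flag u) (str u) y (bit u) (prf u)) = str r then storeKernel P lam
        (mkKey (flag u) (str u) y (bit u) (prf u)) (elim (bit r) fun q => prf r q.1 q.2) else 0)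
      = if flag u = true then if bit r = bit u ∧ prf r = prf u then 1 else 0 else
        (1 / 2 ^ S.keyLen lam) * ∏ i, slotStore P lam (bit r i) (str u i) (y i) (prf r i) :=
    fun y => if_pos hs
  simp only [hstr]
  cases hf : flag u
  · have hf' : flag u' = false := h.1.symm.trans hf
    simp only [Bool.false_eq_true, if_false, false_and, ite_self, add_zero]
    rw [if_pos ⟨trivial, hf', hs, h.2.1.symm.trans hs, h.2.2⟩]
    simp only [mul_left_comm _ (1 / 2 ^ S.keyLen lam : ℂ), ← mul_sum, ← prod_mul_distrib]
    refine congrArg (1 / 2 ^ S.keyLen lam * ·) (congrArg (ρ u u' * ·) ?_)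
    refine ((prod_univ_sum_pi fun i y => (P.destruct lam).coeff y (sys u i) (sys u' i) *
      slotStore P lam (bit r i) (str u i) y (prf r i)).symm.trans
        (prod_congr rfl fun i _ => (sum_coeff_slotStore _ _ _ _ _).trans ?_))
    rw [hs]
    rfl
  · simp only [Bool.true_eq_false, if_true, false_and, if_false, mul_zero, zero_add, ← sum_mul,
      true_and]
    rw [← prod_univ_sum_pi fun i y => (P.destruct lam).coeff y (sys u i) (sys u' i)]
    simp only [QAlg.sum_coeff]
    by_cases huu : u = u'
    · subst huu
      simp only [if_true, prod_const_one, hs, eq_comm (a := bit u),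
        eq_comm (a := prf u), true_and, mul_ite, mul_one, mul_zero]
    · rw [if_neg huu]
      have : ∃ i, sys u i ≠ sys u' i := by
        by_contra! hc
        exact huu (key_ext h.1 h.2.1 (funext hc) h.2.2.1 h.2.2.2)
      obtain ⟨i, hi⟩ := this
      rw [prod_eq_zero (mem_univ i) (if_neg hi), zero_mul, mul_zero]

lemma kchan_tensorId {ι κ R μ : Type} [Fintype ι] [DecidableEq ι] [Fintype κ] [DecidableEq κ]
    [Fintype R] [DecidableEq R] [Fintype μ] [DecidableEq μ] (N : Cfg (κ ⊕ R) → Cfg μ → ℂ)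
    (C : Cfg ι → Cfg ι → Cfg κ → Cfg κ → ℂ) (ρ : Op ι) (m : Cfg R) (y : Cfg μ) :
    kchan N (tensorId R (cchan C) (tensor ρ (pureState (ket m)))) y y = ∑ a, cchan C ρ a a *
    N (elim a m) y := by
  rw [kchan_apply, if_pos rfl, sum_cfgSum]
  refine sum_congr rfl fun a _ => ?_
  rw [sum_eq_single m]
  · refine congrArg (· * _) ?_
    simp only [tensorId_apply, cchan_apply]
    refine sum_congr rfl fun u _ => sum_congr rfl fun u' _ => congrArg (· * _) ?_
    simp [tensor, pureState_ket]
  · intro m' _ hm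
    refine mul_eq_zero_of_left ?_ _
    rw [tensorId_apply, cchan_apply]
    refine sum_eq_zero fun u _ => sum_eq_zero fun u' _ => mul_eq_zero_of_left ?_ _
    simp [tensor, pureState_ket, single_apply, hm.symm]
  · simp

lemma exists_enc (P : PRFSPD) (S : SKE) (lam ℓ : ℕ) : ∃ A : QAlg (Key P S lam ⊕ Fin ℓ)
    (Key P S lam ⊕ Ct P S lam ℓ), A.size ≤
    (300 * (S.keyLen lam * P.cost lam) + 100 * (S.enc lam ℓ).size + 300) + ℓ ∧ ∀ m z ρ r r',
    Construction.enc P S lam ℓ m z ρ r r' = A.run (tensor ρ (pureState (ket m))) (elim r z)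
    (elim r' z) := by
  obtain ⟨A, hA, hrun⟩ := exists_qalg (((Circ.slotwise (O := noOracle) (s := S.keyLen lam)
    (d := P.inLen lam) (P.destruct lam)).tensorId (R := Fin ℓ)).comp (KCirc.encrypt P S lam ℓ))
  refine ⟨A, hA.trans ?_, fun m z ρ r r' => ?_⟩
  · have := P.le_cost lam
    have c a (h : a ≤ P.cost lam) := Nat.mul_le_mul_left (S.keyLen lam) h
    simp only [card_sum, card_prod, card_fin, card_unit]
    have e1 := c ((P.inLen lam + P.outLen lam) + (1 + P.proofLen lam)) (by omega)
    have e2 := c ((P.destruct lam).size) (by omega)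
    omega
  · rw [hrun]
    by_cases hrr : r = r'
    swap
    · rw [Construction.enc, of_apply, if_neg fun h => hrr h.1, kchan_apply,
        if_neg fun h => hrr (funext fun j => congrFun h (inl j))]
    subst hrr
    refine Eq.trans ?_ (kchan_tensorId _ _ _ _ _).symm
    by_cases h : flag r = true ∧ sys r = (fun _ _ => false) ∧ str r = ctStr z ∧ prf r = ctPrf z
    · refine (if_pos ⟨rfl, h⟩).trans ?_
      rw [← sum_storeKernel, sum_mul]
      refine sum_congr rfl fun a _ => ?_
      rw [mul_assoc]
      refine congrArg (_ * ·) ?_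
      by_cases ha : str a = str r
      · rw [if_pos ha]
        exact (if_pos ⟨h.1, h.2.1, h.2.2.1, h.2.2.2, ha⟩).symm
      · rw [if_neg ha, zero_mul]
        exact (if_neg fun h' => ha h'.2.2.2.2).symm
    · refine (if_neg fun h' => h h'.2).trans (sum_eq_zero fun a _ => ?_).symm
      exact mul_eq_zero_of_right _ (if_neg fun h' => h ⟨h'.1, h'.2.1, h'.2.2.1, h'.2.2.2.1⟩)

lemma exists_gen (P : PRFSPD) (S : SKE) (lam : ℕ) : ∃ A : QAlg Empty (Dk P S lam),
    A.size ≤ 6 * (S.keyLen lam * P.keyLen lam) ∧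
    ∀ dk, 1 / 2 ^ (S.keyLen lam * P.keyLen lam) = A.prob Empty.elim dk := by
  obtain ⟨A, hA, h⟩ := exists_qalg_kernel (M := fun (_ : Cfg Empty) (_ : Cfg (Dk P S lam)) =>
    1 / 2 ^ (S.keyLen lam * P.keyLen lam)) ((KCirc.uniform (O := noOracle)).congr fun _ _ _ => by
      simp)
  refine ⟨A, hA.trans (by simp), fun dk => (h _ _).symm⟩

lemma exists_qpkGen (P : PRFSPD) (S : SKE) (lam : ℕ) : ∃ A : QAlg (Dk P S lam) (Key P S lam),
    A.size ≤ 3 * (S.keyLen lam * P.cost lam) + 1 ∧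
    ∀ dk, A.run (pureState (ket dk)) = pureState (qpk P S lam dk) := by
  obtain ⟨G, hG, h⟩ := StatePrep.pi (O := noOracle) fun _ : S.Slot lam =>
    StatePrep.slotGen P lam
  obtain ⟨A, hA, hrun⟩ := exists_qalg (G := fun ρ => place (slotWires _ _ _ _) (G () ρ)) (hG.comp
      (Circ.place
    (slotWires (S.keyLen lam) (P.inLen lam) (P.outLen lam) (P.proofLen lam))))
  refine ⟨A, hA.trans ?_, fun dk => ?_⟩
  · have := P.le_cost lam
    have c a (h : a ≤ P.cost lam) := Nat.mul_le_mul_left (S.keyLen lam) h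
    simp only [card_sum, card_prod, card_fin, card_unit]
    have e1 := c ((P.inLen lam + P.outLen lam) + (1 + P.proofLen lam)) (by omega)
    have e2 := c (P.keyLen lam) (by omega)
    omega
  · rw [hrun]
    exact (congrArg _ (h () dk)).trans (pureState_pkVec fun i => P.state lam (slotKey dk i))

lemma exists_dec (P : PRFSPD) (S : SKE) (lam ℓ : ℕ) : ∃ A : QAlg (Dk P S lam ⊕ Ct P S lam ℓ)
    (Fin ℓ), A.size ≤ 100 * (S.keyLen lam * P.cost lam) + 100 * (S.dec lam ℓ).size ∧ ∀ dk z m,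
    Construction.dec P S lam ℓ dk z m = A.prob (elim dk z) m := by
  have hv := KCirc.verify (O := noOracle) (P := P) (lam := lam) fun (i : S.Slot lam) j =>
    (elim (fun j => inl (i, j)) (fun j => inr (inr (i, j))) j :
      Dk P S lam ⊕ Ct P S lam ℓ)
  have hd := (KCirc.prob (O := noOracle) (S.dec lam ℓ)).comap (elim inr
    (fun j => inl (inr (inl j))) :
      S.Slot lam ⊕ Fin (S.ctLen lam ℓ) → (Dk P S lam ⊕ Ct P S lam ℓ) ⊕ S.Slot lam)
  have key : ∀ (a : Cfg (Dk P S lam ⊕ Ct P S lam ℓ)) m,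
      (Construction.dec P S lam ℓ (a ∘ inl) (a ∘ inr) m : ℂ) =
        ∑ k : Cfg (S.Slot lam), ((∏ i, bitSuccess (P := P) (lam := lam) (k i,
          slotKey (a ∘ inl) i, ctStr (a ∘ inr) i, ctPrf (a ∘ inr) i) : ℝ) : ℂ) *
            (S.decProb lam ℓ k (ctSym (a ∘ inr)) m : ℂ) := by
    intro a m
    simp only [← ofReal_mul, ← ofReal_sum]
    rfl
  obtain ⟨A, hA, h⟩ := exists_qalg_kernel (M := fun a m =>
    Construction.dec P S lam ℓ (a ∘ inl) (a ∘ inr) m) ((hv.bind hd id).congr fun _ a m => by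
      refine (key a m).trans (sum_congr rfl fun k _ => ?_)
      rw [SKE.decProb]
      refine congrArg₂ (· * ·) rfl ?_
      congr 2
      funext j
      rcases j with j | j <;> rfl)
  refine ⟨A, hA.trans ?_, fun dk z m =>
    by rw [h, elim_comp_inl, elim_comp_inr]⟩
  have := P.le_cost lam
  have c a (h : a ≤ P.cost lam) := Nat.mul_le_mul_left (S.keyLen lam) h
  have e1 := card_le_size_inp (S.dec lam ℓ)
  have e2 := card_le_size_out (S.dec lam ℓ)
  simp only [card_sum, card_prod, card_fin] at e1 e2 ⊢
  have e3 := c (P.inLen lam + P.proofLen lam) (by omega)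
  have e4 := c (P.keyLen lam) (by omega)
  rw [mul_left_comm _ 4]
  omega

lemma construction_isQPT (hP : P.IsQPT) (hS : S.IsQPT) : (construction P S).IsQPT := by
  choose G hG hG' using exists_gen P S
  choose H hH hH' using exists_qpkGen P S
  choose E hE hE' using exists_enc P S
  choose D hD hD' using exists_dec P S
  have hk := PolyBounded.symKeyLen hS
  have hc := PolyBounded.cost hP
  obtain ⟨q, hq⟩ := hS
  have he : PolyBoundedLen fun lam ℓ => (S.enc lam ℓ).size := ⟨q, fun lam ℓ => (hq lam ℓ).1⟩
  have hd : PolyBoundedLen fun lam ℓ => (S.dec lam ℓ).size := ⟨q, fun lam ℓ => (hq lam ℓ).2⟩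
  have const : ∀ n, PolyBoundedLen fun _ _ => n := fun n => (PolyBounded.const n).len
  obtain ⟨p, hp⟩ := (((((const 300).mul (hk.mul hc).len).add ((const 100).mul he)).add
    (const 300)).add .length).add (((const 100).mul (hk.mul hc).len).add ((const 100).mul hd))
  refine ⟨G, H, E, D, ((PolyBounded.const 6).mul (hk.mul (PolyBounded.lengths hP).1)).of_le hG,
    (((PolyBounded.const 3).mul (hk.mul hc)).add (.const 1)).of_le hH, ⟨p, fun lam ℓ =>
    ⟨(hE lam ℓ).trans ((Nat.le_add_right _ _).trans (hp lam ℓ)),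
      (hD lam ℓ).trans ((Nat.le_add_left _ _).trans (hp lam ℓ))⟩⟩, hG', hH', hE', hD'⟩

end Encryption

end

end QPK

theorem mainTheorem3 (P : QPK.PRFSPD) (hP : P.QuantumSecure) (hd : P.SuperlogInput) :
    (∃ S : QPK.SKE, S.QuantumSecure) ∧ ∀ S : QPK.SKE, S.QuantumSecure →
      (QPK.construction P S).IsQPT ∧ (QPK.construction P S).Correct ∧
      (QPK.construction P S).Reusable ∧ (QPK.construction P S).INDCPAEO :=
  ⟨⟨QPK.symScheme P, QPK.symScheme_quantumSecure hP hd⟩, fun _ hS =>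
    ⟨QPK.construction_isQPT hP.qpt hS.qpt, (QPK.reusable hP hS).correct, QPK.reusable hP hS,
      QPK.indcpaeo hP hd hS⟩⟩
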